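/- **Notation.** $B_n$ is the braid group with Artin generators $\sigma_1,\dots,\sigma_{n-1}$, $P_n=\ker(B_n\to S_n)$, $h_n=\sigma_1(\sigma_2\sigma_1)\cdots(\sigma_{n-1}\cdots\sigma_1)$, $z_n=(\sigma_1\cdots\sigma_{n-1})^n=h_n^2$, and $\Gamma_{0,n}$ is the quotient of $B_n$ by the normal subgroup generated by $z_n$ and $\sigma_1\cdots\sigma_{n-1}^2\cdots\sigma_1$ (also a group over $S_n$). $F_2$ is the free group on $X,Y$. **Settings.** Each statement is made in four settings, with a ring of scalars $R$ and, for a group $G$ and a normal subgroup $P$, a completion $G^\wedge$ of $G$ relative to $G\to G/P$, which maps to $G/P$: (1) *discrete*: $R=\mathbb Z$, $G^\wedge=G$; (2) *profinite*: $R=\widehat{\mathbb Z}$, $G^\wedge=\varprojlim G/N$ over the normal subgroups $N\subset P$ of $G$ with $[P:N]<\infty$; (3) *pro-$l$* ($l$ prime): $R=\mathbb Z_l$, $G^\wedge=\varprojlim G/N$ over those $N$ for which $[P:N]$ is a power of $l$; (4) *prounipotent* ($\mathbf k$ a commutative $\mathbb Q$-algebra): $R=\mathbf k$, and $G^\wedge$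 is the group of pairs $(u,c)$, where $c\in G/P$, $u$ is a group-like unit of $\varprojlim_n \mathbf k[G]/J^n$, $J=\ker(\mathbf k[G]\to\mathbf k[G/P])$, and $u\equiv c$ modulo $J$. For $B_n$ and $\Gamma_{0,n}$ the completion is relative to the map to $S_n$; for $F_2$ and $P_4$ it is the full one ($P=G$). In each setting, elements of $\ker(G^\wedge\to G/P)$ have powers with exponents in $R$, and $f(x,y)$ denotes the image of $f\in F_2^\wedge$ under the morphism $X\mapsto x$, $Y\mapsto y$ to such a kernel. **The semigroup.** $\underline{\mathrm{GT}}$ is the set of pairs $(\lambda,f)\in(1+2R)\times F_2^\wedge$, $\lambda=1+2m$, with $f(Y,X)=f(X,Y)^{-1}$, $$f(X_3,X_1)X_3^mf(X_2,X_3)X_2^mf(X_1,X_2)X_1^m=1\quad(X_1=X,\ X_2=Y,\ X_1X_2X_3=1),$$ and $\partial_3(f)\partial_1(f)=\partial_0(f)\partial_2(f)\partial_4(f)$ in $P_4^\wedge$, where $\partial_0,\dots,\partial_4:F_2\to P_4$ send $(X,Y)$ to $(\sigma_2^2,\sigma_3^2)$, $(\sigma_2\sigma_1^2\sigma_2,\sigma_3^2)$,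 $(\sigma_1\sigma_2^2\sigma_1,\sigma_3\sigma_2^2\sigma_3)$, $(\sigma_1^2,\sigma_2\sigma_3^2\sigma_2)$, $(\sigma_1^2,\sigma_2^2)$. The product is $(\lambda,f)(\lambda',f')=(\lambda\lambda',\ f(f'X^{\lambda'}f'^{-1},Y^{\lambda'})\,f')$. **Parenthesized braids.** Let $S$ be a set. The objects of $\mathbf{PaB}_S$ are the triples $X=(n,t,\underline s)$, $n\ge 0$, $t$ a parenthesization of a word of length $n$ (a rooted planar binary tree), $\underline s\in S^n$; the morphisms $(n,t,\underline s)\to(n,t',\underline s')$ are the $b\in B_n^\wedge$ with underlying permutation $p$ such that $s'_{p(i)}=s_i$ for all $i$; there are none between objects of different lengths; composition is the product. The tensor product is concatenation of words and juxtaposition of braids, $\beta_{XY}=(\sigma_{n'}\cdots\sigma_1)\cdots(\sigma_{n+n'-1}\cdots\sigma_n)$ for $X,Y$ of lengths $n,n'$, $a_{XYZ}=1$; the involution $*$ is the mirror image on objects and is induced by $\sigma_i\mapsto\sigma_{n-i}$ on morphisms; $a_X=h_n:X\to X^*$ and $\theta_X=a_{X^*}a_X$. For $(\lambda,f)\in\underline{\mathrm{GT}}$,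 $\lambda=1+2m$, $i_{(\lambda,f)}$ is the endofunctor of $\mathbf{PaB}_S$ which is the identity on objects, is compatible with $\otimes$ and $*$, satisfies $$\beta_{XY}\mapsto\beta_{XY}(\beta_{YX}\beta_{XY})^m,\qquad a_X\mapsto a_X\theta_X^m,$$ $$a_{XYZ}\mapsto a_{XYZ}\,f\bigl(\beta_{YX}\beta_{XY}\otimes\mathrm{id}_Z,\ a_{XYZ}^{-1}(\mathrm{id}_X\otimes\beta_{ZY}\beta_{YZ})a_{XYZ}\bigr),$$ and is continuous (profinite and pro-$l$ settings), resp. algebraic (prounipotent setting: modulo each power of $J$ it is given by a linear map on some $\mathbf k[B_n]/J^M$) on morphisms. **The universal contraction.** The objects of $\widetilde{\mathbf{PaDih}}_S$ are the triples $(n,t,\underline s)$, $t$ a planar $3$-valent tree with leaves numbered by $1,\dots,n$ compatibly with the cyclic orders, $\underline s\in S^n$; morphisms are defined as for $\mathbf{PaB}_S$, with $B_n$ replaced by $\Gamma_{0,n}$. The infinite dihedral group $D=\langle r,s\mid s^2=(rs)^2=1\rangle$ acts: $r$ shifts the numbering of the leaves and the letters cyclically by one, $s$ reverses it, with isomorphisms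 $i_X^r=\sigma_1\cdots\sigma_{n-1}:X\to r\cdot X$ and $i_X^s=h_n:X\to s\cdot X$. $\mathbf{PaDih}_S=\widetilde{\mathbf{PaDih}}_S/D$ is the quotient category: its objects are the $D$-orbits, and it is universal among the targets of functors from $\widetilde{\mathbf{PaDih}}_S$ which turn all $i_X^r,i_X^s$ into identities. The half-balanced contraction $\langle-\rangle:\mathbf{PaB}_S\to\mathbf{PaDih}_S$ replaces the root of a rooted tree and the edges at the root by a single edge, and $B_n^\wedge$ by $\Gamma_{0,n}^\wedge$. **Proposition.** In each of the four settings (for every prime $l$ in the third and every commutative $\mathbb Q$-algebra $\mathbf k$ in the fourth) and for every set $S$: the above product makes $\underline{\mathrm{GT}}$ a semigroup with unit $(1,1)$; for every $(\lambda,f)\in\underline{\mathrm{GT}}$ there is a unique endofunctor $i_{(\lambda,f)}$ of $\mathbf{PaB}_S$ as above, and there is a unique endofunctor $j_{(\lambda,f)}$ of $\mathbf{PaDih}_S$ such that $j_{(\lambda,f)}\circ\langle-\rangle=\langle-\rangle\circ i_{(\lambda,f)}$; and $(\lambda,f)\mapsto j_{(\lambda,f)}$ is a (unital) semigroup morphism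 $$\underline{\mathrm{GT}}\to\mathrm{End}(\mathbf{PaDih}_S)^{op},\qquad\text{i.e. } j_{(\lambda,f)(\lambda',f')}=j_{(\lambda',f')}\circ j_{(\lambda,f)}.$$ -/

import Mathlib

open CategoryTheory

noncomputable section

namespace HalfBalanced

universe u v

set_option linter.unusedSectionVars false

/-! ## Completions -/

/-- A common interface to the four settings in which the constructions are carried out (see
`discrete`, `proL` and `unip` below): a ring of scalars, and for every group `G` and every normal
subgroup `P` the completion of `G` relative to `G → G / P`, with the canonical map from `G`, the
projection to `G / P`, the extension of group morphisms to completions, and powers of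
elements of the kernel of the projection with exponents in the ring of scalars. `Regular p q` says
that `q` is a continuous, resp. algebraic, function of `p`. -/
structure Setting where
  Scal : Type v
  [ring : CommRing Scal]
  Obj : ∀ (G : Type) [Group G] (P : Subgroup G) [P.Normal], Type v
  [grp : ∀ (G : Type) [Group G] (P : Subgroup G) [P.Normal], Group (Obj G P)]
  of : ∀ {G : Type} [Group G] (P : Subgroup G) [P.Normal], G →* Obj G P
  proj : ∀ {G : Type} [Group G] (P : Subgroup G) [P.Normal], Obj G P →* G ⧸ P
  lift : ∀ {G H : Type} [Group G] [Group H] (P : Subgroup G) (Q : Subgroup H) [P.Normal]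
    [Q.Normal] (θ : G →* Obj H Q), (∀ p ∈ P, proj Q (θ p) = 1) → (Obj G P →* Obj H Q)
  pow : ∀ {G : Type} [Group G] (P : Subgroup G) [P.Normal],
    (proj P).ker → Scal → (proj P).ker
  Regular : ∀ {α : Type v} {G H : Type} [Group G] [Group H] (P : Subgroup G) (Q : Subgroup H)
    [P.Normal] [Q.Normal], (α → Obj G P) → (α → Obj H Q) → Prop
  proj_of : ∀ {G : Type} [Group G] (P : Subgroup G) [P.Normal] (g : G),
    proj P (of P g) = QuotientGroup.mk' P g
  lift_of : ∀ {G H : Type} [Group G] [Group H] (P : Subgroup G) (Q : Subgroup H) [P.Normal]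
    [Q.Normal] (θ : G →* Obj H Q) (hθ : ∀ p ∈ P, proj Q (θ p) = 1) (g : G),
    lift P Q θ hθ (of P g) = θ g
  proj_lift : ∀ {G H : Type} [Group G] [Group H] (P : Subgroup G) (Q : Subgroup H) [P.Normal]
    [Q.Normal] (θ : G →* Obj H Q) (hθ : ∀ p ∈ P, proj Q (θ p) = 1) (x : Obj G P),
    proj Q (lift P Q θ hθ x) = QuotientGroup.lift P ((proj Q).comp θ) hθ (proj P x)

attribute [instance] Setting.ring Setting.grp

/-- The uncompleted setting: scalars `ℤ`, and every group is its own completion. -/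
def discrete : Setting.{0} where
  Scal := ℤ
  Obj := fun G _ _ _ => G
  grp := fun _ i _ _ => i
  of := fun {G} _ _ _ => MonoidHom.id G
  proj := fun P _ => QuotientGroup.mk' P
  lift := fun _ _ _ _ θ _ => θ
  pow := fun _ _ x k => x ^ k
  Regular := fun _ _ _ _ _ _ => True
  proj_of := fun _ _ _ => rfl
  lift_of := fun _ _ _ _ _ _ _ => rfl
  proj_lift := fun _ _ _ _ _ _ _ => rfl

/-! ### Profinite and pro-`l` completions -/

section ProL

/-- `n` is a positive integer with all prime factors in `L`. -/
def IsLNum (L : Set ℕ) (n : ℕ) : Prop := n ≠ 0 ∧ ∀ p : ℕ, p.Prime → p ∣ n → p ∈ L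

theorem IsLNum.of_dvd {L : Set ℕ} {m n : ℕ} (hn : IsLNum L n) (h : m ∣ n) : IsLNum L m :=
  ⟨fun h0 => hn.1 (by subst h0; exact zero_dvd_iff.mp h), fun p hp hpm => hn.2 p hp (hpm.trans h)⟩

/-- The ring `lim ℤ/n`, for `n` with prime factors in `L`: the profinite integers if `L` is the
set of all primes, and the `l`-adic integers if `L = {l}`. -/
def ZHat (L : Set ℕ) : Subring (∀ n : {n : ℕ // IsLNum L n}, ZMod n.1) where
  carrier := {a | ∀ (m n : {n : ℕ // IsLNum L n}) (h : m.1 ∣ n.1), ZMod.castHom h _ (a n) = a m}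
  zero_mem' := fun m n h => by simp only [Pi.zero_apply, map_zero]
  one_mem' := fun m n h => by simp only [Pi.one_apply, map_one]
  add_mem' := fun {a b} ha hb m n h => by
    simp only [Pi.add_apply, map_add]; rw [ha m n h, hb m n h]
  mul_mem' := fun {a b} ha hb m n h => by
    simp only [Pi.mul_apply, map_mul]; rw [ha m n h, hb m n h]
  neg_mem' := fun {a} ha m n h => by
    simp only [Pi.neg_apply, map_neg]; rw [ha m n h]

/-- The normal subgroups `N` of `G` contained in `P` such that `[P : N]` is finite with prime
factors in `L`. -/
structure OpenSub (L : Set ℕ) {G : Type} [Group G] (P : Subgroup G) where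
  N : Subgroup G
  [normal : N.Normal]
  le : N ≤ P
  idx : IsLNum L (N.relIndex P)

attribute [instance] OpenSub.normal

variable (L : Set ℕ) {G H : Type} [Group G] [Group H] (P : Subgroup G) (Q : Subgroup H)
  [P.Normal] [Q.Normal]

/-- The canonical map `G/N → G/M` for normal subgroups `N ≤ M`. -/
def transition {G : Type} [Group G] {N M : Subgroup G} [N.Normal] [M.Normal] (h : N ≤ M) :
    G ⧸ N →* G ⧸ M :=
  QuotientGroup.map N M (MonoidHom.id G) h

/-- The pro-`L` completion of `G` relative to `G → G / P`: the limit of the quotients `G / N`. -/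
def ProCompl : Subgroup (∀ N : OpenSub L P, G ⧸ N.N) where
  carrier := {x | ∀ (N M : OpenSub L P) (h : N.N ≤ M.N),
    transition h (x N) = x M}
  one_mem' := fun N M h => by simp only [Pi.one_apply, map_one]
  mul_mem' := fun {x y} hx hy N M h => by
    simp only [Pi.mul_apply, map_mul]; rw [hx N M h, hy N M h]
  inv_mem' := fun {x} hx N M h => by
    simp only [Pi.inv_apply, map_inv]; rw [hx N M h]

namespace ProCompl
variable {L}

def of : G →* ProCompl L P where
  toFun g := ⟨fun N => QuotientGroup.mk' N.N g, fun _ _ _ => rfl⟩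
  map_one' := rfl
  map_mul' _ _ := rfl

variable {P} in
def comp (N : OpenSub L P) : ProCompl L P →* G ⧸ N.N :=
  (Pi.evalMonoidHom _ N).comp (ProCompl L P).subtype

def self (L : Set ℕ) : OpenSub L P where
  N := P
  le := le_rfl
  idx := by
    rw [Subgroup.relIndex_self]
    exact ⟨one_ne_zero, fun p hp h => absurd (Nat.dvd_one.mp h) hp.one_lt.ne'⟩

def proj : ProCompl L P →* G ⧸ P := comp (self P L)

variable {P Q}

theorem comp_mem_map (M : OpenSub L Q) (x : ProCompl L Q) (hx : proj Q x = 1) :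
    comp M x ∈ Q.map (QuotientGroup.mk' M.N) := by
  have h := x.2 M (self Q L) M.le
  obtain ⟨g, hg⟩ := QuotientGroup.mk'_surjective M.N (comp M x)
  have h2 : transition M.le (QuotientGroup.mk' M.N g) = 1 := by
    rw [hg]; exact h.trans hx
  refine ⟨g, ?_, hg⟩
  exact (QuotientGroup.eq_one_iff g).mp h2

theorem comp_pow (M : OpenSub L Q) (x : ProCompl L Q) (hx : proj Q x = 1) :
    comp M x ^ (M.N.relIndex Q) = 1 := by
  obtain ⟨g, hg, h⟩ := comp_mem_map M x hx
  have h1 := Subgroup.pow_index_mem (M.N.subgroupOf Q) (⟨g, hg⟩ : Q)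
  rw [← h, ← map_pow]
  exact (QuotientGroup.eq_one_iff _).mpr h1

def liftSub (θ : G →* ProCompl L Q) (hθ : ∀ p ∈ P, proj Q (θ p) = 1) (M : OpenSub L Q) :
    OpenSub L P where
  N := ((comp M).comp θ).ker ⊓ P
  le := inf_le_right
  idx := by
    rw [Subgroup.inf_relIndex_right, Subgroup.relIndex_ker]
    refine M.idx.of_dvd ?_
    have h1 : M.N.relIndex Q = Nat.card (Q.map (QuotientGroup.mk' M.N)) := by
      rw [← Subgroup.relIndex_ker, QuotientGroup.ker_mk']
    rw [h1]
    refine Subgroup.card_dvd_of_le ?_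
    rintro _ ⟨p, hp, rfl⟩
    exact comp_mem_map M (θ p) (hθ p hp)

def lift (θ : G →* ProCompl L Q) (hθ : ∀ p ∈ P, proj Q (θ p) = 1) :
    ProCompl L P →* ProCompl L Q where
  toFun x := ⟨fun M => QuotientGroup.lift (liftSub θ hθ M).N ((comp M).comp θ)
      inf_le_left (comp (liftSub θ hθ M) x), by
    intro N M h
    have hle : (liftSub θ hθ N).N ≤ (liftSub θ hθ M).N := by
      refine le_inf (fun g hg => ?_) inf_le_right
      have h1 : comp N (θ g) = 1 := hg.1
      have h2 := (θ g).2 N M h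
      change transition h (comp N (θ g)) = comp M (θ g) at h2
      rw [h1, map_one] at h2
      exact h2.symm
    have hx := x.2 (liftSub θ hθ N) (liftSub θ hθ M) hle
    change transition hle (comp _ x) = comp _ x at hx
    change transition h (QuotientGroup.lift _ _ _ (comp (liftSub θ hθ N) x)) =
      QuotientGroup.lift _ _ _ (comp (liftSub θ hθ M) x)
    rw [← hx]
    obtain ⟨g, hg⟩ := QuotientGroup.mk'_surjective _ (comp (liftSub θ hθ N) x)
    rw [← hg]
    exact (θ g).2 N M h⟩
  map_one' := Subtype.ext (funext fun M => by
    change QuotientGroup.lift (liftSub θ hθ M).N ((comp M).comp θ) inf_le_left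
      (comp (liftSub θ hθ M) 1) = 1
    rw [map_one, map_one])
  map_mul' x y := Subtype.ext (funext fun M => by
    change QuotientGroup.lift (liftSub θ hθ M).N ((comp M).comp θ) inf_le_left
      (comp (liftSub θ hθ M) (x * y)) = QuotientGroup.lift (liftSub θ hθ M).N _ _ (comp _ x) *
        QuotientGroup.lift (liftSub θ hθ M).N _ _ (comp _ y)
    rw [map_mul, map_mul])

theorem proj_lift (θ : G →* ProCompl L Q) (hθ : ∀ p ∈ P, proj Q (θ p) = 1) (x : ProCompl L P) :
    proj Q (lift θ hθ x) = QuotientGroup.lift P ((proj Q).comp θ) hθ (proj P x) := by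
  have hx : transition (N := (liftSub θ hθ (self Q L)).N) (M := P) inf_le_right
      (comp (liftSub θ hθ (self Q L)) x) = proj P x :=
    x.2 (liftSub θ hθ (self Q L)) (self P L) inf_le_right
  rw [← hx]
  change QuotientGroup.lift (liftSub θ hθ (self Q L)).N ((comp (self Q L)).comp θ) inf_le_left
    (comp _ x) = _
  obtain ⟨g, hg⟩ := QuotientGroup.mk'_surjective _ (comp (liftSub θ hθ (self Q L)) x)
  rw [← hg]
  rfl

/-- `x ^ a` has component `x_N ^ {a mod [P : N]}`. -/
def pow (x : (proj (L := L) P).ker) (a : ZHat L) : (proj (L := L) P).ker :=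
  ⟨⟨fun N => comp N x.1 ^ (a.1 ⟨N.N.relIndex P, N.idx⟩).val, by
    intro N M h
    have hx := x.1.2 N M h
    change transition h (comp N x.1) = comp M x.1 at hx
    change transition h (comp N x.1 ^ _) = comp M x.1 ^ _
    rw [map_pow, hx]
    have hd : M.N.relIndex P ∣ N.N.relIndex P := Subgroup.relIndex_dvd_of_le_left P h
    have ha := a.2 ⟨_, M.idx⟩ ⟨_, N.idx⟩ hd
    have hM : NeZero (M.N.relIndex P) := ⟨M.idx.1⟩
    have hN : NeZero (N.N.relIndex P) := ⟨N.idx.1⟩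
    dsimp only
    rw [← ha, pow_eq_pow_iff_modEq]
    refine Nat.ModEq.of_dvd (orderOf_dvd_of_pow_eq_one (comp_pow M x.1 x.2)) ?_
    rw [← ZMod.natCast_eq_natCast_iff]
    simp⟩, by
    change comp (self P L) x.1 ^ _ = 1
    have h : comp (self P L) x.1 = 1 := x.2
    rw [h, one_pow]⟩

end ProCompl

/-- The pro-`L` setting; profinite for `L` the set of all primes, pro-`l` for `L = {l}`. -/
def proL : Setting.{0} where
  Scal := ZHat L
  Obj := fun _ _ P _ => ProCompl L P
  of := fun P _ => ProCompl.of P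
  proj := fun P _ => ProCompl.proj P
  lift := fun _ _ _ _ θ hθ => ProCompl.lift θ hθ
  pow := fun _ _ x a => ProCompl.pow x a
  Regular := fun {α} {_ _} _ _ P Q _ _ p q => ∀ N : OpenSub L Q, ∃ M : OpenSub L P,
    ∀ a b : α, (p a).1 M = (p b).1 M → (q a).1 N = (q b).1 N
  proj_of := fun _ _ _ => rfl
  lift_of := fun _ _ _ _ _ _ _ => rfl
  proj_lift := fun _ _ _ _ θ hθ x => ProCompl.proj_lift θ hθ x

end ProL
/-! ### Prounipotent completions -/

section Unip
variable (k : Type v) [CommRing k] {G H : Type} [Group G] [Group H] (P : Subgroup G)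
  (Q : Subgroup H) [P.Normal] [Q.Normal]

/-- The kernel `J` of `k[G] → k[G / P]`. -/
def augIdeal : Ideal (MonoidAlgebra k G) :=
  RingHom.ker (MonoidAlgebra.mapDomainRingHom k (QuotientGroup.mk' P))

instance : (augIdeal k P).IsTwoSided := by unfold augIdeal; infer_instance

/-- `k[G] / J ^ n`. -/
abbrev Trunc (n : ℕ) : Type v := MonoidAlgebra k G ⧸ (augIdeal k P) ^ n

/-- The completed group algebra `lim k[G] / J ^ n`. -/
def AlgCompl : Subalgebra k (∀ n, Trunc k P n) where
  carrier := {a | ∀ (m n : ℕ) (h : m ≤ n),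
    Ideal.Quotient.factor (Ideal.pow_le_pow_right h) (a n) = a m}
  mul_mem' := fun {a b} ha hb m n h => by
    simp only [Pi.mul_apply, map_mul]; rw [ha m n h, hb m n h]
  add_mem' := fun {a b} ha hb m n h => by
    simp only [Pi.add_apply, map_add]; rw [ha m n h, hb m n h]
  algebraMap_mem' := fun r m n h => rfl

namespace AlgCompl
variable {k}

def eval (n : ℕ) : AlgCompl k P →ₐ[k] Trunc k P n :=
  (Pi.evalAlgHom k _ n).comp (AlgCompl k P).val

theorem factor_eval (a : AlgCompl k P) {m n : ℕ} (h : m ≤ n) :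
    Ideal.Quotient.factor (Ideal.pow_le_pow_right h) (eval P n a) = eval P m a := a.2 m n h

variable {P} in
theorem ext {a b : AlgCompl k P} (h : ∀ n, eval P n a = eval P n b) : a = b :=
  Subtype.ext (funext h)

variable (k) in
def of : G →* AlgCompl k P where
  toFun g := ⟨fun n => Ideal.Quotient.mk _ (MonoidAlgebra.of k G g), fun _ _ _ => rfl⟩
  map_one' := by
    refine ext fun n => ?_
    rw [map_one]
    change Ideal.Quotient.mk (augIdeal k P ^ n) (MonoidAlgebra.of k G 1) = 1
    rw [map_one, map_one]
  map_mul' x y := by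
    refine ext fun n => ?_
    change Ideal.Quotient.mk (augIdeal k P ^ n) (MonoidAlgebra.of k G (x * y)) =
      Ideal.Quotient.mk (augIdeal k P ^ n) (MonoidAlgebra.of k G x) *
        Ideal.Quotient.mk (augIdeal k P ^ n) (MonoidAlgebra.of k G y)
    rw [map_mul, map_mul]

theorem eval_of (n : ℕ) (g : G) :
    eval P n (of k P g) = Ideal.Quotient.mk _ (MonoidAlgebra.of k G g) := rfl

theorem eval_one_of (p : G) (hp : p ∈ P) : eval P 1 (of k P p) = 1 := by
  rw [eval_of, ← map_one (Ideal.Quotient.mk (augIdeal k P ^ 1)), Ideal.Quotient.eq, Submodule.pow_one,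
    augIdeal, RingHom.mem_ker, map_sub, map_one, sub_eq_zero]
  have : QuotientGroup.mk' P p = 1 := (QuotientGroup.eq_one_iff p).mpr hp
  simp only [MonoidAlgebra.of_apply, MonoidAlgebra.mapDomainRingHom_apply,
    MonoidAlgebra.mapDomain_single, this]
  rfl

variable {P Q}

/-- Components of the extension of `θ`, before passing to the quotient. -/
def pre (θ : G →* AlgCompl k Q) (n : ℕ) : MonoidAlgebra k G →ₐ[k] Trunc k Q n :=
  MonoidAlgebra.lift k (Trunc k Q n) G ((eval (k := k) Q n).toRingHom.toMonoidHom.comp θ)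

theorem pre_of (θ : G →* AlgCompl k Q) (n : ℕ) (g : G) :
    pre θ n (MonoidAlgebra.of k G g) = eval Q n (θ g) := by
  simp [pre]

theorem factor_pre (θ : G →* AlgCompl k Q) {m n : ℕ} (h : m ≤ n) (x : MonoidAlgebra k G) :
    Ideal.Quotient.factor (Ideal.pow_le_pow_right h) (pre θ n x) = pre θ m x := by
  induction x using MonoidAlgebra.induction_on with
  | of g => rw [pre_of, pre_of, factor_eval _ _ h]
  | add x y hx hy => rw [map_add, map_add, map_add, hx, hy]
  | smul r x hx =>
    rw [map_smul (pre θ n), map_smul (pre θ m), ← hx, Algebra.smul_def, map_mul, Algebra.smul_def]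
    rfl

theorem pre_one (θ : G →* AlgCompl k Q) (hθ : ∀ p ∈ P, eval Q 1 (θ p) = 1)
    (x : MonoidAlgebra k G) (hx : x ∈ augIdeal k P) : pre θ 1 x = 0 := by
  let t : G →* (Trunc k Q 1)ˣ := MonoidHom.toHomUnits
    ((eval (k := k) Q 1).toRingHom.toMonoidHom.comp θ)
  let t' : G ⧸ P →* (Trunc k Q 1)ˣ := QuotientGroup.lift P t (fun p hp => Units.ext (hθ p hp))
  have key : ∀ x, pre θ 1 x = MonoidAlgebra.lift k (Trunc k Q 1) (G ⧸ P)
      ((Units.coeHom _).comp t') (MonoidAlgebra.mapDomainRingHom k (QuotientGroup.mk' P) x) := by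
    intro x
    induction x using MonoidAlgebra.induction_on with
    | of g =>
      rw [pre_of]
      simp [t', t]
    | add x y hx hy => rw [map_add, map_add, map_add, hx, hy]
    | smul r x hx =>
      rw [map_smul, hx, ← map_smul]
      congr 1
      exact (MonoidAlgebra.mapDomain_smul _ _ _).symm
  rw [key, (RingHom.mem_ker).mp hx, map_zero]

theorem pre_mem (θ : G →* AlgCompl k Q) (hθ : ∀ p ∈ P, eval Q 1 (θ p) = 1) (n m : ℕ)
    (x : MonoidAlgebra k G) (hx : x ∈ augIdeal k P ^ m) :
    ∃ y ∈ augIdeal k Q ^ m, Ideal.Quotient.mk (augIdeal k Q ^ n) y = pre θ n x := by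
  induction m generalizing x with
  | zero =>
    obtain ⟨y, hy⟩ := Ideal.Quotient.mk_surjective (pre θ n x)
    exact ⟨y, by rw [Submodule.pow_zero, Ideal.one_eq_top]; trivial, hy⟩
  | succ m ih =>
    have h1 : ∀ x ∈ augIdeal k P, ∃ y ∈ augIdeal k Q,
        Ideal.Quotient.mk (augIdeal k Q ^ n) y = pre θ n x := by
      intro x hx
      rcases Nat.eq_zero_or_pos n with rfl | hn
      · refine ⟨0, Submodule.zero_mem _, ?_⟩
        have : Subsingleton (Trunc k Q 0) := by
          rw [Ideal.Quotient.subsingleton_iff, Submodule.pow_zero, Ideal.one_eq_top]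
        exact Subsingleton.elim _ _
      · obtain ⟨y, hy⟩ := Ideal.Quotient.mk_surjective (pre θ n x)
        refine ⟨y, ?_, hy⟩
        have h := factor_pre θ (Nat.succ_le_of_lt hn) x
        rw [← hy, Ideal.Quotient.factor_mk] at h
        have h2 := h.trans (pre_one θ hθ x hx)
        rw [Ideal.Quotient.eq_zero_iff_mem, Nat.succ_eq_add_one, zero_add, Submodule.pow_one] at h2
        exact h2
    rw [Submodule.pow_succ] at hx
    induction hx using Submodule.mul_induction_on' with
    | mem_mul_mem a ha b hb =>
      obtain ⟨y, hy, hy'⟩ := ih a ha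
      obtain ⟨z, hz, hz'⟩ := h1 b hb
      refine ⟨y * z, ?_, by rw [map_mul, map_mul, hy', hz']⟩
      rw [Submodule.pow_succ]
      exact Ideal.mul_mem_mul hy hz
    | add a _ b _ ha hb =>
      obtain ⟨y, hy, hy'⟩ := ha
      obtain ⟨z, hz, hz'⟩ := hb
      exact ⟨y + z, Ideal.add_mem _ hy hz, by rw [map_add, map_add, hy', hz']⟩

def liftComp (θ : G →* AlgCompl k Q) (hθ : ∀ p ∈ P, eval Q 1 (θ p) = 1) (n : ℕ) :
    Trunc k P n →ₐ[k] Trunc k Q n :=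
  Ideal.Quotient.liftₐ (augIdeal k P ^ n) (pre θ n) (fun x hx => by
    obtain ⟨y, hy, hy'⟩ := pre_mem θ hθ n n x hx
    rw [← hy']
    exact Ideal.Quotient.eq_zero_iff_mem.mpr hy)

theorem liftComp_mk (θ : G →* AlgCompl k Q) (hθ : ∀ p ∈ P, eval Q 1 (θ p) = 1) (n : ℕ)
    (x : MonoidAlgebra k G) : liftComp θ hθ n (Ideal.Quotient.mk _ x) = pre θ n x := rfl

def lift (θ : G →* AlgCompl k Q) (hθ : ∀ p ∈ P, eval Q 1 (θ p) = 1) :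
    AlgCompl k P →ₐ[k] AlgCompl k Q :=
  AlgHom.codRestrict (AlgHom.pi fun n => (liftComp θ hθ n).comp (eval P n)) _ (by
    intro a m n h
    change Ideal.Quotient.factor _ (liftComp θ hθ n (eval P n a)) = liftComp θ hθ m (eval P m a)
    rw [← factor_eval P a h]
    obtain ⟨x, hx⟩ := Ideal.Quotient.mk_surjective (eval P n a)
    rw [← hx, Ideal.Quotient.factor_mk, liftComp_mk, liftComp_mk]
    exact factor_pre θ h x)

theorem eval_lift (θ : G →* AlgCompl k Q) (hθ : ∀ p ∈ P, eval Q 1 (θ p) = 1) (n : ℕ)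
    (a : AlgCompl k P) : eval Q n (lift θ hθ a) = liftComp θ hθ n (eval P n a) := rfl

theorem lift_of (θ : G →* AlgCompl k Q) (hθ : ∀ p ∈ P, eval Q 1 (θ p) = 1) (g : G) :
    lift θ hθ (of k P g) = θ g :=
  ext fun n => by rw [eval_lift, eval_of, liftComp_mk, pre_of]

theorem liftComp_comp_of (θ : G →* AlgCompl k Q) (hθ : ∀ p ∈ P, eval Q 1 (θ p) = 1)
    (θ' : G →* AlgCompl k Q) (hθ' : ∀ p ∈ P, eval Q 1 (θ' p) = 1) (h : θ = θ') :
    lift θ hθ = lift θ' hθ' := by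
  subst h; rfl

theorem hom_ext_mk {K : Type} [Group K] {R : Subgroup K} [R.Normal] (n : ℕ)
    (f g : Trunc k P n →ₐ[k] Trunc k R n)
    (h : ∀ x : G, f (Ideal.Quotient.mk _ (MonoidAlgebra.of k G x)) =
      g (Ideal.Quotient.mk _ (MonoidAlgebra.of k G x))) : f = g := by
  refine Ideal.Quotient.algHom_ext k ?_
  refine MonoidAlgebra.algHom_ext' ?_ ?_
  · exact MonoidHom.ext h
  · ext

theorem lift_lift {K : Type} [Group K] {R : Subgroup K} [R.Normal]
    (θ : G →* AlgCompl k Q) (hθ : ∀ p ∈ P, eval Q 1 (θ p) = 1)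
    (η : H →* AlgCompl k R) (hη : ∀ q ∈ Q, eval R 1 (η q) = 1)
    (ζ : G →* AlgCompl k R) (hζ : ∀ p ∈ P, eval R 1 (ζ p) = 1)
    (h : ∀ g, lift η hη (θ g) = ζ g) (a : AlgCompl k P) :
    lift η hη (lift θ hθ a) = lift ζ hζ a := by
  refine ext fun n => ?_
  rw [eval_lift, eval_lift, eval_lift]
  have : (liftComp η hη n).comp (liftComp θ hθ n) = liftComp ζ hζ n := by
    refine hom_ext_mk n _ _ fun x => ?_
    rw [AlgHom.comp_apply, liftComp_mk, liftComp_mk, pre_of, pre_of, ← h x, eval_lift]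
  rw [← this]
  rfl

/-- Functoriality of the completed group algebra. -/
def map (φ : G →* H) (h : P ≤ Q.comap φ) : AlgCompl k P →ₐ[k] AlgCompl k Q :=
  lift ((of k Q).comp φ) (fun p hp => eval_one_of Q (φ p) (h hp))

theorem map_of (φ : G →* H) (h : P ≤ Q.comap φ) (g : G) :
    map (k := k) φ h (of k P g) = of k Q (φ g) := lift_of _ _ g

theorem le_comap_diag :
    P ≤ (P.prod P).comap ((MonoidHom.id G).prod (MonoidHom.id G)) := fun _ hp => ⟨hp, hp⟩

theorem le_comap_inl : P ≤ (P.prod P).comap (MonoidHom.inl G G) := fun _ hp => ⟨hp, P.one_mem⟩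

theorem le_comap_inr : P ≤ (P.prod P).comap (MonoidHom.inr G G) := fun _ hp => ⟨P.one_mem, hp⟩

variable (P) in
/-- The (completed) coproduct, induced by the diagonal of `G`. -/
def comul : AlgCompl k P →ₐ[k] AlgCompl k (P.prod P) :=
  map ((MonoidHom.id G).prod (MonoidHom.id G)) le_comap_diag

variable (P) in
/-- `a ↦ a ⊗ 1`. -/
def inl : AlgCompl k P →ₐ[k] AlgCompl k (P.prod P) :=
  map (MonoidHom.inl G G) le_comap_inl

variable (P) in
/-- `a ↦ 1 ⊗ a`. -/
def inr : AlgCompl k P →ₐ[k] AlgCompl k (P.prod P) :=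
  map (MonoidHom.inr G G) le_comap_inr

theorem comul_of (g : G) : comul P (of k P g) = of k (P.prod P) (g, g) :=
  map_of (Q := P.prod P) ((MonoidHom.id G).prod (MonoidHom.id G)) le_comap_diag g

theorem inl_of (g : G) : inl P (of k P g) = of k (P.prod P) (g, 1) :=
  map_of (Q := P.prod P) (MonoidHom.inl G G) le_comap_inl g

theorem inr_of (g : G) : inr P (of k P g) = of k (P.prod P) (1, g) :=
  map_of (Q := P.prod P) (MonoidHom.inr G G) le_comap_inr g

theorem commute_pre (n : ℕ) (x y : MonoidAlgebra k G) :
    Commute (pre ((of k (P.prod P)).comp (MonoidHom.inl G G)) n x)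
      (pre ((of k (P.prod P)).comp (MonoidHom.inr G G)) n y) := by
  induction x using MonoidAlgebra.induction_on with
  | of g =>
    induction y using MonoidAlgebra.induction_on with
    | of g' =>
      rw [pre_of, pre_of]
      change _ * _ = _ * _
      rw [← map_mul, ← map_mul, MonoidHom.comp_apply, MonoidHom.comp_apply, ← map_mul, ← map_mul]
      simp
    | add x y h1 h2 => rw [map_add]; exact h1.add_right h2
    | smul r x h1 => rw [map_smul]; exact h1.smul_right r
  | add x y h1 h2 => rw [map_add]; exact h1.add_left h2
  | smul r x h1 => rw [map_smul]; exact h1.smul_left r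

theorem eval_map (φ : G →* H) (h : P ≤ Q.comap φ) (n : ℕ) (a : AlgCompl k P) :
    eval Q n (map φ h a) = liftComp ((of k Q).comp φ)
      (fun p hp => eval_one_of Q (φ p) (h hp)) n (eval P n a) := rfl

theorem commute_inl_inr (a b : AlgCompl k P) : Commute (inl P a) (inr P b) := by
  refine ext fun n => ?_
  obtain ⟨x, hx⟩ := Ideal.Quotient.mk_surjective (eval P n a)
  obtain ⟨y, hy⟩ := Ideal.Quotient.mk_surjective (eval P n b)
  have h1 : eval _ n (inl P a) = pre ((of k (P.prod P)).comp (MonoidHom.inl G G)) n x := by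
    rw [inl, eval_map, ← hx, liftComp_mk]
  have h2 : eval _ n (inr P b) = pre ((of k (P.prod P)).comp (MonoidHom.inr G G)) n y := by
    rw [inr, eval_map, ← hy, liftComp_mk]
  rw [map_mul, map_mul, h1, h2]
  exact commute_pre n x y

/-- `Δ(a) = (a ⊗ 1)(1 ⊗ a)`, in the completed group algebra of `G × G`. -/
def IsGroupLike (a : AlgCompl k P) : Prop := comul P a = inl P a * inr P a

theorem isGroupLike_of (g : G) : IsGroupLike (of k P g) := by
  rw [IsGroupLike, comul_of, inl_of, inr_of, ← map_mul]
  simp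

theorem IsGroupLike.mul {a b : AlgCompl k P} (ha : IsGroupLike a) (hb : IsGroupLike b) :
    IsGroupLike (a * b) := by
  unfold IsGroupLike at *
  rw [map_mul, map_mul, map_mul, ha, hb, mul_assoc, mul_assoc]
  congr 1
  rw [← mul_assoc, ← mul_assoc, (commute_inl_inr b a).eq]

theorem IsGroupLike.inv {u : (AlgCompl k P)ˣ} (hu : IsGroupLike (u : AlgCompl k P)) :
    IsGroupLike ((u⁻¹ : (AlgCompl k P)ˣ) : AlgCompl k P) := by
  unfold IsGroupLike at *
  refine left_inv_eq_right_inv (a := comul P (u : AlgCompl k P)) ?_ ?_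
  · rw [← map_mul, Units.inv_mul, map_one]
  · rw [hu, (commute_inl_inr _ _).eq, mul_assoc, ← mul_assoc (inl P (u : AlgCompl k P)),
      ← map_mul, Units.mul_inv, map_one, one_mul, ← map_mul, Units.mul_inv, map_one]

theorem IsGroupLike.lift {θ : G →* AlgCompl k Q} {hθ : ∀ p ∈ P, eval Q 1 (θ p) = 1}
    (hg : ∀ g, IsGroupLike (θ g)) {a : AlgCompl k P} (ha : IsGroupLike a) :
    IsGroupLike (AlgCompl.lift θ hθ a) := by
  let ψ : G × G →* AlgCompl k (Q.prod Q) :=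
    MonoidHom.noncommCoprod ((inl (k := k) Q).toRingHom.toMonoidHom.comp θ)
      ((inr (k := k) Q).toRingHom.toMonoidHom.comp θ) (fun g h => commute_inl_inr (θ g) (θ h))
  have e1 : ∀ (x : AlgCompl k Q), eval Q 1 x = 1 → eval _ 1 (inl Q x) = 1 := by
    intro x hx
    rw [inl, eval_map, hx, map_one]
  have e2 : ∀ (x : AlgCompl k Q), eval Q 1 x = 1 → eval _ 1 (inr Q x) = 1 := by
    intro x hx
    rw [inr, eval_map, hx, map_one]
  have hψ : ∀ p ∈ P.prod P, eval (Q.prod Q) 1 (ψ p) = 1 := by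
    rintro ⟨p, p'⟩ ⟨hp, hp'⟩
    change eval _ 1 (inl Q (θ p) * inr Q (θ p')) = 1
    rw [map_mul, e1 _ (hθ p hp), e2 _ (hθ p' hp'), one_mul]
  have hc : ∀ g, IsGroupLike (θ g) := hg
  unfold IsGroupLike at *
  have k1 : comul Q (AlgCompl.lift θ hθ a) = AlgCompl.lift ψ hψ (comul P a) := by
    have hz : ∀ p ∈ P, eval (Q.prod Q) 1 (((comul (k := k) Q).toRingHom.toMonoidHom.comp θ) p) = 1 := by
      intro p hp
      change eval _ 1 (comul Q (θ p)) = 1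
      rw [hc, map_mul, e1 _ (hθ p hp), e2 _ (hθ p hp), one_mul]
    refine (lift_lift θ hθ _ _ ((comul (k := k) Q).toRingHom.toMonoidHom.comp θ) hz (fun g => rfl) a).trans
      (lift_lift _ _ ψ hψ _ _ (fun g => ?_) a).symm
    rw [MonoidHom.comp_apply, lift_of]
    exact (hc g).symm
  have k2 : inl Q (AlgCompl.lift θ hθ a) = AlgCompl.lift ψ hψ (inl P a) := by
    refine (lift_lift θ hθ _ _ ((inl (k := k) Q).toRingHom.toMonoidHom.comp θ)
      (fun p hp => e1 _ (hθ p hp)) (fun g => rfl) a).trans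
      (lift_lift _ _ ψ hψ _ _ (fun g => ?_) a).symm
    rw [MonoidHom.comp_apply, lift_of]
    change inl Q (θ g) * inr Q (θ 1) = inl Q (θ g)
    rw [map_one, map_one, mul_one]
  have k3 : inr Q (AlgCompl.lift θ hθ a) = AlgCompl.lift ψ hψ (inr P a) := by
    refine (lift_lift θ hθ _ _ ((inr (k := k) Q).toRingHom.toMonoidHom.comp θ)
      (fun p hp => e2 _ (hθ p hp)) (fun g => rfl) a).trans
      (lift_lift _ _ ψ hψ _ _ (fun g => ?_) a).symm
    rw [MonoidHom.comp_apply, lift_of]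
    change inl Q (θ 1) * inr Q (θ g) = inr Q (θ g)
    rw [map_one, map_one, one_mul]
  rw [k1, k2, k3, ha, map_mul]

/-! ### Powers with exponents in a `ℚ`-algebra -/

end AlgCompl

section BinomialSeries

variable {k} [Algebra ℚ k]

/-- The generalized binomial coefficient `λ(λ-1)⋯(λ-j+1)/j!`. -/
def binom (c : k) (j : ℕ) : k := ((j.factorial : ℚ)⁻¹) • ∏ i ∈ Finset.range j, (c - i)

/-- The generalized binomial coefficient as a polynomial. -/
def binomPoly (j : ℕ) : Polynomial ℚ :=
  Polynomial.C ((j.factorial : ℚ)⁻¹) * ∏ i ∈ Finset.range j, (Polynomial.X - (i : Polynomial ℚ))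

theorem aeval_binomPoly (c : k) (j : ℕ) : Polynomial.aeval c (binomPoly j) = binom c j := by
  simp [binomPoly, binom, map_prod, Algebra.smul_def]

theorem binom_natCast (n j : ℕ) : binom (n : k) j = (n.choose j : k) := by
  have h : (∏ i ∈ Finset.range j, ((n : k) - i)) = ((n.descFactorial j : ℕ) : k) := by
    induction j with
    | zero => simp
    | succ j ih =>
      rw [Finset.prod_range_succ, ih, Nat.descFactorial_succ]
      rcases le_or_gt j n with h | h
      · push_cast [Nat.cast_sub h]; ring
      · rw [Nat.descFactorial_of_lt h]; simp
  rw [binom, h, Nat.descFactorial_eq_factorial_mul_choose, Algebra.smul_def]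
  push_cast
  have h2 : ((j.factorial : ℕ) : k) = algebraMap ℚ k (j.factorial : ℚ) := by simp
  rw [h2, ← mul_assoc, ← map_mul, inv_mul_cancel₀ (by positivity), map_one, one_mul]

/-- A polynomial expression in an exponent which vanishes on natural numbers vanishes. -/
theorem sum_aeval_smul_eq_zero {R ι : Type*} [Ring R] [Algebra k R] (s : Finset ι)
    (p : ι → Polynomial ℚ) (r : ι → R)
    (h : ∀ n : ℕ, ∑ i ∈ s, Polynomial.aeval (n : k) (p i) • r i = 0) (c : k) :
    ∑ i ∈ s, Polynomial.aeval c (p i) • r i = 0 := by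
  let _ : Algebra ℚ R := ((algebraMap k R).comp (algebraMap ℚ k)).toAlgebra'
    (fun q x => Algebra.commutes _ _)
  have tower : IsScalarTower ℚ k R := IsScalarTower.of_algebraMap_eq fun _ => rfl
  let b := Module.Basis.ofVectorSpace ℚ R
  let q : Module.Basis.ofVectorSpaceIndex ℚ R → Polynomial ℚ := fun x =>
    ∑ i ∈ s, Polynomial.C (b.repr (r i) x) * p i
  have hq : ∀ x, q x = 0 := by
    intro x
    refine Polynomial.eq_zero_of_infinite_isRoot _ (Set.infinite_of_injective_forall_mem
      (f := fun n : ℕ => (n : ℚ)) Nat.cast_injective fun n => ?_)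
    have h1 := congrArg (fun y => b.repr y x) (h n)
    simp only [map_sum, Finsupp.coe_finsetSum, Finset.sum_apply, map_zero,
      Finsupp.coe_zero, Pi.zero_apply] at h1
    change Polynomial.eval (n : ℚ) (q x) = 0
    rw [Polynomial.eval_finsetSum, ← h1]
    refine Finset.sum_congr rfl fun i _ => ?_
    have h2 : Polynomial.aeval (n : k) (p i) = algebraMap ℚ k (Polynomial.eval (n : ℚ) (p i)) := by
      rw [← Polynomial.aeval_algebraMap_apply_eq_algebraMap_eval]; simp
    rw [h2, algebraMap_smul, map_smul]
    simp [mul_comm]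
  let t : Finset (Module.Basis.ofVectorSpaceIndex ℚ R) :=
    by classical exact s.biUnion fun i => (b.repr (r i)).support
  have hr : ∀ i ∈ s, r i = ∑ x ∈ t, (b.repr (r i) x) • b x := by
    classical
    intro i hi
    conv_lhs => rw [← b.linearCombination_repr (r i)]
    rw [Finsupp.linearCombination_apply]
    refine Finsupp.sum_of_support_subset _ ?_ _ (by simp)
    intro x hx
    exact Finset.mem_biUnion.mpr ⟨i, hi, hx⟩
  calc ∑ i ∈ s, Polynomial.aeval c (p i) • r i
      = ∑ i ∈ s, ∑ x ∈ t, Polynomial.aeval c (Polynomial.C (b.repr (r i) x) * p i) • b x := by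
        refine Finset.sum_congr rfl fun i hi => ?_
        conv_lhs => rw [hr i hi]
        rw [Finset.smul_sum]
        refine Finset.sum_congr rfl fun x _ => ?_
        rw [map_mul, Polynomial.aeval_C, mul_comm, mul_smul, algebraMap_smul]
    _ = ∑ x ∈ t, Polynomial.aeval c (q x) • b x := by
        rw [Finset.sum_comm]
        refine Finset.sum_congr rfl fun x _ => ?_
        rw [map_sum, Finset.sum_smul]
    _ = 0 := by simp [hq]

variable {R : Type*} [Ring R] [Algebra k R]

/-- `(1+a)^c` truncated at order `n`. -/
def powTrunc (n : ℕ) (a : R) (c : k) : R := ∑ j ∈ Finset.range n, binom c j • a ^ j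

theorem powTrunc_natCast (n : ℕ) (a : R) (h : a ^ n = 0) (N : ℕ) :
    powTrunc n a (N : k) = (1 + a) ^ N := by
  have h1 : ∀ m, n ≤ m → powTrunc m a (N : k) = powTrunc n a (N : k) := by
    intro m hm
    unfold powTrunc
    refine (Finset.sum_subset (Finset.range_mono hm) fun j _ hj => ?_).symm
    rw [Finset.mem_range, not_lt] at hj
    rw [pow_eq_zero_of_le hj h, smul_zero]
  rw [← h1 (n + N + 1) (by omega), powTrunc, add_comm 1 a, (Commute.one_right a).add_pow]
  refine (Finset.sum_subset (Finset.range_mono (by omega : N + 1 ≤ n + N + 1))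
    fun j _ hj => ?_).symm.trans ?_
  · rw [Finset.mem_range, not_lt] at hj
    rw [binom_natCast, Nat.choose_eq_zero_of_lt (by omega)]
    simp
  · refine Finset.sum_congr rfl fun j _ => ?_
    rw [binom_natCast, one_pow, mul_one, Algebra.smul_def, map_natCast, Nat.cast_comm]

theorem powTrunc_mul (n : ℕ) (a b : R) (hab : Commute a b) (ha : a ^ n = 0) (hb : b ^ n = 0)
    (h : (a + b + a * b) ^ n = 0) (c : k) :
    powTrunc n (a + b + a * b) c = powTrunc n a c * powTrunc n b c := by
  rw [← sub_eq_zero]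
  have e : ∀ c : k, powTrunc n (a + b + a * b) c - powTrunc n a c * powTrunc n b c =
      ∑ x ∈ (Finset.range n).disjSum (Finset.range n ×ˢ Finset.range n),
        Polynomial.aeval c (Sum.elim (fun j => binomPoly j)
          (fun y : ℕ × ℕ => binomPoly y.1 * binomPoly y.2) x) •
        (Sum.elim (fun j => (a + b + a * b) ^ j) (fun y : ℕ × ℕ => -(a ^ y.1 * b ^ y.2)) x) := by
    intro c
    rw [Finset.sum_disjSum, Finset.sum_product, sub_eq_add_neg]
    congr 1
    · simp only [Sum.elim_inl, aeval_binomPoly, powTrunc]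
    · simp only [Sum.elim_inr, map_mul, aeval_binomPoly, powTrunc, Finset.sum_mul_sum, smul_neg,
        Finset.sum_neg_distrib, smul_mul_smul_comm]
  rw [e]
  refine sum_aeval_smul_eq_zero _ _ _ (fun N => ?_) c
  rw [← e, powTrunc_natCast n _ ha, powTrunc_natCast n _ hb, powTrunc_natCast n _ h,
    ← Commute.mul_pow, sub_eq_zero]
  · congr 1; noncomm_ring
  · exact ((Commute.one_left _).add_left ((Commute.one_right a).add_right hab))

end BinomialSeries

end Unip

section UnipSetting

section PowMore
variable {k : Type v} [CommRing k] [Algebra ℚ k] {R : Type*} [Ring R] [Algebra k R]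

theorem powTrunc_zero_right (n : ℕ) (hn : n ≠ 0) (c : k) : powTrunc n (0 : R) c = 1 := by
  unfold powTrunc
  rw [Finset.sum_eq_single_of_mem 0 (Finset.mem_range.mpr (Nat.pos_of_ne_zero hn))]
  · simp [binom]
  · intro j _ hj
    rw [zero_pow hj, smul_zero]

theorem map_powTrunc {R' : Type*} [Ring R'] [Algebra k R'] (φ : R →ₐ[k] R') (n : ℕ) (a : R)
    (c : k) : φ (powTrunc n a c) = powTrunc n (φ a) c := by
  simp [powTrunc]

theorem powTrunc_of_le {m n : ℕ} (h : m ≤ n) (a : R) (ha : a ^ m = 0) (c : k) :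
    powTrunc n a c = powTrunc m a c := by
  unfold powTrunc
  refine (Finset.sum_subset (Finset.range_mono h) fun j _ hj => ?_).symm
  rw [Finset.mem_range, not_lt] at hj
  rw [pow_eq_zero_of_le hj ha, smul_zero]

end PowMore

variable {k : Type v} [CommRing k] {G H : Type} [Group G] [Group H] (P : Subgroup G)
  (Q : Subgroup H) [P.Normal] [Q.Normal]

namespace AlgCompl

theorem sub_one_pow {a : AlgCompl k P} (ha : eval P 1 a = 1) (n : ℕ) :
    (eval P n a - 1) ^ n = 0 := by
  rcases Nat.eq_zero_or_pos n with rfl | hn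
  · have : Subsingleton (Trunc k P 0) := by
      rw [Ideal.Quotient.subsingleton_iff, Submodule.pow_zero, Ideal.one_eq_top]
    exact Subsingleton.elim _ _
  · obtain ⟨y, hy⟩ := Ideal.Quotient.mk_surjective (eval P n a - 1)
    have h := factor_eval P a (Nat.succ_le_of_lt hn)
    have hy1 : y ∈ augIdeal k P := by
      have h3 : Ideal.Quotient.factor (Ideal.pow_le_pow_right (Nat.succ_le_of_lt hn))
          (eval P n a - 1) = 0 := by
        rw [map_sub, h, map_one]
        exact sub_eq_zero.mpr ha
      rw [← hy, Ideal.Quotient.factor_mk, Ideal.Quotient.eq_zero_iff_mem, Nat.succ_eq_add_one,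
        zero_add, Submodule.pow_one] at h3
      exact h3
    rw [← hy, ← map_pow]
    exact Ideal.Quotient.eq_zero_iff_mem.mpr (Ideal.pow_mem_pow hy1 n)

variable {P Q}

variable (P) in
/-- The group of `k`-points of the relative prounipotent completion of `G → G / P`: pairs of a
group-like unit of the completed group algebra and of a class in `G / P` which agree in
`k[G / P] = k[G] / J`. -/
def GroupLike (k : Type v) [CommRing k] : Subgroup ((AlgCompl k P)ˣ × (G ⧸ P)) where
  carrier := {x | IsGroupLike (x.1 : AlgCompl k P) ∧
    ∃ g, QuotientGroup.mk' P g = x.2 ∧ eval P 1 (x.1 : AlgCompl k P) = eval P 1 (of k P g)}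
  one_mem' := ⟨by simpa using isGroupLike_of (k := k) (P := P) 1, 1, by simp⟩
  mul_mem' := by
    rintro x y ⟨hx, g, hg, hgx⟩ ⟨hy, h, hh, hhy⟩
    refine ⟨hx.mul hy, g * h, ?_, ?_⟩
    · rw [map_mul, hg, hh]; rfl
    · rw [map_mul, map_mul, ← hgx, ← hhy, ← map_mul]; rfl
  inv_mem' := by
    rintro x ⟨hx, g, hg, hgx⟩
    refine ⟨hx.inv, g⁻¹, ?_, ?_⟩
    · rw [map_inv, hg]; rfl
    · refine left_inv_eq_right_inv (a := eval P 1 (x.1 : AlgCompl k P)) ?_ ?_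
      · rw [← map_mul]
        exact (congrArg (eval P 1) (Units.inv_mul x.1)).trans (map_one _)
      · rw [hgx, ← map_mul, ← map_mul, mul_inv_cancel, map_one, map_one]

variable (P) in
def glOf (k : Type v) [CommRing k] : G →* GroupLike P k :=
  MonoidHom.codRestrict ((MonoidHom.toHomUnits (of k P)).prod (QuotientGroup.mk' P)) _
    (fun g => ⟨isGroupLike_of g, g, rfl, rfl⟩)

variable (P) in
def glProj (k : Type v) [CommRing k] : GroupLike P k →* G ⧸ P :=
  (MonoidHom.snd _ _).comp (GroupLike P k).subtype

/-- The underlying element of the completed group algebra. -/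
def glVal (x : GroupLike P k) : AlgCompl k P := ((x.1.1 : (AlgCompl k P)ˣ) : AlgCompl k P)

theorem eval_one_glVal (x : GroupLike P k) (hx : glProj P k x = 1) : eval P 1 (glVal x) = 1 := by
  obtain ⟨-, g, hg, hgx⟩ := x.2
  have h1 : QuotientGroup.mk' P g = 1 := hg.trans hx
  exact hgx.trans (eval_one_of P g ((QuotientGroup.eq_one_iff g).mp h1))

/-- The morphism `G → k[H]^` underlying a morphism to the completion of `H`. -/
def glHom (θ : G →* GroupLike Q k) : G →* AlgCompl k Q :=
  (Units.coeHom _).comp ((MonoidHom.fst _ _).comp ((GroupLike Q k).subtype.comp θ))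

theorem glHom_one (θ : G →* GroupLike Q k) (hθ : ∀ p ∈ P, glProj Q k (θ p) = 1) :
    ∀ p ∈ P, eval Q 1 (glHom θ p) = 1 := fun p hp => eval_one_glVal (θ p) (hθ p hp)

def glLift (θ : G →* GroupLike Q k) (hθ : ∀ p ∈ P, glProj Q k (θ p) = 1) :
    GroupLike P k →* GroupLike Q k :=
  MonoidHom.codRestrict
    (((Units.map (lift (glHom θ) (glHom_one θ hθ)).toRingHom.toMonoidHom).prodMap
      (QuotientGroup.lift P ((glProj Q k).comp θ) hθ)).comp (GroupLike P k).subtype) _ (by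
    intro x
    obtain ⟨hx, g, hg, hgx⟩ := x.2
    obtain ⟨-, h, hh, hhx⟩ := (θ g).2
    refine ⟨IsGroupLike.lift (fun g => (θ g).2.1) hx, h, ?_, ?_⟩
    · refine hh.trans ?_
      change _ = QuotientGroup.lift P ((glProj Q k).comp θ) hθ x.1.2
      rw [← hg]; rfl
    · refine Eq.trans ?_ hhx
      change eval Q 1 (lift (glHom θ) (glHom_one θ hθ) (glVal x)) = eval Q 1 (glHom θ g)
      rw [← lift_of (glHom θ) (glHom_one θ hθ) g, eval_lift, eval_lift]
      exact congrArg _ hgx)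

variable [Algebra ℚ k]

variable (P) in
/-- The power `u ^ c` of an element congruent to `1`, given by the binomial series. -/
def powVal (a : AlgCompl k P) (ha : eval P 1 a = 1) (c : k) : AlgCompl k P :=
  ⟨fun n => powTrunc n (eval P n a - 1) c, by
    intro m n h
    have e : Ideal.Quotient.factor (Ideal.pow_le_pow_right (I := augIdeal k P) h)
        (powTrunc n (eval P n a - 1) c) =
        powTrunc n (Ideal.Quotient.factor (Ideal.pow_le_pow_right (I := augIdeal k P) h)
          (eval P n a - 1)) c :=
      map_powTrunc (Ideal.Quotient.factorₐ k (Ideal.pow_le_pow_right (I := augIdeal k P) h))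
        n (eval P n a - 1) c
    refine e.trans ?_
    rw [map_sub, map_one, factor_eval P a h]
    exact powTrunc_of_le h _ (sub_one_pow P ha m) c⟩

theorem eval_powVal (a : AlgCompl k P) (ha : eval P 1 a = 1) (c : k) (n : ℕ) :
    eval P n (powVal P a ha c) = powTrunc n (eval P n a - 1) c := rfl

theorem eval_one_powVal (a : AlgCompl k P) (ha : eval P 1 a = 1) (c : k) :
    eval P 1 (powVal P a ha c) = 1 := by
  rw [eval_powVal, ha, sub_self, powTrunc_zero_right 1 one_ne_zero]

theorem powVal_mul (a b : AlgCompl k P) (hab : Commute a b) (ha : eval P 1 a = 1)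
    (hb : eval P 1 b = 1) (h : eval P 1 (a * b) = 1) (c : k) :
    powVal P (a * b) h c = powVal P a ha c * powVal P b hb c := by
  refine ext fun n => ?_
  rw [map_mul, eval_powVal, eval_powVal, eval_powVal]
  have e : eval P n (a * b) - 1 =
      (eval P n a - 1) + (eval P n b - 1) + (eval P n a - 1) * (eval P n b - 1) := by
    rw [map_mul]; noncomm_ring
  have hc : Commute (eval P n a - 1) (eval P n b - 1) :=
    ((hab.map (eval P n)).sub_left (Commute.one_left _)).sub_right
      ((Commute.one_right _))
  rw [e]
  refine powTrunc_mul n _ _ hc (sub_one_pow P ha n) (sub_one_pow P hb n) ?_ c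
  rw [← e]
  exact sub_one_pow P h n

theorem powVal_one (h : eval P 1 (1 : AlgCompl k P) = 1) (c : k) : powVal P 1 h c = 1 := by
  refine ext fun n => ?_
  rw [eval_powVal, map_one, sub_self]
  rcases Nat.eq_zero_or_pos n with rfl | hn
  · have : Subsingleton (Trunc k P 0) := by
      rw [Ideal.Quotient.subsingleton_iff, Submodule.pow_zero, Ideal.one_eq_top]
    exact Subsingleton.elim _ _
  · exact powTrunc_zero_right n hn.ne' c

theorem powVal_congr {a b : AlgCompl k P} (h : a = b) (ha : eval P 1 a = 1)
    (hb : eval P 1 b = 1) (c : k) : powVal P a ha c = powVal P b hb c := by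
  subst h; rfl

theorem map_powVal (φ : G →* H) (h : P ≤ Q.comap φ) (a : AlgCompl k P) (ha : eval P 1 a = 1)
    (ha' : eval Q 1 (map φ h a) = 1) (c : k) :
    map φ h (powVal P a ha c) = powVal Q (map φ h a) ha' c := by
  refine ext fun n => ?_
  rw [eval_map, eval_powVal, eval_powVal, map_powTrunc, map_sub, map_one, eval_map]

theorem eval_one_map (φ : G →* H) (h : P ≤ Q.comap φ) (a : AlgCompl k P) (ha : eval P 1 a = 1) :
    eval Q 1 (map φ h a) = 1 := by
  rw [eval_map, ha, map_one]

theorem isGroupLike_powVal {a : AlgCompl k P} (hg : IsGroupLike a) (ha : eval P 1 a = 1) (c : k) :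
    IsGroupLike (powVal P a ha c) := by
  unfold IsGroupLike comul inl inr at *
  have h1 := eval_one_map ((MonoidHom.id G).prod (MonoidHom.id G))
    (le_comap_diag (P := P)) a ha
  have h2 := eval_one_map (MonoidHom.inl G G) (le_comap_inl (P := P)) a ha
  have h3 := eval_one_map (MonoidHom.inr G G) (le_comap_inr (P := P)) a ha
  rw [map_powVal _ _ _ ha h1, map_powVal _ _ _ ha h2, map_powVal _ _ _ ha h3,
    ← powVal_mul (map (MonoidHom.inl G G) (le_comap_inl (P := P)) a)
      (map (MonoidHom.inr G G) (le_comap_inr (P := P)) a) (commute_inl_inr a a) h2 h3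
      (by rw [map_mul, h2, h3, one_mul])]
  exact powVal_congr hg _ _ c

theorem glVal_mul_inv (x : GroupLike P k) : glVal x * glVal x⁻¹ = 1 := Units.mul_inv x.1.1

theorem glVal_inv_mul (x : GroupLike P k) : glVal x⁻¹ * glVal x = 1 := Units.inv_mul x.1.1

theorem powVal_mul_eq_one (a b : AlgCompl k P) (h : a * b = 1) (h' : b * a = 1)
    (ha : eval P 1 a = 1) (hb : eval P 1 b = 1) (c : k) :
    powVal P a ha c * powVal P b hb c = 1 := by
  rw [← powVal_mul a b (h.trans h'.symm) ha hb (by rw [h, map_one]),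
    powVal_congr h _ (map_one _) c, powVal_one]

/-- The power of a group-like element lying over `1`. -/
def glPowUnit (x : (glProj P k).ker) (c : k) : (AlgCompl k P)ˣ where
  val := powVal P (glVal x.1) (eval_one_glVal x.1 x.2) c
  inv := powVal P (glVal x.1⁻¹) (eval_one_glVal x.1⁻¹ x⁻¹.2) c
  val_inv := powVal_mul_eq_one _ _ (glVal_mul_inv x.1) (glVal_inv_mul x.1) _ _ c
  inv_val := powVal_mul_eq_one _ _ (glVal_inv_mul x.1) (glVal_mul_inv x.1) _ _ c

theorem glPow_mem (x : (glProj P k).ker) (c : k) : (glPowUnit x c, 1) ∈ GroupLike P k :=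
  ⟨isGroupLike_powVal x.1.2.1 (eval_one_glVal x.1 x.2) c, 1, map_one _, by
    rw [map_one, map_one]; exact eval_one_powVal _ (eval_one_glVal x.1 x.2) c⟩

def glPow (x : (glProj P k).ker) (c : k) : (glProj P k).ker :=
  ⟨⟨(glPowUnit x c, 1), glPow_mem x c⟩, rfl⟩

end AlgCompl

variable (k) [Algebra ℚ k]

/-- The prounipotent setting over a `ℚ`-algebra `k`. -/
def unip : Setting.{v} where
  Scal := k
  Obj := fun _ _ P _ => AlgCompl.GroupLike P k
  of := fun P _ => AlgCompl.glOf P k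
  proj := fun P _ => AlgCompl.glProj P k
  lift := fun _ _ _ _ θ hθ => AlgCompl.glLift θ hθ
  pow := fun _ _ x c => AlgCompl.glPow x c
  Regular := fun {α} {_ _} _ _ P Q _ _ p q => ∀ N : ℕ, ∃ M : ℕ, ∃ Λ : Trunc k P M →ₗ[k] Trunc k Q N,
    ∀ a : α, AlgCompl.eval Q N (AlgCompl.glVal (q a)) =
      Λ (AlgCompl.eval P M (AlgCompl.glVal (p a)))
  proj_of := fun _ _ _ => rfl
  lift_of := fun _ _ _ _ _ _ g => Subtype.ext (Prod.ext
    (Units.ext (AlgCompl.lift_of _ _ g)) rfl)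
  proj_lift := fun _ _ _ _ _ _ _ => rfl

end UnipSetting

/-! ## Braid groups -/

section Braids

/-- The Artin relations on generators `σ₀, …, σ_{n-2}`. -/
def artinRels (n : ℕ) : Set (FreeGroup (Fin (n - 1))) :=
  {r | ∃ i j : Fin (n - 1), (i : ℕ) + 1 = j ∧
      r = (FreeGroup.of i * FreeGroup.of j * FreeGroup.of i) *
        (FreeGroup.of j * FreeGroup.of i * FreeGroup.of j)⁻¹} ∪
  {r | ∃ i j : Fin (n - 1), (i : ℕ) + 2 ≤ j ∧
      r = (FreeGroup.of i * FreeGroup.of j) * (FreeGroup.of j * FreeGroup.of i)⁻¹}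

/-- The braid group on `n` strands. -/
abbrev Braid (n : ℕ) : Type := PresentedGroup (artinRels n)

/-- The generator `σᵢ` (`0 ≤ i ≤ n - 2`), exchanging the strands `i` and `i + 1`;
the value is `1` for `i` out of range. -/
def sigma (n i : ℕ) : Braid n := if h : i < n - 1 then PresentedGroup.of ⟨i, h⟩ else 1

theorem of_eq_sigma {n : ℕ} (i : Fin (n - 1)) : (PresentedGroup.of i : Braid n) = sigma n i := by
  simp [sigma]

theorem sigma_braid {n i : ℕ} (h : i + 2 < n) :
    sigma n i * sigma n (i + 1) * sigma n i =
      sigma n (i + 1) * sigma n i * sigma n (i + 1) := by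
  rw [sigma, sigma, dif_pos (by omega), dif_pos (by omega), ← mul_inv_eq_one]
  exact PresentedGroup.one_of_mem (Or.inl ⟨⟨i, by omega⟩, ⟨i + 1, by omega⟩, rfl, rfl⟩)

theorem sigma_comm {n i j : ℕ} (h : i + 2 ≤ j) (hj : j + 1 < n) :
    sigma n i * sigma n j = sigma n j * sigma n i := by
  rw [sigma, sigma, dif_pos (by omega), dif_pos (by omega), ← mul_inv_eq_one]
  exact PresentedGroup.one_of_mem (Or.inr ⟨⟨i, by omega⟩, ⟨j, by omega⟩, h, rfl⟩)

/-- Morphisms out of the braid group. -/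
def braidLift {K : Type*} [Group K] (n : ℕ) (f : ℕ → K)
    (hb : ∀ i, i + 2 < n → f i * f (i + 1) * f i = f (i + 1) * f i * f (i + 1))
    (hc : ∀ i j, i + 2 ≤ j → j + 1 < n → f i * f j = f j * f i) : Braid n →* K :=
  PresentedGroup.toGroup (f := fun i : Fin (n - 1) => f i) (by
    rintro r (⟨i, j, hij, rfl⟩ | ⟨i, j, hij, rfl⟩)
    · have := hb i (by omega)
      simp only [map_mul, map_inv, FreeGroup.lift_apply_of, ← hij]
      rw [this, mul_inv_cancel]
    · have := hc i j hij (by omega)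
      simp only [map_mul, map_inv, FreeGroup.lift_apply_of]
      rw [this, mul_inv_cancel])

theorem braidLift_sigma {K : Type*} [Group K] (n : ℕ) (f : ℕ → K)
    (hb : ∀ i, i + 2 < n → f i * f (i + 1) * f i = f (i + 1) * f i * f (i + 1))
    (hc : ∀ i j, i + 2 ≤ j → j + 1 < n → f i * f j = f j * f i) {i : ℕ} (h : i + 1 < n) :
    braidLift n f hb hc (sigma n i) = f i := by
  rw [sigma, dif_pos (by omega), braidLift]
  exact PresentedGroup.toGroup.of _

theorem braid_hom_ext {K : Type*} [Group K] {n : ℕ} {φ ψ : Braid n →* K}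
    (h : ∀ i, i + 1 < n → φ (sigma n i) = ψ (sigma n i)) : φ = ψ :=
  PresentedGroup.ext fun i => by rw [of_eq_sigma]; exact h i (by omega)

/-- The transposition of `i` and `i + 1`. -/
def transp (n i : ℕ) : Equiv.Perm (Fin n) :=
  if h : i + 1 < n then Equiv.swap ⟨i, by omega⟩ ⟨i + 1, h⟩ else 1

theorem transp_val (n i : ℕ) (h : i + 1 < n) (x : Fin n) :
    ((transp n i x : Fin n) : ℕ) =
      if (x : ℕ) = i then i + 1 else if (x : ℕ) = i + 1 then i else x := by
  rw [transp, dif_pos h, Equiv.swap_apply_def]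
  simp only [Fin.ext_iff]
  split_ifs <;> rfl

/-- The permutation underlying a braid. -/
def braidPerm (n : ℕ) : Braid n →* Equiv.Perm (Fin n) :=
  braidLift n (transp n)
    (fun i hi => by
      ext x
      have h1 := transp_val n i (by omega)
      have h2 := transp_val n (i + 1) (by omega)
      simp only [Equiv.Perm.mul_apply, h1, h2]
      split_ifs <;> omega)
    (fun i j hij hj => by
      ext x
      have h1 := transp_val n i (by omega)
      have h2 := transp_val n j hj
      simp only [Equiv.Perm.mul_apply, h1, h2]
      split_ifs <;> omega)

theorem braidPerm_sigma {n i : ℕ} (h : i + 1 < n) : braidPerm n (sigma n i) = transp n i :=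
  braidLift_sigma _ _ _ _ h

theorem braidPerm_sigma_val {n i : ℕ} (h : i + 1 < n) (x : Fin n) :
    ((braidPerm n (sigma n i) x : Fin n) : ℕ) =
      if (x : ℕ) = i then i + 1 else if (x : ℕ) = i + 1 then i else x := by
  rw [braidPerm_sigma h, transp_val n i h]

/-- Insertion of a braid on the strands `k, …, k + n - 1` of a braid on `N` strands:
`σᵢ ↦ σ_{k+i}`. -/
def shift (n k N : ℕ) (h : k + n ≤ N) : Braid n →* Braid N :=
  braidLift n (fun i => sigma N (k + i))
    (fun i hi => sigma_braid (by omega))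
    (fun i j hij hj => sigma_comm (by omega) (by omega))

/-- The embedding `i ↦ k + i`. -/
def shiftEmb (n k N : ℕ) (h : k + n ≤ N) : Fin n ↪ Fin N where
  toFun i := ⟨k + i, by omega⟩
  inj' i j hij := Fin.ext (by have := congrArg Fin.val hij; dsimp only at this; omega)

theorem shiftEmb_val (n k N : ℕ) (h : k + n ≤ N) (i : Fin n) :
    ((shiftEmb n k N h i : Fin N) : ℕ) = k + i := rfl

theorem notMem_range_shiftEmb (n k N : ℕ) (h : k + n ≤ N) (i : Fin N)
    (hi : ¬ (k ≤ (i : ℕ) ∧ (i : ℕ) < k + n)) : i ∉ Set.range (shiftEmb n k N h) := by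
  rintro ⟨y, rfl⟩
  rw [shiftEmb_val] at hi
  omega

theorem braidPerm_shift (n k N : ℕ) (h : k + n ≤ N) (g : Braid n) :
    braidPerm N (shift n k N h g) =
      Equiv.Perm.viaEmbeddingHom (shiftEmb n k N h) (braidPerm n g) := by
  have e : (braidPerm N).comp (shift n k N h) =
      (Equiv.Perm.viaEmbeddingHom (shiftEmb n k N h)).comp (braidPerm n) := by
    refine braid_hom_ext fun i hi => ?_
    ext x
    rw [MonoidHom.comp_apply, MonoidHom.comp_apply, shift, braidLift_sigma _ _ _ _ hi,
      braidPerm_sigma_val (by omega), braidPerm_sigma hi, Equiv.Perm.viaEmbeddingHom_apply]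
    by_cases hx : k ≤ (x : ℕ) ∧ (x : ℕ) < k + n
    · obtain ⟨y, rfl⟩ : ∃ y : Fin n, shiftEmb n k N h y = x :=
        ⟨⟨x - k, by omega⟩, Fin.ext (by rw [shiftEmb_val]; dsimp only; omega)⟩
      rw [Equiv.Perm.viaEmbedding_apply, shiftEmb_val, shiftEmb_val, transp_val n i hi]
      split_ifs <;> omega
    · rw [Equiv.Perm.viaEmbedding_apply_of_notMem _ _ _ (notMem_range_shiftEmb n k N h x hx)]
      split_ifs <;> omega
  exact DFunLike.congr_fun e g

theorem braidPerm_shift_of_mem (n k N : ℕ) (h : k + n ≤ N) (g : Braid n) (i : Fin n) :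
    braidPerm N (shift n k N h g) ⟨k + i, by omega⟩ = ⟨k + braidPerm n g i, by omega⟩ := by
  rw [braidPerm_shift]
  exact Equiv.Perm.viaEmbedding_apply _ (shiftEmb n k N h) i

theorem braidPerm_shift_of_notMem (n k N : ℕ) (h : k + n ≤ N) (g : Braid n) (i : Fin N)
    (hi : ¬ (k ≤ (i : ℕ) ∧ (i : ℕ) < k + n)) : braidPerm N (shift n k N h g) i = i := by
  rw [braidPerm_shift]
  exact Equiv.Perm.viaEmbedding_apply_of_notMem _ _ i (notMem_range_shiftEmb n k N h i hi)

/-- The automorphism `σᵢ ↦ σ_{n-2-i}` of the braid group. -/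
def braidStar (n : ℕ) : Braid n →* Braid n :=
  braidLift n (fun i => sigma n (n - 2 - i))
    (fun i hi => by
      have e : n - 2 - i = n - 2 - (i + 1) + 1 := by omega
      rw [e]
      exact (sigma_braid (by omega)).symm)
    (fun i j hij hj => (sigma_comm (by omega) (by omega)).symm)

theorem braidPerm_star (n : ℕ) (g : Braid n) (i : Fin n) :
    braidPerm n (braidStar n g) i = (braidPerm n g i.rev).rev := by
  have e : (braidPerm n).comp (braidStar n) =
      (MulAut.conj (Fin.revPerm : Equiv.Perm (Fin n))).toMonoidHom.comp (braidPerm n) := by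
    refine braid_hom_ext fun i hi => ?_
    ext x
    rw [MonoidHom.comp_apply, braidStar, braidLift_sigma _ _ _ _ hi,
      braidPerm_sigma_val (by omega)]
    change _ = ((braidPerm n (sigma n i) x.rev).rev : ℕ)
    rw [Fin.val_rev, braidPerm_sigma_val hi, Fin.val_rev]
    split_ifs <;> omega
  have e2 := DFunLike.congr_fun (DFunLike.congr_fun e g) i
  exact e2

/-- `row N j m = σ_{j+m-1} ⋯ σ_{j+1} σ_j`. -/
def row (N j : ℕ) : ℕ → Braid N
  | 0 => 1
  | m + 1 => sigma N (j + m) * row N j m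

/-- `block N n m = (σ_{m-1} ⋯ σ_0) (σ_m ⋯ σ_1) ⋯ (σ_{n+m-2} ⋯ σ_{n-1})`, which exchanges a block
of `n` strands with a block of `m` strands. -/
def block (N : ℕ) : ℕ → ℕ → Braid N
  | 0, _ => 1
  | n + 1, m => block N n m * row N n m

/-- `halfTw N k = σ_0 (σ_1 σ_0) ⋯ (σ_{k-2} ⋯ σ_0)`. -/
def halfTw (N : ℕ) : ℕ → Braid N
  | 0 => 1
  | k + 1 => halfTw N k * row N 0 k

/-- `rho N k = σ_0 σ_1 ⋯ σ_{k-1}`. -/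
def rho (N : ℕ) : ℕ → Braid N
  | 0 => 1
  | k + 1 => rho N k * sigma N k

/-- The half-twist `h_n = σ_0 (σ_1 σ_0) ⋯ (σ_{n-2} ⋯ σ_0)`. -/
def halfTwist (n : ℕ) : Braid n := halfTw n n

theorem row_val (N j m : ℕ) (h : j + m < N ∨ m = 0) (x : Fin N) :
    ((braidPerm N (row N j m) x : Fin N) : ℕ) =
      if (x : ℕ) = j then j + m else if j < (x : ℕ) ∧ (x : ℕ) ≤ j + m then (x : ℕ) - 1 else x := by
  induction m with
  | zero =>
    rw [row, map_one, Equiv.Perm.one_apply]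
    split_ifs <;> omega
  | succ m ih =>
    rw [row, map_mul, Equiv.Perm.mul_apply, braidPerm_sigma_val (by omega), ih (by omega)]
    split_ifs <;> omega

theorem block_val (N n m : ℕ) (h : n + m ≤ N) (x : Fin N) :
    ((braidPerm N (block N n m) x : Fin N) : ℕ) =
      if (x : ℕ) < n then x + m else if (x : ℕ) < n + m then (x : ℕ) - n else x := by
  induction n generalizing x with
  | zero =>
    rw [block, map_one, Equiv.Perm.one_apply]
    split_ifs <;> omega
  | succ n ih =>
    rw [block, map_mul, Equiv.Perm.mul_apply, ih (by omega), row_val _ _ _ (by omega)]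
    split_ifs <;> omega

theorem halfTw_val (N k : ℕ) (h : k ≤ N) (x : Fin N) :
    ((braidPerm N (halfTw N k) x : Fin N) : ℕ) =
      if (x : ℕ) < k then k - 1 - x else x := by
  induction k generalizing x with
  | zero =>
    rw [halfTw, map_one, Equiv.Perm.one_apply]
    split_ifs <;> omega
  | succ k ih =>
    rw [halfTw, map_mul, Equiv.Perm.mul_apply, ih (by omega), row_val _ _ _ (by omega)]
    split_ifs <;> omega

theorem rho_val (N k : ℕ) (h : k < N ∨ k = 0) (x : Fin N) :
    ((braidPerm N (rho N k) x : Fin N) : ℕ) =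
      if (x : ℕ) < k then (x : ℕ) + 1 else if (x : ℕ) = k then 0 else x := by
  induction k generalizing x with
  | zero =>
    rw [rho, map_one, Equiv.Perm.one_apply]
    split_ifs <;> omega
  | succ k ih =>
    rw [rho, map_mul, Equiv.Perm.mul_apply, ih (by omega), braidPerm_sigma_val (by omega)]
    split_ifs <;> omega

theorem braidPerm_halfTwist (n : ℕ) (x : Fin n) : braidPerm n (halfTwist n) x = x.rev := by
  ext
  rw [halfTwist, halfTw_val n n le_rfl, Fin.val_rev]
  split_ifs <;> omega

theorem braidPerm_rho (n : ℕ) (x : Fin n) : braidPerm n (rho n (n - 1)) x = finRotate n x := by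
  obtain _ | n := n
  · exact x.elim0
  · ext
    rw [rho_val _ _ (by omega), coe_finRotate]
    simp only [Fin.ext_iff, Fin.val_last]
    split_ifs <;> omega

/-- The full twist `z_n = (σ_0 ⋯ σ_{n-2})^n`. -/
def fullTwist (n : ℕ) : Braid n := rho n (n - 1) ^ n

/-- The word `σ_0 ⋯ σ_{n-3} σ_{n-2}² σ_{n-3} ⋯ σ_0`. -/
def sphereWord (n : ℕ) : Braid n := rho n (n - 1) * row n 0 (n - 1)

/-- The mapping class group `Γ_{0,n}` of the sphere with `n` (unordered) marked points. -/
abbrev SphereMCG (n : ℕ) : Type :=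
  Braid n ⧸ Subgroup.normalClosure ({fullTwist n, sphereWord n} : Set (Braid n))

theorem finRotate_pow_self (n : ℕ) : finRotate n ^ n = 1 := by
  ext x
  have key : ∀ k : ℕ, ((finRotate n ^ k) x : ℕ) = ((x : ℕ) + k) % n := by
    intro k
    induction k with
    | zero => simp [Nat.mod_eq_of_lt x.2]
    | succ k ih =>
      obtain _ | n := n
      · exact x.elim0
      · rw [pow_succ', Equiv.Perm.mul_apply, finRotate_apply, Fin.val_add, ih]
        simp [Nat.add_assoc]
  rw [key, Nat.add_mod_right, Nat.mod_eq_of_lt x.2]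
  rfl

/-- The permutation underlying a mapping class. -/
def spherePerm (n : ℕ) : SphereMCG n →* Equiv.Perm (Fin n) :=
  QuotientGroup.lift _ (braidPerm n) (by
    refine Subgroup.normalClosure_le_normal (N := (braidPerm n).ker) ?_
    rintro g (rfl | rfl)
    · have e : braidPerm n (rho n (n - 1)) = finRotate n := Equiv.ext (braidPerm_rho n)
      change braidPerm n (fullTwist n) = 1
      rw [fullTwist, map_pow, e, finRotate_pow_self]
    · change braidPerm n (sphereWord n) = 1
      ext x
      rw [sphereWord, map_mul, Equiv.Perm.mul_apply, rho_val _ _ (by omega),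
        row_val _ _ _ (by omega), Equiv.Perm.one_apply]
      split_ifs <;> omega)

end Braids

/-! ## Groupoids of words -/

namespace Setting
variable (T : Setting.{v}) {G H : Type} [Group G] [Group H]

/-- The morphism between completions induced by a morphism of groups. -/
def map (P : Subgroup G) (Q : Subgroup H) [P.Normal] [Q.Normal] (φ : G →* H)
    (h : ∀ p ∈ P, φ p ∈ Q) : T.Obj G P →* T.Obj H Q :=
  T.lift P Q ((T.of Q).comp φ) (fun p hp => by
    rw [MonoidHom.comp_apply, T.proj_of]
    exact (QuotientGroup.eq_one_iff _).mpr (h p hp))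

theorem map_of (P : Subgroup G) (Q : Subgroup H) [P.Normal] [Q.Normal] (φ : G →* H)
    (h : ∀ p ∈ P, φ p ∈ Q) (g : G) : T.map P Q φ h (T.of P g) = T.of Q (φ g) :=
  T.lift_of P Q _ _ g

theorem proj_map (P : Subgroup G) (Q : Subgroup H) [P.Normal] [Q.Normal] (φ : G →* H)
    (h : ∀ p ∈ P, φ p ∈ Q) (x : T.Obj G P) (g : G) (hg : T.proj P x = QuotientGroup.mk' P g) :
    T.proj Q (T.map P Q φ h x) = QuotientGroup.mk' Q (φ g) := by
  rw [map, T.proj_lift, hg]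
  exact T.proj_of Q (φ g)

/-- The permutation underlying an element of the completion of `G` relative to `π : G → S_n`. -/
def permT {n : ℕ} (π : G →* Equiv.Perm (Fin n)) : T.Obj G π.ker →* Equiv.Perm (Fin n) :=
  (QuotientGroup.kerLift π).comp (T.proj π.ker)

theorem permT_eq {n : ℕ} (π : G →* Equiv.Perm (Fin n)) (x : T.Obj G π.ker) (g : G)
    (hg : T.proj π.ker x = QuotientGroup.mk' π.ker g) : T.permT π x = π g := by
  rw [permT, MonoidHom.comp_apply, hg]
  rfl

theorem permT_of {n : ℕ} (π : G →* Equiv.Perm (Fin n)) (g : G) :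
    T.permT π (T.of π.ker g) = π g :=
  T.permT_eq π _ g (T.proj_of _ g)

theorem exists_rep (P : Subgroup G) [P.Normal] (x : T.Obj G P) :
    ∃ g, T.proj P x = QuotientGroup.mk' P g :=
  (QuotientGroup.mk'_surjective P _).imp fun _ h => h.symm

open Classical in
/-- `x ^ c` for `x` in the kernel of the projection to `G / P` (and `1` otherwise). -/
def powT (P : Subgroup G) [P.Normal] (x : T.Obj G P) (c : T.Scal) : T.Obj G P :=
  if h : x ∈ (T.proj P).ker then (T.pow P ⟨x, h⟩ c : (T.proj P).ker) else 1

theorem proj_powT (P : Subgroup G) [P.Normal] (x : T.Obj G P) (c : T.Scal) :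
    T.proj P (T.powT P x c) = 1 := by
  unfold powT
  split_ifs
  · exact (T.pow P _ c).2
  · exact map_one _

/-- The completion of the free group on two generators. -/
abbrev Free2 : Type v := T.Obj (FreeGroup (Fin 2)) ⊤

open Classical in
/-- The element `f(x, y)`, for `x` and `y` in the kernel of the projection to `G / P`
(and `1` otherwise). -/
def substT (P : Subgroup G) [P.Normal] (f : T.Free2) (x y : T.Obj G P) : T.Obj G P :=
  if h : T.proj P x = 1 ∧ T.proj P y = 1 then
    T.lift ⊤ P (FreeGroup.lift ![x, y]) (fun p _ => by
      have e : (T.proj P).comp (FreeGroup.lift ![x, y]) = 1 := by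
        refine FreeGroup.ext_hom _ _ fun i => ?_
        rw [MonoidHom.comp_apply, FreeGroup.lift_apply_of, MonoidHom.one_apply]
        fin_cases i
        · exact h.1
        · exact h.2
      exact DFunLike.congr_fun e p) f
  else 1

theorem proj_substT (P : Subgroup G) [P.Normal] (f : T.Free2) (x y : T.Obj G P) :
    T.proj P (T.substT P f x y) = 1 := by
  unfold substT
  split_ifs with h
  · rw [T.proj_lift]
    obtain ⟨g, hg⟩ := T.exists_rep ⊤ f
    have : T.proj ⊤ f = 1 := by
      rw [hg]; exact (QuotientGroup.eq_one_iff g).mpr trivial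
    rw [this, map_one]
  · exact map_one _

end Setting

/-- A family of groups over the symmetric groups. -/
structure PermFamily where
  G : ℕ → Type
  [grp : ∀ n, Group (G n)]
  π : ∀ n, G n →* Equiv.Perm (Fin n)

attribute [instance] PermFamily.grp

/-- The braid groups. -/
def braidFamily : PermFamily where
  G := Braid
  π := braidPerm

/-- The mapping class groups `Γ_{0,n}`. -/
def sphereFamily : PermFamily where
  G := SphereMCG
  π := spherePerm

/-- Words in the alphabet `S`. -/
abbrev Word (S : Type u) : Type u := Σ n : ℕ, Fin n → S

section Words
variable (T : Setting.{v}) (F : PermFamily) {S : Type u}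

/-- The completion of `F.G n` relative to `F.π n`. -/
abbrev PermFamily.Compl (n : ℕ) : Type v := T.Obj (F.G n) (F.π n).ker

/-- The permutation underlying an element of the completion. -/
abbrev PermFamily.permC (n : ℕ) : F.Compl T n →* Equiv.Perm (Fin n) := T.permT (F.π n)

/-- Transport along an equality of indices. -/
def PermFamily.castC {m n : ℕ} (h : m = n) : F.Compl T m →* F.Compl T n :=
  h ▸ MonoidHom.id _

/-- Morphisms between words: elements of the completed group of the appropriate index whose
underlying permutation carries the first word to the second one. -/
structure WordHom (x y : Word S) : Type v where
  len : x.1 = y.1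
  val : F.Compl T x.1
  compat : ∀ i, y.2 (Fin.cast len (F.permC T x.1 val i)) = x.2 i

namespace WordHom
variable {T F}

@[ext] theorem ext {x y : Word S} {φ ψ : WordHom T F x y} (h : φ.val = ψ.val) : φ = ψ := by
  cases φ; cases ψ; cases h; rfl

def id (x : Word S) : WordHom T F x x where
  len := rfl
  val := 1
  compat i := by rw [map_one]; rfl

/-- The composite of `φ : x → y` and `ψ : y → z`, given by the product `ψ φ`. -/
def comp {x y z : Word S} (φ : WordHom T F x y) (ψ : WordHom T F y z) : WordHom T F x z where
  len := φ.len.trans ψ.len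
  val := F.castC T φ.len.symm ψ.val * φ.val
  compat i := by
    obtain ⟨m, s⟩ := x
    obtain ⟨n, s'⟩ := y
    obtain ⟨l, s''⟩ := z
    obtain ⟨h, f, hf⟩ := φ
    obtain ⟨h', g, hg⟩ := ψ
    dsimp only at h h'
    subst h h'
    rw [map_mul]
    exact (hg _).trans (hf i)

def inv {x y : Word S} (φ : WordHom T F x y) : WordHom T F y x where
  len := φ.len.symm
  val := F.castC T φ.len φ.val⁻¹
  compat i := by
    obtain ⟨m, s⟩ := x
    obtain ⟨n, s'⟩ := y
    obtain ⟨h, f, hf⟩ := φ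
    dsimp only at h
    subst h
    change s (F.permC T m f⁻¹ i) = s' i
    have h1 := hf ((F.permC T m f)⁻¹ i)
    rw [map_inv]
    refine h1.symm.trans ?_
    change s' (F.permC T m f ((F.permC T m f)⁻¹ i)) = s' i
    exact congrArg s' (Equiv.apply_symm_apply (F.permC T m f) i)

theorem id_comp {x y : Word S} (φ : WordHom T F x y) : (id x).comp φ = φ := by
  obtain ⟨m, s⟩ := x
  obtain ⟨n, s'⟩ := y
  obtain ⟨h, f, hf⟩ := φ
  dsimp only at h
  subst h
  exact ext (mul_one f)

theorem comp_id {x y : Word S} (φ : WordHom T F x y) : φ.comp (id y) = φ := by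
  obtain ⟨m, s⟩ := x
  obtain ⟨n, s'⟩ := y
  obtain ⟨h, f, hf⟩ := φ
  dsimp only at h
  subst h
  exact ext (one_mul f)

theorem comp_assoc {x y z w : Word S} (φ : WordHom T F x y) (ψ : WordHom T F y z)
    (χ : WordHom T F z w) : (φ.comp ψ).comp χ = φ.comp (ψ.comp χ) := by
  obtain ⟨m, s⟩ := x
  obtain ⟨n, s'⟩ := y
  obtain ⟨l, s''⟩ := z
  obtain ⟨p, s'''⟩ := w
  obtain ⟨h, f, hf⟩ := φ
  obtain ⟨h', g, hg⟩ := ψ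
  obtain ⟨h'', k, hk⟩ := χ
  dsimp only at h h' h''
  subst h h' h''
  exact ext (mul_assoc k g f).symm

theorem inv_comp {x y : Word S} (φ : WordHom T F x y) : φ.inv.comp φ = id y := by
  obtain ⟨m, s⟩ := x
  obtain ⟨n, s'⟩ := y
  obtain ⟨h, f, hf⟩ := φ
  dsimp only at h
  subst h
  exact ext (mul_inv_cancel f)

theorem comp_inv {x y : Word S} (φ : WordHom T F x y) : φ.comp φ.inv = id x := by
  obtain ⟨m, s⟩ := x
  obtain ⟨n, s'⟩ := y
  obtain ⟨h, f, hf⟩ := φ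
  dsimp only at h
  subst h
  exact ext (inv_mul_cancel f)

/-- The `c`-th power of an automorphism whose underlying permutation is trivial. -/
def pow {x : Word S} (φ : WordHom T F x x) (c : T.Scal) : WordHom T F x x where
  len := rfl
  val := T.powT (F.π x.1).ker φ.val c
  compat i := by
    have : F.permC T x.1 (T.powT (F.π x.1).ker φ.val c) = 1 := by
      rw [PermFamily.permC, Setting.permT, MonoidHom.comp_apply, T.proj_powT, map_one]
    rw [this]; rfl

/-- The automorphism `f(φ, ψ)`, for `φ` and `ψ` with trivial underlying permutations. -/
def subst {x : Word S} (f : T.Free2) (φ ψ : WordHom T F x x) : WordHom T F x x where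
  len := rfl
  val := T.substT (F.π x.1).ker f φ.val ψ.val
  compat i := by
    have : F.permC T x.1 (T.substT (F.π x.1).ker f φ.val ψ.val) = 1 := by
      rw [PermFamily.permC, Setting.permT, MonoidHom.comp_apply, T.proj_substT, map_one]
    rw [this]; rfl

end WordHom

end Words

/-! ## Quotient categories -/

section Quotient

variable {C : Type u} [Groupoid.{v} C] (W : MorphismProperty C)

/-- The smallest class of morphisms which contains `W` and the identities and is closed under
composition and inverses. -/
inductive GenBy : ∀ {X Y : C}, (X ⟶ Y) → Prop
  | of {X Y : C} (φ : X ⟶ Y) : W φ → GenBy φ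
  | id (X : C) : GenBy (𝟙 X)
  | comp {X Y Z : C} (φ : X ⟶ Y) (ψ : Y ⟶ Z) : GenBy φ → GenBy ψ → GenBy (φ ≫ ψ)
  | inv {X Y : C} (φ : X ⟶ Y) : GenBy φ → GenBy (Groupoid.inv φ)

/-- Two objects are identified if they are connected by a morphism generated by `W`. -/
def collapseSetoid : Setoid C where
  r X Y := ∃ φ : X ⟶ Y, GenBy W φ
  iseqv :=
    { refl := fun X => ⟨𝟙 X, .id X⟩
      symm := fun ⟨φ, h⟩ => ⟨Groupoid.inv φ, .inv φ h⟩
      trans := fun ⟨φ, h⟩ ⟨ψ, h'⟩ => ⟨φ ≫ ψ, .comp φ ψ h h'⟩ }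

/-- The objects of the category obtained from `C` by turning all morphisms of `W` into
identities. -/
def Collapse : Type u := Quotient (collapseSetoid W)

namespace Collapse
variable {W}

/-- A morphism of `C` whose source and target have the given classes. -/
structure Rep (α β : Collapse W) : Type (max u v) where
  {src tgt : C}
  hsrc : Quotient.mk (collapseSetoid W) src = α
  htgt : Quotient.mk (collapseSetoid W) tgt = β
  hom : src ⟶ tgt

/-- The identifications between representatives which are forced by turning the morphisms of `W`
into identities. -/
inductive Rep.Rel {α β : Collapse W} : Rep α β → Rep α β → Prop
  | move {X Y X' Y' : C} (hX : Quotient.mk (collapseSetoid W) X = α)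
      (hY : Quotient.mk (collapseSetoid W) Y = β)
      (hX' : Quotient.mk (collapseSetoid W) X' = α)
      (hY' : Quotient.mk (collapseSetoid W) Y' = β) (φ : X ⟶ Y) (i : X' ⟶ X) (j : Y ⟶ Y') :
      GenBy W i → GenBy W j → Rel ⟨hX, hY, φ⟩ ⟨hX', hY', i ≫ φ ≫ j⟩
  | middle {X Y X' Y' : C} (hX : Quotient.mk (collapseSetoid W) X = α)
      (hY : Quotient.mk (collapseSetoid W) Y = β) (φ : X ⟶ X') (i j : X' ⟶ Y') (ψ : Y' ⟶ Y) :
      GenBy W i → GenBy W j → Rel ⟨hX, hY, φ ≫ i ≫ ψ⟩ ⟨hX, hY, φ ≫ j ≫ ψ⟩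

/-- The morphisms of the quotient category. -/
def Hom (α β : Collapse W) : Type (max u v) := Quot (Rep.Rel (α := α) (β := β))

theorem Rep.connect {α β γ : Collapse W} (p : Rep α β) (q : Rep β γ) :
    ∃ i : p.tgt ⟶ q.src, GenBy W i :=
  Quotient.exact (p.htgt.trans q.hsrc.symm)

def Rep.comp {α β γ : Collapse W} (p : Rep α β) (q : Rep β γ) : Rep α γ where
  hsrc := p.hsrc
  htgt := q.htgt
  hom := p.hom ≫ (p.connect q).choose ≫ q.hom

theorem Rep.mk_comp {α β γ : Collapse W} (p : Rep α β) (q : Rep β γ) (i : p.tgt ⟶ q.src)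
    (hi : GenBy W i) : Quot.mk Rep.Rel (p.comp q) =
      Quot.mk Rep.Rel ⟨p.hsrc, q.htgt, p.hom ≫ i ≫ q.hom⟩ :=
  Quot.sound (.middle p.hsrc q.htgt p.hom _ i q.hom (p.connect q).choose_spec hi)

theorem Rep.sound_left {α β γ : Collapse W} {p p' : Rep α β} (h : Rep.Rel p p') (q : Rep β γ) :
    Quot.mk Rep.Rel (p.comp q) = Quot.mk Rep.Rel (p'.comp q) := by
  cases h with
  | @move X Y X' Y' hX hY hX' hY' φ i j hi hj =>
    obtain ⟨k, hk⟩ := Rep.connect ⟨hX', hY', i ≫ φ ≫ j⟩ q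
    rw [Rep.mk_comp _ q k hk, Rep.mk_comp ⟨hX, hY, φ⟩ q (j ≫ k) (.comp _ _ hj hk)]
    refine (Quot.sound (.move hX q.htgt hX' q.htgt _ i (𝟙 _) hi (.id _))).trans ?_
    simp only [Category.assoc, Category.comp_id]
  | @middle X Y X' Y' hX hY φ i j ψ hi hj =>
    obtain ⟨k, hk⟩ := Rep.connect ⟨hX, hY, φ ≫ i ≫ ψ⟩ q
    rw [Rep.mk_comp _ q k hk, Rep.mk_comp ⟨hX, hY, φ ≫ j ≫ ψ⟩ q k hk]
    have := Quot.sound (Rep.Rel.middle hX q.htgt φ i j (ψ ≫ k ≫ q.hom) hi hj)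
    simpa only [Category.assoc] using this

theorem Rep.sound_right {α β γ : Collapse W} (p : Rep α β) {q q' : Rep β γ} (h : Rep.Rel q q') :
    Quot.mk Rep.Rel (p.comp q) = Quot.mk Rep.Rel (p.comp q') := by
  cases h with
  | @move X Y X' Y' hX hY hX' hY' φ i j hi hj =>
    obtain ⟨k, hk⟩ := p.connect ⟨hX', hY', i ≫ φ ≫ j⟩
    rw [Rep.mk_comp p ⟨hX', hY', i ≫ φ ≫ j⟩ k hk,
      Rep.mk_comp p ⟨hX, hY, φ⟩ (k ≫ i) (.comp _ _ hk hi)]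
    refine (Quot.sound (.move p.hsrc hY p.hsrc hY' _ (𝟙 _) j (.id _) hj)).trans ?_
    simp only [Category.assoc, Category.id_comp]
  | @middle X Y X' Y' hX hY φ i j ψ hi hj =>
    obtain ⟨k, hk⟩ := p.connect ⟨hX, hY, φ ≫ i ≫ ψ⟩
    rw [Rep.mk_comp p ⟨hX, hY, φ ≫ i ≫ ψ⟩ k hk, Rep.mk_comp p ⟨hX, hY, φ ≫ j ≫ ψ⟩ k hk]
    have := Quot.sound (Rep.Rel.middle p.hsrc hY (p.hom ≫ k ≫ φ) i j ψ hi hj)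
    simpa only [Category.assoc] using this

def Hom.comp {α β γ : Collapse W} : Hom α β → Hom β γ → Hom α γ :=
  Quot.lift₂ (fun p q => Quot.mk _ (p.comp q)) (fun p _ _ h => p.sound_right h)
    (fun _ _ q h => Rep.sound_left h q)

theorem Rep.exists_id (α : Collapse W) :
    ∃ X : C, Quotient.mk (collapseSetoid W) X = α := Quotient.exists_rep α

def Rep.id (α : Collapse W) : Rep α α where
  hsrc := (Rep.exists_id α).choose_spec
  htgt := (Rep.exists_id α).choose_spec
  hom := 𝟙 _

theorem Rep.mk_id (α : Collapse W) {X : C} (hX : Quotient.mk (collapseSetoid W) X = α)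
    (i : (Rep.id α).src ⟶ X) (hi : GenBy W i) :
    Quot.mk Rep.Rel (Rep.id α) = Quot.mk Rep.Rel ⟨hX, hX, 𝟙 X⟩ := by
  refine (Quot.sound (Rep.Rel.move (Rep.id α).hsrc (Rep.id α).htgt hX hX (Rep.id α).hom
    (Groupoid.inv i) i (.inv _ hi) hi)).trans ?_
  have e : Groupoid.inv i ≫ (Rep.id α).hom ≫ i = 𝟙 X := by
    refine (congrArg _ (Category.id_comp i)).trans (Groupoid.inv_comp i)
  rw [e]

/-- The quotient of the groupoid `C` by `W`: the universal category under `C` in which the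
morphisms of `W` become identities. -/
instance category : Category.{max u v} (Collapse W) where
  Hom := Hom
  id α := Quot.mk _ (Rep.id α)
  comp := Hom.comp
  id_comp := by
    rintro α β ⟨p⟩
    change Quot.mk _ ((Rep.id α).comp p) = _
    obtain ⟨i, hi⟩ := (Rep.id α).connect p
    rw [Rep.mk_comp _ p i hi]
    refine Eq.trans ?_ (Quot.sound (Rep.Rel.move p.hsrc p.htgt (Rep.id α).hsrc p.htgt p.hom i
      (𝟙 _) hi (.id _))).symm
    simp only [Rep.id, Category.id_comp, Category.comp_id]
  comp_id := by
    rintro α β ⟨p⟩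
    change Quot.mk _ (p.comp (Rep.id β)) = _
    obtain ⟨i, hi⟩ := p.connect (Rep.id β)
    rw [Rep.mk_comp p _ i hi]
    refine Eq.trans ?_ (Quot.sound (Rep.Rel.move p.hsrc p.htgt p.hsrc (Rep.id β).htgt p.hom
      (𝟙 _) i (.id _) hi)).symm
    have e : p.hom ≫ i ≫ (Rep.id β).hom = 𝟙 _ ≫ p.hom ≫ i := by
      rw [Category.id_comp]
      exact congrArg _ (Category.comp_id i)
    rw [e]
    rfl
  assoc := by
    rintro α β γ δ ⟨p⟩ ⟨q⟩ ⟨r⟩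
    change Quot.mk _ ((p.comp q).comp r) = Quot.mk _ (p.comp (q.comp r))
    refine congrArg (Quot.mk _) ?_
    simp [Rep.comp]

theorem mk_eq_of_gen {X Y : C} (i : X ⟶ Y) (hi : GenBy W i) :
    Quotient.mk (collapseSetoid W) X = Quotient.mk (collapseSetoid W) Y :=
  Quotient.sound ⟨i, hi⟩

/-- The quotient functor. -/
def quotientFunctor (W : MorphismProperty C) : C ⥤ Collapse W where
  obj X := Quotient.mk (collapseSetoid W) X
  map φ := Quot.mk _ ⟨rfl, rfl, φ⟩
  map_id X := by
    obtain ⟨i, hi⟩ := Quotient.exact (s := collapseSetoid W)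
      (Rep.id (Quotient.mk (collapseSetoid W) X)).hsrc
    exact (Rep.mk_id _ rfl i hi).symm
  map_comp {X Y Z} φ ψ := by
    change _ = Quot.mk _ (Rep.comp ⟨rfl, rfl, φ⟩ ⟨rfl, rfl, ψ⟩)
    rw [Rep.mk_comp ⟨rfl, rfl, φ⟩ ⟨rfl, rfl, ψ⟩ (𝟙 _) (.id _)]
    simp

end Collapse
end Quotient

/-! ## Parenthesizations and planar trees -/

/-- The mirror image of a non-empty parenthesized word. -/
def mirrorTree : FreeMagma Unit → FreeMagma Unit
  | .of x => .of x
  | .mul a b => .mul (mirrorTree b) (mirrorTree a)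

theorem length_mirrorTree (a : FreeMagma Unit) : (mirrorTree a).length = a.length := by
  induction a using FreeMagma.recOnMul with
  | ih1 x => rfl
  | ih2 a b iha ihb =>
    change (mirrorTree b).length + (mirrorTree a).length = a.length + b.length
    rw [iha, ihb, add_comm]

/-- The number of letters of a parenthesized word (`none` is the empty word). -/
def numLetters : Option (FreeMagma Unit) → ℕ
  | none => 0
  | some a => a.length

/-- Concatenation of parenthesized words; the empty word is a unit. -/
def concat : Option (FreeMagma Unit) → Option (FreeMagma Unit) → Option (FreeMagma Unit)
  | none, t => t
  | some a, none => some a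
  | some a, some b => some (a * b)

/-- Parenthesizations of a word in `n` identical letters. -/
def Par (n : ℕ) : Type := {t : Option (FreeMagma Unit) // numLetters t = n}

/-- Concatenation `t * t'`. -/
def Par.concat {n m : ℕ} (t : Par n) (t' : Par m) : Par (n + m) :=
  ⟨HalfBalanced.concat t.1 t'.1, by
    obtain ⟨_ | a, rfl⟩ := t <;> obtain ⟨_ | b, rfl⟩ := t'
    · rfl
    · exact (Nat.zero_add _).symm
    · rfl
    · rfl⟩

/-- The mirror image `t*`. -/
def Par.mirror {n : ℕ} (t : Par n) : Par n :=
  ⟨t.1.map mirrorTree, by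
    obtain ⟨_ | a, rfl⟩ := t
    · rfl
    · exact length_mirrorTree a⟩

/-- The sets of leaves lying below the vertices of a rooted planar binary tree, when the leaves
are numbered from left to right, starting with `o`. -/
def leafSets : FreeMagma Unit → ℕ → Set (Set ℕ)
  | .of _, o => {{o}}
  | .mul a b, o => {Set.Ico o (o + a.length + b.length)} ∪ leafSets a o ∪ leafSets b (o + a.length)

/-- The edges of the planar 3-valent tree obtained from a rooted planar binary tree with `n` leaves
by replacing the root and the two edges at the root by a single edge. An edge is
recorded by the two (complementary, non-empty) sets of leaves on its two sides. -/
def Par.edges {n : ℕ} (t : Par n) : Set (Set (Fin n)) :=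
  {A | A.Nonempty ∧ Aᶜ.Nonempty ∧ ∃ a ∈ t.1, ∃ I ∈ leafSets a 0,
    A = {i : Fin n | (i : ℕ) ∈ I} ∨ Aᶜ = {i : Fin n | (i : ℕ) ∈ I}}

/-- Planar 3-valent trees whose leaves are numbered by `Fin n`, compatibly with the cyclic orders.
Such a tree is encoded by the bipartitions of the set of leaves defined by its edges, which
determine it; each of these trees arises from a rooted one. -/
def PlT (n : ℕ) : Type := {F : Set (Set (Fin n)) // ∃ t : Par n, t.edges = F}

/-- The planar tree underlying a parenthesization. -/
def Par.toPlT {n : ℕ} (t : Par n) : PlT n := ⟨t.edges, t, rfl⟩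

/-- The tree `t'` is obtained from `t` by renumbering the leaves by `τ`. -/
def PlT.IsRenumbering {n : ℕ} (τ : Equiv.Perm (Fin n)) (t t' : PlT n) : Prop :=
  t'.1 = (fun A => τ '' A) '' t.1

/-! ## The half-balanced braided monoidal category of parenthesized braids -/

/-- Objects of the category of (completed) parenthesized braids with strands labelled by `S`. -/
structure PaB (T : Setting.{v}) (S : Type u) where
  n : ℕ
  t : Par n
  s : Fin n → S

namespace PaB
variable {T : Setting.{v}} {S : Type u}

/-- The underlying word. -/
abbrev word (X : PaB T S) : Word S := ⟨X.n, X.s⟩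

instance : Groupoid.{v} (PaB T S) where
  Hom X Y := WordHom T braidFamily X.word Y.word
  id X := WordHom.id X.word
  comp φ ψ := WordHom.comp φ ψ
  id_comp := WordHom.id_comp
  comp_id := WordHom.comp_id
  assoc := WordHom.comp_assoc
  inv φ := WordHom.inv φ
  inv_comp := WordHom.inv_comp
  comp_inv := WordHom.comp_inv

/-- The class of a braid in the completed braid group. -/
def br (T : Setting.{v}) (n : ℕ) : Braid n →* braidFamily.Compl T n := T.of (braidPerm n).ker

theorem perm_br (n : ℕ) (g : Braid n) : braidFamily.permC T n (br T n g) = braidPerm n g :=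
  T.permT_of (braidPerm n) g

abbrev tensor (X Y : PaB T S) : PaB T S where
  n := X.n + Y.n
  t := X.t.concat Y.t
  s := Fin.append X.s Y.s

theorem shift_mem {n k N : ℕ} (h : k + n ≤ N) :
    ∀ p ∈ (braidPerm n).ker, shift n k N h p ∈ (braidPerm N).ker := by
  intro p hp
  rw [MonoidHom.mem_ker] at hp ⊢
  rw [braidPerm_shift, hp, map_one]

/-- Insertion of a (completed) braid on the strands `k, …, k + n - 1`. -/
def shiftC (T : Setting.{v}) (n k N : ℕ) (h : k + n ≤ N) :
    braidFamily.Compl T n →* braidFamily.Compl T N :=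
  T.map (braidPerm n).ker (braidPerm N).ker (shift n k N h) (shift_mem h)

theorem exists_perm_shiftC (n k N : ℕ) (h : k + n ≤ N) (x : braidFamily.Compl T n) :
    ∃ g : Braid n, braidFamily.permC T n x = braidPerm n g ∧
      braidFamily.permC T N (shiftC T n k N h x) = braidPerm N (shift n k N h g) := by
  obtain ⟨g, hg⟩ := T.exists_rep (braidPerm n).ker x
  exact ⟨g, T.permT_eq (braidPerm n) x g hg,
    T.permT_eq (braidPerm N) _ _ (T.proj_map _ _ _ (shift_mem h) x g hg)⟩

theorem cast_castAdd {a b a' b' : ℕ} (ha : a = a') (h : a + b = a' + b') (i : Fin a) :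
    Fin.cast h (Fin.castAdd b i) = Fin.castAdd b' (Fin.cast ha i) := rfl

theorem cast_natAdd {a b a' b' : ℕ} (ha : a = a') (hb : b = b') (h : a + b = a' + b') (i : Fin b) :
    Fin.cast h (Fin.natAdd a i) = Fin.natAdd a' (Fin.cast hb i) := by
  subst ha; rfl

/-- The tensor product of morphisms, given by the juxtaposition of braids. -/
def tensorHom {X X' Y Y' : PaB T S} (φ : X ⟶ X') (ψ : Y ⟶ Y') :
    X.tensor Y ⟶ X'.tensor Y' where
  len := congrArg₂ (· + ·) φ.len ψ.len
  val := shiftC T X.n 0 (X.n + Y.n) (by omega) φ.val *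
    shiftC T Y.n X.n (X.n + Y.n) le_rfl ψ.val
  compat := by
    obtain ⟨g, hg, hg'⟩ := exists_perm_shiftC X.n 0 (X.n + Y.n) (by omega) φ.val
    obtain ⟨h, hh, hh'⟩ := exists_perm_shiftC Y.n X.n (X.n + Y.n) le_rfl ψ.val
    intro (i : Fin (X.n + Y.n))
    change Fin.append X'.s Y'.s (Fin.cast _ (braidFamily.permC T (X.n + Y.n) (_ * _) i)) =
      Fin.append X.s Y.s i
    rw [map_mul, hg', hh', Equiv.Perm.mul_apply]
    have hφ := φ.compat
    have hψ := ψ.compat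
    change ∀ i, X'.s (Fin.cast φ.len (braidFamily.permC T X.n φ.val i)) = X.s i at hφ
    change ∀ i, Y'.s (Fin.cast ψ.len (braidFamily.permC T Y.n ψ.val i)) = Y.s i at hψ
    rw [hg] at hφ
    rw [hh] at hψ
    refine Fin.addCases (fun i => ?_) (fun i => ?_) i
    · rw [braidPerm_shift_of_notMem _ _ _ _ _ (Fin.castAdd Y.n i) (by simp)]
      have e := braidPerm_shift_of_mem X.n 0 (X.n + Y.n) (by omega) g i
      have e' : (⟨0 + (i : ℕ), by omega⟩ : Fin (X.n + Y.n)) = Fin.castAdd Y.n i :=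
        Fin.ext (Nat.zero_add _)
      have e'' : (⟨0 + (braidPerm X.n g i : ℕ), by omega⟩ : Fin (X.n + Y.n)) =
        Fin.castAdd Y.n (braidPerm X.n g i) := Fin.ext (Nat.zero_add _)
      rw [e', e''] at e
      rw [e, cast_castAdd φ.len]
      refine (Fin.append_left _ _ _).trans ((hφ i).trans (Fin.append_left _ _ _).symm)
    · have e := braidPerm_shift_of_mem Y.n X.n (X.n + Y.n) le_rfl h i
      change braidPerm _ _ (Fin.natAdd X.n i) = Fin.natAdd X.n _ at e
      rw [e, braidPerm_shift_of_notMem _ _ _ _ _ (Fin.natAdd X.n _) (by simp)]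
      rw [cast_natAdd φ.len ψ.len]
      refine (Fin.append_right _ _ _).trans ((hψ i).trans (Fin.append_right _ _ _).symm)

/-- The braiding `β_{XY}`. -/
def braiding (X Y : PaB T S) : X.tensor Y ⟶ Y.tensor X where
  len := Nat.add_comm _ _
  val := br T (X.n + Y.n) (block (X.n + Y.n) X.n Y.n)
  compat i := by
    change Fin.append Y.s X.s (Fin.cast _ (braidFamily.permC T (X.n + Y.n) _ i)) =
      Fin.append X.s Y.s i
    rw [perm_br]
    refine Fin.addCases (fun i => ?_) (fun i => ?_) i
    · have e : Fin.cast (Nat.add_comm X.n Y.n) (braidPerm _ (block (X.n + Y.n) X.n Y.n)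
          (Fin.castAdd Y.n i)) = Fin.natAdd Y.n i := by
        ext
        rw [Fin.val_cast, block_val _ _ _ le_rfl]
        simp [add_comm]
      rw [Fin.append_left]
      exact (congrArg _ e).trans (Fin.append_right _ _ _)
    · have e : Fin.cast (Nat.add_comm X.n Y.n) (braidPerm _ (block (X.n + Y.n) X.n Y.n)
          (Fin.natAdd X.n i)) = Fin.castAdd X.n i := by
        ext
        rw [Fin.val_cast, block_val _ _ _ le_rfl]
        simp
      rw [Fin.append_right]
      exact (congrArg _ e).trans (Fin.append_left _ _ _)

/-- The associativity constraint `a_{XYZ}`. -/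
def assoc (X Y Z : PaB T S) : (X.tensor Y).tensor Z ⟶ X.tensor (Y.tensor Z) where
  len := Nat.add_assoc _ _ _
  val := 1
  compat i := by
    rw [map_one]
    exact (congrFun (Fin.append_assoc X.s Y.s Z.s) i).symm

/-- The mirror image `X*`. -/
abbrev star (X : PaB T S) : PaB T S where
  n := X.n
  t := X.t.mirror
  s := X.s ∘ Fin.rev

theorem star_mem (n : ℕ) : ∀ p ∈ (braidPerm n).ker, braidStar n p ∈ (braidPerm n).ker := by
  intro p hp
  rw [MonoidHom.mem_ker] at hp ⊢
  ext i
  rw [braidPerm_star, hp, Equiv.Perm.one_apply, Fin.rev_rev, Equiv.Perm.one_apply]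

/-- The involution `φ ↦ φ*` on morphisms. -/
def starHom {X Y : PaB T S} (φ : X ⟶ Y) : X.star ⟶ Y.star where
  len := φ.len
  val := T.map (braidPerm X.n).ker (braidPerm X.n).ker (braidStar X.n) (star_mem X.n) φ.val
  compat i := by
    revert i
    intro (i : Fin X.n)
    obtain ⟨g, hg⟩ := T.exists_rep (braidPerm X.n).ker φ.val
    have h1 : braidFamily.permC T X.n φ.val = braidPerm X.n g :=
      T.permT_eq (braidPerm X.n) _ g hg
    have h2 := T.permT_eq (braidPerm X.n) _ _ (T.proj_map _ _ _ (star_mem X.n) φ.val g hg)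
    have hφ := φ.compat i.rev
    change Y.s (Fin.cast φ.len (braidFamily.permC T X.n φ.val i.rev)) = X.s i.rev at hφ
    change Y.s (Fin.rev (Fin.cast φ.len (T.permT (braidPerm X.n) _ i))) = X.s i.rev
    rw [h2, braidPerm_star, ← hφ, h1]
    refine congrArg Y.s (Fin.ext ?_)
    have hl : X.n = Y.n := φ.len
    have hw : X.word.fst = X.n := rfl
    have := (braidPerm X.n g i.rev).2
    rw [Fin.val_rev, Fin.val_cast, Fin.val_rev, Fin.val_cast]
    omega

/-- The half-twist `a_X : X → X*`. -/
def half (X : PaB T S) : X ⟶ X.star where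
  len := rfl
  val := br T X.n (halfTwist X.n)
  compat := by
    intro (i : Fin X.n)
    change X.s (Fin.rev (braidFamily.permC T X.n _ i)) = X.s i
    rw [perm_br, braidPerm_halfTwist, Fin.rev_rev]

/-- The twist `θ_X = a_{X*} a_X : X → X`. -/
def twist (X : PaB T S) : X ⟶ X where
  len := rfl
  val := br T X.n (halfTwist X.n) * br T X.n (halfTwist X.n)
  compat := by
    intro (i : Fin X.n)
    change X.s (braidFamily.permC T X.n _ i) = X.s i
    rw [map_mul, perm_br, Equiv.Perm.mul_apply, braidPerm_halfTwist, braidPerm_halfTwist,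
      Fin.rev_rev]

end PaB

/-- An endofunctor which is the identity on objects. -/
@[ext]
structure IdEndofunctor (C : Type u) [Category.{v} C] where
  map : ∀ {X Y : C}, (X ⟶ Y) → (X ⟶ Y)
  map_id : ∀ X : C, map (𝟙 X) = 𝟙 X
  map_comp : ∀ {X Y Z : C} (φ : X ⟶ Y) (ψ : Y ⟶ Z), map (φ ≫ ψ) = map φ ≫ map ψ

def IdEndofunctor.toFunctor {C : Type u} [Category.{v} C] (i : IdEndofunctor C) : C ⥤ C where
  obj X := X
  map := i.map
  map_id := i.map_id
  map_comp := i.map_comp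

/-! ## The universal contraction -/

section Contraction
/-- Objects: a planar 3-valent tree with numbered leaves and a word. -/
structure PaDihTilde (T : Setting.{v}) (S : Type u) where
  n : ℕ
  t : PlT n
  s : Fin n → S

variable {T : Setting.{v}} {S : Type u}

/-- The underlying word. -/
abbrev PaDihTilde.word (X : PaDihTilde T S) : Word S := ⟨X.n, X.s⟩

instance : Groupoid.{v} (PaDihTilde T S) where
  Hom X Y := WordHom T sphereFamily X.word Y.word
  id X := WordHom.id X.word
  comp φ ψ := WordHom.comp φ ψ
  id_comp := WordHom.id_comp
  comp_id := WordHom.comp_id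
  assoc := WordHom.comp_assoc
  inv φ := WordHom.inv φ
  inv_comp := WordHom.inv_comp
  comp_inv := WordHom.comp_inv

namespace PaDihTilde

/-- The class of a braid in the completion of `Γ_{0,n}`. -/
def br (T : Setting.{v}) (n : ℕ) : Braid n →* sphereFamily.Compl T n :=
  (T.of (spherePerm n).ker).comp (QuotientGroup.mk' _)

theorem perm_br (n : ℕ) (g : Braid n) : sphereFamily.permC T n (br T n g) = braidPerm n g :=
  T.permT_of (spherePerm n) _

/-- The action of the generators `r` and `s` of the infinite dihedral group: the
isomorphisms `i^r : X → r • X` and `i^s : X → s • X`, where `r` shifts the numbering of the leaves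
and of the letters cyclically by one and `s` reverses it. They are given by the classes of
`σ_0 ⋯ σ_{n-2}` and of the half-twist. -/
inductive DihedralGen : ∀ ⦃X Y : PaDihTilde T S⦄, (X ⟶ Y) → Prop
  | rotation {n : ℕ} {t t' : PlT n} {s s' : Fin n → S}
      (ht : PlT.IsRenumbering (finRotate n) t t') (hs : ∀ i, s' (finRotate n i) = s i)
      (φ : (⟨n, t, s⟩ : PaDihTilde T S) ⟶ ⟨n, t', s'⟩) (hφ : φ.val = br T n (rho n (n - 1))) :
      DihedralGen φ
  | reflection {n : ℕ} {t t' : PlT n} {s s' : Fin n → S}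
      (ht : PlT.IsRenumbering Fin.revPerm t t') (hs : ∀ i, s' (Fin.rev i) = s i)
      (φ : (⟨n, t, s⟩ : PaDihTilde T S) ⟶ ⟨n, t', s'⟩) (hφ : φ.val = br T n (halfTwist n)) :
      DihedralGen φ

variable (T S) in
/-- The class of morphisms which are turned into identities. -/
def dihedral : MorphismProperty (PaDihTilde T S) := fun _ _ φ => DihedralGen φ

end PaDihTilde

variable (T S) in
/-- The quotient of `PaDihTilde` by the action of the infinite dihedral group. -/
def PaDih : Type u := Collapse (PaDihTilde.dihedral T S)

instance : Category.{max u v} (PaDih T S) :=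
  Collapse.category (W := PaDihTilde.dihedral T S)

theorem mk_mem_ker (n : ℕ) : ∀ p ∈ (braidPerm n).ker,
    QuotientGroup.mk' (Subgroup.normalClosure ({fullTwist n, sphereWord n} : Set (Braid n))) p ∈
      (spherePerm n).ker := fun _ hp => hp

/-- The morphism from the completed braid group to the completion of `Γ_{0,n}`. -/
def toSphere (T : Setting.{v}) (n : ℕ) : braidFamily.Compl T n →* sphereFamily.Compl T n :=
  T.map (braidPerm n).ker (spherePerm n).ker (QuotientGroup.mk' _) (mk_mem_ker n)

theorem permC_toSphere (n : ℕ) (x : braidFamily.Compl T n) :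
    sphereFamily.permC T n (toSphere T n x) = braidFamily.permC T n x := by
  obtain ⟨g, hg⟩ := T.exists_rep (braidPerm n).ker x
  have h1 : braidFamily.permC T n x = braidPerm n g := T.permT_eq (braidPerm n) x g hg
  have h2 : sphereFamily.permC T n (toSphere T n x) = spherePerm n (QuotientGroup.mk' _ g) :=
    T.permT_eq (spherePerm n) _ _ (T.proj_map _ _ _ (mk_mem_ker n) x g hg)
  rw [h1, h2]
  rfl

theorem toSphere_castC {m n : ℕ} (h : m = n) (x : braidFamily.Compl T m) :
    toSphere T n (braidFamily.castC T h x) = sphereFamily.castC T h (toSphere T m x) := by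
  subst h; rfl

variable (T S) in
/-- The functor from parenthesized braids to `PaDihTilde`. -/
def PaB.toTilde : PaB T S ⥤ PaDihTilde T S where
  obj X := ⟨X.n, X.t.toPlT, X.s⟩
  map {X Y} φ :=
    { len := φ.len
      val := toSphere T X.n φ.val
      compat := fun (i : Fin X.n) => by
        have h : sphereFamily.permC T X.n (toSphere T X.n φ.val) =
          braidFamily.permC T X.n φ.val := permC_toSphere X.n φ.val
        have h2 := φ.compat i
        rw [← h] at h2
        exact h2 }
  map_id X := WordHom.ext (map_one (toSphere T X.n))
  map_comp {X Y Z} φ ψ := WordHom.ext (by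
    have h1 : toSphere T X.n (braidFamily.castC T φ.len.symm ψ.val * φ.val) =
        sphereFamily.castC T φ.len.symm (toSphere T Y.n ψ.val) * toSphere T X.n φ.val := by
      rw [map_mul, toSphere_castC]
    exact h1)

variable (T S) in
/-- The half-balanced contraction `⟨-⟩ : PaB → PaDih`. -/
def contraction : PaB T S ⥤ PaDih T S :=
  PaB.toTilde T S ⋙
    (Collapse.quotientFunctor (PaDihTilde.dihedral T S) : PaDihTilde T S ⥤ PaDih T S)

end Contraction

/-! ## The Grothendieck–Teichmüller semigroup -/

section GT
variable (T : Setting.{v})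

/-- The pure braid group on four strands. -/
abbrev PureBraid4 : Type := (braidPerm 4).ker

theorem sigma_sq_mem (i : ℕ) (hi : i + 1 < 4) : sigma 4 i * sigma 4 i ∈ (braidPerm 4).ker := by
  rw [MonoidHom.mem_ker]
  ext x
  rw [map_mul, Equiv.Perm.mul_apply, braidPerm_sigma_val hi, braidPerm_sigma_val hi,
    Equiv.Perm.one_apply]
  split_ifs <;> omega

/-- The pure braid `σᵢ²`. -/
def sq (i : ℕ) (hi : i + 1 < 4) : PureBraid4 := ⟨sigma 4 i * sigma 4 i, sigma_sq_mem i hi⟩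

/-- The pure braid `σᵢ g σᵢ`. -/
def sandwich (i : ℕ) (hi : i + 1 < 4) (g : PureBraid4) : PureBraid4 :=
  ⟨sigma 4 i * g.1 * sigma 4 i, by
    have h := sigma_sq_mem i hi
    have hg := g.2
    rw [MonoidHom.mem_ker] at *
    rw [map_mul, map_mul, hg, mul_one, ← map_mul, h]⟩

/-- The five simplicial morphisms `∂₀, …, ∂₄ : F₂ → P₄`. -/
def face : Fin 5 → (FreeGroup (Fin 2) →* PureBraid4) :=
  ![FreeGroup.lift ![sq 1 (by decide), sq 2 (by decide)],
    FreeGroup.lift ![sandwich 1 (by decide) (sq 0 (by decide)), sq 2 (by decide)],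
    FreeGroup.lift ![sandwich 0 (by decide) (sq 1 (by decide)),
      sandwich 2 (by decide) (sq 1 (by decide))],
    FreeGroup.lift ![sq 0 (by decide), sandwich 1 (by decide) (sq 2 (by decide))],
    FreeGroup.lift ![sq 0 (by decide), sq 1 (by decide)]]

/-- The morphisms induced by `∂ⱼ` between the completions. -/
def faceC (j : Fin 5) : T.Free2 →* T.Obj PureBraid4 ⊤ :=
  T.map ⊤ ⊤ (face j) (fun _ _ => trivial)

/-- The generator `X` of `F₂`. -/
def genX : T.Free2 := T.of ⊤ (FreeGroup.of 0)

/-- The generator `Y` of `F₂`. -/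
def genY : T.Free2 := T.of ⊤ (FreeGroup.of 1)

/-- The element `Z` of `F₂` such that `X Y Z = 1`. -/
def genZ : T.Free2 := (genX T * genY T)⁻¹

/-- Substitution: `f(x, y)` for `x` and `y` in the completion of `F₂`. -/
def Setting.sub (f x y : T.Free2) : T.Free2 := T.substT ⊤ f x y

/-- Exponentiation in the completion of `F₂`. -/
def Setting.exp (x : T.Free2) (c : T.Scal) : T.Free2 := T.powT ⊤ x c

/-- The defining conditions of the Grothendieck–Teichmüller semigroup, for `λ = 1 + 2 m`. -/
structure IsGT (m : T.Scal) (f : T.Free2) : Prop where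
  symm : T.sub f (genY T) (genX T) = f⁻¹
  hexagon : T.sub f (genZ T) (genX T) * T.exp (genZ T) m * T.sub f (genY T) (genZ T) *
    T.exp (genY T) m * T.sub f (genX T) (genY T) * T.exp (genX T) m = 1
  pentagon : faceC T 3 f * faceC T 1 f = faceC T 0 f * faceC T 2 f * faceC T 4 f

/-- The underlying set of the Grothendieck–Teichmüller semigroup. -/
def GT : Type v := {p : T.Scal × T.Free2 // ∃ m, p.1 = 1 + 2 * m ∧ IsGT T m p.2}

variable {T}

/-- The element `θ_{(λ',f')}(f)`, where `θ_{(λ',f')} : X ↦ f' X^{λ'} f'⁻¹, Y ↦ Y^{λ'}`. -/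
def gtTheta (p' : T.Scal × T.Free2) (f : T.Free2) : T.Free2 :=
  T.sub f (p'.2 * T.exp (genX T) p'.1 * p'.2⁻¹) (T.exp (genY T) p'.1)

/-- The product `(λ, f)(λ', f') = (λ λ', θ_{(λ',f')}(f) f')`. -/
def gtMul (p p' : T.Scal × T.Free2) : T.Scal × T.Free2 :=
  (p.1 * p'.1, gtTheta p' p.2 * p'.2)

end GT

/-! ## The action -/

section Action
variable {T : Setting.{v}} {S : Type u}
open PaB

/-- The power of an automorphism with trivial underlying permutation. -/
def PaB.pow {X : PaB T S} (φ : X ⟶ X) (c : T.Scal) : X ⟶ X := WordHom.pow φ c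

/-- `f(φ, ψ)` for automorphisms with trivial underlying permutations. -/
def PaB.subst {X : PaB T S} (f : T.Free2) (φ ψ : X ⟶ X) : X ⟶ X := WordHom.subst f φ ψ

/-- `i` is the underlying functor of a morphism of half-balanced braided monoidal categories
from `PaB` to its twist by `(λ, f)`, with `λ = 1 + 2 m`, which is the identity on objects. Here
the twisted category has the same tensor product and involution and its constraints
are `β'_{XY} = β_{XY} (β_{YX} β_{XY})^m`,
`a'_{XYZ} = a_{XYZ} f(β_{YX} β_{XY} ⊗ id_Z, a_{XYZ}⁻¹ (id_X ⊗ β_{ZY} β_{YZ}) a_{XYZ})` and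
`a'_X = a_X θ_X^m`. -/
structure IsTwistFor (m : T.Scal) (f : T.Free2) (i : IdEndofunctor (PaB T S)) : Prop where
  map_tensor : ∀ {X X' Y Y' : PaB T S} (φ : X ⟶ X') (ψ : Y ⟶ Y'),
    i.map (tensorHom φ ψ) = tensorHom (i.map φ) (i.map ψ)
  map_braiding : ∀ X Y : PaB T S,
    i.map (braiding X Y) = PaB.pow (braiding X Y ≫ braiding Y X) m ≫ braiding X Y
  map_assoc : ∀ X Y Z : PaB T S, i.map (assoc X Y Z) =
    PaB.subst f (tensorHom (braiding X Y ≫ braiding Y X) (𝟙 Z))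
      (assoc X Y Z ≫ tensorHom (𝟙 X) (braiding Y Z ≫ braiding Z Y) ≫ inv (assoc X Y Z)) ≫
    assoc X Y Z
  map_star : ∀ {X Y : PaB T S} (φ : X ⟶ Y), i.map (starHom φ) = starHom (i.map φ)
  map_half : ∀ X : PaB T S, i.map (half X) = PaB.pow (twist X) m ≫ half X
  regular : ∀ X Y : PaB T S, T.Regular (α := X ⟶ Y) (braidPerm X.n).ker (braidPerm X.n).ker
    (fun φ => φ.val) (fun φ => (i.map φ).val)

/-- `i = i_{(λ, f)}`. -/
def IsTwist (g : GT T) (i : IdEndofunctor (PaB T S)) : Prop :=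
  ∃ m, g.1.1 = 1 + 2 * m ∧ IsTwistFor m g.1.2 i

variable (T S) in
/-- The pairs `(λ, f)` form a monoid; every `(λ, f)` determines a unique endofunctor `i_{(λ,f)}` of
`PaB` and a unique endofunctor `j_{(λ,f)}` of `PaDih` such that
`j_{(λ,f)} ∘ ⟨-⟩ = ⟨-⟩ ∘ i_{(λ,f)}`; and `(λ, f) ↦ j_{(λ,f)}` is a morphism from this monoid to the
opposite of the monoid of endofunctors of `PaDih`. -/
def DefinesMorphism : Prop :=
  ∃ _ : Monoid (GT T), (∀ g g' : GT T, (g * g').1 = gtMul g.1 g'.1) ∧ (1 : GT T).1 = (1, 1) ∧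
    ∃ j : GT T →* (End (Cat.of (PaDih T S)))ᵐᵒᵖ, ∀ g : GT T,
      ∃ i : IdEndofunctor (PaB T S), (IsTwist g i ∧ ∀ i', IsTwist g i' → i' = i) ∧
        ∀ J : End (Cat.of (PaDih T S)),
          contraction T S ⋙ J.toFunctor = i.toFunctor ⋙ contraction T S ↔ J = (j g).unop

end Action

end HalfBalanced

end

/-!
# The action of the Grothendieck–Teichmüller semigroup on the universal contraction

The four settings enter only through the properties collected in `Setting.IsNice`: regular maps are
closed under the constructions which occur and are determined by their values on the uncompleted
group (`reg_ext`), powers obey the rules of exponents, and completion respects surjections `G → H`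
and the inclusion of the normal subgroup `P` into `G`. Everything up to `definesMorphism` is proved
in a setting with these properties.

**The endofunctors `i_g`.** Let `(λ, f)` be in the semigroup, `λ = 1 + 2 m`. For one fixed
parenthesization, the left-normed one, the defining equations give an action of `(λ, f)` on the
completed braid group: `σ₁ ↦ σ₁ (σ₁ ^ 2) ^ m`, and `σ_i` goes to the conjugate of the same
expression in `σ_i` by the associator which brings the strands `i` and `i + 1` together (`actB`,
`actC`). For other parenthesizations this action is corrected by an element `cPar`, a product of
values of `f` along a sequence of associativity moves from the left-normed parenthesization; the
action on a morphism is then `actVal`. The pentagon equation, transported to arbitrary blocks of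
strands by cabling (`Cables.cable`, `assr_pentagon`), makes it independent of the sequence of moves
(`actVal_assoc`). The hexagon equation gives the twisted crossing of a block with two blocks
(`cbl_add_right`), from which the rule for the crossing of any two blocks (`crossingRule`) and for
half-twists (`cTree_half`) follow by induction on trees; `f (Y, X) = f (X, Y)⁻¹` gives the
compatibility with mirror images (`cstar_actC`). Conversely, the requirements fix the values on
braidings of two letters, hence on all uncompleted braids, and the rest is density
(`IsTwistFor.unique`).

**The semigroup.** That the product of two solutions satisfies the hexagon equation is a direct
computation (`gtMul_hexagon`). For the pentagon equation, the action of the second factor is applied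
to the pentagon of the first one along the five parenthesizations of four letters: it turns the
associators formed with `f` into those formed with the product (`actVal_assr`, `gtMul_pentagon`).
This proves the equation in the completed braid group, where it may be checked since the completion
of the pure braid group embeds into it (`pentagon_of_assr`). The composite of two endofunctors
satisfies the requirements for the product (`isTwistFor_comp`), so that uniqueness gives the
morphism property.

**The contraction.** In `Γ_{0,n}`, the double crossing of a block with its complement is the class
of a braid of the strands of this block alone (`exists_toMCG_dbl`). Thus the two arguments of an
associator whose blocks exhaust all strands commute (`commute_toMCG_dbl`), and the associator is
trivial on the sphere (`csph_assr`), because `f` is trivial on commuting arguments. Hence the action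
does not see the root, and depends only on the planar tree (`csph_cPar_eq`). Rotations are crossings
of one strand with all others, and the twisting factor is a power of the sphere relation
(`plVal_rotation`); reflections are half-twists, and their twisting factor is a power of `z_n`
(`plVal_reflection`). Both are therefore fixed, and the action descends to the quotient category
(`Collapse.mapFunctor`). Since every morphism of the quotient is represented by one between
contractions, the descended endofunctor is unique (`contraction_cancel`).

**The four settings.** The discrete case is immediate. In the profinite and pro-`l` cases
(`proL_isNice`) surjectivity follows from compactness (`ProCompl.lift_surjective`), and injectivity
from the fact that an open subgroup of `P` has finitely many conjugates in `G`
(`OpenSub.exists_le_map`). In the prounipotent case (`unip_isNice`), identities between powers are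
identities between polynomials in the exponents. On group-like elements, a product of linear maps is
again given by a linear map, by `IsGroupLike.conv_eq`; and group-like elements are lifted along
surjections by lifting their logarithms (`AlgCompl.exists_map_eq`).
-/

open CategoryTheory
set_option autoImplicit false
set_option linter.unusedSectionVars false
noncomputable section
namespace HalfBalanced
universe u v

/-! ### Abstract properties of the settings -/

/-- The properties of a setting on which the construction relies. The fields `reg_…` say that
regular maps form a category closed under products which contains the extensions of morphisms; the
field `reg_ext` is a density statement: regular maps are equal as soon as they agree at some point
over each class which is represented by an element of the uncompleted group. The fields `pow_…`,
`mul_pow` and `two_cancel` are the rules of exponents. The last two are exactness properties, which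
are needed for the quotient of the braid group and for the pure braids on four strands. -/
structure Setting.IsNice (T : Setting.{v}) : Prop where
  reg_refl : ∀ {α : Type v} {G : Type} [Group G] (P : Subgroup G) [P.Normal] (p : α → T.Obj G P),
    T.Regular P P p p
  reg_trans : ∀ {α : Type v} {G H K : Type} [Group G] [Group H] [Group K] (P : Subgroup G)
    (Q : Subgroup H) (R : Subgroup K) [P.Normal] [Q.Normal] [R.Normal] (p : α → T.Obj G P)
    (q : α → T.Obj H Q) (r : α → T.Obj K R), T.Regular P Q p q → T.Regular Q R q r →
    T.Regular P R p r
  reg_mul : ∀ {α : Type v} {G H : Type} [Group G] [Group H] (P : Subgroup G) (Q : Subgroup H)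
    [P.Normal] [Q.Normal] (p : α → T.Obj G P) (q q' : α → T.Obj H Q), T.Regular P Q p q →
    T.Regular P Q p q' → T.Regular P Q p (fun a => q a * q' a)
  reg_const : ∀ {α : Type v} {G H : Type} [Group G] [Group H] (P : Subgroup G) (Q : Subgroup H)
    [P.Normal] [Q.Normal] (p : α → T.Obj G P) (c : T.Obj H Q), T.Regular P Q p (fun _ => c)
  reg_lift : ∀ {α : Type v} {G H : Type} [Group G] [Group H] (P : Subgroup G) (Q : Subgroup H)
    [P.Normal] [Q.Normal] (θ : G →* T.Obj H Q) (hθ : ∀ p ∈ P, T.proj Q (θ p) = 1)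
    (p : α → T.Obj G P), T.Regular P Q p (fun a => T.lift P Q θ hθ (p a))
  reg_ext : ∀ {α : Type v} {G H : Type} [Group G] [Group H] (P : Subgroup G) (Q : Subgroup H)
    [P.Normal] [Q.Normal] (p : α → T.Obj G P) (q q' : α → T.Obj H Q), Function.Injective p →
    T.Regular P Q p q → T.Regular P Q p q' →
    (∀ a g, T.proj P (p a) = QuotientGroup.mk' P g → ∃ b, p b = T.of P g ∧ q b = q' b) → q = q'
  pow_lift : ∀ {G H : Type} [Group G] [Group H] (P : Subgroup G) (Q : Subgroup H)
    [P.Normal] [Q.Normal] (θ : G →* T.Obj H Q) (hθ : ∀ p ∈ P, T.proj Q (θ p) = 1)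
    (x : T.Obj G P), T.proj P x = 1 → ∀ c,
    T.lift P Q θ hθ (T.powT P x c) = T.powT Q (T.lift P Q θ hθ x) c
  pow_add : ∀ {G : Type} [Group G] (P : Subgroup G) [P.Normal] (x : T.Obj G P), T.proj P x = 1 →
    ∀ a b, T.powT P x (a + b) = T.powT P x a * T.powT P x b
  pow_mul : ∀ {G : Type} [Group G] (P : Subgroup G) [P.Normal] (x : T.Obj G P), T.proj P x = 1 →
    ∀ a b, T.powT P x (a * b) = T.powT P (T.powT P x a) b
  pow_one : ∀ {G : Type} [Group G] (P : Subgroup G) [P.Normal] (x : T.Obj G P), T.proj P x = 1 →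
    T.powT P x 1 = x
  mul_pow : ∀ {G : Type} [Group G] (P : Subgroup G) [P.Normal] (x y : T.Obj G P),
    T.proj P x = 1 → T.proj P y = 1 → Commute x y → ∀ c,
    T.powT P (x * y) c = T.powT P x c * T.powT P y c
  two_cancel : ∀ a b : T.Scal, 2 * a = 2 * b → a = b
  map_surjective : ∀ {G H : Type} [Group G] [Group H] (P : Subgroup G) (Q : Subgroup H)
    [P.Normal] [Q.Normal] (φ : G →* H) (h : ∀ p ∈ P, φ p ∈ Q), Function.Surjective φ →
    (∀ g, φ g ∈ Q → g ∈ P) → Function.Surjective (T.map P Q φ h)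
  map_subtype_injective : ∀ {G : Type} [Group G] (P : Subgroup G) [P.Normal] [Finite (G ⧸ P)],
    Function.Injective (T.map (⊤ : Subgroup P) P P.subtype (fun p _ => p.2))

namespace Setting.IsNice
variable {T : Setting.{v}} (hT : T.IsNice) {G H K : Type} [Group G] [Group H] [Group K]
  {P : Subgroup G} {Q : Subgroup H} {R : Subgroup K} [P.Normal] [Q.Normal] [R.Normal]

theorem proj_free (f : T.Free2) : T.proj ⊤ f = 1 := by
  obtain ⟨g, hg⟩ := T.exists_rep ⊤ f
  rw [hg]; exact (QuotientGroup.eq_one_iff g).mpr trivial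

theorem proj_top (x : T.Obj G ⊤) : T.proj ⊤ x = 1 := by
  obtain ⟨g, hg⟩ := T.exists_rep ⊤ x
  rw [hg]; exact (QuotientGroup.eq_one_iff g).mpr trivial

/-- A morphism between completions which is regular. -/
def _root_.HalfBalanced.Setting.RegHom (T : Setting.{v}) (P : Subgroup G) (Q : Subgroup H)
    [P.Normal] [Q.Normal] (h : T.Obj G P →* T.Obj H Q) : Prop :=
  T.Regular P Q (α := T.Obj G P) (fun x => x) (fun x => h x)

include hT

/-- A regular morphism is determined by its values on the uncompleted group. -/
theorem hom_ext {h h' : T.Obj G P →* T.Obj H Q} (hh : T.RegHom P Q h) (hh' : T.RegHom P Q h')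
    (e : ∀ g, h (T.of P g) = h' (T.of P g)) : h = h' :=
  MonoidHom.ext fun x => congrFun (hT.reg_ext P Q (α := T.Obj G P) (fun x => x) (fun x => h x)
    (fun x => h' x) (fun _ _ h => h) hh hh' (fun _ g _ => ⟨T.of P g, rfl, e g⟩)) x

theorem regHom_lift (θ : G →* T.Obj H Q) (hθ : ∀ p ∈ P, T.proj Q (θ p) = 1) :
    T.RegHom P Q (T.lift P Q θ hθ) := hT.reg_lift P Q θ hθ _

theorem regHom_map (φ : G →* H) (h : ∀ p ∈ P, φ p ∈ Q) : T.RegHom P Q (T.map P Q φ h) :=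
  hT.reg_lift P Q _ _ _

theorem regHom_comp {h : T.Obj G P →* T.Obj H Q} {h' : T.Obj H Q →* T.Obj K R}
    (hh' : T.Regular Q R (α := T.Obj G P) (fun x => h x) (fun x => h' (h x)))
    (hh : T.RegHom P Q h) : T.RegHom P R (h'.comp h) := hT.reg_trans P Q R _ _ _ hh hh'

theorem regHom_lift_comp (θ : H →* T.Obj K R) (hθ : ∀ p ∈ Q, T.proj R (θ p) = 1)
    {h : T.Obj G P →* T.Obj H Q} (hh : T.RegHom P Q h) :
    T.RegHom P R ((T.lift Q R θ hθ).comp h) :=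
  hT.regHom_comp (h := h) (h' := T.lift Q R θ hθ) (hT.reg_lift _ _ _ _ _) hh

theorem regHom_conj {h : T.Obj G P →* T.Obj H Q} (hh : T.RegHom P Q h) (u : T.Obj H Q) :
    T.RegHom P Q ((MulAut.conj u).toMonoidHom.comp h) :=
  hT.reg_mul P Q _ (fun x => u * h x) _ (hT.reg_mul P Q _ _ _ (hT.reg_const P Q _ u) hh)
    (hT.reg_const P Q _ u⁻¹)

theorem regHom_id : T.RegHom P P (MonoidHom.id _) := hT.reg_refl P _

/-- Every regular morphism over a morphism which kills `P` is the extension of its restriction. -/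
theorem eq_lift {h : T.Obj G P →* T.Obj H Q} (hh : T.RegHom P Q h)
    (hP : ∀ p ∈ P, T.proj Q (h (T.of P p)) = 1) : h = T.lift P Q (h.comp (T.of P)) hP :=
  hT.hom_ext hh (hT.regHom_lift _ _) fun g => by
    rw [T.lift_of]; rfl

theorem proj_of_one {h : T.Obj G P →* T.Obj H Q} (hh : T.RegHom P Q h)
    (hP : ∀ p ∈ P, T.proj Q (h (T.of P p)) = 1) {x : T.Obj G P} (hx : T.proj P x = 1) :
    T.proj Q (h x) = 1 := by
  rw [hT.eq_lift hh hP, T.proj_lift, hx, map_one]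

theorem lift_lift (θ : G →* T.Obj H Q) (hθ : ∀ p ∈ P, T.proj Q (θ p) = 1)
    (η : H →* T.Obj K R) (hη : ∀ p ∈ Q, T.proj R (η p) = 1) (ζ : G →* T.Obj K R)
    (hζ : ∀ p ∈ P, T.proj R (ζ p) = 1) (e : ∀ g, T.lift Q R η hη (θ g) = ζ g) (x : T.Obj G P) :
    T.lift Q R η hη (T.lift P Q θ hθ x) = T.lift P R ζ hζ x :=
  DFunLike.congr_fun (hT.hom_ext (hT.regHom_lift_comp η hη (hT.regHom_lift θ hθ))
    (hT.regHom_lift ζ hζ) (fun g => by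
      rw [MonoidHom.comp_apply, T.lift_of, T.lift_of, e])) x

theorem map_map (φ : G →* H) (h : ∀ p ∈ P, φ p ∈ Q) (ψ : H →* K) (h' : ∀ p ∈ Q, ψ p ∈ R)
    (χ : G →* K) (h'' : ∀ p ∈ P, χ p ∈ R) (e : ∀ g, ψ (φ g) = χ g) (x : T.Obj G P) :
    T.map Q R ψ h' (T.map P Q φ h x) = T.map P R χ h'' x :=
  hT.lift_lift _ _ _ _ _ _ (fun g => by
    change T.map Q R ψ h' (T.of Q (φ g)) = T.of R (χ g)
    rw [T.map_of, e]) x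

/-! ### Powers -/

theorem pow_hom {h : T.Obj G P →* T.Obj H Q} (hh : T.RegHom P Q h)
    (hP : ∀ p ∈ P, T.proj Q (h (T.of P p)) = 1) {x : T.Obj G P} (hx : T.proj P x = 1)
    (c : T.Scal) : h (T.powT P x c) = T.powT Q (h x) c := by
  rw [hT.eq_lift hh hP, hT.pow_lift _ _ _ _ _ hx]

theorem pow_map (φ : G →* H) (h : ∀ p ∈ P, φ p ∈ Q) {x : T.Obj G P} (hx : T.proj P x = 1)
    (c : T.Scal) : T.map P Q φ h (T.powT P x c) = T.powT Q (T.map P Q φ h x) c :=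
  hT.pow_lift _ _ _ _ _ hx c

omit hT in
theorem proj_conj {x : T.Obj G P} (hx : T.proj P x = 1) (u : T.Obj G P) :
    T.proj P (u * x * u⁻¹) = 1 := by simp [hx]

omit hT in
theorem proj_mul {x y : T.Obj G P} (hx : T.proj P x = 1) (hy : T.proj P y = 1) :
    T.proj P (x * y) = 1 := by rw [map_mul, hx, hy, one_mul]

omit hT in
theorem proj_inv {x : T.Obj G P} (hx : T.proj P x = 1) : T.proj P x⁻¹ = 1 := by
  rw [map_inv, hx, inv_one]

omit hT in
theorem proj_of_mem {p : G} (hp : p ∈ P) : T.proj P (T.of P p) = 1 := by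
  rw [T.proj_of]; exact (QuotientGroup.eq_one_iff p).mpr hp

omit hT in
theorem conj_kills (u : T.Obj G P) : ∀ p ∈ P, T.proj P
    (((MulAut.conj u).toMonoidHom.comp (MonoidHom.id (T.Obj G P))) (T.of P p)) = 1 := fun _ hp =>
  proj_conj (proj_of_mem hp) u

theorem pow_conj {x : T.Obj G P} (hx : T.proj P x = 1) (u : T.Obj G P) (c : T.Scal) :
    u * T.powT P x c * u⁻¹ = T.powT P (u * x * u⁻¹) c :=
  hT.pow_hom (hT.regHom_conj hT.regHom_id u) (conj_kills u) hx c

/-- An identity `u x = y u` persists when `x` and `y` are raised to the same power. -/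
theorem pow_intertwine {x y u : T.Obj G P} (hx : T.proj P x = 1) (h : u * x = y * u)
    (c : T.Scal) : u * T.powT P x c = T.powT P y c * u := by
  have : y = u * x * u⁻¹ := by rw [h, mul_inv_cancel_right]
  rw [this, ← hT.pow_conj hx, inv_mul_cancel_right]

theorem commute_pow {x u : T.Obj G P} (hx : T.proj P x = 1) (h : Commute u x) (c : T.Scal) :
    Commute u (T.powT P x c) := hT.pow_intertwine hx h c

theorem pow_zero {x : T.Obj G P} (hx : T.proj P x = 1) : T.powT P x 0 = 1 := by
  have h := hT.pow_add P x hx 0 0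
  rw [add_zero] at h
  exact (left_eq_mul.mp h)

theorem one_pow (c : T.Scal) : T.powT P 1 c = 1 := by
  have h := hT.mul_pow P 1 1 (map_one _) (map_one _) (Commute.one_left _) c
  rw [one_mul] at h
  exact left_eq_mul.mp h

theorem inv_pow {x : T.Obj G P} (hx : T.proj P x = 1) (c : T.Scal) :
    T.powT P x⁻¹ c = (T.powT P x c)⁻¹ := by
  have h := hT.mul_pow P x x⁻¹ hx (proj_inv hx) (Commute.inv_right rfl) c
  rw [mul_inv_cancel, hT.one_pow] at h
  exact (inv_eq_of_mul_eq_one_right h.symm).symm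

/-! ### Substitution -/

omit hT in
theorem lift_kills {x y : T.Obj G P} (hx : T.proj P x = 1) (hy : T.proj P y = 1) :
    ∀ p ∈ (⊤ : Subgroup (FreeGroup (Fin 2))), T.proj P (FreeGroup.lift ![x, y] p) = 1 := by
  intro p _
  have e : (T.proj P).comp (FreeGroup.lift ![x, y]) = 1 := by
    refine FreeGroup.ext_hom _ _ fun i => ?_
    rw [MonoidHom.comp_apply, FreeGroup.lift_apply_of, MonoidHom.one_apply]
    fin_cases i
    · exact hx
    · exact hy
  exact DFunLike.congr_fun e p

/-- The morphism `f ↦ f(x, y)`. -/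
def _root_.HalfBalanced.Setting.subHom {x y : T.Obj G P} (hx : T.proj P x = 1)
    (hy : T.proj P y = 1) : T.Free2 →* T.Obj G P :=
  T.lift ⊤ P (FreeGroup.lift ![x, y]) (lift_kills hx hy)

omit hT in
theorem sub_eq {x y : T.Obj G P} (hx : T.proj P x = 1) (hy : T.proj P y = 1) (f : T.Free2) :
    T.substT P f x y = Setting.subHom hx hy f := by
  rw [Setting.substT, dif_pos ⟨hx, hy⟩]; rfl

theorem regHom_sub {x y : T.Obj G P} (hx : T.proj P x = 1) (hy : T.proj P y = 1) :
    T.RegHom ⊤ P (Setting.subHom hx hy) := hT.regHom_lift _ _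

omit hT in
theorem sub_X {x y : T.Obj G P} (hx : T.proj P x = 1) (hy : T.proj P y = 1) :
    T.substT P (genX T) x y = x := by
  rw [sub_eq hx hy, Setting.subHom, genX, T.lift_of]; simp

omit hT in
theorem sub_Y {x y : T.Obj G P} (hx : T.proj P x = 1) (hy : T.proj P y = 1) :
    T.substT P (genY T) x y = y := by
  rw [sub_eq hx hy, Setting.subHom, genY, T.lift_of]; simp

/-- A regular morphism out of the completed free group is a substitution. -/
theorem hom_eq_sub {h : T.Free2 →* T.Obj G P} (hh : T.RegHom ⊤ P h) {x y : T.Obj G P}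
    (hx : T.proj P x = 1) (hy : T.proj P y = 1) (ex : h (genX T) = x) (ey : h (genY T) = y)
    (f : T.Free2) : h f = T.substT P f x y := by
  rw [sub_eq hx hy]
  refine DFunLike.congr_fun (hT.hom_ext hh (hT.regHom_sub hx hy) ?_) f
  intro g
  have : h.comp (T.of ⊤) = (Setting.subHom hx hy).comp (T.of ⊤) := by
    refine FreeGroup.ext_hom _ _ fun i => ?_
    have e1 := sub_X hx hy
    have e2 := sub_Y hx hy
    rw [sub_eq hx hy] at e1 e2
    fin_cases i
    · exact ex.trans e1.symm
    · exact ey.trans e2.symm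
  exact DFunLike.congr_fun this g

theorem sub_XY (f : T.Free2) : T.substT ⊤ f (genX T) (genY T) = f :=
  (hT.hom_eq_sub hT.regHom_id (proj_free _) (proj_free _) rfl rfl f).symm

/-- Regular morphisms commute with the evaluation of elements of the completed free group. -/
theorem sub_hom {h : T.Obj G P →* T.Obj H Q} (hh : T.RegHom P Q h)
    (hP : ∀ p ∈ P, T.proj Q (h (T.of P p)) = 1) {x y : T.Obj G P} (hx : T.proj P x = 1)
    (hy : T.proj P y = 1) (f : T.Free2) :
    h (T.substT P f x y) = T.substT Q f (h x) (h y) := by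
  have e := hT.hom_eq_sub (h := h.comp (Setting.subHom hx hy)) (x := h x) (y := h y)
    (by
      rw [hT.eq_lift hh hP]
      exact hT.regHom_lift_comp _ _ (hT.regHom_sub hx hy))
    (hT.proj_of_one hh hP hx) (hT.proj_of_one hh hP hy)
    (by rw [MonoidHom.comp_apply, ← sub_eq, sub_X hx hy])
    (by rw [MonoidHom.comp_apply, ← sub_eq, sub_Y hx hy]) f
  rw [← e, MonoidHom.comp_apply, sub_eq hx hy]

theorem sub_map (φ : G →* H) (h : ∀ p ∈ P, φ p ∈ Q) {x y : T.Obj G P} (hx : T.proj P x = 1)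
    (hy : T.proj P y = 1) (f : T.Free2) :
    T.map P Q φ h (T.substT P f x y) = T.substT Q f (T.map P Q φ h x) (T.map P Q φ h y) :=
  hT.sub_hom (hT.regHom_map φ h) (fun p hp => by rw [T.map_of]; exact proj_of_mem (h p hp)) hx hy f

theorem sub_conj {x y : T.Obj G P} (hx : T.proj P x = 1) (hy : T.proj P y = 1) (f : T.Free2)
    (u : T.Obj G P) : u * T.substT P f x y * u⁻¹ = T.substT P f (u * x * u⁻¹) (u * y * u⁻¹) :=
  hT.sub_hom (hT.regHom_conj hT.regHom_id u) (conj_kills u) hx hy f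

/-- Simultaneous intertwining relations persist under the evaluation of an element of the completed
free group. -/
theorem sub_intertwine {x y x' y' u : T.Obj G P} (hx : T.proj P x = 1) (hy : T.proj P y = 1)
    (h : u * x = x' * u) (h' : u * y = y' * u) (f : T.Free2) :
    u * T.substT P f x y = T.substT P f x' y' * u := by
  have e : x' = u * x * u⁻¹ := by rw [h, mul_inv_cancel_right]
  have e' : y' = u * y * u⁻¹ := by rw [h', mul_inv_cancel_right]
  rw [e, e', ← hT.sub_conj hx hy, inv_mul_cancel_right]

theorem commute_sub {x y u : T.Obj G P} (hx : T.proj P x = 1) (hy : T.proj P y = 1)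
    (h : Commute u x) (h' : Commute u y) (f : T.Free2) : Commute u (T.substT P f x y) :=
  hT.sub_intertwine hx hy h h' f

omit hT in
theorem sub_mul {x y : T.Obj G P} (hx : T.proj P x = 1) (hy : T.proj P y = 1) (f g : T.Free2) :
    T.substT P (f * g) x y = T.substT P f x y * T.substT P g x y := by
  simp only [sub_eq hx hy, map_mul]

omit hT in
theorem sub_inv {x y : T.Obj G P} (hx : T.proj P x = 1) (hy : T.proj P y = 1) (f : T.Free2) :
    T.substT P f⁻¹ x y = (T.substT P f x y)⁻¹ := by
  simp only [sub_eq hx hy, map_inv]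

omit hT in
theorem one_sub {x y : T.Obj G P} (hx : T.proj P x = 1) (hy : T.proj P y = 1) :
    T.substT P 1 x y = 1 := by
  simp only [sub_eq hx hy, map_one]

theorem sub_pow {x y : T.Obj G P} (hx : T.proj P x = 1) (hy : T.proj P y = 1) (f : T.Free2)
    (c : T.Scal) : T.substT P (T.powT ⊤ f c) x y = T.powT P (T.substT P f x y) c := by
  simp only [sub_eq hx hy]
  exact hT.pow_lift _ _ _ _ _ (proj_free f) c

theorem sub_sub {x y : T.Obj G P} (hx : T.proj P x = 1) (hy : T.proj P y = 1) (f a b : T.Free2) :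
    T.substT P (T.substT ⊤ f a b) x y = T.substT P f (T.substT P a x y) (T.substT P b x y) := by
  simp only [sub_eq hx hy]
  exact hT.sub_hom (hT.regHom_sub hx hy)
    (fun p _ => by rw [← sub_eq hx hy]; exact T.proj_substT _ _ _ _) (proj_free _) (proj_free _) f

theorem sub_one_one (f : T.Free2) : T.substT P f 1 1 = 1 :=
  (hT.hom_eq_sub (h := 1) (hT.reg_const _ _ _ 1) (map_one _) (map_one _) rfl rfl f).symm

/-- If `x`, `y` commute with `x'`, `y'`, then `f(x x', y y') = f(x, y) f(x', y')`. -/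
theorem sub_mul_mul {x y x' y' : T.Obj G P} (hx : T.proj P x = 1) (hy : T.proj P y = 1)
    (hx' : T.proj P x' = 1) (hy' : T.proj P y' = 1) (h1 : Commute x x') (h2 : Commute x y')
    (h3 : Commute y x') (h4 : Commute y y') (f : T.Free2) :
    T.substT P f (x * x') (y * y') = T.substT P f x y * T.substT P f x' y' := by
  have c : ∀ f g : T.Free2, Commute (T.substT P f x y) (T.substT P g x' y') := fun f g =>
    hT.commute_sub hx' hy' (hT.commute_sub hx hy h1.symm h3.symm f).symm
      (hT.commute_sub hx hy h2.symm h4.symm f).symm g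
  let ψ : T.Free2 →* T.Obj G P :=
    { toFun := fun f => T.substT P f x y * T.substT P f x' y'
      map_one' := by rw [one_sub hx hy, one_sub hx' hy', one_mul]
      map_mul' := fun f g => by
        rw [sub_mul hx hy, sub_mul hx' hy']
        rw [mul_assoc, mul_assoc, ← mul_assoc (T.substT P g x y), (c g f).eq, mul_assoc] }
  refine (hT.hom_eq_sub (h := ψ) ?_ (proj_mul hx hx') (proj_mul hy hy') ?_ ?_ f).symm
  · refine hT.reg_mul _ _ _ _ _ ?_ ?_
    · have := hT.regHom_sub hx hy
      simp only [Setting.RegHom, ← sub_eq] at this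
      exact this
    · have := hT.regHom_sub hx' hy'
      simp only [Setting.RegHom, ← sub_eq] at this
      exact this
  · change T.substT P _ x y * T.substT P _ x' y' = _
    rw [sub_X hx hy, sub_X hx' hy']
  · change T.substT P _ x y * T.substT P _ x' y' = _
    rw [sub_Y hx hy, sub_Y hx' hy']

end Setting.IsNice

/-! ### Crossings of blocks of strands -/

/-- Two morphisms on the braid group are intertwined by `u` as soon as this holds on the Artin
generators. -/
theorem braid_intertwine {K : Type*} [Group K] {n : ℕ} (φ ψ : Braid n →* K) (u : K)
    (h : ∀ i, i + 1 < n → u * φ (sigma n i) = ψ (sigma n i) * u) (g : Braid n) :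
    u * φ g = ψ g * u := by
  have e : (MulAut.conj u).toMonoidHom.comp φ = ψ := braid_hom_ext fun i hi => by
    change u * φ _ * u⁻¹ = _
    rw [h i hi, mul_inv_cancel_right]
  rw [← e]
  change _ = u * φ g * u⁻¹ * u
  rw [inv_mul_cancel_right]

theorem shift_sigma {n k N : ℕ} (h : k + n ≤ N) {i : ℕ} (hi : i + 1 < n) :
    shift n k N h (sigma n i) = sigma N (k + i) := braidLift_sigma _ _ _ _ hi

theorem shift_shift {n k M l N : ℕ} (h : k + n ≤ M) (h' : l + M ≤ N) (g : Braid n) :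
    shift M l N h' (shift n k M h g) = shift n (l + k) N (by omega) g :=
  DFunLike.congr_fun (f := (shift M l N h').comp (shift n k M h)) (braid_hom_ext fun i hi => by
    rw [MonoidHom.comp_apply, shift_sigma h hi, shift_sigma _ (by omega), shift_sigma _ hi,
      add_assoc]) g

theorem shift_self (n : ℕ) (g : Braid n) (h : 0 + n ≤ n) : shift n 0 n h g = g :=
  DFunLike.congr_fun (g := MonoidHom.id _) (braid_hom_ext fun i hi => by
    rw [shift_sigma _ hi, MonoidHom.id_apply, zero_add]) g

section Crossings
variable {N : ℕ}

theorem commute_sigma {i j : ℕ} (h : i + 2 ≤ j ∨ j + 2 ≤ i) :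
    Commute (sigma N i) (sigma N j) := by
  by_cases hi : i + 1 < N
  · by_cases hj : j + 1 < N
    · rcases h with h | h
      · exact sigma_comm h hj
      · exact (sigma_comm h hi).symm
    · rw [sigma, sigma, dif_neg (show ¬ j < N - 1 by omega)]
      exact Commute.one_right _
  · rw [sigma, dif_neg (show ¬ i < N - 1 by omega)]
    exact Commute.one_left _

/-- Braids on disjoint sets of strands commute. -/
theorem commute_shift {n k m l : ℕ} (h : k + n ≤ N) (h' : l + m ≤ N) (hd : k + n ≤ l)
    (g : Braid n) (g' : Braid m) : Commute (shift n k N h g) (shift m l N h' g') := by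
  refine braid_intertwine _ _ _ (fun j hj => ?_) g'
  refine (braid_intertwine _ _ _ (fun i hi => ?_) g).symm
  rw [shift_sigma h hi, shift_sigma h' hj]
  exact (commute_sigma (Or.inl (by omega))).eq.symm

theorem row_add (j m k : ℕ) : row N j (m + k) = row N (j + m) k * row N j m := by
  induction k with
  | zero => rw [add_zero, row, one_mul]
  | succ k ih => rw [← add_assoc, row, row, ih, mul_assoc, add_assoc]

theorem row_sigma_comm {i j m : ℕ} (h : i + 2 ≤ j ∨ j + m + 1 ≤ i) :
    Commute (sigma N i) (row N j m) := by
  induction m with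
  | zero => exact Commute.one_right _
  | succ m ih => exact (commute_sigma (by omega)).mul_right (ih (by omega))

/-- A generator slides through a strand which crosses both of its strands. -/
theorem row_sigma {i j m : ℕ} (hj : j ≤ i) (hm : i + 2 ≤ j + m) (hN : j + m < N) :
    row N j m * sigma N (i + 1) = sigma N i * row N j m := by
  induction m with
  | zero => omega
  | succ m ih =>
    by_cases h : i + 2 ≤ j + m
    · rw [row, mul_assoc, ih h (by omega), ← mul_assoc, ← mul_assoc,
        (commute_sigma (N := N) (i := j + m) (j := i) (Or.inr h)).eq]
    · obtain _ | m := m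
      · omega
      · obtain rfl : i = j + m := by omega
        have e : j + (m + 1) = j + m + 1 := by omega
        rw [row, row, e, mul_assoc, mul_assoc, ← (row_sigma_comm (Or.inr le_rfl)).eq, ← mul_assoc,
          ← mul_assoc, ← sigma_braid (by omega), mul_assoc, mul_assoc]

/-- `bl N o p q` exchanges the block of strands `o, …, o + p - 1` with the following block of `q`
strands. -/
def bl (N o : ℕ) : ℕ → ℕ → Braid N
  | 0, _ => 1
  | p + 1, q => bl N o p q * row N (o + p) q

theorem block_eq_bl (p q : ℕ) : block N p q = bl N 0 p q := by
  induction p with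
  | zero => rfl
  | succ p ih => rw [block, bl, ih, zero_add]

@[simp] theorem bl_zero_left (o q : ℕ) : bl N o 0 q = 1 := rfl

@[simp] theorem bl_zero_right (o p : ℕ) : bl N o p 0 = 1 := by
  induction p with
  | zero => rfl
  | succ p ih => rw [bl, ih, row, one_mul]

theorem bl_one_left (o q : ℕ) : bl N o 1 q = row N o q := by
  rw [bl, bl, one_mul, add_zero]

theorem bl_one_one (o : ℕ) : bl N o 1 1 = sigma N o := by
  rw [bl_one_left, row, row, mul_one, add_zero]

theorem bl_add_left (o p r q : ℕ) : bl N o (p + r) q = bl N o p q * bl N (o + p) r q := by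
  induction r with
  | zero => rw [add_zero, bl, mul_one]
  | succ r ih => rw [← add_assoc, bl, bl, ih, mul_assoc, add_assoc]

theorem bl_sigma_comm {i o p q : ℕ} (h : i + 2 ≤ o ∨ o + p + q ≤ i) :
    Commute (sigma N i) (bl N o p q) := by
  induction p with
  | zero => exact Commute.one_right _
  | succ p ih => exact (ih (by omega)).mul_right (row_sigma_comm (by omega))

theorem bl_row_comm {o p q j m : ℕ} (h : o + p + q ≤ j) : Commute (bl N o p q) (row N j m) := by
  induction m with
  | zero => exact Commute.one_right _
  | succ m ih => exact (bl_sigma_comm (by omega)).symm.mul_right ih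

theorem bl_add_right (o p q r : ℕ) : bl N o p (q + r) = bl N (o + q) p r * bl N o p q := by
  induction p with
  | zero => rw [bl, bl, bl, one_mul]
  | succ p ih =>
    rw [bl, bl, bl, ih, row_add, mul_assoc, mul_assoc, ← mul_assoc (bl N o p q),
      (bl_row_comm (by omega)).eq, mul_assoc, add_right_comm]

theorem bl_sigma_right {i o p q : ℕ} (hi : i + 1 < q) (hN : o + p + q ≤ N) :
    bl N o p q * sigma N (o + p + i) = sigma N (o + i) * bl N o p q := by
  induction p with
  | zero => rw [bl, one_mul, mul_one, add_zero]
  | succ p ih =>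
    rw [bl, mul_assoc, show o + (p + 1) + i = o + p + i + 1 by omega,
      row_sigma (by omega) (by omega) (by omega), ← mul_assoc, ih (by omega), mul_assoc]

/-- A generator inside a block slides through the crossing of the block with one strand. -/
theorem bl_one_sigma {i o p : ℕ} (hi : i + 1 < p) (hN : o + p + 1 ≤ N) :
    bl N o p 1 * sigma N (o + i) = sigma N (o + i + 1) * bl N o p 1 := by
  have r1 : ∀ j, row N j 1 = sigma N j := fun j => by rw [row, row, mul_one, add_zero]
  induction p with
  | zero => omega
  | succ p ih =>
    by_cases h : i + 1 < p
    · rw [bl, r1, mul_assoc, (commute_sigma (N := N) (i := o + p) (j := o + i)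
        (Or.inr (by omega))).eq, ← mul_assoc, ih h (by omega), mul_assoc]
    · obtain rfl : p = i + 1 := by omega
      rw [bl, bl, r1, r1, ← add_assoc, mul_assoc, mul_assoc, ← mul_assoc (sigma N (o + i)),
        sigma_braid (by omega), mul_assoc, ← mul_assoc, ← (bl_sigma_comm (by omega)).eq]
      simp only [mul_assoc]

theorem bl_sigma_left {i o p q : ℕ} (hi : i + 1 < p) (hN : o + p + q ≤ N) :
    bl N o p q * sigma N (o + i) = sigma N (o + q + i) * bl N o p q := by
  induction q with
  | zero => rw [bl_zero_right, one_mul, mul_one, add_zero]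
  | succ q ih =>
    rw [bl_add_right, mul_assoc, ih (by omega), ← mul_assoc, bl_one_sigma hi (by omega), mul_assoc]
    congr 2; omega

/-- Braids on the first block slide through a crossing of blocks. -/
theorem bl_shift_left {o p q n k : ℕ} (hk : o ≤ k) (hn : k + n ≤ o + p) (hN : o + p + q ≤ N)
    (g : Braid n) : bl N o p q * shift n k N (by omega) g =
      shift n (k + q) N (by omega) g * bl N o p q := by
  refine braid_intertwine _ _ _ (fun i hi => ?_) g
  rw [shift_sigma _ hi, shift_sigma _ hi]
  have := bl_sigma_left (i := k - o + i) (o := o) (p := p) (q := q) (by omega) hN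
  rwa [show o + (k - o + i) = k + i by omega, show o + q + (k - o + i) = k + q + i by omega] at this

/-- Braids on the second block slide through a crossing of blocks. -/
theorem bl_shift_right {o p q n k : ℕ} (hk : o ≤ k) (hn : k + n ≤ o + q) (hN : o + p + q ≤ N)
    (g : Braid n) : bl N o p q * shift n (k + p) N (by omega) g =
      shift n k N (by omega) g * bl N o p q := by
  refine braid_intertwine _ _ _ (fun i hi => ?_) g
  rw [shift_sigma _ hi, shift_sigma _ hi]
  have := bl_sigma_right (i := k - o + i) (o := o) (p := p) (q := q) (by omega) hN
  rwa [show o + p + (k - o + i) = k + p + i by omega, show o + (k - o + i) = k + i by omega] at this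

theorem shift_row {n k : ℕ} (h : k + n ≤ N) {j m : ℕ} (hm : j + m < n ∨ m = 0) :
    shift n k N h (row n j m) = row N (k + j) m := by
  induction m with
  | zero => exact map_one _
  | succ m ih => rw [row, row, map_mul, shift_sigma h (by omega), ih (by omega), add_assoc]

theorem shift_bl {n k : ℕ} (h : k + n ≤ N) {o p q : ℕ} (hn : o + p + q ≤ n) :
    shift n k N h (bl n o p q) = bl N (k + o) p q := by
  induction p with
  | zero => exact map_one _
  | succ p ih => rw [bl, bl, map_mul, shift_row h (by omega), ih (by omega), add_assoc]

theorem bl_eq_shift {o p q : ℕ} (h : o + p + q ≤ N) :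
    bl N o p q = shift (p + q) o N (by omega) (bl (p + q) 0 p q) := by
  rw [shift_bl _ (by omega), add_zero]

/-- The permutation underlying a crossing of blocks. -/
theorem bl_val (o p q : ℕ) (h : o + p + q ≤ N) (x : Fin N) :
    ((braidPerm N (bl N o p q) x : Fin N) : ℕ) =
      if (x : ℕ) < o then (x : ℕ) else if (x : ℕ) < o + p then x + q
      else if (x : ℕ) < o + p + q then (x : ℕ) - p else x := by
  induction p generalizing x with
  | zero =>
    rw [bl, map_one, Equiv.Perm.one_apply]
    split_ifs <;> omega
  | succ p ih =>
    rw [bl, map_mul, Equiv.Perm.mul_apply, ih (by omega), row_val _ _ _ (by omega)]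
    split_ifs <;> omega

/-- Crossings of blocks slide through a crossing of blocks, on the first block. -/
theorem bl_bl_left {o p q s a b : ℕ} (hs : o ≤ s) (h : s + a + b ≤ o + p) (hN : o + p + q ≤ N) :
    bl N o p q * bl N s a b = bl N (s + q) a b * bl N o p q := by
  rw [bl_eq_shift (o := s) (by omega), bl_shift_left hs (by omega) hN,
    bl_eq_shift (o := s + q) (by omega)]

/-- Crossings of blocks slide through a crossing of blocks, on the second block. -/
theorem bl_bl_right {o p q s a b : ℕ} (hs : o ≤ s) (h : s + a + b ≤ o + q) (hN : o + p + q ≤ N) :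
    bl N o p q * bl N (s + p) a b = bl N s a b * bl N o p q := by
  rw [bl_eq_shift (o := s + p) (by omega), bl_shift_right hs (by omega) hN,
    bl_eq_shift (o := s) (by omega)]

theorem bl_bl_comm {o p q s a b : ℕ} (h : o + p + q ≤ s) (hN : s + a + b ≤ N) :
    Commute (bl N o p q) (bl N s a b) := by
  rw [bl_eq_shift (o := s) (by omega), bl_eq_shift (o := o) (by omega)]
  exact commute_shift _ _ (by omega) _ _

/-- The braid relation for blocks. -/
theorem bl_braid {o p q r : ℕ} (hN : o + p + q + r ≤ N) :
    bl N o q r * bl N (o + q) p r * bl N o p q =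
      bl N (o + r) p q * bl N o p r * bl N (o + p) q r := by
  rw [mul_assoc, ← bl_add_right, mul_assoc, ← bl_add_left]
  rw [show bl N o p (q + r) = bl N o p (r + q) by rw [add_comm]]
  have h := bl_bl_right (N := N) (o := o) (p := p) (q := r + q) (s := o) (a := q) (b := r) le_rfl
    (by omega) (by omega)
  rw [← h, bl_add_right, bl_add_left, mul_assoc]

/-! ### Double crossings of blocks -/

/-- The pure braid in which the block of strands `o, …, o + p - 1` and the following block of `q`
strands turn once around each other. -/
def dbl (N o p q : ℕ) : Braid N := bl N o q p * bl N o p q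

@[simp] theorem dbl_zero_left (o q : ℕ) : dbl N o 0 q = 1 := by simp [dbl]

@[simp] theorem dbl_zero_right (o p : ℕ) : dbl N o p 0 = 1 := by simp [dbl]

theorem dbl_mem {o p q : ℕ} (h : o + p + q ≤ N) : dbl N o p q ∈ (braidPerm N).ker := by
  rw [MonoidHom.mem_ker]
  ext x
  rw [dbl, map_mul, Equiv.Perm.mul_apply, bl_val _ _ _ (by omega), bl_val _ _ _ (by omega),
    Equiv.Perm.one_apply]
  split_ifs <;> omega

theorem shift_dbl {n k : ℕ} (h : k + n ≤ N) {o p q : ℕ} (hn : o + p + q ≤ n) :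
    shift n k N h (dbl n o p q) = dbl N (k + o) p q := by
  rw [dbl, map_mul, shift_bl h (by omega), shift_bl h (by omega), dbl]

theorem dbl_eq_shift {o p q : ℕ} (h : o + p + q ≤ N) :
    dbl N o p q = shift (p + q) o N (by omega) (dbl (p + q) 0 p q) := by
  rw [shift_dbl _ (by omega), add_zero]

theorem dbl_shift_left {o p q n k : ℕ} (hk : o ≤ k) (hn : k + n ≤ o + p) (hN : o + p + q ≤ N)
    (g : Braid n) : Commute (dbl N o p q) (shift n k N (by omega) g) := by
  change _ * _ = _ * _
  rw [dbl, mul_assoc, bl_shift_left hk hn hN, ← mul_assoc,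
    bl_shift_right hk (by omega) (by omega), mul_assoc]

theorem dbl_shift_right {o p q n k : ℕ} (hk : o + p ≤ k) (hn : k + n ≤ o + p + q)
    (hN : o + p + q ≤ N) (g : Braid n) : Commute (dbl N o p q) (shift n k N (by omega) g) := by
  obtain ⟨k, rfl⟩ : ∃ l, k = l + p := ⟨k - p, by omega⟩
  change _ * _ = _ * _
  rw [dbl, mul_assoc, bl_shift_right (by omega) (by omega) hN, ← mul_assoc,
    bl_shift_left (by omega) (by omega) (by omega), mul_assoc]

theorem dbl_shift_of_le {o p q n k : ℕ} (h : k + n ≤ o ∨ o + p + q ≤ k) (hN : o + p + q ≤ N)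
    (hn : k + n ≤ N) (g : Braid n) : Commute (dbl N o p q) (shift n k N hn g) := by
  rw [dbl_eq_shift hN]
  rcases h with h | h
  · exact (commute_shift _ _ h _ _).symm
  · exact commute_shift _ _ (by omega) _ _

/-- A crossing of blocks slides through a double crossing which does not separate its strands. -/
theorem dbl_commute_bl {o p q s a b : ℕ} (h : (o ≤ s ∧ s + a + b ≤ o + p) ∨
    (o + p ≤ s ∧ s + a + b ≤ o + p + q) ∨ s + a + b ≤ o ∨ o + p + q ≤ s) (hN : o + p + q ≤ N)
    (hn : s + a + b ≤ N) : Commute (dbl N o p q) (bl N s a b) := by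
  rw [bl_eq_shift hn]
  rcases h with ⟨h, h'⟩ | ⟨h, h'⟩ | h | h
  · exact dbl_shift_left h (by omega) hN _
  · exact dbl_shift_right h (by omega) hN _
  · exact dbl_shift_of_le (Or.inl (by omega)) hN _ _
  · exact dbl_shift_of_le (Or.inr h) hN _ _

theorem dbl_commute_dbl {o p q s a b : ℕ} (h : (o ≤ s ∧ s + a + b ≤ o + p) ∨
    (o + p ≤ s ∧ s + a + b ≤ o + p + q) ∨ s + a + b ≤ o ∨ o + p + q ≤ s) (hN : o + p + q ≤ N)
    (hn : s + a + b ≤ N) : Commute (dbl N o p q) (dbl N s a b) :=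
  (dbl_commute_bl (by omega) hN (by omega)).mul_right (dbl_commute_bl h hN hn)

theorem bl_dbl_right {o p q s a b : ℕ} (hs : o ≤ s) (h : s + a + b ≤ o + q) (hN : o + p + q ≤ N) :
    bl N o p q * dbl N (s + p) a b = dbl N s a b * bl N o p q := by
  rw [dbl, ← mul_assoc, bl_bl_right hs (by omega) hN, mul_assoc, bl_bl_right hs h hN, ← mul_assoc,
    dbl]

theorem bl_dbl (o p q : ℕ) : bl N o p q * dbl N o p q = dbl N o q p * bl N o p q := by
  rw [dbl, dbl, mul_assoc]

theorem dbl_add_right {o p q r : ℕ} : dbl N o p (q + r) =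
    bl N o q p * dbl N (o + q) p r * bl N o p q := by
  rw [dbl, dbl, bl_add_left, bl_add_right]; simp only [mul_assoc]

theorem dbl_add_left {o p q r : ℕ} : dbl N o (p + q) r =
    bl N (o + p) r q * dbl N o p r * bl N (o + p) q r := by
  rw [dbl, dbl, bl_add_left, bl_add_right]; simp only [mul_assoc]

/-- The two expressions of the full twist on three blocks, up to the full twists of the blocks. -/
theorem dbl_mul_dbl {o p q r : ℕ} (hN : o + p + q + r ≤ N) :
    dbl N (o + p) q r * dbl N o p (q + r) = dbl N o p q * dbl N o (p + q) r := by
  rw [← (dbl_commute_dbl (by omega) (by omega) (by omega) :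
    Commute (dbl N o (p + q) r) (dbl N o p q)).eq]
  have e : bl N o (q + r) p = bl N o r p * bl N (o + r) q p := by rw [add_comm, bl_add_left]
  calc dbl N (o + p) q r * dbl N o p (q + r)
      = bl N (o + p) r q * (bl N (o + p) q r * bl N o (q + r) p) * bl N o p (q + r) := by
        rw [dbl, dbl]; simp only [mul_assoc]
    _ = bl N (o + p) r q * (bl N o (q + r) p * bl N o q r) * bl N o p (q + r) := by
        rw [← bl_bl_left (s := o) (o := o) (p := q + r) le_rfl (by omega) (by omega)]
    _ = bl N (o + p) r q * bl N o r p * bl N (o + r) q p *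
          (bl N o q r * bl N (o + q) p r * bl N o p q) := by
        rw [e, bl_add_right]; simp only [mul_assoc]
    _ = bl N (o + p) r q * bl N o r p * (bl N o p r * bl N (o + p) q r * bl N o q p) *
          bl N o p q := by
        have := bl_braid (N := N) (o := o) (p := q) (q := p) (r := r) (by omega)
        rw [this]; simp only [mul_assoc]
    _ = _ := by rw [dbl_add_left, dbl, dbl]; simp only [mul_assoc]

/-! ### The mirror image of a crossing -/

theorem star_sigma {i : ℕ} (h : i + 1 < N) : braidStar N (sigma N i) = sigma N (N - 2 - i) :=
  braidLift_sigma _ _ _ _ h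

theorem star_row {j m : ℕ} (h : j + m + 1 ≤ N) :
    braidStar N (row N j m) = bl N (N - 1 - j - m) m 1 := by
  induction m with
  | zero => exact map_one _
  | succ m ih =>
    have e : bl N (N - 1 - j - (m + 1)) (m + 1) 1 =
        bl N (N - 1 - j - (m + 1)) 1 1 * bl N (N - 1 - j - (m + 1) + 1) m 1 :=
      (congrArg (fun t => bl N (N - 1 - j - (m + 1)) t 1) (add_comm m 1)).trans (bl_add_left _ _ _ _)
    rw [row, map_mul, star_sigma (by omega), ih (by omega), e, bl_one_one]
    congr 2 <;> omega

/-- The mirror image of a crossing of blocks: the sizes of the blocks are exchanged, and positions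
are counted from the right. -/
theorem star_bl {o p q : ℕ} (h : o + p + q ≤ N) :
    braidStar N (bl N o p q) = bl N (N - o - p - q) q p := by
  induction p with
  | zero => rw [bl, map_one, bl_zero_right]
  | succ p ih =>
    rw [bl, map_mul, ih (by omega), star_row (by omega), add_comm p 1, bl_add_right]
    congr 2 <;> omega

theorem star_dbl {o p q : ℕ} (h : o + p + q ≤ N) :
    braidStar N (dbl N o p q) = dbl N (N - o - p - q) q p := by
  rw [dbl, map_mul, star_bl h, star_bl (by omega), dbl, Nat.sub_right_comm]

theorem star_shift {n k : ℕ} (h : k + n ≤ N) (g : Braid n) :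
    braidStar N (shift n k N h g) = shift n (N - k - n) N (by omega) (braidStar n g) :=
  DFunLike.congr_fun (f := (braidStar N).comp (shift n k N h))
    (g := (shift n (N - k - n) N (by omega)).comp (braidStar n)) (braid_hom_ext fun i hi => by
    rw [MonoidHom.comp_apply, MonoidHom.comp_apply, shift_sigma h hi, star_sigma (by omega),
      star_sigma hi, shift_sigma _ (by omega)]
    congr 1; omega) g

/-! ### Half-twists -/

theorem halfTw_eq_shift {k : ℕ} (h : k ≤ N) : halfTw N k = shift k 0 N (by omega) (halfTwist k) := by
  have : ∀ l, l ≤ k → halfTw N l = shift k 0 N (by omega) (halfTw k l) := by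
    intro l
    induction l with
    | zero => intro _; exact (map_one _).symm
    | succ l ih =>
      intro hl
      rw [halfTw, halfTw, map_mul, ih (by omega), shift_row _ (by omega)]
  exact this k le_rfl

theorem halfTwist_succ (n : ℕ) : halfTwist (n + 1) =
    shift n 0 (n + 1) (by omega) (halfTwist n) * bl (n + 1) 0 1 n := by
  rw [halfTwist, halfTw, halfTw_eq_shift (by omega), bl_one_left]

theorem halfTwist_cast {m n : ℕ} (h : m = n) (h0 : 0 + m ≤ n) :
    shift m 0 n h0 (halfTwist m) = halfTwist n := by
  subst h; exact shift_self _ _ _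

/-- The half-twist on the union of two blocks. -/
theorem halfTwist_add (p q : ℕ) : halfTwist (p + q) =
    shift q 0 (p + q) (by omega) (halfTwist q) * shift p q (p + q) (by omega) (halfTwist p) *
      bl (p + q) 0 p q := by
  induction p with
  | zero =>
    rw [show halfTwist 0 = 1 from rfl, map_one, bl, mul_one, mul_one, halfTwist_cast (by omega)]
  | succ p ih =>
    have h1 : halfTwist (p + 1 + q) = shift (p + q) 0 (p + 1 + q) (by omega) (halfTwist (p + q)) *
        bl (p + 1 + q) 0 1 (p + q) := by
      rw [← halfTwist_cast (show p + q + 1 = p + 1 + q by omega) (by omega), halfTwist_succ, map_mul,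
        shift_shift, shift_bl _ (by omega)]
    have h2 : bl (p + 1 + q) 0 p q * bl (p + 1 + q) 0 1 (p + q) =
        bl (p + 1 + q) q 1 p * bl (p + 1 + q) 0 (p + 1) q := by
      have := bl_bl_left (N := p + 1 + q) (o := 0) (p := p + 1) (q := q) (s := 0) (a := 1) (b := p)
        le_rfl (by omega) (by omega)
      rw [zero_add] at this
      rw [← this, bl_add_left, bl_add_right, mul_assoc]
    rw [h1, ih, map_mul, map_mul, shift_shift, shift_shift, shift_bl _ (by omega), mul_assoc,
      halfTwist_succ, map_mul, shift_shift, shift_bl _ (by omega)]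
    simp only [mul_assoc, add_zero, zero_add, h2]

/-- The full twist on a union of two blocks consists of the full twists on the blocks and of their
double crossing. -/
theorem halfTwist_sq_add (p q : ℕ) : halfTwist (p + q) * halfTwist (p + q) =
    shift p 0 (p + q) (by omega) (halfTwist p * halfTwist p) *
      shift q p (p + q) (by omega) (halfTwist q * halfTwist q) * dbl (p + q) 0 p q := by
  have h : halfTwist (p + q) = shift p 0 (p + q) (by omega) (halfTwist p) *
      shift q p (p + q) (by omega) (halfTwist q) * bl (p + q) 0 q p := by
    rw [← halfTwist_cast (Nat.add_comm q p) (by omega), halfTwist_add, map_mul, map_mul,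
      shift_shift, shift_shift, shift_bl _ (by omega)]
    simp only [zero_add]
  have h1 := bl_shift_right (N := p + q) (o := 0) (p := q) (q := p) (n := p) (k := 0) le_rfl
    (by omega) (by omega) (halfTwist p)
  have h2 := bl_shift_left (N := p + q) (o := 0) (p := q) (q := p) (n := q) (k := 0) le_rfl
    (by omega) (by omega) (halfTwist q)
  simp only [zero_add] at h1 h2
  have h3 := (commute_shift (N := p + q) (n := p) (k := 0) (m := q) (l := p) (by omega) (by omega)
    (by omega) (halfTwist p) (halfTwist q)).eq
  conv_lhs => enter [1]; rw [h]
  rw [halfTwist_add, map_mul, map_mul, dbl]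
  calc _ = shift p 0 (p + q) (by omega) (halfTwist p) * shift q p (p + q) (by omega) (halfTwist q) *
      (bl (p + q) 0 q p * shift q 0 (p + q) (by omega) (halfTwist q)) *
        shift p q (p + q) (by omega) (halfTwist p) * bl (p + q) 0 p q := by simp only [mul_assoc]
    _ = shift p 0 (p + q) (by omega) (halfTwist p) * shift q p (p + q) (by omega) (halfTwist q) *
      shift q p (p + q) (by omega) (halfTwist q) * (bl (p + q) 0 q p *
        shift p q (p + q) (by omega) (halfTwist p)) * bl (p + q) 0 p q := by
          rw [h2]; simp only [mul_assoc]
    _ = shift p 0 (p + q) (by omega) (halfTwist p) * (shift q p (p + q) (by omega) (halfTwist q) *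
      (shift q p (p + q) (by omega) (halfTwist q) * shift p 0 (p + q) (by omega) (halfTwist p))) *
        (bl (p + q) 0 q p * bl (p + q) 0 p q) := by rw [h1]; simp only [mul_assoc]
    _ = _ := by
      rw [← h3, ← mul_assoc (shift q p _ _ _) (shift p 0 _ _ _), ← h3]; simp only [mul_assoc]

theorem rho_eq_bl (k : ℕ) : rho N k = bl N 0 k 1 := by
  induction k with
  | zero => rfl
  | succ k ih => rw [rho, bl, ih, row, row, mul_one, zero_add, add_zero]

/-- The identity `z = h ^ 2`. By induction on the number of strands: both sides acquire the double
crossing of the last strand with all the others. -/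
theorem fullTwist_eq (n : ℕ) : fullTwist n = halfTwist n * halfTwist n := by
  induction n with
  | zero => rw [fullTwist, pow_zero]; exact (mul_one _).symm
  | succ n ih =>
    have hs := halfTwist_sq_add n 1
    rw [show halfTwist 1 = 1 by rw [halfTwist, halfTw, halfTw, row, one_mul], one_mul, map_one,
      mul_one, ← ih] at hs
    rw [hs, fullTwist, fullTwist, map_pow]
    change rho (n + 1) n ^ (n + 1) = _
    -- Each factor `σ₁ ⋯ σₙ` of the power is `σ₁ ⋯ σₙ₋₁` followed by `σₙ`; the latter are moved to
    -- the right, where they accumulate to a strand which crosses the others.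
    have key : ∀ k, k ≤ n → rho (n + 1) n ^ k =
        shift n 0 (n + 1) (by omega) (rho n (n - 1)) ^ k * row (n + 1) (n - k) k := by
      intro k
      induction k with
      | zero => intro _; simp [row]
      | succ k ihk =>
        intro hk
        have e1 : row (n + 1) (n - k) k * rho (n + 1) n =
            rho (n + 1) n * row (n + 1) (n - (k + 1)) k := by
          have h := bl_shift_left (N := n + 1) (o := 0) (p := n) (q := 1) (n := k + 1)
            (k := n - (k + 1)) (by omega) (by omega) (by omega) (row (k + 1) 0 k)
          rw [shift_row _ (by omega), shift_row _ (by omega), add_zero, add_zero, ← rho_eq_bl,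
            show n - (k + 1) + 1 = n - k by omega] at h
          exact h.symm
        have e2 : rho (n + 1) n = shift n 0 (n + 1) (by omega) (rho n (n - 1)) *
            sigma (n + 1) (n - 1) := by
          obtain ⟨l, rfl⟩ : ∃ l, n = l + 1 := ⟨n - 1, by omega⟩
          change rho (l + 1 + 1) (l + 1) = shift _ _ _ _ (rho (l + 1) l) * sigma (l + 1 + 1) l
          rw [rho_eq_bl, rho_eq_bl, shift_bl _ (by omega), bl, row, row, mul_one, zero_add,
            add_zero]
        rw [pow_succ, ihk (by omega), mul_assoc, e1, e2, ← mul_assoc, ← mul_assoc, ← pow_succ,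
          mul_assoc, row]
        congr 3; omega
    rw [pow_succ, key n le_rfl, Nat.sub_self, mul_assoc, dbl, bl_one_left, ← rho_eq_bl n]

theorem sphereWord_eq (n : ℕ) : sphereWord n = bl n 0 (n - 1) 1 * bl n 0 1 (n - 1) := by
  rw [sphereWord, rho_eq_bl, bl_one_left]

end Crossings

/-! ### Cabling of pure braids on four strands -/

theorem braid_induction {n : ℕ} {p : Braid n → Prop} (h1 : p 1)
    (hs : ∀ i, i + 1 < n → p (sigma n i)) (hm : ∀ g h, p g → p h → p (g * h))
    (hi : ∀ g, p g → p g⁻¹) (g : Braid n) : p g := by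
  have hg : g ∈ Subgroup.closure (Set.range (PresentedGroup.of (rels := artinRels n))) := by
    rw [PresentedGroup.closure_range_of]; trivial
  refine Subgroup.closure_induction (p := fun g _ => p g) ?_ h1 (fun x y _ _ => hm x y)
    (fun x _ => hi x) hg
  rintro _ ⟨i, rfl⟩
  rw [of_eq_sigma]
  exact hs i (by omega)

/-- Multiplicities of four strands, for a cabling of the strands inside `o, …, N - 1`. -/
abbrev Cables (o N : ℕ) : Type := {c : Fin 4 → ℕ // o + ∑ i, c i ≤ N}

namespace Cables
variable {o N : ℕ}

/-- The action of permutations on multiplicities. -/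
def perm (π : Equiv.Perm (Fin 4)) (c : Cables o N) : Cables o N :=
  ⟨c.1 ∘ π.symm, by
    have := Equiv.sum_comp π.symm c.1
    simp only [Function.comp_apply, this]
    exact c.2⟩

/-- The cabling of the generator `σᵢ`. -/
def gen (c : Cables o N) (i : ℕ) : Braid N :=
  if i = 0 then bl N o (c.1 0) (c.1 1) else if i = 1 then bl N (o + c.1 0) (c.1 1) (c.1 2)
  else bl N (o + c.1 0 + c.1 1) (c.1 2) (c.1 3)

theorem transp_symm (i : ℕ) : (transp 4 i).symm = transp 4 i := by
  unfold transp; split_ifs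
  · exact Equiv.symm_swap _ _
  · rfl

theorem transp_transp (i : ℕ) (x : Fin 4) : transp 4 i (transp 4 i x) = x := by
  unfold transp; split_ifs
  · exact Equiv.swap_apply_self _ _ _
  · rfl

theorem perm_transp_transp (i : ℕ) (c : Cables o N) :
    perm (transp 4 i) (perm (transp 4 i) c) = c :=
  Subtype.ext (funext fun x => by simp [perm, transp_symm, transp_transp])

theorem perm_val (i : ℕ) (c : Cables o N) (x : Fin 4) :
    (perm (transp 4 i) c).1 x = c.1 (transp 4 i x) := by simp [perm, transp_symm]

/-- The action of the generator `σᵢ` on pairs of multiplicities and a braid: the braid is multiplied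
by the crossing of the blocks which replace the strands `i` and `i + 1`, and the multiplicities are
permuted. The groupoid of cabled braids is thus encoded in an honest action of the group. -/
def act (i : ℕ) : Equiv.Perm (Cables o N × Braid N) where
  toFun x := (perm (transp 4 i) x.1, gen x.1 i * x.2)
  invFun x := (perm (transp 4 i) x.1, (gen (perm (transp 4 i) x.1) i)⁻¹ * x.2)
  left_inv x := by simp [perm_transp_transp]
  right_inv x := by simp [perm_transp_transp]

/-- The value `tij` of the transposition of `i` and `i + 1` at `j`, for four strands. -/
theorem t00 : transp 4 0 0 = 1 := by decide
theorem t01 : transp 4 0 1 = 0 := by decide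
theorem t02 : transp 4 0 2 = 2 := by decide
theorem t03 : transp 4 0 3 = 3 := by decide
theorem t10 : transp 4 1 0 = 0 := by decide
theorem t11 : transp 4 1 1 = 2 := by decide
theorem t12 : transp 4 1 2 = 1 := by decide
theorem t13 : transp 4 1 3 = 3 := by decide
theorem t20 : transp 4 2 0 = 0 := by decide
theorem t21 : transp 4 2 1 = 1 := by decide
theorem t22 : transp 4 2 2 = 3 := by decide
theorem t23 : transp 4 2 3 = 2 := by decide

theorem sum_eq (c : Cables o N) : o + (c.1 0 + c.1 1 + c.1 2 + c.1 3) ≤ N := by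
  have := c.2
  rwa [Fin.sum_univ_four] at this

/-- The action respects the braid relations: this is the braid relation for blocks of strands of
arbitrary sizes. -/
theorem act_braid (i : ℕ) (hi : i + 2 < 4) : act (o := o) (N := N) i * act (i + 1) * act i =
    act (i + 1) * act i * act (i + 1) := by
  ext1 x
  obtain ⟨c, g⟩ := x
  have hc := c.sum_eq
  have h01 : ∀ x, transp 4 0 (transp 4 1 (transp 4 0 x)) = transp 4 1 (transp 4 0 (transp 4 1 x)) := by
    decide
  have h12 : ∀ x, transp 4 1 (transp 4 2 (transp 4 1 x)) = transp 4 2 (transp 4 1 (transp 4 2 x)) := by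
    decide
  obtain rfl | rfl : i = 0 ∨ i = 1 := by omega
  · refine Prod.ext (Subtype.ext (funext fun x => ?_)) ?_
    · simp [act, perm, transp_symm, h01]
    · simp only [act, Equiv.Perm.mul_apply, Equiv.coe_fn_mk, gen, perm_val, if_true, zero_add,
        one_ne_zero, if_false, t00, t01, t02, t10, t11, t12]
      have := bl_braid (N := N) (o := o) (p := c.1 0) (q := c.1 1) (r := c.1 2) (by omega)
      simp only [← mul_assoc, this]
  · refine Prod.ext (Subtype.ext (funext fun x => ?_)) ?_
    · simp [act, perm, transp_symm, h12]
    · simp only [act, Equiv.Perm.mul_apply, Equiv.coe_fn_mk, gen, perm_val, if_true,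
        one_ne_zero, if_false, t10, t11, t12, t13, t20, t21, t22, t23, Nat.reduceAdd,
        show (2 : ℕ) ≠ 0 by decide, show (2 : ℕ) ≠ 1 by decide]
      have := bl_braid (N := N) (o := o + c.1 0) (p := c.1 1) (q := c.1 2) (r := c.1 3) (by omega)
      simp only [← mul_assoc, this]

theorem act_comm (i j : ℕ) (hij : i + 2 ≤ j) (hj : j + 1 < 4) :
    act (o := o) (N := N) i * act j = act j * act i := by
  obtain ⟨rfl, rfl⟩ : i = 0 ∧ j = 2 := by omega
  ext1 x
  obtain ⟨c, g⟩ := x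
  have hc := c.sum_eq
  have h02 : ∀ x, transp 4 0 (transp 4 2 x) = transp 4 2 (transp 4 0 x) := by decide
  refine Prod.ext (Subtype.ext (funext fun x => ?_)) ?_
  · simp [act, perm, transp_symm, h02]
  · simp only [act, Equiv.Perm.mul_apply, Equiv.coe_fn_mk, gen, perm_val, if_true,
      if_false, t00, t01, t02, t03, t20, t21, t22, t23,
      show (2 : ℕ) ≠ 0 by decide, show (2 : ℕ) ≠ 1 by decide]
    have := (bl_bl_comm (N := N) (o := o) (p := c.1 0) (q := c.1 1) (s := o + c.1 0 + c.1 1)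
      (a := c.1 2) (b := c.1 3) (by omega) (by omega)).eq
    rw [← mul_assoc, this, mul_assoc, add_right_comm o (c.1 1)]

/-- The action of the braid group on four strands. -/
def actHom : Braid 4 →* Equiv.Perm (Cables o N × Braid N) := braidLift 4 act act_braid act_comm

theorem actHom_sigma {i : ℕ} (hi : i + 1 < 4) (c : Cables o N) (x : Braid N) :
    actHom (sigma 4 i) (c, x) = (perm (transp 4 i) c, gen c i * x) := by
  rw [actHom, braidLift_sigma _ _ _ _ hi]; rfl

theorem actHom_mul_right (g : Braid 4) (c : Cables o N) (x y : Braid N) :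
    actHom g (c, x * y) = ((actHom g (c, x)).1, (actHom g (c, x)).2 * y) := by
  let u : Equiv.Perm (Cables o N × Braid N) := (Equiv.refl _).prodCongr (Equiv.mulRight y)
  have := braid_intertwine actHom actHom u (fun i hi => Equiv.ext fun ⟨c, x⟩ => by
    change u (actHom _ (c, x)) = actHom _ (c, x * y)
    rw [actHom_sigma hi, actHom_sigma hi]
    exact Prod.ext rfl (mul_assoc _ _ _)) g
  exact (DFunLike.congr_fun this (c, x)).symm

/-- The strand of the cable to which a position belongs, and its place in this strand. -/
def label (c : Cables o N) (z : ℕ) : Fin 4 × ℕ ⊕ ℕ :=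
  if z < o then .inr z else if z < o + c.1 0 then .inl (0, z - o)
  else if z < o + c.1 0 + c.1 1 then .inl (1, z - (o + c.1 0))
  else if z < o + c.1 0 + c.1 1 + c.1 2 then .inl (2, z - (o + c.1 0 + c.1 1))
  else if z < o + c.1 0 + c.1 1 + c.1 2 + c.1 3 then .inl (3, z - (o + c.1 0 + c.1 1 + c.1 2))
  else .inr z

theorem label_injective (c : Cables o N) : Function.Injective c.label := by
  intro z w h
  unfold label at h
  split_ifs at h <;> simp at h <;> omega

/-- Cabled generators permute the cables and keep the order inside each cable. -/
theorem label_gen {i : ℕ} (hi : i + 1 < 4) (c : Cables o N) (z : Fin N) :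
    label (perm (transp 4 i) c) (braidPerm N (gen c i) z : Fin N) =
      Sum.map (Prod.map (transp 4 i) id) id (label c z) := by
  have hc := c.sum_eq
  have hz : (z : ℕ) < o ∨ (o ≤ z ∧ (z : ℕ) < o + c.1 0) ∨
      (o + c.1 0 ≤ z ∧ (z : ℕ) < o + c.1 0 + c.1 1) ∨
      (o + c.1 0 + c.1 1 ≤ z ∧ (z : ℕ) < o + c.1 0 + c.1 1 + c.1 2) ∨
      (o + c.1 0 + c.1 1 + c.1 2 ≤ z ∧ (z : ℕ) < o + c.1 0 + c.1 1 + c.1 2 + c.1 3) ∨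
      o + c.1 0 + c.1 1 + c.1 2 + c.1 3 ≤ z := by omega
  obtain rfl | rfl | rfl : i = 0 ∨ i = 1 ∨ i = 2 := by omega
  · rw [gen, if_pos rfl, bl_val _ _ _ (by omega)]
    simp only [label, perm_val, t00, t01, t02, t03]
    rcases hz with h | ⟨h, h'⟩ | ⟨h, h'⟩ | ⟨h, h'⟩ | ⟨h, h'⟩ | h <;>
      simp (disch := omega) only [if_pos, if_neg, Sum.map_inl, Sum.map_inr, Prod.map_apply, id_eq,
        t00, t01, t02, t03] <;> congr 2 <;> omega
  · rw [gen, if_neg (by omega), if_pos rfl, bl_val _ _ _ (by omega)]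
    simp only [label, perm_val, t10, t11, t12, t13]
    rcases hz with h | ⟨h, h'⟩ | ⟨h, h'⟩ | ⟨h, h'⟩ | ⟨h, h'⟩ | h <;>
      simp (disch := omega) only [if_pos, if_neg, Sum.map_inl, Sum.map_inr, Prod.map_apply, id_eq,
        t10, t11, t12, t13] <;> congr 2 <;> omega
  · rw [gen, if_neg (by omega), if_neg (by omega), bl_val _ _ _ (by omega)]
    simp only [label, perm_val, t20, t21, t22, t23]
    rcases hz with h | ⟨h, h'⟩ | ⟨h, h'⟩ | ⟨h, h'⟩ | ⟨h, h'⟩ | h <;>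
      simp (disch := omega) only [if_pos, if_neg, Sum.map_inl, Sum.map_inr, Prod.map_apply, id_eq,
        t20, t21, t22, t23] <;> congr 2 <;> omega

theorem perm_inv_perm (π : Equiv.Perm (Fin 4)) (c : Cables o N) : perm π⁻¹ (perm π c) = c :=
  Subtype.ext (funext fun x => congrArg c.1 (π.symm_apply_apply x))

/-- The multiplicities and the permutation underlying a cabled braid. -/
theorem actHom_perm (g : Braid 4) : ∀ (c : Cables o N) (x : Braid N),
    (actHom g (c, x)).1 = perm (braidPerm 4 g) c ∧ ∀ z : Fin N,
      label (actHom g (c, x)).1 (braidPerm N (actHom g (c, x)).2 z : Fin N) =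
        Sum.map (Prod.map (braidPerm 4 g) id) id (label c (braidPerm N x z : Fin N)) := by
  refine braid_induction (p := fun g => ∀ (c : Cables o N) (x : Braid N),
    (actHom g (c, x)).1 = perm (braidPerm 4 g) c ∧ ∀ z : Fin N,
      label (actHom g (c, x)).1 (braidPerm N (actHom g (c, x)).2 z : Fin N) =
        Sum.map (Prod.map (braidPerm 4 g) id) id (label c (braidPerm N x z : Fin N)))
    ?_ ?_ ?_ ?_ g
  · intro c x
    rw [map_one, map_one]
    refine ⟨rfl, fun z => ?_⟩
    change label c _ = Sum.map (Prod.map id id) id _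
    simp
  · intro i hi c x
    rw [actHom_sigma hi, braidPerm_sigma hi]
    refine ⟨rfl, fun z => ?_⟩
    rw [map_mul, Equiv.Perm.mul_apply]
    exact label_gen hi c _
  · intro g h hg hh c x
    rw [map_mul, map_mul, Equiv.Perm.mul_apply]
    obtain ⟨h1, h2⟩ := hh c x
    obtain ⟨h3, h4⟩ := hg (actHom h (c, x)).1 (actHom h (c, x)).2
    rw [Prod.mk.eta] at h3 h4
    refine ⟨by rw [h3, h1]; rfl, fun z => ?_⟩
    rw [h4, h2, Sum.map_map, Prod.map_comp_map]
    rfl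
  · intro g hg c x
    obtain ⟨h1, h2⟩ := hg (actHom g⁻¹ (c, x)).1 (actHom g⁻¹ (c, x)).2
    have e : actHom g (actHom g⁻¹ (c, x)) = (c, x) := by
      rw [← Equiv.Perm.mul_apply, ← map_mul, mul_inv_cancel, map_one]; rfl
    rw [Prod.mk.eta, e] at h1 h2
    change c = _ at h1
    rw [map_inv (braidPerm 4)]
    refine ⟨?_, fun z => ?_⟩
    · conv_rhs => rw [h1]
      exact (perm_inv_perm _ _).symm
    · have h3 := h2 z
      change label c _ = _ at h3
      rw [h3, Sum.map_map, Prod.map_comp_map]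
      have : ⇑((braidPerm 4 g)⁻¹) ∘ ⇑(braidPerm 4 g) = id := funext fun x => by simp
      rw [this]; simp

/-- The cabling morphism: the `i`-th strand is replaced by `c i` parallel strands. -/
def cable (c : Cables o N) : PureBraid4 →* Braid N where
  toFun g := (actHom g.1 (c, 1)).2
  map_one' := by rw [Subgroup.coe_one, map_one]; rfl
  map_mul' g h := by
    have h1 : (actHom h.1 (c, 1)).1 = c := by
      rw [(actHom_perm h.1 c 1).1, show braidPerm 4 h.1 = 1 from h.2]
      rfl
    have h2 : actHom h.1 (c, 1) = (c, 1 * (actHom h.1 (c, 1)).2) := by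
      rw [one_mul]; exact Prod.ext h1 rfl
    rw [Subgroup.coe_mul, map_mul, Equiv.Perm.mul_apply]
    conv_lhs => rw [h2]
    rw [actHom_mul_right]

theorem cable_mem (c : Cables o N) (g : PureBraid4) : cable c g ∈ (braidPerm N).ker := by
  rw [MonoidHom.mem_ker]
  ext z
  obtain ⟨h1, h2⟩ := actHom_perm g.1 c 1
  have hg : braidPerm 4 g.1 = 1 := g.2
  have h3 := h2 z
  rw [h1, hg] at h3
  refine label_injective c ?_
  refine Eq.trans h3 ?_
  rw [map_one]
  change Sum.map (Prod.map id id) id _ = _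
  simp

section Values
variable (c : Cables o N)

theorem cable_sq {i : ℕ} (hi : i + 1 < 4) : cable c (sq i hi) =
    gen (perm (transp 4 i) c) i * gen c i := by
  change (actHom (sigma 4 i * sigma 4 i) (c, 1)).2 = _
  rw [map_mul, Equiv.Perm.mul_apply, actHom_sigma hi, actHom_sigma hi, mul_one]

theorem cable_sandwich {i j : ℕ} (hi : i + 1 < 4) (hj : j + 1 < 4) :
    cable c (sandwich i hi (sq j hj)) = gen (perm (transp 4 i) c) i *
      (gen (perm (transp 4 j) (perm (transp 4 i) c)) j * gen (perm (transp 4 i) c) j) * gen c i := by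
  change (actHom (sigma 4 i * (sigma 4 j * sigma 4 j) * sigma 4 i) (c, 1)).2 = _
  rw [map_mul, map_mul, map_mul, Equiv.Perm.mul_apply, Equiv.Perm.mul_apply, Equiv.Perm.mul_apply,
    actHom_sigma hi, actHom_sigma hj, actHom_sigma hj, actHom_sigma hi, perm_transp_transp]
  simp only [mul_one, mul_assoc]

theorem cable_sq0 : cable c (sq 0 (by decide)) = dbl N o (c.1 0) (c.1 1) := by
  rw [cable_sq]
  simp only [gen, perm_val, if_true, t00, t01, dbl]

theorem cable_sq1 : cable c (sq 1 (by decide)) = dbl N (o + c.1 0) (c.1 1) (c.1 2) := by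
  rw [cable_sq]
  simp only [gen, perm_val, if_true, one_ne_zero, if_false, t10, t11, t12, dbl]

theorem cable_sq2 : cable c (sq 2 (by decide)) = dbl N (o + c.1 0 + c.1 1) (c.1 2) (c.1 3) := by
  rw [cable_sq]
  simp only [gen, perm_val, show (2 : ℕ) ≠ 0 by decide, show (2 : ℕ) ≠ 1 by decide, if_false, t20,
    t21, t22, t23, dbl]

theorem cable_sandwich10 : cable c (sandwich 1 (by decide) (sq 0 (by decide))) =
    dbl N o (c.1 0 + c.1 1) (c.1 2) := by
  rw [cable_sandwich, dbl_add_left, dbl]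
  simp only [gen, perm_val, if_true, one_ne_zero, if_false, t00, t01, t02, t10, t11, t12]

theorem cable_sandwich12 : cable c (sandwich 1 (by decide) (sq 2 (by decide))) =
    dbl N (o + c.1 0) (c.1 1) (c.1 2 + c.1 3) := by
  rw [cable_sandwich, dbl_add_right, dbl]
  simp only [gen, perm_val, if_true, one_ne_zero, if_false, t10, t11, t12, t13, t20, t21, t22, t23,
    show (2 : ℕ) ≠ 0 by decide, show (2 : ℕ) ≠ 1 by decide]

theorem cable_sandwich01 : cable c (sandwich 0 (by decide) (sq 1 (by decide))) =
    dbl N o (c.1 0) (c.1 1 + c.1 2) := by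
  rw [cable_sandwich, dbl_add_right, dbl]
  simp only [gen, perm_val, if_true, one_ne_zero, if_false, t00, t01, t02, t10, t11, t12]

theorem cable_sandwich21 : cable c (sandwich 2 (by decide) (sq 1 (by decide))) =
    dbl N (o + c.1 0) (c.1 1 + c.1 2) (c.1 3) := by
  rw [cable_sandwich, dbl_add_left, dbl]
  simp only [gen, perm_val, if_true, one_ne_zero, if_false, t10, t11, t12, t13, t20, t21, t22, t23,
    show (2 : ℕ) ≠ 0 by decide, show (2 : ℕ) ≠ 1 by decide]

end Values
end Cables

/-- Half of the exponent sum of the pure braid on the first two strands which underlies a pure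
braid on four strands. -/
def winding : PureBraid4 →* Multiplicative ℤ := by
  let e : Braid 2 →* Multiplicative ℤ := braidLift 2 (fun _ => Multiplicative.ofAdd 1)
    (fun _ _ => rfl) (fun _ _ _ _ => rfl)
  let c : Cables 0 2 := ⟨![1, 1, 0, 0], by decide⟩
  let sgn : Multiplicative ℤ →* ℤˣ := zpowersHom ℤˣ (-1)
  have h1 : sgn.comp e = Equiv.Perm.sign.comp (braidPerm 2) := by
    refine braid_hom_ext fun i hi => ?_
    obtain rfl : i = 0 := by omega
    rw [MonoidHom.comp_apply, MonoidHom.comp_apply, braidPerm_sigma hi, braidLift_sigma _ _ _ _ hi]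
    decide
  -- The exponent sum of a pure braid is even, since its parity is the sign of the permutation.
  have h2 : ∀ g, (2 : ℤ) ∣ Multiplicative.toAdd (e (Cables.cable c g)) := by
    intro g
    have h3 := DFunLike.congr_fun h1 (Cables.cable c g)
    rw [MonoidHom.comp_apply, MonoidHom.comp_apply,
      (MonoidHom.mem_ker).mp (Cables.cable_mem c g), map_one] at h3
    change (-1 : ℤˣ) ^ (Multiplicative.toAdd (e (Cables.cable c g))) = 1 at h3
    rw [← even_iff_two_dvd]
    by_contra hodd
    rw [Int.not_even_iff_odd] at hodd
    rw [hodd.neg_one_zpow] at h3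
    exact absurd h3 (by decide)
  exact
    { toFun := fun g => Multiplicative.ofAdd (Multiplicative.toAdd (e (Cables.cable c g)) / 2)
      map_one' := by rw [map_one, map_one]; rfl
      map_mul' := fun g h => by
        rw [map_mul, map_mul, toAdd_mul, Int.add_ediv_of_dvd_left (h2 g), ofAdd_add] }

theorem winding_eq (g : PureBraid4) : winding g = Multiplicative.ofAdd (Multiplicative.toAdd
    (braidLift 2 (fun _ => Multiplicative.ofAdd (1 : ℤ)) (fun _ _ => rfl) (fun _ _ _ _ => rfl)
      (Cables.cable (⟨![1, 1, 0, 0], by decide⟩ : Cables 0 2) g)) / 2) := rfl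

/-! ### Consequences of the defining equations -/

section IsGT
variable {T : Setting.{v}} (hT : T.IsNice) {G : Type} [Group G] {P : Subgroup G} [P.Normal]
open Setting.IsNice

include hT in
theorem map_free (φ : FreeGroup (Fin 2) →* G) (h : ∀ p ∈ (⊤ : Subgroup (FreeGroup (Fin 2))), φ p ∈ P)
    (f : T.Free2) : T.map ⊤ P φ h f =
      T.substT P f (T.of P (φ (FreeGroup.of 0))) (T.of P (φ (FreeGroup.of 1))) := by
  have h0 := proj_of_mem (T := T) (h (FreeGroup.of 0) trivial)
  have h1 := proj_of_mem (T := T) (h (FreeGroup.of 1) trivial)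
  exact hT.hom_eq_sub (hT.regHom_map φ h) h0 h1 (T.map_of _ _ _ _ _) (T.map_of _ _ _ _ _) f

include hT in
/-- The image of `∂ⱼ(f)` under a morphism. -/
theorem map_faceC (φ : PureBraid4 →* G) (h : ∀ p ∈ (⊤ : Subgroup PureBraid4), φ p ∈ P)
    (j : Fin 5) (f : T.Free2) : T.map ⊤ P φ h (faceC T j f) =
      T.substT P f (T.of P (φ (face j (FreeGroup.of 0)))) (T.of P (φ (face j (FreeGroup.of 1)))) := by
  have := hT.map_map (P := (⊤ : Subgroup (FreeGroup (Fin 2)))) (Q := (⊤ : Subgroup PureBraid4))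
    (R := P) (face j) (fun _ _ => trivial) φ h (φ.comp (face j)) (fun p _ => h _ trivial)
    (fun _ => rfl) f
  rw [faceC, this, map_free hT]; rfl

/-- The morphisms `∂ⱼ` on the generators, composed with a morphism `φ`. -/
theorem face_values (φ : PureBraid4 →* G) :
    φ (face 0 (FreeGroup.of 0)) = φ (sq 1 (by decide)) ∧
    φ (face 0 (FreeGroup.of 1)) = φ (sq 2 (by decide)) ∧
    φ (face 1 (FreeGroup.of 0)) = φ (sandwich 1 (by decide) (sq 0 (by decide))) ∧
    φ (face 1 (FreeGroup.of 1)) = φ (sq 2 (by decide)) ∧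
    φ (face 2 (FreeGroup.of 0)) = φ (sandwich 0 (by decide) (sq 1 (by decide))) ∧
    φ (face 2 (FreeGroup.of 1)) = φ (sandwich 2 (by decide) (sq 1 (by decide))) ∧
    φ (face 3 (FreeGroup.of 0)) = φ (sq 0 (by decide)) ∧
    φ (face 3 (FreeGroup.of 1)) = φ (sandwich 1 (by decide) (sq 2 (by decide))) ∧
    φ (face 4 (FreeGroup.of 0)) = φ (sq 0 (by decide)) ∧
    φ (face 4 (FreeGroup.of 1)) = φ (sq 1 (by decide)) := by
  simp [face]

variable {m : T.Scal} {f : T.Free2} (hf : IsGT T m f)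

include hT hf

namespace IsGT

theorem swap {x y : T.Obj G P} (hx : T.proj P x = 1) (hy : T.proj P y = 1) :
    T.substT P f y x = (T.substT P f x y)⁻¹ := by
  rw [← sub_inv hx hy, ← hf.symm, Setting.sub, hT.sub_sub hx hy, sub_X hx hy, sub_Y hx hy]

/-- The identity `f(x, 1) = 1`. The winding number of the first two strands is a morphism `P₄ → ℤ`.
With `t` the generator of `ℤ`, the induced morphism sends `∂₂(f)`, `∂₃(f)` and `∂₄(f)` to `f(t, 1)`,
and the other two factors of the pentagon to `1`, which leaves `f(t, 1) = 1`. -/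
theorem sub_one_right {x : T.Obj G P} (hx : T.proj P x = 1) : T.substT P f x 1 = 1 := by
  let c : Cables 0 2 := ⟨![1, 1, 0, 0], by decide⟩
  let t : Multiplicative ℤ := Multiplicative.ofAdd 1
  have h0 : winding (sq 0 (by decide)) = t := by
    rw [winding_eq, Cables.cable_sq0]
    change Multiplicative.ofAdd (Multiplicative.toAdd (braidLift 2 _ _ _ (dbl 2 0 1 1)) / 2) = _
    rw [dbl, bl_one_one, map_mul, braidLift_sigma _ _ _ _ (by decide)]
    rfl
  -- Half of an exponent sum is not given by a formula, hence the values of the winding number are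
  -- compared through the underlying braids on two strands.
  have hw1 : ∀ g, Cables.cable c g = 1 → winding g = 1 := fun g hg => by
    rw [winding_eq, show Cables.cable _ g = 1 from hg, map_one]; rfl
  have hw2 : ∀ g, Cables.cable c g = Cables.cable c (sq 0 (by decide)) → winding g = t :=
    fun g hg => by
      rw [← h0, winding_eq, winding_eq, show Cables.cable _ g = Cables.cable _ _ from hg]
  have htop : ∀ p ∈ (⊤ : Subgroup PureBraid4), winding p ∈ (⊤ : Subgroup (Multiplicative ℤ)) :=
    fun _ _ => Subgroup.mem_top _
  have hp := congrArg (T.map ⊤ (⊤ : Subgroup (Multiplicative ℤ)) winding htop) hf.pentagon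
  obtain ⟨a1, a2, a3, a4, a5, a6, a7, a8, a9, a10⟩ := face_values winding
  simp only [map_mul, map_faceC hT, a1, a2, a3, a4, a5, a6, a7, a8, a9, a10] at hp
  rw [h0, hw1 (sandwich 1 _ (sq 2 _)) (by rw [Cables.cable_sandwich12]; exact dbl_zero_right _ _),
    hw1 (sandwich 1 _ (sq 0 _)) (by rw [Cables.cable_sandwich10]; exact dbl_zero_right _ _),
    hw1 (sq 2 _) (by rw [Cables.cable_sq2]; exact dbl_zero_right _ _),
    hw1 (sq 1 _) (by rw [Cables.cable_sq1]; exact dbl_zero_right _ _),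
    hw2 (sandwich 0 _ (sq 1 _)) (by rw [Cables.cable_sandwich01, Cables.cable_sq0]; rfl),
    hw1 (sandwich 2 _ (sq 1 _)) (by rw [Cables.cable_sandwich21]; exact dbl_zero_right _ _),
    map_one, hT.sub_one_one, mul_one, one_mul] at hp
  have hu := left_eq_mul.mp hp
  let θ : Multiplicative ℤ →* T.Obj G P := zpowersHom _ x
  have hθ : ∀ p ∈ (⊤ : Subgroup (Multiplicative ℤ)), T.proj P (θ p) = 1 := fun p _ => by
    change T.proj P (x ^ (Multiplicative.toAdd p)) = 1
    rw [map_zpow, hx, one_zpow]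
  have e := congrArg (T.lift ⊤ P θ hθ) hu
  rw [hT.sub_hom (hT.regHom_lift θ hθ) (fun p hp => by rw [T.lift_of]; exact hθ p hp)
    (proj_top _) (map_one _), map_one, T.lift_of] at e
  have ht : θ t = x := zpow_one x
  rwa [ht] at e

theorem sub_one_left {x : T.Obj G P} (hx : T.proj P x = 1) : T.substT P f 1 x = 1 := by
  rw [swap hT hf hx (map_one _), sub_one_right hT hf hx, inv_one]

/-- `f(x, y) = 1` for commuting `x` and `y`. -/
theorem sub_of_commute {x y : T.Obj G P} (hx : T.proj P x = 1) (hy : T.proj P y = 1)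
    (h : Commute x y) : T.substT P f x y = 1 := by
  have := hT.sub_mul_mul hx (map_one _) (map_one _) hy (Commute.one_right _) h
    (Commute.one_left _) (Commute.one_left _) f
  rw [mul_one, one_mul] at this
  rw [this, sub_one_right hT hf hx, sub_one_left hT hf hy, one_mul]

/-- Central factors of the first argument do not matter, since `f` is trivial on commuting pairs. -/
theorem sub_mul_central {x y z : T.Obj G P} (hx : T.proj P x = 1) (hy : T.proj P y = 1)
    (hz : T.proj P z = 1) (h : Commute x z) (h' : Commute y z) :
    T.substT P f (x * z) y = T.substT P f x y := by
  have := hT.sub_mul_mul hx hy hz (map_one _) h (Commute.one_right _) h' (Commute.one_right _) f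
  rw [mul_one] at this
  rw [this, sub_one_right hT hf hz, mul_one]

theorem sub_mul_central_right {x y z : T.Obj G P} (hx : T.proj P x = 1) (hy : T.proj P y = 1)
    (hz : T.proj P z = 1) (h : Commute x z) (h' : Commute y z) :
    T.substT P f x (y * z) = T.substT P f x y := by
  rw [swap hT hf (proj_mul hy hz) hx, sub_mul_central hT hf hy hx hz h' h, swap hT hf hx hy,
    inv_inv]

/-- The hexagon equation for elements whose product is trivial. -/
theorem hexagon_of_mul {x y z : T.Obj G P} (hx : T.proj P x = 1) (hy : T.proj P y = 1)
    (h : x * y * z = 1) :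
    T.substT P f z x * T.powT P z m * T.substT P f y z * T.powT P y m * T.substT P f x y *
      T.powT P x m = 1 := by
  have hz' : T.substT P (genZ T) x y = z := by
    rw [genZ, sub_inv hx hy, sub_mul hx hy, sub_X hx hy, sub_Y hx hy]
    exact inv_eq_of_mul_eq_one_right h
  have e := congrArg (fun g => T.substT P g x y) hf.hexagon
  simp only [Setting.sub, Setting.exp, sub_mul hx hy, hT.sub_sub hx hy, hT.sub_pow hx hy,
    sub_X hx hy, sub_Y hx hy, hz', one_sub hx hy] at e
  exact e

end IsGT
end IsGT

/-! ### Completed braid groups -/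

/-- The completed braid group. -/
abbrev CBraid (T : Setting.{v}) (n : ℕ) : Type v := T.Obj (Braid n) (braidPerm n).ker

/-- The class of a braid in the completed braid group. -/
def cof (T : Setting.{v}) (n : ℕ) : Braid n →* CBraid T n := T.of (braidPerm n).ker

section Completed
variable {T : Setting.{v}} (hT : T.IsNice) {N : ℕ}
open Setting.IsNice

/-- The class of a double crossing of blocks. -/
def cdbl (T : Setting.{v}) (N o p q : ℕ) : CBraid T N := cof T N (dbl N o p q)

@[simp] theorem cdbl_zero_left (o q : ℕ) : cdbl T N o 0 q = 1 := by
  rw [cdbl, dbl_zero_left, map_one]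

@[simp] theorem cdbl_zero_right (o p : ℕ) : cdbl T N o p 0 = 1 := by
  rw [cdbl, dbl_zero_right, map_one]

theorem proj_cdbl {o p q : ℕ} (h : o + p + q ≤ N) : T.proj _ (cdbl T N o p q) = 1 :=
  proj_of_mem (dbl_mem h)

/-- The class of the associator `f(β_{YX} β_{XY} ⊗ id, id ⊗ β_{ZY} β_{YZ})`, where `X`, `Y`, `Z`
are consecutive blocks of `p`, `q`, `r` strands. -/
def assr (f : T.Free2) (N o p q r : ℕ) : CBraid T N :=
  T.substT _ f (cdbl T N o p q) (cdbl T N (o + p) q r)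

theorem proj_assr (f : T.Free2) (o p q r : ℕ) : T.proj _ (assr f N o p q r) = 1 :=
  T.proj_substT _ _ _ _

/-- Insertion of strands. -/
def cshift (T : Setting.{v}) (n k N : ℕ) (h : k + n ≤ N) : CBraid T n →* CBraid T N :=
  T.map (braidPerm n).ker (braidPerm N).ker (shift n k N h) (PaB.shift_mem h)

theorem cshift_cof {n k : ℕ} (h : k + n ≤ N) (g : Braid n) :
    cshift T n k N h (cof T n g) = cof T N (shift n k N h g) := T.map_of _ _ _ _ _

theorem cshift_cdbl {n k : ℕ} (h : k + n ≤ N) {o p q : ℕ} (hn : o + p + q ≤ n) :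
    cshift T n k N h (cdbl T n o p q) = cdbl T N (k + o) p q := by
  rw [cdbl, cshift_cof, shift_dbl h hn, cdbl]

theorem proj_cshift {n k : ℕ} (h : k + n ≤ N) {x : CBraid T n} (hx : T.proj _ x = 1) :
    T.proj _ (cshift T n k N h x) = 1 := by
  have := T.proj_map (braidPerm n).ker (braidPerm N).ker (shift n k N h) (PaB.shift_mem h) x 1
    (by rw [hx, map_one])
  rw [cshift, this, map_one, map_one]

include hT in
theorem cshift_pow {n k : ℕ} (h : k + n ≤ N) {x : CBraid T n} (hx : T.proj _ x = 1)
    (c : T.Scal) : cshift T n k N h (T.powT _ x c) = T.powT _ (cshift T n k N h x) c :=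
  hT.pow_map _ _ hx c

include hT in
theorem cshift_sub {n k : ℕ} (h : k + n ≤ N) {x y : CBraid T n} (hx : T.proj _ x = 1)
    (hy : T.proj _ y = 1) (f : T.Free2) : cshift T n k N h (T.substT _ f x y) =
      T.substT _ f (cshift T n k N h x) (cshift T n k N h y) :=
  hT.sub_map _ _ hx hy f

include hT in
theorem cshift_assr {n k : ℕ} (h : k + n ≤ N) (f : T.Free2) {o p q r : ℕ}
    (hn : o + p + q + r ≤ n) :
    cshift T n k N h (assr f n o p q r) = assr f N (k + o) p q r := by
  rw [assr, cshift_sub hT _ (proj_cdbl (by omega)) (proj_cdbl (by omega)), cshift_cdbl _ (by omega),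
    cshift_cdbl _ (by omega), assr, add_assoc]

include hT in
/-- Slide relations for uncompleted braids extend to the completion. -/
theorem cshift_intertwine {n k l : ℕ} (hk : k + n ≤ N) (hl : l + n ≤ N) (u : CBraid T N)
    (h : ∀ g : Braid n, u * cof T N (shift n k N hk g) = cof T N (shift n l N hl g) * u)
    (x : CBraid T n) : u * cshift T n k N hk x = cshift T n l N hl x * u := by
  have := DFunLike.congr_fun (hT.hom_ext (hT.regHom_conj (hT.regHom_map (shift n k N hk)
    (PaB.shift_mem hk)) u) (hT.regHom_map (shift n l N hl) (PaB.shift_mem hl)) (fun g => by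
      rw [MonoidHom.comp_apply, T.map_of, T.map_of]
      change u * cof T N _ * u⁻¹ = cof T N _
      rw [h, mul_inv_cancel_right])) x
  change u * cshift T n k N hk x * u⁻¹ = cshift T n l N hl x at this
  rw [← this, inv_mul_cancel_right]

include hT in
theorem cdbl_cshift {o p q n k : ℕ} (h : (o ≤ k ∧ k + n ≤ o + p) ∨
    (o + p ≤ k ∧ k + n ≤ o + p + q) ∨ k + n ≤ o ∨ o + p + q ≤ k) (hN : o + p + q ≤ N)
    (hn : k + n ≤ N) (x : CBraid T n) : Commute (cdbl T N o p q) (cshift T n k N hn x) := by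
  refine cshift_intertwine hT hn hn _ (fun g => ?_) x
  rw [cdbl, ← map_mul, ← map_mul]
  congr 1
  rcases h with ⟨h, h'⟩ | ⟨h, h'⟩ | h | h
  · exact (dbl_shift_left h (by omega) hN _).eq
  · exact (dbl_shift_right h (by omega) hN _).eq
  · exact (dbl_shift_of_le (Or.inl (by omega)) hN _ _).eq
  · exact (dbl_shift_of_le (Or.inr h) hN _ _).eq

include hT in
theorem cshift_commute {n k n' k' : ℕ} (h : k + n ≤ N) (h' : k' + n' ≤ N) (hd : k + n ≤ k')
    (x : CBraid T n) (y : CBraid T n') :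
    Commute (cshift T n k N h x) (cshift T n' k' N h' y) := by
  refine cshift_intertwine hT h' h' _ (fun g => ?_) y
  refine (cshift_intertwine hT h h _ (fun g' => ?_) x).symm
  rw [← map_mul, ← map_mul, (commute_shift h h' hd g' g).eq]

include hT in
/-- An associator commutes with the braids inside one of its three blocks or outside of them. -/
theorem assr_cshift (f : T.Free2) {o p q r n k : ℕ} (h : (o ≤ k ∧ k + n ≤ o + p) ∨
    (o + p ≤ k ∧ k + n ≤ o + p + q) ∨ (o + p + q ≤ k ∧ k + n ≤ o + p + q + r) ∨ k + n ≤ o ∨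
    o + p + q + r ≤ k) (hN : o + p + q + r ≤ N)
    (hn : k + n ≤ N) (x : CBraid T n) : Commute (assr f N o p q r) (cshift T n k N hn x) :=
  (hT.commute_sub (proj_cdbl (by omega)) (proj_cdbl (by omega))
    (cdbl_cshift hT (by omega) (by omega) hn x).symm
    (cdbl_cshift hT (by omega) (by omega) hn x).symm f).symm

theorem cof_bl_eq_cshift {o p q : ℕ} (h : o + p + q ≤ N) : cof T N (bl N o p q) =
    cshift T (p + q) o N (by omega) (cof T (p + q) (bl (p + q) 0 p q)) := by
  rw [cshift_cof, shift_bl _ (by omega), add_zero]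

theorem cdbl_eq_cshift {o p q : ℕ} (h : o + p + q ≤ N) : cdbl T N o p q =
    cshift T (p + q) o N (by omega) (cdbl T (p + q) 0 p q) := by
  rw [cshift_cdbl _ (by omega), add_zero]

variable {m : T.Scal} {f : T.Free2} (hf : IsGT T m f)

include hT hf in
/-- The pentagon equation for blocks of strands. -/
theorem assr_pentagon {o p q r s : ℕ} (hN : o + p + q + r + s ≤ N) :
    assr f N (o + p) q r s * assr f N o p (q + r) s * assr f N o p q r =
      assr f N o p q (r + s) * assr f N o (p + q) r s := by
  let c : Cables o N := ⟨![p, q, r, s], by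
    rw [Fin.sum_univ_four]; change o + (p + q + r + s) ≤ N; omega⟩
  have hp := congrArg (T.map ⊤ (braidPerm N).ker c.cable (fun g _ => c.cable_mem g)) hf.pentagon
  obtain ⟨a1, a2, a3, a4, a5, a6, a7, a8, a9, a10⟩ := face_values c.cable
  simp only [map_mul, map_faceC hT, a1, a2, a3, a4, a5, a6, a7, a8, a9, a10, c.cable_sq0,
    c.cable_sq1, c.cable_sq2, c.cable_sandwich10, c.cable_sandwich01, c.cable_sandwich12,
    c.cable_sandwich21] at hp
  have e := hp.symm
  unfold assr
  simp only [← add_assoc]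
  exact e

include hT hf in
theorem assr_zero_left (o q r : ℕ) (hN : o + q + r ≤ N) : assr f N o 0 q r = 1 := by
  rw [assr, cdbl_zero_left, IsGT.sub_one_left hT hf (proj_cdbl (by omega))]

include hT in
theorem assr_zero_mid (o p r : ℕ) : assr f N o p 0 r = 1 := by
  rw [assr, cdbl_zero_left, cdbl_zero_right, hT.sub_one_one]

include hT hf in
theorem assr_zero_right (o p q : ℕ) (hN : o + p + q ≤ N) : assr f N o p q 0 = 1 := by
  rw [assr, cdbl_zero_right, IsGT.sub_one_right hT hf (proj_cdbl (by omega))]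

/-! ### Twisted crossings -/

/-- The twisted crossing `β (β β)^m` of blocks of strands. -/
def cbl (m : T.Scal) (N o p q : ℕ) : CBraid T N :=
  cof T N (bl N o p q) * T.powT _ (cdbl T N o p q) m

include hT in
theorem cshift_cbl {n k : ℕ} (h : k + n ≤ N) {o p q : ℕ} (hn : o + p + q ≤ n) :
    cshift T n k N h (cbl m n o p q) = cbl m N (k + o) p q := by
  rw [cbl, map_mul, cshift_cof, shift_bl h hn, cshift_pow hT _ (proj_cdbl hn), cshift_cdbl h hn,
    cbl]

include hT in
theorem cbl_eq_cshift {o p q : ℕ} (h : o + p + q ≤ N) : cbl m N o p q =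
    cshift T (p + q) o N (by omega) (cbl m (p + q) 0 p q) := by
  rw [cshift_cbl hT _ (by omega), add_zero]

include hT in
/-- Braids inside the first block slide through a twisted crossing. -/
theorem cbl_cshift_left {o p q n k : ℕ} (hk : o ≤ k) (hn : k + n ≤ o + p) (hN : o + p + q ≤ N)
    (x : CBraid T n) : cbl m N o p q * cshift T n k N (by omega) x =
      cshift T n (k + q) N (by omega) x * cbl m N o p q := by
  have h1 := hT.commute_pow (proj_cdbl hN) (cdbl_cshift hT (Or.inl ⟨hk, hn⟩) hN (by omega) x).symm m
  have h2 : cof T N (bl N o p q) * cshift T n k N (by omega) x =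
      cshift T n (k + q) N (by omega) x * cof T N (bl N o p q) :=
    cshift_intertwine hT _ _ _ (fun g => by
      rw [← map_mul, ← map_mul, bl_shift_left hk hn hN]) x
  rw [cbl, mul_assoc, ← h1.eq, ← mul_assoc, h2, mul_assoc]

include hT in
/-- Braids inside the second block slide through a twisted crossing. -/
theorem cbl_cshift_right {o p q n k : ℕ} (hk : o ≤ k) (hn : k + n ≤ o + q) (hN : o + p + q ≤ N)
    (x : CBraid T n) : cbl m N o p q * cshift T n (k + p) N (by omega) x =
      cshift T n k N (by omega) x * cbl m N o p q := by
  have h1 := hT.commute_pow (proj_cdbl hN)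
    (cdbl_cshift hT (Or.inr (Or.inl ⟨by omega, by omega⟩)) hN (by omega) x :
      Commute _ (cshift T n (k + p) N (by omega) x)).symm m
  have h2 : cof T N (bl N o p q) * cshift T n (k + p) N (by omega) x =
      cshift T n k N (by omega) x * cof T N (bl N o p q) :=
    cshift_intertwine hT _ _ _ (fun g => by
      rw [← map_mul, ← map_mul, bl_shift_right hk hn hN]) x
  rw [cbl, mul_assoc, ← h1.eq, ← mul_assoc, h2, mul_assoc]

include hT hf in
/-- The hexagon equation for blocks of strands, for the crossing of a block with the union of two
blocks. It is the hexagon of `f` at `(Y, X, V z⁻¹)`, where `X` and `Y` are the two double crossings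
of adjacent blocks, `V` is the conjugate of the third one and `z = Y X V` is central. -/
theorem cbl_add_right {o p q r : ℕ} (hN : o + p + q + r ≤ N) :
    cbl m N o p (q + r) = (assr f N o q r p)⁻¹ * cbl m N (o + q) p r * assr f N o q p r *
      cbl m N o p q * (assr f N o p q r)⁻¹ := by
  set X := cdbl T N o p q with hX
  set Y := cdbl T N (o + p) q r with hY
  set b := cof T N (bl N o p q) with hb
  set b' := cof T N (bl N (o + q) p r) with hb'
  set D := cdbl T N (o + q) p r with hD
  set V := b⁻¹ * D * b with hV
  set z := Y * X * V with hz
  have pX : T.proj _ X = 1 := proj_cdbl (by omega)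
  have pY : T.proj _ Y = 1 := proj_cdbl (by omega)
  have pD : T.proj _ D = 1 := proj_cdbl (by omega)
  have pV : T.proj _ V = 1 := by
    rw [hV]; simpa using proj_conj pD b⁻¹
  have pz : T.proj _ z = 1 := proj_mul (proj_mul pY pX) pV
  have hW : cdbl T N o p (q + r) = X * V := by
    have e : dbl N o p q = bl N o q p * bl N o p q := rfl
    rw [hX, hV, hD, cdbl, cdbl, cdbl, dbl_add_right, e, map_mul, map_mul, map_mul, ← hb]
    group
  have hz1 : z = Y * cdbl T N o p (q + r) := by rw [hW, hz, mul_assoc]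
  have hz2 : z = X * cdbl T N o (p + q) r := by
    rw [hz1, hX, hY, cdbl, cdbl, ← map_mul, dbl_mul_dbl (by omega), map_mul]; rfl
  have cYW : Commute Y (cdbl T N o p (q + r)) := by
    rw [hY, cdbl_eq_cshift (o := o + p) (by omega)]
    exact (cdbl_cshift hT (by omega) (by omega) _ _).symm
  have cYz : Commute Y z := by
    rw [hz1]; exact (Commute.refl Y).mul_right cYW
  have cXz : Commute X z := by
    rw [hz2]
    refine (Commute.refl X).mul_right ?_
    rw [hX, cdbl_eq_cshift (o := o) (q := q) (by omega)]
    exact (cdbl_cshift hT (by omega) (by omega) _ _).symm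
  have cVz : Commute V z := by
    have : V = (Y * X)⁻¹ * z := by rw [hz]; group
    rw [this]
    exact ((cYz.mul_left cXz).inv_left).mul_left (Commute.refl z)
  have pzi := proj_inv pz
  have hprod : Y * X * (V * z⁻¹) = 1 := by rw [← mul_assoc, ← hz, mul_inv_cancel]
  have hex := IsGT.hexagon_of_mul hT hf pY pX hprod
  rw [IsGT.sub_mul_central hT hf pV pY pzi cVz.inv_right cYz.inv_right,
    IsGT.sub_mul_central_right hT hf pX pV pzi cXz.inv_right cVz.inv_right,
    hT.mul_pow _ _ _ pV pzi cVz.inv_right, hT.inv_pow pz] at hex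
  -- the power of the central element
  have hWz : z = cdbl T N o p (q + r) * Y := by rw [hz1]; exact cYW.eq
  have hzm : T.powT _ z m = T.powT _ (cdbl T N o p (q + r)) m * T.powT _ Y m := by
    rw [hWz, hT.mul_pow _ _ _ (proj_cdbl (by omega)) pY cYW.symm]
  have cz : ∀ w, T.proj _ w = 1 → Commute w z → Commute (T.powT _ w m) (T.powT _ z m) :=
    fun w hw h => hT.commute_pow pz (hT.commute_pow hw h.symm m).symm m
  have czX : ∀ a c, T.proj _ a = 1 → T.proj _ c = 1 → Commute a z → Commute c z →
      Commute (T.substT _ f a c) (T.powT _ z m) := fun a c ha hc h1 h2 =>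
    hT.commute_pow pz (hT.commute_sub ha hc h1.symm h2.symm f).symm m
  have hWm : T.powT _ (cdbl T N o p (q + r)) m = T.substT _ f V Y * T.powT _ V m *
      T.substT _ f X V * T.powT _ X m * T.substT _ f Y X := by
    have k1 : T.powT _ z m = T.substT _ f V Y * T.powT _ V m *
        T.substT _ f X V * T.powT _ X m * T.substT _ f Y X * T.powT _ Y m := by
      have c1 := czX X V pX pV cXz cVz
      have c2 := cz X pX cXz
      have c3 := czX Y X pY pX cYz cXz
      have c4 := cz Y pY cYz
      have c5 : Commute (T.substT _ f X V * T.powT _ X m * T.substT _ f Y X * T.powT _ Y m)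
          (T.powT _ z m)⁻¹ := (((c1.mul_left c2).mul_left c3).mul_left c4).inv_right
      have e2 : T.substT _ f V Y * (T.powT _ V m * (T.powT _ z m)⁻¹) * T.substT _ f X V *
          T.powT _ X m * T.substT _ f Y X * T.powT _ Y m = T.substT _ f V Y * T.powT _ V m *
          (T.substT _ f X V * T.powT _ X m * T.substT _ f Y X * T.powT _ Y m) *
            (T.powT _ z m)⁻¹ := by
        rw [mul_assoc _ _ (T.powT _ z m)⁻¹, c5.eq]; simp only [mul_assoc]
      rw [e2, mul_inv_eq_one] at hex
      rw [← hex]; simp only [mul_assoc]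
    rw [hzm] at k1
    exact mul_right_cancel k1
  have hB : cof T N (bl N o p (q + r)) = b' * b := by rw [bl_add_right, map_mul]
  have i1 : (b' * b) * Y = cdbl T N o q r * (b' * b) := by
    rw [← hB, hY, cdbl, cdbl, ← map_mul, ← map_mul, bl_dbl_right le_rfl (by omega) (by omega)]
  have i2 : (b' * b) * V = cdbl T N (o + q) r p * (b' * b) := by
    have : b' * D = cdbl T N (o + q) r p * b' := by
      rw [hb', hD, cdbl, cdbl, ← map_mul, ← map_mul, bl_dbl]
    rw [hV, show b' * b * (b⁻¹ * D * b) = b' * D * b by group, this, mul_assoc]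
  have j1 : b * X = cdbl T N o q p * b := by
    rw [hb, hX, cdbl, cdbl, ← map_mul, ← map_mul, bl_dbl]
  have j2 : b * V = D * b := by rw [hV]; group
  have k1 := hT.sub_intertwine pY pV i1 i2 f
  have k2 := hT.pow_intertwine pV j2 m
  have k3 := hT.sub_intertwine pX pV j1 j2 f
  have e1 : assr f N o q r p = T.substT _ f (cdbl T N o q r) (cdbl T N (o + q) r p) := rfl
  have e2 : assr f N o q p r = T.substT _ f (cdbl T N o q p) D := rfl
  have e3 : assr f N o p q r = T.substT _ f X Y := rfl
  rw [← e1] at k1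
  rw [← e2] at k3
  have k1' : (b' * b) * (T.substT _ f Y V)⁻¹ = (assr f N o q r p)⁻¹ * (b' * b) := by
    rw [mul_inv_eq_iff_eq_mul, mul_assoc, k1, inv_mul_cancel_left]
  calc cbl m N o p (q + r) = (b' * b) * (T.substT _ f Y V)⁻¹ * T.powT _ V m * T.substT _ f X V *
        T.powT _ X m * (T.substT _ f X Y)⁻¹ := by
        rw [cbl, hWm, hB, IsGT.swap hT hf pY pV, IsGT.swap hT hf pX pY]
        simp only [mul_assoc]
    _ = (assr f N o q r p)⁻¹ * b' * (b * T.powT _ V m) * T.substT _ f X V *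
        T.powT _ X m * (T.substT _ f X Y)⁻¹ := by rw [k1']; simp only [mul_assoc]
    _ = (assr f N o q r p)⁻¹ * b' * T.powT _ D m * (b * T.substT _ f X V) *
        T.powT _ X m * (T.substT _ f X Y)⁻¹ := by rw [k2]; simp only [mul_assoc]
    _ = _ := by rw [k3, e3, cbl, cbl, ← hX, ← hD]; simp only [mul_assoc]; rfl

end Completed

section Coherence
variable {T : Setting.{v}} (hT : T.IsNice) {N : ℕ} {m : T.Scal} {f : T.Free2}
  (hf : IsGT T m f)
open Setting.IsNice

/-! ### The mirror image in the completed braid groups -/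

/-- The involution of the completed braid group. -/
def cstar (T : Setting.{v}) (N : ℕ) : CBraid T N →* CBraid T N :=
  T.map (braidPerm N).ker (braidPerm N).ker (braidStar N) (PaB.star_mem N)

theorem cstar_cof (g : Braid N) : cstar T N (cof T N g) = cof T N (braidStar N g) :=
  T.map_of _ _ _ _ _

theorem cstar_cdbl {o p q : ℕ} (h : o + p + q ≤ N) :
    cstar T N (cdbl T N o p q) = cdbl T N (N - o - p - q) q p := by
  rw [cdbl, cstar_cof, star_dbl h, cdbl]

include hT in
theorem cstar_cbl {o p q : ℕ} (h : o + p + q ≤ N) :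
    cstar T N (cbl m N o p q) = cbl m N (N - o - p - q) q p := by
  rw [cbl, map_mul, cstar_cof, star_bl h, cstar, hT.pow_map _ _ (proj_cdbl h), ← cstar,
    cstar_cdbl h, cbl]

include hT hf in
theorem cstar_assr {o p q r : ℕ} (h : o + p + q + r ≤ N) :
    cstar T N (assr f N o p q r) = (assr f N (N - o - p - q - r) r q p)⁻¹ := by
  rw [assr, cstar, hT.sub_map _ _ (proj_cdbl (by omega)) (proj_cdbl (by omega)), ← cstar,
    cstar_cdbl (by omega), cstar_cdbl (by omega),
    IsGT.swap hT hf (proj_cdbl (by omega)) (proj_cdbl (by omega)), assr]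
  congr 3 <;> omega

include hT in
theorem cstar_cshift {n k : ℕ} (h : k + n ≤ N) (x : CBraid T n) : cstar T N (cshift T n k N h x) =
    cshift T n (N - k - n) N (by omega) (cstar T n x) := by
  rw [cstar, cshift, hT.map_map _ _ _ _ ((braidStar N).comp (shift n k N h))
    (fun p hp => PaB.star_mem N _ (PaB.shift_mem h _ hp)) (fun _ => rfl), cstar, cshift,
    hT.map_map _ _ _ _ ((braidStar N).comp (shift n k N h))
    (fun p hp => PaB.star_mem N _ (PaB.shift_mem h _ hp)) (fun g => (star_shift h g).symm)]

include hT hf in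
/-- The mirror image of the first hexagon equation. -/
theorem cbl_add_left {o p q r : ℕ} (hN : o + p + q + r ≤ N) :
    cbl m N o (p + q) r = assr f N o r p q * cbl m N o p r * (assr f N o p r q)⁻¹ *
      cbl m N (o + p) q r * assr f N o p q r := by
  obtain ⟨l, rfl⟩ : ∃ l, N = o + p + q + r + l := ⟨N - (o + p + q + r), by omega⟩
  have h := congrArg (cstar T _) (cbl_add_right hT hf (N := o + p + q + r + l) (o := l) (p := r)
    (q := q) (r := p) (by omega))
  simp (disch := omega) only [map_mul, map_inv, cstar_cbl hT, cstar_assr hT hf, inv_inv] at h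
  rw [show o + p + q + r + l - l - r - (q + p) = o by omega, add_comm q p,
    show o + p + q + r + l - l - q - p - r = o by omega,
    show o + p + q + r + l - (l + q) - r - p = o by omega,
    show o + p + q + r + l - l - q - r - p = o by omega,
    show o + p + q + r + l - l - r - q = o + p by omega,
    show o + p - p = o by omega] at h
  exact h

/-! ### Coherence -/

/-- The associator from the left-normed parenthesization of `p + q` strands to the product of the
left-normed parenthesizations of `p` and of `q` strands. -/
def acat (f : T.Free2) (N o p : ℕ) : ℕ → CBraid T N
  | 0 => 1
  | q + 1 => assr f N o p q 1 * acat f N o p q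

theorem proj_acat (o p q : ℕ) : T.proj _ (acat f N o p q) = 1 := by
  induction q with
  | zero => exact map_one _
  | succ q ih => exact proj_mul (proj_assr _ _ _ _ _) ih

include hT in
theorem acat_one (o p : ℕ) : acat f N o p 1 = 1 := by
  rw [acat, acat, assr_zero_mid hT, one_mul]

include hT hf in
theorem acat_zero_left {o q : ℕ} (h : o + q ≤ N) : acat f N o 0 q = 1 := by
  induction q with
  | zero => rfl
  | succ q ih => rw [acat, ih (by omega), assr_zero_left hT hf _ _ _ (by omega), one_mul]

include hT in
theorem cshift_acat {n k : ℕ} (h : k + n ≤ N) {o p q : ℕ} (hn : o + p + q ≤ n) :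
    cshift T n k N h (acat f n o p q) = acat f N (k + o) p q := by
  induction q with
  | zero => exact map_one _
  | succ q ih => rw [acat, map_mul, cshift_assr hT h f (by omega), ih (by omega), acat]

include hT in
theorem acat_eq_cshift {o p q : ℕ} (h : o + p + q ≤ N) : acat f N o p q =
    cshift T (p + q) o N (by omega) (acat f (p + q) 0 p q) := by
  rw [cshift_acat hT _ (by omega), add_zero]

include hT in
theorem acat_cshift {o p q n k : ℕ} (h : (o ≤ k ∧ k + n ≤ o + p) ∨ k + n ≤ o ∨ o + p + q ≤ k)
    (hN : o + p + q ≤ N) (hn : k + n ≤ N) (x : CBraid T n) :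
    Commute (acat f N o p q) (cshift T n k N hn x) := by
  induction q with
  | zero => exact Commute.one_left _
  | succ q ih =>
    exact (assr_cshift hT f (by omega) (by omega) hn x).mul_left (ih (by omega) (by omega))

include hT hf in
/-- The comparison of the two ways to pass from the left-normed parenthesization of `p + q + r`
strands to the product of those of `p`, `q` and `r` strands. -/
theorem acat_coherence {o p q r : ℕ} (hN : o + p + q + r ≤ N) :
    acat f N (o + p) q r * acat f N o p (q + r) =
      assr f N o p q r * acat f N o p q * acat f N o (p + q) r := by
  induction r with
  | zero => rw [add_zero, acat, acat, one_mul, mul_one, assr_zero_right hT hf _ _ _ (by omega),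
      one_mul]
  | succ r ih =>
    have c1 : Commute (acat f N (o + p) q r) (assr f N o p (q + r) 1) := by
      rw [acat_eq_cshift hT (by omega)]
      exact (assr_cshift hT f (by omega) (by omega) _ _).symm
    have c2 : Commute (acat f N o p q) (assr f N o (p + q) r 1) := by
      rw [acat_eq_cshift hT (by omega)]
      exact (assr_cshift hT f (by omega) (by omega) _ _).symm
    rw [← add_assoc, acat, acat, acat]
    calc _ = assr f N (o + p) q r 1 * (acat f N (o + p) q r * assr f N o p (q + r) 1) *
          acat f N o p (q + r) := by simp only [mul_assoc]
      _ = assr f N (o + p) q r 1 * assr f N o p (q + r) 1 *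
          (acat f N (o + p) q r * acat f N o p (q + r)) := by
          rw [c1.eq]; simp only [mul_assoc]
      _ = (assr f N (o + p) q r 1 * assr f N o p (q + r) 1 * assr f N o p q r) *
          (acat f N o p q * acat f N o (p + q) r) := by
          rw [ih (by omega)]; simp only [mul_assoc]
      _ = assr f N o p q (r + 1) * (assr f N o (p + q) r 1 * acat f N o p q) *
          acat f N o (p + q) r := by
          rw [assr_pentagon hT hf (by omega)]; simp only [mul_assoc]
      _ = _ := by rw [← c2.eq]; simp only [mul_assoc]

/-! ### The action on the braid groups -/

/-- The image of a generator under the action, in the left-normed parenthesization. -/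
def agen (m : T.Scal) (f : T.Free2) (N o i : ℕ) : CBraid T N :=
  (assr f N o i 1 1)⁻¹ * cbl m N (o + i) 1 1 * assr f N o i 1 1

include hT in
theorem cshift_agen {n k : ℕ} (h : k + n ≤ N) {o i : ℕ} (hn : o + i + 2 ≤ n) :
    cshift T n k N h (agen m f n o i) = agen m f N (k + o) i := by
  rw [agen, map_mul, map_mul, map_inv, cshift_assr hT h f (by omega), cshift_cbl hT h (by omega),
    agen, add_assoc]

include hT hf in
theorem agen_zero {o : ℕ} (h : o + 2 ≤ N) : agen m f N o 0 = cbl m N o 1 1 := by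
  rw [agen, assr_zero_left hT hf _ _ _ (by omega), inv_one, one_mul, mul_one, add_zero]

include hT in
theorem agen_eq_cshift {o i n : ℕ} (hi : i + 2 ≤ n) (h : o + n ≤ N) : agen m f N o i =
    cshift T n o N h (agen m f n 0 i) := by
  rw [cshift_agen hT _ (by omega), add_zero]

include hT in
theorem agen_cshift {o i n k : ℕ} (h : (o ≤ k ∧ k + n ≤ o + i) ∨ k + n ≤ o ∨ o + i + 2 ≤ k)
    (hN : o + i + 2 ≤ N) (hn : k + n ≤ N) (x : CBraid T n) :
    Commute (agen m f N o i) (cshift T n k N hn x) := by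
  have h1 := assr_cshift hT f (o := o) (p := i) (q := 1) (r := 1) (n := n) (k := k) (by omega)
    (by omega) hn x
  have h2 : Commute (cbl m N (o + i) 1 1) (cshift T n k N hn x) := by
    rw [cbl_eq_cshift hT (by omega)]
    by_cases hk : k + n ≤ o + i
    · exact (cshift_commute hT _ _ hk _ _).symm
    · exact cshift_commute hT _ _ (by omega) _ _
  exact (h1.inv_left.mul_left h2).mul_left h1

include hT hf in
/-- The associator carries the action on the last `q` strands of the left-normed parenthesization
to the action on the left-normed parenthesization of these strands. -/
theorem acat_agen {o p q j : ℕ} (hj : j + 1 < q) (hN : o + p + q ≤ N) :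
    acat f N o p q * agen m f N o (p + j) = agen m f N (o + p) j * acat f N o p q := by
  induction q with
  | zero => omega
  | succ q ih =>
    by_cases h : j + 1 < q
    · have c : Commute (assr f N o p q 1) (agen m f N (o + p) j) := by
        rw [agen_eq_cshift hT (n := q) (by omega) (by omega)]
        exact assr_cshift hT f (by omega) (by omega) _ _
      rw [acat, mul_assoc, ih h (by omega), ← mul_assoc, c.eq, mul_assoc]
    · obtain rfl : q = j + 1 := by omega
      have pent := assr_pentagon hT hf (N := N) (o := o) (p := p) (q := j) (r := 1) (s := 1)
        (by omega)
      have c1 : Commute (acat f N o p j) (agen m f N o (p + j)) := by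
        rw [acat_eq_cshift hT (by omega)]
        exact (agen_cshift hT (by omega) (by omega) _ _).symm
      have c2 : Commute (assr f N o p j (1 + 1)) (cbl m N (o + p + j) 1 1) := by
        rw [cbl_eq_cshift hT (by omega)]
        exact assr_cshift hT f (by omega) (by omega) _ _
      have hB : assr f N o p (j + 1) 1 * assr f N o p j 1 = (assr f N (o + p) j 1 1)⁻¹ *
          assr f N o p j (1 + 1) * assr f N o (p + j) 1 1 := by
        rw [mul_assoc, ← pent]; group
      rw [acat, acat]
      calc _ = assr f N o p (j + 1) 1 * assr f N o p j 1 *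
            (acat f N o p j * agen m f N o (p + j)) := by simp only [mul_assoc]
        _ = (assr f N o p (j + 1) 1 * assr f N o p j 1) * agen m f N o (p + j) *
            acat f N o p j := by rw [c1.eq]; simp only [mul_assoc]
        _ = (assr f N (o + p) j 1 1)⁻¹ * (assr f N o p j (1 + 1) * cbl m N (o + p + j) 1 1) *
            assr f N o (p + j) 1 1 * acat f N o p j := by
            rw [hB, agen, ← add_assoc o p j]; group
        _ = agen m f N (o + p) j * (assr f N o p (j + 1) 1 * assr f N o p j 1) *
            acat f N o p j := by
            rw [c2.eq, hB, agen]; group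
        _ = _ := by simp only [mul_assoc]

include hT hf in
/-- The braid relation for the first three strands: the hexagon expresses both sides as the
composite of the crossing of a strand with two strands and of the crossing of these two. -/
theorem agen_braid_zero {o : ℕ} (hN : o + 3 ≤ N) :
    agen m f N o 0 * agen m f N o 1 * agen m f N o 0 =
      agen m f N o 1 * agen m f N o 0 * agen m f N o 1 := by
  have hex := cbl_add_right hT hf (N := N) (o := o) (p := 1) (q := 1) (r := 1) (by omega)
  have hs := cbl_cshift_right hT (m := m) (N := N) (o := o) (p := 1) (q := 1 + 1) (n := 2) (k := o)
    le_rfl (by omega) (by omega) (cbl m 2 0 1 1)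
  rw [cshift_cbl hT _ (by omega), cshift_cbl hT _ (by omega), add_zero, add_zero] at hs
  rw [agen_zero hT hf (by omega), agen]
  calc _ = cbl m N o 1 1 * ((assr f N o 1 1 1)⁻¹ * cbl m N (o + 1) 1 1 * assr f N o 1 1 1 *
        cbl m N o 1 1 * (assr f N o 1 1 1)⁻¹) * assr f N o 1 1 1 := by group
    _ = (cbl m N o 1 (1 + 1) * cbl m N (o + 1) 1 1) * assr f N o 1 1 1 := by rw [← hex, hs]
    _ = _ := by rw [hex]; group

include hT hf in
/-- The braid relation in general position follows from the one for the first three strands,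
transported by an associator. -/
theorem agen_braid {i : ℕ} (hi : i + 2 < N) :
    agen m f N 0 i * agen m f N 0 (i + 1) * agen m f N 0 i =
      agen m f N 0 (i + 1) * agen m f N 0 i * agen m f N 0 (i + 1) := by
  have h0 := acat_agen hT hf (N := N) (o := 0) (p := i) (q := 3) (j := 0) (by omega) (by omega)
  have h1 := acat_agen hT hf (N := N) (o := 0) (p := i) (q := 3) (j := 1) (by omega) (by omega)
  have hb := agen_braid_zero hT hf (N := N) (o := 0 + i) (by omega)
  rw [add_zero] at h0
  rw [← mul_right_inj (acat f N 0 i 3)]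
  simp only [← mul_assoc, h0, h1]
  simp only [mul_assoc, h0, h1]
  simp only [← mul_assoc]
  rw [hb]

include hT in
theorem agen_comm {i j : ℕ} (hij : i + 2 ≤ j) (hj : j + 1 < N) :
    agen m f N 0 i * agen m f N 0 j = agen m f N 0 j * agen m f N 0 i := by
  rw [agen_eq_cshift hT (i := i) (n := j) (by omega) (by omega)]
  exact (agen_cshift hT (by omega) (by omega) _ _).eq.symm

/-- The action of `(λ, f)` on the braid group, in the left-normed parenthesization. -/
def actB (n : ℕ) : Braid n →* CBraid T n :=
  braidLift n (agen m f n 0) (fun _ hi => agen_braid hT hf hi)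
    (fun _ _ hij hj => agen_comm hT hij hj)

theorem actB_sigma {n i : ℕ} (hi : i + 1 < n) : actB hT hf n (sigma n i) = agen m f n 0 i :=
  braidLift_sigma _ _ _ _ hi

theorem proj_cbl (o p q : ℕ) :
    T.proj _ (cbl m N o p q) = QuotientGroup.mk' _ (bl N o p q) := by
  rw [cbl, map_mul, T.proj_powT, mul_one]
  exact T.proj_of _ _

theorem proj_actB {n : ℕ} (g : Braid n) : T.proj _ (actB hT hf n g) = QuotientGroup.mk' _ g :=
  DFunLike.congr_fun (f := (T.proj _).comp (actB hT hf n)) (braid_hom_ext fun i hi => by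
    rw [MonoidHom.comp_apply, actB_sigma hT hf hi, agen, map_mul, map_mul, map_inv, proj_assr,
      inv_one, one_mul, mul_one, zero_add, proj_cbl, bl_one_one]) g

theorem actB_kills (n : ℕ) : ∀ p ∈ (braidPerm n).ker, T.proj _ (actB hT hf n p) = 1 := fun p hp => by
  rw [proj_actB]; exact (QuotientGroup.eq_one_iff p).mpr hp

/-- The action of `(λ, f)` on the completed braid group, in the left-normed parenthesization. -/
def actC (n : ℕ) : CBraid T n →* CBraid T n :=
  T.lift _ _ (actB hT hf n) (actB_kills hT hf n)

theorem actC_cof {n : ℕ} (g : Braid n) : actC hT hf n (cof T n g) = actB hT hf n g :=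
  T.lift_of _ _ _ _ _

theorem regHom_actC (n : ℕ) : T.RegHom _ _ (actC hT hf n) := hT.regHom_lift _ _

theorem proj_actC {n : ℕ} (x : CBraid T n) : T.proj _ (actC hT hf n x) = T.proj _ x := by
  obtain ⟨g, hg⟩ := T.exists_rep _ x
  rw [actC, T.proj_lift, hg]
  exact proj_actB hT hf g

/-- The action is compatible with adding strands on the right. -/
theorem actC_cshift_left {p n : ℕ} (h : 0 + p ≤ n) (x : CBraid T p) :
    actC hT hf n (cshift T p 0 n h x) = cshift T p 0 n h (actC hT hf p x) :=
  DFunLike.congr_fun (f := (actC hT hf n).comp (cshift T p 0 n h))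
    (g := (cshift T p 0 n h).comp (actC hT hf p))
    (hT.hom_ext (hT.regHom_lift_comp _ _ (hT.regHom_map _ _))
      (hT.regHom_lift_comp _ _ (hT.regHom_lift _ _)) (fun g => by
        change actC hT hf n (cshift T p 0 n h (cof T p g)) =
          cshift T p 0 n h (actC hT hf p (cof T p g))
        rw [cshift_cof, actC_cof, actC_cof]
        exact DFunLike.congr_fun (f := (actB hT hf n).comp (shift p 0 n h))
          (g := (cshift T p 0 n h).comp (actB hT hf p)) (braid_hom_ext fun i hi => by
            rw [MonoidHom.comp_apply, MonoidHom.comp_apply, shift_sigma h hi,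
              actB_sigma hT hf (by omega), actB_sigma hT hf hi, cshift_agen hT h (by omega),
              zero_add]) g)) x

/-- The associator carries the action on the last `q` strands of the left-normed parenthesization of
`p + q` strands to the action on `q` strands. -/
theorem acat_actC {p q : ℕ} (hN : p + q ≤ N) (x : CBraid T q) :
    acat f N 0 p q * actC hT hf N (cshift T q p N hN x) =
      cshift T q p N hN (actC hT hf q x) * acat f N 0 p q := by
  have := DFunLike.congr_fun (hT.hom_ext (h := (MulAut.conj (acat f N 0 p q)).toMonoidHom.comp
      ((actC hT hf N).comp (cshift T q p N hN)))
    (h' := (cshift T q p N hN).comp (actC hT hf q))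
    (hT.regHom_conj (hT.regHom_lift_comp _ _ (hT.regHom_map _ _)) _)
    (hT.regHom_lift_comp _ _ (hT.regHom_lift _ _)) (fun g => by
      change acat f N 0 p q * actC hT hf N (cshift T q p N hN (cof T q g)) *
        (acat f N 0 p q)⁻¹ = cshift T q p N hN (actC hT hf q (cof T q g))
      rw [cshift_cof, actC_cof, actC_cof, mul_inv_eq_iff_eq_mul]
      refine braid_intertwine ((actB hT hf N).comp (shift q p N hN))
        ((cshift T q p N hN).comp (actB hT hf q)) _ (fun j hj => ?_) g
      rw [MonoidHom.comp_apply, MonoidHom.comp_apply, shift_sigma _ hj, actB_sigma hT hf (by omega),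
        actB_sigma hT hf hj, cshift_agen hT _ (by omega), acat_agen hT hf hj (by omega), zero_add,
        add_zero])) x
  change acat f N 0 p q * actC hT hf N (cshift T q p N hN x) *
        (acat f N 0 p q)⁻¹ = cshift T q p N hN (actC hT hf q x) at this
  rw [← this, inv_mul_cancel_right]

/-- The action is compatible with juxtaposition, up to the associator. -/
theorem acat_actC_mul {p q : ℕ} (hN : p + q ≤ N) (x : CBraid T p) (y : CBraid T q) :
    acat f N 0 p q * actC hT hf N (cshift T p 0 N (by omega) x *
      cshift T q p N hN y) = cshift T p 0 N (by omega) (actC hT hf p x) *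
        cshift T q p N hN (actC hT hf q y) * acat f N 0 p q := by
  rw [map_mul, actC_cshift_left, ← mul_assoc,
    (acat_cshift hT (by omega) (by omega) (by omega) _).eq, mul_assoc, acat_actC, mul_assoc]

end Coherence

section Constraints
variable {T : Setting.{v}} (hT : T.IsNice) {N : ℕ} {m : T.Scal} {f : T.Free2}
  (hf : IsGT T m f)
open Setting.IsNice

/-! ### The action on crossings of blocks -/

include hT in
theorem acat_commute {o p q s a b : ℕ} (h : (o ≤ s ∧ s + a + b ≤ o + p) ∨ s + a + b ≤ o ∨
    o + p + q ≤ s) (hN : o + p + q ≤ N) (hn : s + a + b ≤ N) :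
    Commute (acat f N o p q) (acat f N s a b) := by
  rw [acat_eq_cshift hT hn]
  exact acat_cshift hT (by omega) hN _ _

include hT in
theorem acat_commute_cbl {o p q s a b : ℕ} (h : (o ≤ s ∧ s + a + b ≤ o + p) ∨ s + a + b ≤ o ∨
    o + p + q ≤ s) (hN : o + p + q ≤ N) (hn : s + a + b ≤ N) :
    Commute (acat f N o p q) (cbl m N s a b) := by
  rw [cbl_eq_cshift hT hn]
  exact acat_cshift hT (by omega) hN _ _

/-- The action on the crossing of two blocks at the left end of the strands. -/
def CrossingRule (p q : ℕ) : Prop := ∀ N, p + q ≤ N →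
  acat f N 0 q p * actC hT hf N (cof T N (bl N 0 p q)) = cbl m N 0 p q * acat f N 0 p q

/-- The action on the crossing of two blocks. -/
theorem CrossingRule.shift {p q : ℕ} (h : CrossingRule hT hf p q) {o : ℕ} (hN : o + p + q ≤ N) :
    acat f N o q p * acat f N 0 o (q + p) * actC hT hf N (cof T N (bl N o p q)) =
      cbl m N o p q * acat f N o p q * acat f N 0 o (p + q) := by
  have e := congrArg (cshift T (p + q) o N (by omega)) (h (p + q) le_rfl)
  rw [map_mul, map_mul, cshift_acat hT _ (by omega), cshift_acat hT _ (by omega),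
    cshift_cbl hT _ (by omega), add_zero] at e
  rw [add_comm q p, cof_bl_eq_cshift hN, mul_assoc, acat_actC hT hf (by omega), ← mul_assoc, e]

theorem crossingRule_zero_left (q : ℕ) : CrossingRule hT hf 0 q := fun N hN => by
  rw [bl_zero_left, map_one, map_one, acat_zero_left hT hf (by omega), cbl, bl_zero_left, map_one,
    cdbl_zero_left, hT.one_pow, acat]
  simp

theorem crossingRule_zero_right (p : ℕ) : CrossingRule hT hf p 0 := fun N hN => by
  rw [bl_zero_right, map_one, map_one, acat_zero_left hT hf (by omega), cbl, bl_zero_right, map_one,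
    cdbl_zero_right, hT.one_pow, acat]
  simp

theorem crossingRule_one_one : CrossingRule hT hf 1 1 := fun N hN => by
  rw [acat_one hT, bl_one_one, actC_cof, actB_sigma hT hf (by omega), agen_zero hT hf (by omega),
    one_mul, mul_one]

/-- The rule for the crossing with a union of two blocks, by the hexagon for blocks and the
coherence of the associators. -/
theorem CrossingRule.add_right {p q r : ℕ} (h1 : CrossingRule hT hf p q)
    (h2 : CrossingRule hT hf p r) : CrossingRule hT hf p (q + r) := fun N hN => by
  have e1 := h1 N (by omega)
  have e2 := h2.shift hT hf (N := N) (o := q) (by omega)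
  have k1 := acat_coherence hT hf (N := N) (o := 0) (p := q) (q := r) (r := p) (by omega)
  have k2 := acat_coherence hT hf (N := N) (o := 0) (p := q) (q := p) (r := r) (by omega)
  have k3 := acat_coherence hT hf (N := N) (o := 0) (p := p) (q := q) (r := r) (by omega)
  have hex := cbl_add_right hT hf (N := N) (o := 0) (p := p) (q := q) (r := r) (by omega)
  have sl := cbl_cshift_right hT (m := m) (N := N) (o := 0) (p := p) (q := q + r) (n := q + r)
    (k := 0) le_rfl (by omega) (by omega) (acat f (q + r) 0 q r)
  rw [cshift_acat hT _ (by omega), cshift_acat hT _ (by omega)] at sl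
  have c1 : Commute (acat f N 0 (q + p) r) (acat f N 0 q p) :=
    acat_commute hT (by omega) (by omega) (by omega)
  have c2 : Commute (acat f N 0 (q + p) r) (cbl m N 0 p q) :=
    acat_commute_cbl hT (by omega) (by omega) (by omega)
  simp only [zero_add, add_zero] at *
  rw [k1, mul_assoc (cbl m N q p r), k2] at e2
  have a1 : actC hT hf N (cof T N (bl N 0 p q)) =
      (acat f N 0 q p)⁻¹ * (cbl m N 0 p q * acat f N 0 p q) := by rw [← e1]; group
  have a2 : actC hT hf N (cof T N (bl N q p r)) =
      (assr f N 0 q r p * acat f N 0 q r * acat f N 0 (q + r) p)⁻¹ *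
      (cbl m N q p r * (assr f N 0 q p r * acat f N 0 q p * acat f N 0 (q + p) r)) := by
    rw [← e2]; group
  rw [bl_add_right, zero_add, map_mul, map_mul, a1, a2]
  calc _ = (acat f N 0 q r)⁻¹ * (assr f N 0 q r p)⁻¹ * cbl m N q p r * assr f N 0 q p r *
        acat f N 0 q p * (acat f N 0 (q + p) r * (acat f N 0 q p)⁻¹) * cbl m N 0 p q *
        acat f N 0 p q := by group
    _ = (acat f N 0 q r)⁻¹ * (assr f N 0 q r p)⁻¹ * cbl m N q p r * assr f N 0 q p r *
        (acat f N 0 (q + p) r * cbl m N 0 p q) * acat f N 0 p q := by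
        rw [c1.inv_right.eq]; group
    _ = (acat f N 0 q r)⁻¹ * cbl m N 0 p (q + r) * (assr f N 0 p q r *
        acat f N 0 p q * acat f N 0 (p + q) r) := by
        rw [c2.eq, hex, add_comm q p]
        have c3 : Commute (acat f N 0 (p + q) r) (acat f N 0 p q) :=
          acat_commute hT (by omega) (by omega) (by omega)
        simp only [mul_assoc, inv_mul_cancel_left, c3.eq]
    _ = (acat f N 0 q r)⁻¹ * (cbl m N 0 p (q + r) * acat f N p q r) * acat f N 0 p (q + r) := by
        rw [← k3]; simp only [mul_assoc]
    _ = _ := by rw [sl]; group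

theorem CrossingRule.add_left {p q r : ℕ} (h1 : CrossingRule hT hf p r)
    (h2 : CrossingRule hT hf q r) : CrossingRule hT hf (p + q) r := fun N hN => by
  have e1 := h1 N (by omega)
  have e2 := h2.shift hT hf (N := N) (o := p) (by omega)
  have k1 := acat_coherence hT hf (N := N) (o := 0) (p := p) (q := r) (r := q) (by omega)
  have k2 := acat_coherence hT hf (N := N) (o := 0) (p := p) (q := q) (r := r) (by omega)
  have k3 := acat_coherence hT hf (N := N) (o := 0) (p := r) (q := p) (r := q) (by omega)
  have hex := cbl_add_left hT hf (N := N) (o := 0) (p := p) (q := q) (r := r) (by omega)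
  have sl := cbl_cshift_left hT (m := m) (N := N) (o := 0) (p := p + q) (q := r) (n := p + q)
    (k := 0) le_rfl (by omega) (by omega) (acat f (p + q) 0 p q)
  rw [cshift_acat hT _ (by omega), cshift_acat hT _ (by omega)] at sl
  have c1 : Commute (acat f N 0 (p + r) q) (acat f N 0 p r) :=
    acat_commute hT (by omega) (by omega) (by omega)
  have c2 : Commute (acat f N 0 (r + p) q) (cbl m N 0 p r) :=
    acat_commute_cbl hT (by omega) (by omega) (by omega)
  simp only [zero_add, add_zero] at *
  rw [k1, mul_assoc (cbl m N p q r), k2] at e2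
  have a1 : actC hT hf N (cof T N (bl N 0 p r)) =
      (acat f N 0 r p)⁻¹ * (cbl m N 0 p r * acat f N 0 p r) := by rw [← e1]; group
  have a2 : actC hT hf N (cof T N (bl N p q r)) =
      (assr f N 0 p r q * acat f N 0 p r * acat f N 0 (p + r) q)⁻¹ *
      (cbl m N p q r * (assr f N 0 p q r * acat f N 0 p q * acat f N 0 (p + q) r)) := by
    rw [← e2]; group
  rw [bl_add_left, zero_add, map_mul, map_mul, a1, a2]
  rw [add_comm r p] at c2 k3
  calc _ = acat f N 0 r (p + q) * (acat f N 0 r p)⁻¹ * (cbl m N 0 p r * (acat f N 0 p r *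
        (acat f N 0 (p + r) q)⁻¹) * (acat f N 0 p r)⁻¹) * (assr f N 0 p r q)⁻¹ * cbl m N p q r *
        assr f N 0 p q r * acat f N 0 p q * acat f N 0 (p + q) r := by group
    _ = acat f N 0 r (p + q) * (acat f N 0 r p)⁻¹ * (cbl m N 0 p r * (acat f N 0 (p + r) q)⁻¹) *
        (assr f N 0 p r q)⁻¹ * cbl m N p q r *
        assr f N 0 p q r * acat f N 0 p q * acat f N 0 (p + q) r := by
        rw [c1.inv_left.symm.eq]; group
    _ = acat f N 0 r (p + q) * (assr f N 0 r p q * acat f N 0 r p * acat f N 0 (p + r) q)⁻¹ *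
        cbl m N 0 (p + q) r * acat f N 0 p q * acat f N 0 (p + q) r := by
        have c3 : Commute (acat f N 0 (p + r) q) (acat f N 0 r p) := by
          rw [add_comm p r]; exact acat_commute hT (by omega) (by omega) (by omega)
        rw [c2.inv_left.symm.eq, hex, mul_inv_rev, mul_inv_rev, ← mul_assoc _⁻¹ _⁻¹,
          ← c3.inv_inv.symm.eq]
        group
    _ = (acat f N r p q)⁻¹ * (cbl m N 0 (p + q) r * acat f N 0 p q) * acat f N 0 (p + q) r := by
        rw [← k3]; group
    _ = _ := by rw [sl]; group

/-- The action sends crossings of blocks to twisted crossings, up to associators. -/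
theorem crossingRule (p q : ℕ) : CrossingRule hT hf p q := by
  have h : ∀ q, CrossingRule hT hf 1 q := fun q => by
    induction q with
    | zero => exact crossingRule_zero_right hT hf 1
    | succ q ih => exact ih.add_right hT hf (crossingRule_one_one hT hf)
  induction p with
  | zero => exact crossingRule_zero_left hT hf q
  | succ p ih => exact ih.add_left hT hf (h q)

/-! ### The change of parenthesization -/

/-- The associator from the left-normed parenthesization to the parenthesization `t` of the strands
following the strand `o`. -/
def cTree (f : T.Free2) (N : ℕ) : FreeMagma Unit → ℕ → CBraid T N
  | .of _, _ => 1
  | .mul a b, o => cTree f N a o * cTree f N b (o + a.length) * acat f N o a.length b.length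

/-- The extension of `cTree` to the empty parenthesization. -/
def cPar (f : T.Free2) (N : ℕ) : Option (FreeMagma Unit) → ℕ → CBraid T N
  | none, _ => 1
  | some t, o => cTree f N t o

theorem cTree_mul (a b : FreeMagma Unit) (o : ℕ) : cTree f N (a * b) o =
  cTree f N a o * cTree f N b (o + a.length) * acat f N o a.length b.length := rfl

theorem proj_cTree (t : FreeMagma Unit) (o : ℕ) : T.proj _ (cTree f N t o) = 1 := by
  induction t using FreeMagma.recOnMul generalizing o with
  | ih1 => exact map_one _
  | ih2 a b iha ihb => exact proj_mul (proj_mul (iha _) (ihb _)) (proj_acat _ _ _)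

theorem proj_cPar (t : Option (FreeMagma Unit)) (o : ℕ) : T.proj _ (cPar f N t o) = 1 := by
  cases t
  · exact map_one _
  · exact proj_cTree _ _

include hT in
theorem cshift_cTree {n k : ℕ} (h : k + n ≤ N) (t : FreeMagma Unit) {o : ℕ}
    (hn : o + t.length ≤ n) : cshift T n k N h (cTree f n t o) = cTree f N t (k + o) := by
  induction t using FreeMagma.recOnMul generalizing o with
  | ih1 => exact map_one _
  | ih2 a b iha ihb =>
    have hn' : o + (a.length + b.length) ≤ n := hn
    rw [cTree_mul, map_mul, map_mul, iha (by omega), ihb (by omega), cshift_acat hT _ (by omega),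
      cTree_mul, add_assoc]

include hT in
theorem cshift_cPar {n k : ℕ} (h : k + n ≤ N) (t : Option (FreeMagma Unit)) {o : ℕ}
    (hn : o + numLetters t ≤ n) : cshift T n k N h (cPar f n t o) = cPar f N t (k + o) := by
  cases t
  · exact map_one _
  · exact cshift_cTree hT h _ hn

include hT in
theorem cPar_eq_cshift (t : Option (FreeMagma Unit)) {o : ℕ} (h : o + numLetters t ≤ N) :
    cPar f N t o = cshift T (numLetters t) o N h (cPar f (numLetters t) t 0) := by
  rw [cshift_cPar hT _ _ (by omega), add_zero]

include hT in
theorem cTree_eq_cshift (t : FreeMagma Unit) {o : ℕ} (h : o + t.length ≤ N) :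
    cTree f N t o = cshift T t.length o N h (cTree f t.length t 0) := by
  rw [cshift_cTree hT _ _ (by omega), add_zero]

include hT hf in
theorem cPar_concat (s t : Option (FreeMagma Unit)) {o : ℕ}
    (h : o + numLetters s + numLetters t ≤ N) : cPar f N (concat s t) o =
      cPar f N s o * cPar f N t (o + numLetters s) *
        acat f N o (numLetters s) (numLetters t) := by
  rcases s with _ | a
  · change cPar f N t o = 1 * cPar f N t (o + 0) * acat f N o 0 _
    rw [acat_zero_left hT hf (by simpa [numLetters] using h), add_zero, one_mul, mul_one]
  · rcases t with _ | b
    · change cTree f N a o = cTree f N a o * 1 * 1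
      rw [mul_one, mul_one]
    · rfl

/-! ### Mirror images -/

/-- The associator from the left-normed to the right-normed parenthesization of the `n` strands
following the strand `o`. -/
def crev (f : T.Free2) (N : ℕ) : ℕ → ℕ → CBraid T N
  | _, 0 => 1
  | o, n + 1 => crev f N (o + 1) n * acat f N o 1 n

include hT in
theorem cshift_crev {n k : ℕ} (h : k + n ≤ N) {o l : ℕ} (hn : o + l ≤ n) :
    cshift T n k N h (crev f n o l) = crev f N (k + o) l := by
  induction l generalizing o with
  | zero => exact map_one _
  | succ l ih =>
    rw [crev, map_mul, ih (by omega), cshift_acat hT _ (by omega), crev, add_assoc]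

include hT in
theorem crev_eq_cshift {o l : ℕ} (h : o + l ≤ N) :
    crev f N o l = cshift T l o N h (crev f l 0 l) := by
  rw [cshift_crev hT _ (by omega), add_zero]

include hT hf in
/-- Two ways from the left-normed parenthesization to a product of two right-normed ones agree. The
mirror image of a left-normed parenthesization is right-normed, whence the involution. -/
theorem crev_add {o p q : ℕ} (h : o + p + q ≤ N) :
    crev f N o q * crev f N (o + q) p * acat f N o q p =
      cstar T N (acat f N (N - o - p - q) p q) * crev f N o (p + q) := by
  induction q generalizing o with
  | zero => rw [acat_zero_left hT hf (by omega), acat, map_one, crev, add_zero, add_zero, mul_one]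
  | succ q ih =>
    have ih' := ih (o := o + 1) (by omega)
    have k := acat_coherence hT hf (N := N) (o := o) (p := 1) (q := q) (r := p) (by omega)
    have c1 : Commute (assr f N o 1 q p) (crev f N (o + 1) q) := by
      rw [crev_eq_cshift hT (by omega)]; exact assr_cshift hT f (by omega) (by omega) _ _
    have c2 : Commute (assr f N o 1 q p) (crev f N (o + 1 + q) p) := by
      rw [crev_eq_cshift hT (by omega)]; exact assr_cshift hT f (by omega) (by omega) _ _
    have c3 : Commute (acat f N o 1 q) (crev f N (o + 1 + q) p) := by
      rw [crev_eq_cshift hT (by omega)]; exact acat_cshift hT (by omega) (by omega) _ _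
    rw [acat, map_mul, cstar_assr hT hf (by omega), ← add_assoc p q 1, crev, crev,
      show N - (N - o - p - (q + 1)) - p - q - 1 = o by omega,
      show N - o - p - (q + 1) = N - (o + 1) - p - q by omega, add_comm q 1, ← add_assoc o 1 q]
    calc _ = crev f N (o + 1) q * (acat f N o 1 q * crev f N (o + 1 + q) p) *
          acat f N o (1 + q) p := by simp only [mul_assoc]
      _ = crev f N (o + 1) q * crev f N (o + 1 + q) p * (acat f N o 1 q *
          acat f N o (1 + q) p) := by rw [c3.eq]; simp only [mul_assoc]
      _ = (assr f N o 1 q p)⁻¹ * (assr f N o 1 q p * (crev f N (o + 1) q *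
          crev f N (o + 1 + q) p)) * (acat f N o 1 q * acat f N o (1 + q) p) := by group
      _ = (assr f N o 1 q p)⁻¹ * (crev f N (o + 1) q * crev f N (o + 1 + q) p) *
          (assr f N o 1 q p * acat f N o 1 q * acat f N o (1 + q) p) := by
          rw [(c1.mul_right c2).eq]; simp only [mul_assoc]
      _ = (assr f N o 1 q p)⁻¹ * (crev f N (o + 1) q * crev f N (o + 1 + q) p *
          acat f N (o + 1) q p) * acat f N o 1 (q + p) := by rw [← k]; simp only [mul_assoc]
      _ = _ := by rw [ih', add_comm q p]; simp only [mul_assoc]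

include hT hf in
/-- The change to a mirrored parenthesization is the mirror image of the change of parenthesization,
preceded by the passage from left-normed to right-normed. -/
theorem cTree_mirror (t : FreeMagma Unit) {o : ℕ} (h : o + t.length ≤ N) :
    cTree f N (mirrorTree t) o =
      cstar T N (cTree f N t (N - o - t.length)) * crev f N o t.length := by
  induction t using FreeMagma.recOnMul generalizing o with
  | ih1 => 
    change 1 = cstar T N 1 * (1 * 1)
    rw [map_one, one_mul, one_mul]
  | ih2 a b iha ihb =>
    have hl : (a * b).length = a.length + b.length := rfl
    rw [hl] at h ⊢
    change cTree f N (mirrorTree b * mirrorTree a) o = _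
    rw [cTree_mul, cTree_mul, length_mirrorTree, length_mirrorTree, ihb (by omega), iha (by omega),
      map_mul, map_mul]
    have c1 : Commute (crev f N o b.length)
        (cstar T N (cTree f N a (N - (o + b.length) - a.length))) := by
      rw [crev_eq_cshift hT (by omega), cTree_eq_cshift hT a (by omega), cstar_cshift hT]
      exact cshift_commute hT _ _ (by omega) _ _
    have c2 : Commute (cTree f N a (N - (o + b.length) - a.length))
        (cTree f N b (N - o - b.length)) := by
      rw [cTree_eq_cshift hT a (by omega), cTree_eq_cshift hT b (by omega)]
      exact cshift_commute hT _ _ (by omega) _ _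
    calc _ = cstar T N (cTree f N b (N - o - b.length)) * (crev f N o b.length *
          cstar T N (cTree f N a (N - (o + b.length) - a.length))) *
          crev f N (o + b.length) a.length * acat f N o b.length a.length := by
          simp only [mul_assoc]
      _ = cstar T N (cTree f N a (N - (o + b.length) - a.length) *
          cTree f N b (N - o - b.length)) * (crev f N o b.length *
          crev f N (o + b.length) a.length * acat f N o b.length a.length) := by
          rw [c1.eq, c2.eq, map_mul]; simp only [mul_assoc]
      _ = _ := by
          rw [crev_add hT hf (by omega), map_mul, show N - (o + b.length) - a.length =
            N - o - (a.length + b.length) by omega, show N - o - (a.length + b.length) + a.length =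
            N - o - b.length by omega, show N - o - (a.length + b.length) =
            N - o - a.length - b.length by omega]
          simp only [mul_assoc]

include hT in
/-- In a parenthesization in which the `i`-th and the next strand are adjacent, the action on the
corresponding generator is a twisted crossing. -/
theorem acat_acat_agen {i j : ℕ} (h : i + 2 + j = N) :
    acat f N 0 i 2 * acat f N 0 (i + 2) j * agen m f N 0 i =
      cbl m N i 1 1 * (acat f N 0 i 2 * acat f N 0 (i + 2) j) := by
  have c : Commute (acat f N 0 (i + 2) j) (agen m f N 0 i) := by
    rw [agen_eq_cshift hT (n := i + 2) (by omega) (by omega)]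
    exact acat_cshift hT (by omega) (by omega) _ _
  have e : acat f N 0 i 2 = assr f N 0 i 1 1 := by rw [acat, acat_one hT, mul_one]
  rw [mul_assoc, c.eq, e, agen, zero_add]
  group

/-- The action commutes with the mirror image, up to the passage from left-normed to right-normed.
It suffices to consider a generator, in a parenthesization in which its two strands are adjacent. -/
theorem cstar_actC {n : ℕ} (x : CBraid T n) : cstar T n (actC hT hf n x) * crev f n 0 n =
    crev f n 0 n * actC hT hf n (cstar T n x) := by
  have := DFunLike.congr_fun (hT.hom_ext (h := (MulAut.conj (crev f n 0 n)⁻¹).toMonoidHom.comp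
      ((cstar T n).comp (actC hT hf n)))
    (h' := (actC hT hf n).comp (cstar T n))
    (hT.regHom_conj (hT.regHom_lift_comp _ _ (hT.regHom_lift _ _)) _)
    (hT.regHom_lift_comp _ _ (hT.regHom_map _ _)) (fun g => by
      change (crev f n 0 n)⁻¹ * cstar T n (actC hT hf n (cof T n g)) * (crev f n 0 n)⁻¹⁻¹ =
        actC hT hf n (cstar T n (cof T n g))
      rw [cstar_cof, actC_cof, actC_cof, inv_inv, mul_assoc, inv_mul_eq_iff_eq_mul, eq_comm]
      refine (braid_intertwine ((actB hT hf n).comp (braidStar n))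
        ((cstar T n).comp (actB hT hf n)) _ (fun i hi => ?_) g)
      obtain ⟨j, hj⟩ : ∃ j, i + 2 + j = n := ⟨n - (i + 2), by omega⟩
      rw [MonoidHom.comp_apply, MonoidHom.comp_apply, star_sigma hi, actB_sigma hT hf hi,
        actB_sigma hT hf (by omega), show n - 2 - i = j by omega]
      have e1 := acat_acat_agen hT (m := m) (f := f) hj
      have e2 := acat_acat_agen hT (m := m) (f := f) (N := n) (i := j) (j := i) (by omega)
      have s1 := crev_add hT hf (N := n) (o := 0) (p := i + 2) (q := j) (by omega)
      have s2 := crev_add hT hf (N := n) (o := j) (p := i) (q := 2) (by omega)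
      have k := acat_coherence hT hf (N := n) (o := 0) (p := j) (q := 2) (r := i) (by omega)
      rw [show n - 0 - (i + 2) - j = 0 by omega, hj] at s1
      rw [show n - j - i - 2 = 0 by omega] at s2
      simp only [zero_add] at s1 s2 k
      have c1 : Commute (crev f n 0 j) (cstar T n (acat f n 0 i 2)) := by
        rw [crev_eq_cshift hT (by omega), acat_eq_cshift hT (by omega), cstar_cshift hT]
        exact cshift_commute hT _ _ (by omega) _ _
      -- There is a single parenthesization of two strands.
      have hr2 : crev f n j 2 = 1 := by
        rw [crev, crev, crev, acat_one hT, acat, mul_one, mul_one]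
      have hcr : cstar T n (acat f n 0 i 2 * acat f n 0 (i + 2) j) * crev f n 0 n =
          crev f n 0 j * crev f n (j + 2) i * assr f n 0 j 2 i *
          (acat f n 0 j 2 * acat f n 0 (j + 2) i) := by
        rw [map_mul, mul_assoc, ← s1, ← mul_assoc, ← mul_assoc, ← c1.eq, mul_assoc (crev f n 0 j),
          ← s2, hr2, one_mul, mul_assoc, mul_assoc, add_comm i 2, k]
        simp only [mul_assoc]
      have c2 : Commute (crev f n 0 j * crev f n (j + 2) i * assr f n 0 j 2 i)
          (cbl m n j 1 1) := by
        rw [cbl_eq_cshift hT (by omega), crev_eq_cshift hT (o := 0) (by omega),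
          crev_eq_cshift hT (o := j + 2) (by omega)]
        refine ((cshift_commute hT _ _ (by omega) _ _).mul_left ?_).mul_left
          (assr_cshift hT f (by omega) (by omega) _ _)
        exact (cshift_commute hT _ _ (by omega) _ _).symm
      have e3 := congrArg (cstar T n) e1
      rw [map_mul, map_mul (cstar T n) (cbl m n i 1 1), cstar_cbl hT (by omega),
        show n - i - 1 - 1 = j by omega] at e3
      rw [← mul_right_inj (cstar T n (acat f n 0 i 2 * acat f n 0 (i + 2) j)), ← mul_assoc, hcr,
        mul_assoc, e2, ← mul_assoc, c2.eq, ← mul_assoc _ (cstar T n _), e3]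
      simp only [mul_assoc] at hcr ⊢
      rw [hcr])) x
  change (crev f n 0 n)⁻¹ * cstar T n (actC hT hf n x) * (crev f n 0 n)⁻¹⁻¹ =
        actC hT hf n (cstar T n x) at this
  rw [← this, inv_inv]
  group

/-! ### Half-twists -/

/-- The twisted half-twist. -/
def chalf (m : T.Scal) (n : ℕ) : CBraid T n :=
  cof T n (halfTwist n) * T.powT _ (cof T n (halfTwist n) * cof T n (halfTwist n)) m

theorem proj_halfTwist_sq (n : ℕ) :
    T.proj _ (cof T n (halfTwist n) * cof T n (halfTwist n)) = 1 := by
  rw [← map_mul]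
  refine proj_of_mem ?_
  rw [MonoidHom.mem_ker]
  ext x
  rw [map_mul, Equiv.Perm.mul_apply, braidPerm_halfTwist, braidPerm_halfTwist, Fin.rev_rev]
  rfl

include hT in
/-- The twisted half-twist of a union of two blocks. -/
theorem chalf_add (p q : ℕ) : chalf m (p + q) = cshift T q 0 (p + q) (by omega) (chalf m q) *
    cshift T p q (p + q) (by omega) (chalf m p) * cbl m (p + q) 0 p q := by
  have pp := proj_halfTwist_sq (T := T) p
  have pq := proj_halfTwist_sq (T := T) q
  have e : cof T (p + q) (halfTwist (p + q)) * cof T (p + q) (halfTwist (p + q)) =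
      cshift T p 0 (p + q) (by omega) (cof T p (halfTwist p) * cof T p (halfTwist p)) *
      cshift T q p (p + q) (by omega) (cof T q (halfTwist q) * cof T q (halfTwist q)) *
      cdbl T (p + q) 0 p q := by
    rw [← map_mul, halfTwist_sq_add, map_mul, map_mul, ← cshift_cof, ← cshift_cof,
      map_mul (cof T p), map_mul (cof T q), cdbl]
  have c1 := cshift_commute hT (N := p + q) (n := p) (k := 0) (n' := q) (k' := p) (by omega) (by omega)
    (by omega) (cof T p (halfTwist p) * cof T p (halfTwist p))
    (cof T q (halfTwist q) * cof T q (halfTwist q))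
  have c2 := cdbl_cshift hT (N := p + q) (o := 0) (p := p) (q := q) (n := p) (k := 0) (by omega)
    (by omega) (by omega) (cof T p (halfTwist p) * cof T p (halfTwist p))
  have c3 := cdbl_cshift hT (N := p + q) (o := 0) (p := p) (q := q) (n := q) (k := p) (by omega)
    (by omega) (by omega) (cof T q (halfTwist q) * cof T q (halfTwist q))
  have pd : T.proj _ (cdbl T (p + q) 0 p q) = 1 := proj_cdbl (by omega)
  have b1 := cbl_cshift_left hT (m := m) (N := p + q) (o := 0) (p := p) (q := q) (n := p) (k := 0)
    le_rfl (by omega) (by omega)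
    (T.powT _ (cof T p (halfTwist p) * cof T p (halfTwist p)) m)
  have b2 := cbl_cshift_right hT (m := m) (N := p + q) (o := 0) (p := p) (q := q) (n := q) (k := 0)
    le_rfl (by omega) (by omega)
    (T.powT _ (cof T q (halfTwist q) * cof T q (halfTwist q)) m)
  simp only [zero_add] at b1 b2
  have c4 := cshift_commute hT (N := p + q) (n := q) (k := 0) (n' := p) (k' := q) (by omega) (by omega)
    (by omega) (T.powT _ (cof T q (halfTwist q) * cof T q (halfTwist q)) m)
    (cof T p (halfTwist p))
  rw [chalf, e, hT.mul_pow _ _ _ (proj_mul (proj_cshift _ pp) (proj_cshift _ pq)) pd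
      (c2.mul_right c3).symm, hT.mul_pow _ _ _ (proj_cshift _ pp) (proj_cshift _ pq) c1,
    ← cshift_pow hT _ pp, ← cshift_pow hT _ pq, halfTwist_add, map_mul, map_mul, ← cshift_cof,
    ← cshift_cof]
  have cD : Commute (cshift T p 0 (p + q) (by omega)
      (T.powT _ (cof T p (halfTwist p) * cof T p (halfTwist p)) m) *
      cshift T q p (p + q) (by omega)
      (T.powT _ (cof T q (halfTwist q) * cof T q (halfTwist q)) m))
      (T.powT _ (cdbl T (p + q) 0 p q) m) :=
    hT.commute_pow pd ((cdbl_cshift hT (by omega) (by omega) _ _).mul_right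
      (cdbl_cshift hT (by omega) (by omega) _ _)).symm m
  rw [cD.eq]
  set U := T.powT (braidPerm p).ker (cof T p (halfTwist p) * cof T p (halfTwist p)) m
  set V := T.powT (braidPerm q).ker (cof T q (halfTwist q) * cof T q (halfTwist q)) m
  set s1 := cshift T q 0 (p + q) (by omega)
  set s2 := cshift T p q (p + q) (by omega)
  calc _ = s1 (cof T q (halfTwist q)) * s2 (cof T p (halfTwist p)) * (cbl m (p + q) 0 p q *
        cshift T p 0 (p + q) (by omega) U) * cshift T q p (p + q) le_rfl V := by
        rw [cbl]; simp only [mul_assoc]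
    _ = s1 (cof T q (halfTwist q)) * s2 (cof T p (halfTwist p)) * s2 U * (cbl m (p + q) 0 p q *
        cshift T q p (p + q) le_rfl V) := by rw [b1]; simp only [mul_assoc]
    _ = s1 (cof T q (halfTwist q)) * (s2 (cof T p (halfTwist p)) * s2 U * s1 V) *
        cbl m (p + q) 0 p q := by rw [b2]; simp only [mul_assoc]
    _ = s1 (cof T q (halfTwist q)) * (s1 V * (s2 (cof T p (halfTwist p)) * s2 U)) *
        cbl m (p + q) 0 p q := by
        rw [← map_mul s2, (cshift_commute hT _ _ (by omega) V _ : Commute (s1 V) (s2 _)).eq]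
    _ = _ := by rw [chalf, chalf, map_mul, map_mul]; simp only [mul_assoc]; rfl

/-- The action sends half-twists to twisted half-twists, by induction on the tree: the half-twist of
a product consists of the two half-twists and of a crossing. -/
theorem cTree_half (t : FreeMagma Unit) : cTree f t.length (mirrorTree t) 0 *
    actC hT hf t.length (cof T t.length (halfTwist t.length)) =
      chalf m t.length * cTree f t.length t 0 := by
  induction t using FreeMagma.recOnMul with
  | ih1 x =>
    have h1 : halfTwist 1 = 1 := by simp [halfTwist, halfTw, row]
    change 1 * actC hT hf 1 (cof T 1 (halfTwist 1)) = chalf m 1 * 1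
    rw [chalf, h1, map_one, map_one, mul_one, hT.one_pow]; simp
  | ih2 a b iha ihb =>
    change cTree f (a.length + b.length) (mirrorTree b * mirrorTree a) 0 *
      actC hT hf (a.length + b.length) (cof T (a.length + b.length)
        (halfTwist (a.length + b.length))) =
      chalf m (a.length + b.length) * cTree f (a.length + b.length) (a * b) 0
    have la := length_mirrorTree a
    have lb := length_mirrorTree b
    rw [cTree_mul, cTree_mul, la, lb, zero_add, zero_add, halfTwist_add, map_mul, map_mul, map_mul,
      ← cshift_cof, ← cshift_cof, chalf_add hT]
    have k1 := acat_actC_mul hT hf (N := a.length + b.length) (p := b.length) (q := a.length)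
      (by omega) (cof T b.length (halfTwist b.length)) (cof T a.length (halfTwist a.length))
    have k2 := crossingRule hT hf a.length b.length (a.length + b.length) le_rfl
    have ea : cTree f (a.length + b.length) (mirrorTree a) b.length = cshift T a.length b.length
        (a.length + b.length) (by omega) (cTree f a.length (mirrorTree a) 0) := by
      rw [cshift_cTree hT _ _ (by omega), add_zero]
    have eb : cTree f (a.length + b.length) (mirrorTree b) 0 = cshift T b.length 0
        (a.length + b.length) (by omega) (cTree f b.length (mirrorTree b) 0) := by
      rw [cshift_cTree hT _ _ (by omega)]
    have ea' := cshift_cTree hT (f := f) (n := a.length) (N := a.length + b.length)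
      (k := 0) (by omega) a (o := 0) (by omega)
    have eb' := cshift_cTree hT (f := f) (n := b.length) (N := a.length + b.length)
      (k := a.length) (by omega) b (o := 0) (by omega)
    simp only [add_zero] at ea' eb'
    set n := a.length + b.length
    set s1 := cshift T b.length 0 n (by omega)
    set s2 := cshift T a.length b.length n (by omega)
    have c : Commute (s1 (actC hT hf b.length (cof T b.length (halfTwist b.length))))
      (s2 (cTree f a.length (mirrorTree a) 0)) := cshift_commute hT _ _ (by omega) _ _
    have c' : Commute (s1 (cTree f b.length b 0))
      (s2 (chalf m a.length * cTree f a.length a 0)) := cshift_commute hT _ _ (by omega) _ _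
    have c'' : Commute (s1 (cTree f b.length b 0))
      (s2 (cTree f a.length a 0)) := cshift_commute hT _ _ (by omega) _ _
    have b1 := cbl_cshift_left hT (m := m) (N := n) (o := 0) (p := a.length) (q := b.length)
      (n := a.length) (k := 0) le_rfl (by omega) (by omega) (cTree f a.length a 0)
    have b2 := cbl_cshift_right hT (m := m) (N := n) (o := 0) (p := a.length) (q := b.length)
      (n := b.length) (k := 0) le_rfl (by omega) (by omega) (cTree f b.length b 0)
    simp only [zero_add] at b1 b2
    rw [ea'] at b1
    rw [eb'] at b2
    rw [ea, eb]
    calc _ = s1 (cTree f b.length (mirrorTree b) 0) * s2 (cTree f a.length (mirrorTree a) 0) *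
          (acat f n 0 b.length a.length * actC hT hf n (s1 (cof T b.length (halfTwist b.length)) *
          s2 (cof T a.length (halfTwist a.length)))) *
          actC hT hf n (cof T n (bl n 0 a.length b.length)) := by simp only [mul_assoc]; rfl
      _ = s1 (cTree f b.length (mirrorTree b) 0) * (s2 (cTree f a.length (mirrorTree a) 0) *
          s1 (actC hT hf b.length (cof T b.length (halfTwist b.length)))) *
          s2 (actC hT hf a.length (cof T a.length (halfTwist a.length))) *
          (acat f n 0 b.length a.length *
          actC hT hf n (cof T n (bl n 0 a.length b.length))) := by
          rw [k1]; simp only [mul_assoc]; rfl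
      _ = s1 (cTree f b.length (mirrorTree b) 0 *
          actC hT hf b.length (cof T b.length (halfTwist b.length))) *
          s2 (cTree f a.length (mirrorTree a) 0 *
            actC hT hf a.length (cof T a.length (halfTwist a.length))) *
          (cbl m n 0 a.length b.length * acat f n 0 a.length b.length) := by
          rw [← c.eq, k2, map_mul s1, map_mul s2]; simp only [mul_assoc]
      _ = s1 (chalf m b.length) * s2 (chalf m a.length) * (s2 (cTree f a.length a 0) *
          (s1 (cTree f b.length b 0) * cbl m n 0 a.length b.length)) *
          acat f n 0 a.length b.length := by
          rw [iha, ihb, map_mul s1]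
          simp only [mul_assoc]
          rw [← mul_assoc (s1 (cTree f b.length b 0)), c'.eq, map_mul s2]
          simp only [mul_assoc]
      _ = s1 (chalf m b.length) * s2 (chalf m a.length) * cbl m n 0 a.length b.length *
          (cTree f n a 0 * cTree f n b a.length) * acat f n 0 a.length b.length := by
          rw [← b2, ← mul_assoc (s2 _), ← b1]; simp only [mul_assoc]; rfl
      _ = _ := by simp only [mul_assoc]; rfl

end Constraints

section ActVal
variable {T : Setting.{v}} (hT : T.IsNice) {m : T.Scal} {f : T.Free2} (hf : IsGT T m f)
open Setting.IsNice

/-! ### The action on parenthesized braids -/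

/-- The action on braids from the parenthesization `s` to the parenthesization `t`. -/
def actVal (n : ℕ) (s t : Option (FreeMagma Unit)) (x : CBraid T n) : CBraid T n :=
  cPar f n t 0 * actC hT hf n x * (cPar f n s 0)⁻¹

theorem proj_actVal {n : ℕ} (s t : Option (FreeMagma Unit)) (x : CBraid T n) :
    T.proj _ (actVal hT hf n s t x) = T.proj _ x := by
  rw [actVal, map_mul, map_mul, map_inv, proj_cPar, proj_cPar, proj_actC, one_mul, inv_one, mul_one]

theorem actVal_mul {n : ℕ} (s t r : Option (FreeMagma Unit)) (y x : CBraid T n) :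
    actVal hT hf n s r (y * x) = actVal hT hf n t r y * actVal hT hf n s t x := by
  simp only [actVal, map_mul]; group

theorem actVal_one {n : ℕ} (s : Option (FreeMagma Unit)) : actVal hT hf n s s 1 = 1 := by
  simp [actVal]

/-- The action on the automorphisms of one parenthesization. -/
def actAut (n : ℕ) (s : Option (FreeMagma Unit)) : CBraid T n →* CBraid T n :=
  (MulAut.conj (cPar f n s 0)).toMonoidHom.comp (actC hT hf n)

theorem regHom_actAut (n : ℕ) (s : Option (FreeMagma Unit)) : T.RegHom _ _ (actAut hT hf n s) :=
  hT.regHom_conj (regHom_actC hT hf n) _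

theorem actAut_kills (n : ℕ) (s : Option (FreeMagma Unit)) : ∀ p ∈ (braidPerm n).ker,
    T.proj _ (actAut hT hf n s (T.of _ p)) = 1 := fun _ hp =>
  (proj_actVal hT hf s s _).trans (proj_of_mem hp)

theorem actVal_pow {n : ℕ} (s : Option (FreeMagma Unit)) {x : CBraid T n} (hx : T.proj _ x = 1)
    (c : T.Scal) : actVal hT hf n s s (T.powT _ x c) = T.powT _ (actVal hT hf n s s x) c :=
  hT.pow_hom (regHom_actAut hT hf n s) (actAut_kills hT hf n s) hx c

theorem actVal_sub {n : ℕ} (s : Option (FreeMagma Unit)) {x y : CBraid T n} (hx : T.proj _ x = 1)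
    (hy : T.proj _ y = 1) (g : T.Free2) : actVal hT hf n s s (T.substT _ g x y) =
      T.substT _ g (actVal hT hf n s s x) (actVal hT hf n s s y) :=
  hT.sub_hom (regHom_actAut hT hf n s) (actAut_kills hT hf n s) hx hy g

/-- The action is compatible with the tensor product of morphisms. -/
theorem actVal_tensor {p q : ℕ} {s s' t t' : Option (FreeMagma Unit)} (hs : numLetters s = p)
    (hs' : numLetters s' = p) (ht : numLetters t = q) (ht' : numLetters t' = q) (x : CBraid T p)
    (y : CBraid T q) : actVal hT hf (p + q) (concat s t) (concat s' t')
      (cshift T p 0 (p + q) (by omega) x * cshift T q p (p + q) le_rfl y) =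
      cshift T p 0 (p + q) (by omega) (actVal hT hf p s s' x) *
        cshift T q p (p + q) le_rfl (actVal hT hf q t t' y) := by
  have e1 := cshift_cPar hT (f := f) (N := p + q) (n := p) (k := 0) (by omega) s (o := 0) (by omega)
  have e1' := cshift_cPar hT (f := f) (N := p + q) (n := p) (k := 0) (by omega) s' (o := 0) (by omega)
  have e2 := cshift_cPar hT (f := f) (N := p + q) (n := q) (k := p) (by omega) t (o := 0) (by omega)
  have e2' := cshift_cPar hT (f := f) (N := p + q) (n := q) (k := p) (by omega) t' (o := 0) (by omega)
  have k := acat_actC_mul hT hf (N := p + q) le_rfl x y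
  have l := cPar_concat hT hf (N := p + q) s t (o := 0) (by omega)
  have l' := cPar_concat hT hf (N := p + q) s' t' (o := 0) (by omega)
  simp only [add_zero] at e1 e1' e2 e2'
  rw [hs, ht, zero_add, ← e1, ← e2] at l
  rw [hs', ht', zero_add, ← e1', ← e2'] at l'
  rw [actVal, l, l', actVal, actVal]
  simp only [map_mul (cshift T p 0 (p + q) _), map_mul (cshift T q p (p + q) _), map_inv]
  set s1 := cshift T p 0 (p + q) (by omega)
  set s2 := cshift T q p (p + q) (by omega)
  have c : ∀ a b, Commute (s1 a) (s2 b) := fun a b => cshift_commute hT _ _ (by omega) _ _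
  calc _ = s1 (cPar f p s' 0) * s2 (cPar f q t' 0) * (acat f (p + q) 0 p q *
        actC hT hf (p + q) (s1 x * s2 y)) * (acat f (p + q) 0 p q)⁻¹ *
        ((s1 (cPar f p s 0)) * (s2 (cPar f q t 0)))⁻¹ := by group
    _ = s1 (cPar f p s' 0) * (s2 (cPar f q t' 0) * s1 (actC hT hf p x)) *
        s2 (actC hT hf q y) * ((s1 (cPar f p s 0)) * (s2 (cPar f q t 0)))⁻¹ := by rw [k]; group
    _ = s1 (cPar f p s' 0) * s1 (actC hT hf p x) * (s2 (cPar f q t' 0) *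
        s2 (actC hT hf q y) * (s2 (cPar f q t 0))⁻¹ * (s1 (cPar f p s 0))⁻¹) := by
        rw [← (c _ _).eq]; group
    _ = _ := by
        rw [← map_inv s2, ← map_mul s2, ← map_mul s2, ← map_inv s1, ← (c _ _).eq]
        simp only [map_mul, map_inv, mul_assoc]

/-- The action sends the braiding to the twisted braiding. -/
theorem actVal_braiding {p q : ℕ} {s t : Option (FreeMagma Unit)} (hs : numLetters s = p)
    (ht : numLetters t = q) : actVal hT hf (p + q) (concat s t) (concat t s)
      (cof T (p + q) (bl (p + q) 0 p q)) = cbl m (p + q) 0 p q := by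
  have l := cPar_concat hT hf (N := p + q) s t (o := 0) (by omega)
  have l' := cPar_concat hT hf (N := p + q) t s (o := 0) (by omega)
  have k := crossingRule hT hf p q (p + q) le_rfl
  have e1 := cshift_cPar hT (f := f) (N := p + q) (n := p) (k := 0) (by omega) s (o := 0) (by omega)
  have e1' := cshift_cPar hT (f := f) (N := p + q) (n := p) (k := q) (by omega) s (o := 0) (by omega)
  have e2 := cshift_cPar hT (f := f) (N := p + q) (n := q) (k := p) (by omega) t (o := 0) (by omega)
  have e2' := cshift_cPar hT (f := f) (N := p + q) (n := q) (k := 0) (by omega) t (o := 0) (by omega)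
  have b1 := cbl_cshift_left hT (m := m) (N := p + q) (o := 0) (p := p) (q := q) (n := p) (k := 0)
    le_rfl (by omega) (by omega) (cPar f p s 0)
  have b2 := cbl_cshift_right hT (m := m) (N := p + q) (o := 0) (p := p) (q := q) (n := q) (k := 0)
    le_rfl (by omega) (by omega) (cPar f q t 0)
  simp only [add_zero, zero_add] at e1 e1' e2 e2' b1 b2
  rw [e1, e1'] at b1
  rw [e2, e2'] at b2
  rw [hs, ht, zero_add] at l
  rw [hs, ht, zero_add] at l'
  rw [actVal, l, l', mul_inv_eq_iff_eq_mul]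
  simp only [mul_assoc]
  rw [k, ← mul_assoc (cbl m _ _ _ _), b1, mul_assoc, ← mul_assoc (cbl m _ _ _ _), b2]
  have c : Commute (cPar f (p + q) t 0) (cPar f (p + q) s q) := by
    rw [← e1', ← e2']; exact cshift_commute hT _ _ (by omega) _ _
  simp only [← mul_assoc]
  rw [c.eq]

/-- The action sends the associativity isomorphism, whose braid is trivial, to `f` evaluated at the
two double crossings. -/
theorem actVal_assoc {p q r : ℕ} {s t w : Option (FreeMagma Unit)} (hs : numLetters s = p)
    (ht : numLetters t = q) (hw : numLetters w = r) : actVal hT hf (p + q + r)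
      (concat (concat s t) w) (concat s (concat t w)) 1 = assr f (p + q + r) 0 p q r := by
  have n1 : numLetters (concat s t) = p + q := by
    subst hs ht; exact (Par.concat ⟨s, rfl⟩ ⟨t, rfl⟩).2
  have n2 : numLetters (concat t w) = q + r := by
    subst hw ht; exact (Par.concat ⟨t, rfl⟩ ⟨w, rfl⟩).2
  have l1 := cPar_concat hT hf (N := p + q + r) (concat s t) w (o := 0) (by omega)
  have l2 := cPar_concat hT hf (N := p + q + r) s t (o := 0) (by omega)
  have l3 := cPar_concat hT hf (N := p + q + r) s (concat t w) (o := 0) (by omega)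
  have l4 := cPar_concat hT hf (N := p + q + r) t w (o := p) (by omega)
  have e1 := cPar_eq_cshift hT (f := f) (N := p + q + r) s (o := 0) (by omega)
  have e2 := cPar_eq_cshift hT (f := f) (N := p + q + r) t (o := p) (by omega)
  have e3 := cPar_eq_cshift hT (f := f) (N := p + q + r) w (o := p + q) (by omega)
  have k := acat_coherence hT hf (N := p + q + r) (o := 0) (p := p) (q := q) (r := r) (by omega)
  rw [n1, hw, zero_add] at l1
  rw [hs, ht, zero_add] at l2
  rw [n2, hs, zero_add] at l3
  rw [ht, hw] at l4
  rw [zero_add] at k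
  rw [actVal, map_one, mul_one, l1, l2, l3, l4, mul_inv_eq_iff_eq_mul]
  have c1 : Commute (acat f (p + q + r) 0 p q) (cPar f (p + q + r) w (p + q)) := by
    rw [e3]; exact acat_cshift hT (by omega) (by omega) (by omega) _
  have d1 : Commute (assr f (p + q + r) 0 p q r) (cPar f (p + q + r) s 0) := by
    rw [e1]; exact assr_cshift hT f (by omega) (by omega) (by omega) _
  have d2 : Commute (assr f (p + q + r) 0 p q r) (cPar f (p + q + r) t p) := by
    rw [e2]; exact assr_cshift hT f (by omega) (by omega) (by omega) _
  have d3 : Commute (assr f (p + q + r) 0 p q r) (cPar f (p + q + r) w (p + q)) := by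
    rw [e3]; exact assr_cshift hT f (by omega) (by omega) (by omega) _
  calc _ = (cPar f (p + q + r) s 0 * cPar f (p + q + r) t p * cPar f (p + q + r) w (p + q)) *
        (acat f (p + q + r) p q r * acat f (p + q + r) 0 p (q + r)) := by simp only [mul_assoc]
    _ = (assr f (p + q + r) 0 p q r) * (cPar f (p + q + r) s 0 * cPar f (p + q + r) t p) *
        (cPar f (p + q + r) w (p + q) * acat f (p + q + r) 0 p q) *
          acat f (p + q + r) 0 (p + q) r := by
        rw [k, ← mul_assoc, ← mul_assoc,
          ← ((d1.mul_right d2).mul_right d3).eq]; simp only [mul_assoc]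
    _ = _ := by rw [← c1.eq]; simp only [mul_assoc]

include hT hf in
theorem cPar_mirror {n : ℕ} {t : Option (FreeMagma Unit)} (ht : numLetters t = n) :
    cPar f n (t.map mirrorTree) 0 = cstar T n (cPar f n t 0) * crev f n 0 n := by
  subst ht
  rcases t with _ | a
  · change 1 = cstar T 0 1 * 1
    rw [map_one, mul_one]
  · have := cTree_mirror hT hf (N := a.length) a (o := 0) (by omega)
    rw [show a.length - 0 - a.length = 0 by omega] at this
    exact this

/-- The action is compatible with the mirror image. -/
theorem actVal_star {n : ℕ} {s t : Option (FreeMagma Unit)} (hs : numLetters s = n)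
    (ht : numLetters t = n) (x : CBraid T n) :
    actVal hT hf n (s.map mirrorTree) (t.map mirrorTree) (cstar T n x) =
      cstar T n (actVal hT hf n s t x) := by
  have := cstar_actC hT hf x
  rw [actVal, cPar_mirror hT hf hs, cPar_mirror hT hf ht, actVal, map_mul, map_mul, map_inv,
    mul_assoc (cstar T n (cPar f n t 0)), ← this]
  group

/-- The action sends half-twists to twisted half-twists. -/
theorem actVal_half {n : ℕ} {s : Option (FreeMagma Unit)} (hs : numLetters s = n) :
    actVal hT hf n s (s.map mirrorTree) (cof T n (halfTwist n)) = chalf m n := by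
  subst hs
  rw [actVal, mul_inv_eq_iff_eq_mul]
  rcases s with _ | a
  · change 1 * actC hT hf 0 (cof T 0 (halfTwist 0)) = chalf m 0 * 1
    have h0 : halfTwist 0 = 1 := by simp [halfTwist, halfTw]
    rw [chalf, h0, map_one, map_one, mul_one, hT.one_pow]; simp
  · exact cTree_half hT hf a

end ActVal

/-! ### The endofunctors of the category of parenthesized braids -/

section Cast
variable {T : Setting.{v}} {k n : ℕ}

/-- Transport along an equality of numbers of strands. -/
def ccast (h : k = n) : CBraid T k →* CBraid T n := braidFamily.castC T h

theorem ccast_cof (h : k = n) (o p q : ℕ) :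
    ccast h (cof T k (bl k o p q)) = cof T n (bl n o p q) := by
  subst h; rfl

theorem ccast_cdbl (h : k = n) (o p q : ℕ) :
    ccast h (cdbl T k o p q) = cdbl T n o p q := by
  subst h; rfl

end Cast

section Functor
variable {T : Setting.{v}} (hT : T.IsNice) {m : T.Scal} {f : T.Free2} (hf : IsGT T m f)
  {S : Type u}
open Setting.IsNice

theorem permT_congr {G : Type} [Group G] {n : ℕ} (π : G →* Equiv.Perm (Fin n)) {x y : T.Obj G π.ker}
    (h : T.proj _ x = T.proj _ y) : T.permT π x = T.permT π y := by
  rw [Setting.permT, MonoidHom.comp_apply, h]; rfl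

variable (S) in
/-- The endofunctor `i_{(λ, f)}`. -/
def iFun : IdEndofunctor (PaB T S) where
  map {X Y} φ :=
    { len := φ.len
      val := actVal hT hf X.n X.t.1 Y.t.1 φ.val
      compat := fun i => by
        have h : braidFamily.permC T X.word.1 (actVal hT hf X.n X.t.1 Y.t.1 φ.val) =
            braidFamily.permC T X.word.1 φ.val :=
          permT_congr (braidPerm X.n) (proj_actVal hT hf _ _ _)
        rw [h]; exact φ.compat i }
  map_id X := WordHom.ext (actVal_one hT hf _)
  map_comp {X Y Z} φ ψ := by
    obtain ⟨n, t, s⟩ := X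
    obtain ⟨n', t', s'⟩ := Y
    obtain ⟨n'', t'', s''⟩ := Z
    obtain ⟨h, x, hx⟩ := φ
    obtain ⟨h', y, hy⟩ := ψ
    change n = n' at h
    change n' = n'' at h'
    subst h h'
    exact WordHom.ext (actVal_mul hT hf t.1 t'.1 t''.1 y x)

theorem iFun_val {X Y : PaB T S} (φ : X ⟶ Y) :
    ((iFun hT hf S).map φ).val = actVal hT hf X.n X.t.1 Y.t.1 φ.val := rfl

omit hT hf in
theorem comp_val {X Y Z : PaB T S} (φ : X ⟶ Y) (ψ : Y ⟶ Z) :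
    (φ ≫ ψ).val = braidFamily.castC T φ.len.symm ψ.val * φ.val := rfl

omit hT hf in
theorem braiding_val (X Y : PaB T S) :
    (PaB.braiding X Y).val = cof T (X.n + Y.n) (bl (X.n + Y.n) 0 X.n Y.n) := by
  change cof T _ (block _ _ _) = _
  rw [block_eq_bl]

omit hT hf in
theorem braiding_braiding_val (X Y : PaB T S) :
    (PaB.braiding X Y ≫ PaB.braiding Y X).val = cdbl T (X.n + Y.n) 0 X.n Y.n := by
  change (ccast (Nat.add_comm Y.n X.n) (cof T (Y.n + X.n) (block (Y.n + X.n) Y.n X.n)) *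
    cof T (X.n + Y.n) (block (X.n + Y.n) X.n Y.n) : CBraid T (X.n + Y.n)) = _
  rw [block_eq_bl, block_eq_bl, ccast_cof, ← map_mul]
  rfl

omit hT hf in
theorem tensorHom_val {X X' Y Y' : PaB T S} (φ : X ⟶ X') (ψ : Y ⟶ Y') :
    (PaB.tensorHom φ ψ).val = cshift T X.n 0 (X.n + Y.n) (by omega) φ.val *
      cshift T Y.n X.n (X.n + Y.n) le_rfl ψ.val := rfl

omit hT hf in
/-- The two double crossings from which the associator is formed. -/
theorem assoc_args (X Y Z : PaB T S) :
    (PaB.tensorHom (PaB.braiding X Y ≫ PaB.braiding Y X) (𝟙 Z)).val =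
        cdbl T (X.n + Y.n + Z.n) 0 X.n Y.n ∧
      (PaB.assoc X Y Z ≫ PaB.tensorHom (𝟙 X) (PaB.braiding Y Z ≫ PaB.braiding Z Y) ≫
        inv (PaB.assoc X Y Z)).val = cdbl T (X.n + Y.n + Z.n) X.n Y.n Z.n := by
  constructor
  · rw [tensorHom_val, braiding_braiding_val]
    change (cshift T (X.n + Y.n) 0 (X.n + Y.n + Z.n) _ _ * cshift T Z.n (X.n + Y.n) _ _ 1 :
      CBraid T (X.n + Y.n + Z.n)) = _
    rw [map_one, mul_one, cshift_cdbl _ (by omega)]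
  · have h1 : inv (PaB.assoc X Y Z) = Groupoid.inv (PaB.assoc X Y Z) :=
      (Groupoid.inv_eq_inv _).symm
    rw [h1]
    change (ccast (Nat.add_assoc X.n Y.n Z.n).symm
      (ccast rfl (ccast (Nat.add_assoc X.n Y.n Z.n) ((1 : CBraid T (X.n + Y.n + Z.n))⁻¹)) *
        (cshift T X.n 0 (X.n + (Y.n + Z.n)) _ 1 * cshift T (Y.n + Z.n) X.n (X.n + (Y.n + Z.n)) _
          (PaB.braiding Y Z ≫ PaB.braiding Z Y).val)) * 1 : CBraid T (X.n + Y.n + Z.n)) = _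
    rw [braiding_braiding_val, inv_one, map_one, map_one, map_one, one_mul, one_mul, mul_one,
      cshift_cdbl _ (by omega), ccast_cdbl, add_zero]

omit hT hf in
theorem subst_val {X : PaB T S} (g : T.Free2) (φ ψ : X ⟶ X) :
    (PaB.subst g φ ψ).val = T.substT (braidPerm X.n).ker g φ.val ψ.val := rfl

omit hT hf in
theorem pow_val {X : PaB T S} (φ : X ⟶ X) (c : T.Scal) :
    (PaB.pow φ c).val = T.powT (braidPerm X.n).ker φ.val c := rfl

omit hT hf in
theorem twisted_assoc_val (g : T.Free2) (X Y Z : PaB T S) :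
    (PaB.subst g (PaB.tensorHom (PaB.braiding X Y ≫ PaB.braiding Y X) (𝟙 Z))
      (PaB.assoc X Y Z ≫ PaB.tensorHom (𝟙 X) (PaB.braiding Y Z ≫ PaB.braiding Z Y) ≫
        inv (PaB.assoc X Y Z)) ≫ PaB.assoc X Y Z).val =
      assr g (X.n + Y.n + Z.n) 0 X.n Y.n Z.n := by
  rw [comp_val, subst_val, (assoc_args X Y Z).1, (assoc_args X Y Z).2]
  change ((1 : CBraid T (X.n + Y.n + Z.n)) * T.substT (braidPerm (X.n + Y.n + Z.n)).ker g _ _) = _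
  rw [one_mul, assr, zero_add]

omit hT hf in
theorem twisted_braiding_val (c : T.Scal) (X Y : PaB T S) :
    (PaB.pow (PaB.braiding X Y ≫ PaB.braiding Y X) c ≫ PaB.braiding X Y).val =
      cbl c (X.n + Y.n) 0 X.n Y.n := by
  rw [comp_val, pow_val, braiding_braiding_val, braiding_val]
  rfl

omit hT hf in
theorem twisted_half_val (c : T.Scal) (X : PaB T S) :
    (PaB.pow (PaB.twist X) c ≫ PaB.half X).val = chalf c X.n := rfl

/-- The endofunctor `i_{(λ, f)}` has the required properties. -/
theorem isTwistFor_iFun : IsTwistFor m f (iFun hT hf S) where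
  map_tensor {X X' Y Y'} φ ψ := by
    obtain ⟨n, t, s⟩ := X
    obtain ⟨n', t', s'⟩ := X'
    obtain ⟨k, w, r⟩ := Y
    obtain ⟨k', w', r'⟩ := Y'
    obtain ⟨h, x, hx⟩ := φ
    obtain ⟨h', y, hy⟩ := ψ
    change n = n' at h
    change k = k' at h'
    subst h h'
    exact WordHom.ext (actVal_tensor hT hf t.2 t'.2 w.2 w'.2 x y)
  map_braiding X Y := WordHom.ext (by
    rw [twisted_braiding_val, iFun_val, braiding_val]
    exact actVal_braiding hT hf X.t.2 Y.t.2)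
  map_assoc X Y Z := WordHom.ext (by
    rw [twisted_assoc_val, iFun_val]
    exact actVal_assoc hT hf X.t.2 Y.t.2 Z.t.2)
  map_star {X Y} φ := by
    obtain ⟨n, t, s⟩ := X
    obtain ⟨n', t', s'⟩ := Y
    obtain ⟨h, x, hx⟩ := φ
    change n = n' at h
    subst h
    exact WordHom.ext (actVal_star hT hf t.2 t'.2 x)
  map_half X := WordHom.ext (by
    rw [twisted_half_val, iFun_val]
    exact actVal_half hT hf X.t.2)
  regular X Y := by
    change T.Regular (braidPerm X.n).ker (braidPerm X.n).ker (fun φ : X ⟶ Y => φ.val)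
      (fun φ => cPar f X.n Y.t.1 0 * actC hT hf X.n φ.val * (cPar f X.n X.t.1 0)⁻¹)
    exact hT.reg_mul _ _ _ _ _ (hT.reg_mul _ _ _ _ _ (hT.reg_const _ _ _ _)
      (hT.reg_lift _ _ _ _ _)) (hT.reg_const _ _ _ _)

end Functor

/-! ### Uniqueness of the endofunctor -/

section Magma

/-- An associative congruence on binary trees relates all trees with the same number of leaves. -/
theorem rel_of_length_eq {R : FreeMagma Unit → FreeMagma Unit → Prop} (hR : Equivalence R)
    (hm : ∀ a a' b b', R a a' → R b b' → R (a * b) (a' * b'))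
    (ha : ∀ a b c, R (a * b * c) (a * (b * c))) {a b : FreeMagma Unit} (h : a.length = b.length) :
    R a b := by
  let comb : ℕ → FreeMagma Unit := fun n => Nat.rec (.of ()) (fun _ t => t * .of ()) n
  have h1 : ∀ (b : FreeMagma Unit) (n : ℕ), R (comb n * b) (comb (n + b.length)) := by
    intro b
    induction b using FreeMagma.recOnMul with
    | ih1 x => exact fun n => hR.refl _
    | ih2 c d ihc ihd =>
      intro n
      have e : comb (n + (c * d).length) = comb (n + c.length + d.length) :=
        congrArg comb (Nat.add_assoc _ _ _).symm
      rw [e]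
      exact hR.trans (hR.symm (ha _ _ _)) (hR.trans (hm _ _ _ _ (ihc n) (hR.refl d)) (ihd _))
  have h2 : ∀ a : FreeMagma Unit, R a (comb (a.length - 1)) := by
    intro a
    induction a using FreeMagma.recOnMul with
    | ih1 x => exact hR.refl _
    | ih2 c d ihc _ =>
      have hc : 0 < c.length := FreeMagma.length_pos c
      have e : comb ((c * d).length - 1) = comb (c.length - 1 + d.length) := by
        change comb (c.length + d.length - 1) = _
        congr 1; omega
      rw [e]
      exact hR.trans (hm _ _ _ _ ihc (hR.refl d)) (h1 d _)
  exact hR.trans (h2 a) (h ▸ hR.symm (h2 b))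

end Magma

section Uniqueness
variable {T : Setting.{v}} {S : Type u}

theorem PaB.ext_of_eq {X Y : PaB T S} (hn : X.n = Y.n) (ht : X.t.1 = Y.t.1)
    (hs : ∀ i, Y.s (Fin.cast hn i) = X.s i) : X = Y := by
  obtain ⟨n, ⟨t, h⟩, s⟩ := X
  obtain ⟨n', ⟨t', h'⟩, s'⟩ := Y
  change n = n' at hn
  subst hn
  change t = t' at ht
  subst ht
  obtain rfl : s' = s := funext hs
  rfl

/-- A morphism of parenthesized braids is determined by its source, its braid and the
parenthesization of its target. -/
theorem PaB.target_eq {X Y Y' : PaB T S} (φ : X ⟶ Y) (φ' : X ⟶ Y') (ht : Y.t.1 = Y'.t.1)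
    (h : φ.val = φ'.val) : ∃ e : Y = Y', φ' = φ ≫ eqToHom e := by
  have e : Y = Y' := by
    refine PaB.ext_of_eq (φ.len.symm.trans φ'.len) ht fun i => ?_
    obtain ⟨j, rfl⟩ : ∃ j, Fin.cast φ.len (braidFamily.permC T X.n φ.val j) = i :=
      ⟨(braidFamily.permC T X.n φ.val).symm (Fin.cast φ.len.symm i), by
        rw [Equiv.apply_symm_apply]; rfl⟩
    have h1 := φ.compat j
    have h2 := φ'.compat j
    rw [← h] at h2
    exact h2.trans h1.symm
  subst e
  exact ⟨rfl, by rw [eqToHom_refl, Category.comp_id]; exact WordHom.ext h.symm⟩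

variable {i i' : IdEndofunctor (PaB T S)}

/-- The endofunctors `i` and `i'` agree on the morphisms from the parenthesization `t` to the
parenthesization `t'` which are given by the braid `g`. -/
def Agree (i i' : IdEndofunctor (PaB T S)) (n : ℕ) (t t' : Option (FreeMagma Unit))
    (g : Braid n) : Prop :=
  ∀ (ht : numLetters t = n) (s : Fin n → S), ∃ (Y : PaB T S)
    (φ : (⟨n, ⟨t, ht⟩, s⟩ : PaB T S) ⟶ Y), Y.t.1 = t' ∧ φ.val = cof T n g ∧ i'.map φ = i.map φ

namespace Agree

theorem map_eq {n : ℕ} {t t' : Option (FreeMagma Unit)} {g : Braid n} (h : Agree i i' n t t' g)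
    (ht : numLetters t = n) (s : Fin n → S) {Y : PaB T S}
    (φ : (⟨n, ⟨t, ht⟩, s⟩ : PaB T S) ⟶ Y) (hY : Y.t.1 = t') (hφ : φ.val = cof T n g) :
    i'.map φ = i.map φ := by
  obtain ⟨Y', φ', hY', hφ', e⟩ := h ht s
  obtain ⟨rfl, h2⟩ := PaB.target_eq φ' φ (hY'.trans hY.symm) (hφ'.trans hφ.symm)
  rw [eqToHom_refl, Category.comp_id] at h2
  rw [h2, e]

theorem refl (n : ℕ) (t : Option (FreeMagma Unit)) : Agree i i' n t t 1 := fun ht s =>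
  ⟨_, 𝟙 _, rfl, (map_one (cof T n)).symm, by rw [i.map_id, i'.map_id]⟩

theorem comp {n : ℕ} {t t' t'' : Option (FreeMagma Unit)} {g h : Braid n}
    (hg : Agree i i' n t t' g) (hh : Agree i i' n t' t'' h) : Agree i i' n t t'' (h * g) :=
  fun ht s => by
    obtain ⟨⟨n', ⟨w, hw⟩, s'⟩, φ, hY, hφ, e⟩ := hg ht s
    have hn : n = n' := φ.len
    subst hn
    change w = t' at hY
    subst hY
    obtain ⟨Z, ψ, hZ, hψ, e'⟩ := hh hw s'
    refine ⟨Z, φ ≫ ψ, hZ, ?_, by rw [i.map_comp, i'.map_comp, e, e']⟩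
    rw [map_mul, ← hψ, ← hφ]
    rfl

theorem symm {n : ℕ} {t t' : Option (FreeMagma Unit)} {g : Braid n} (hn : numLetters t = n)
    (hg : Agree i i' n t t' g) : Agree i i' n t' t g⁻¹ :=
  fun ht s => by
    obtain ⟨⟨n', ⟨w, hw⟩, s'⟩, φ, hY, hφ, e⟩ := hg hn (s ∘ braidPerm n g)
    have hn' : n = n' := φ.len
    subst hn'
    change w = t' at hY
    subst hY
    have hs : s' = s := by
      funext x
      obtain ⟨y, rfl⟩ := (braidPerm n g).surjective x
      have := φ.compat y
      rw [hφ] at this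
      change s' (braidFamily.permC T n (PaB.br T n g) y) = s (braidPerm n g y) at this
      rwa [PaB.perm_br] at this
    subst hs
    refine ⟨_, Groupoid.inv φ, rfl, ?_, ?_⟩
    · change (φ.val : CBraid T n)⁻¹ = _
      rw [hφ, map_inv]
      rfl
    · have h1 : ∀ j : IdEndofunctor (PaB T S), j.map (Groupoid.inv φ) = Groupoid.inv (j.map φ) :=
        fun j => by
          rw [← cancel_epi (j.map φ), ← j.map_comp, Groupoid.comp_inv, Groupoid.comp_inv, j.map_id]
      rw [h1, h1, e]

variable {m : T.Scal} {f : T.Free2} (hi : IsTwistFor m f i) (hi' : IsTwistFor m f i')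
include hi hi'

/-- Both endofunctors are compatible with the tensor product. -/
theorem tensor {p q : ℕ} {t t' w w' : Option (FreeMagma Unit)} (ht : numLetters t = p)
    (hw : numLetters w = q) {g : Braid p} {h : Braid q}
    (hg : Agree i i' p t t' g) (hh : Agree i i' q w w' h) :
    Agree i i' (p + q) (concat t w) (concat t' w')
      (shift p 0 (p + q) (by omega) g * shift q p (p + q) le_rfl h) := fun htw s => by
  obtain ⟨Y, φ, hY, hφ, e⟩ := hg ht (fun x => s (Fin.castAdd q x))
  obtain ⟨Z, ψ, hZ, hψ, e'⟩ := hh hw (fun x => s (Fin.natAdd p x))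
  have hs : s = Fin.append (fun x => s (Fin.castAdd q x)) (fun x => s (Fin.natAdd p x)) :=
    (Fin.append_castAdd_natAdd).symm
  rw [hs]
  refine ⟨Y.tensor Z, PaB.tensorHom φ ψ, ?_, ?_, ?_⟩
  · change concat Y.t.1 Z.t.1 = _
    rw [hY, hZ]
  · rw [tensorHom_val, hφ, hψ]
    change cshift T p 0 (p + q) _ (cof T p g) * cshift T q p (p + q) _ (cof T q h) = _
    rw [cshift_cof, cshift_cof, map_mul]
  · exact (hi'.map_tensor φ ψ).trans (by rw [e, e']; exact (hi.map_tensor φ ψ).symm)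

theorem assoc (t w r : Option (FreeMagma Unit)) :
    Agree i i' (numLetters t + numLetters w + numLetters r) (concat (concat t w) r)
      (concat t (concat w r)) 1 := fun ht s => by
  obtain ⟨s1, s2, rfl⟩ : ∃ s1 s2, s = Fin.append s1 s2 := ⟨_, _, (Fin.append_castAdd_natAdd).symm⟩
  obtain ⟨s0, s1, rfl⟩ : ∃ a b, s1 = Fin.append a b := ⟨_, _, (Fin.append_castAdd_natAdd).symm⟩
  let X : PaB T S := ⟨_, ⟨t, rfl⟩, s0⟩
  let Y : PaB T S := ⟨_, ⟨w, rfl⟩, s1⟩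
  let Z : PaB T S := ⟨_, ⟨r, rfl⟩, s2⟩
  exact ⟨_, PaB.assoc X Y Z, rfl, (map_one (cof T _)).symm,
    (hi'.map_assoc X Y Z).trans (hi.map_assoc X Y Z).symm⟩

theorem sigma_two : Agree i i' 2 (some (.of () * .of ())) (some (.of () * .of ())) (sigma 2 0) :=
  fun ht s => by
  obtain ⟨s1, s2, rfl⟩ : ∃ (s1 s2 : Fin 1 → S), s = Fin.append s1 s2 :=
    ⟨_, _, (Fin.append_castAdd_natAdd (m := 1) (n := 1)).symm⟩
  let X : PaB T S := ⟨1, ⟨some (.of ()), rfl⟩, s1⟩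
  let Y : PaB T S := ⟨1, ⟨some (.of ()), rfl⟩, s2⟩
  refine ⟨_, PaB.braiding X Y, rfl, ?_, (hi'.map_braiding X Y).trans (hi.map_braiding X Y).symm⟩
  rw [braiding_val]
  change cof T 2 (bl 2 0 1 1) = _
  rw [bl_one_one]

/-- The endofunctors agree on the canonical isomorphisms. -/
theorem one_of_length {a b : FreeMagma Unit} (h : a.length = b.length) :
    Agree i i' a.length (some a) (some b) 1 := by
  refine (rel_of_length_eq (R := fun a b => a.length = b.length ∧
    Agree i i' a.length (some a) (some b) 1) ⟨fun a => ⟨rfl, refl _ _⟩, ?_, ?_⟩ ?_ ?_ h).2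
  · rintro a b ⟨h1, h2⟩
    have := h2.symm (n := a.length) rfl
    rw [inv_one] at this
    refine ⟨h1.symm, ?_⟩
    rw [h1] at this
    exact this
  · rintro a b c ⟨h1, h2⟩ ⟨h3, h4⟩
    refine ⟨h1.trans h3, ?_⟩
    rw [← h1] at h4
    have := h2.comp h4
    rwa [one_mul] at this
  · rintro a a' b b' ⟨h1, h2⟩ ⟨h3, h4⟩
    refine ⟨congrArg₂ (· + ·) h1 h3, ?_⟩
    have := tensor hi hi' (p := a.length) (q := b.length) (t := some a) (w := some b) rfl rfl h2 h4
    rw [map_one, map_one, one_mul] at this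
    exact this
  · intro a b c
    refine ⟨Nat.add_assoc _ _ _, ?_⟩
    exact assoc hi hi' (some a) (some b) (some c)

theorem one {n : ℕ} {t t' : Option (FreeMagma Unit)} (ht : numLetters t = n)
    (ht' : numLetters t' = n) : Agree i i' n t t' 1 := by
  subst ht
  rcases t with _ | a <;> rcases t' with _ | b
  · exact refl _ _
  · exact absurd ht' (FreeMagma.length_pos b).ne'
  · exact absurd ht'.symm (FreeMagma.length_pos a).ne'
  · exact one_of_length hi hi' ht'.symm

/-- The endofunctors agree on all uncompleted braids: a generator is, up to canonical isomorphisms,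
the tensor product of the braiding of two letters with identities. -/
theorem all {n : ℕ} {t t' : Option (FreeMagma Unit)} (ht : numLetters t = n)
    (ht' : numLetters t' = n) (g : Braid n) : Agree i i' n t t' g := by
  have hpar : ∀ k, ∃ t : Option (FreeMagma Unit), numLetters t = k := by
    intro k
    induction k with
    | zero => exact ⟨none, rfl⟩
    | succ k ih =>
      obtain ⟨t, rfl⟩ := ih
      exact ⟨_, (Par.concat ⟨t, rfl⟩ ⟨some (.of ()), rfl⟩).2⟩
  revert ht ht'
  refine braid_induction (p := fun g => ∀ t t', numLetters t = n → numLetters t' = n →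
    Agree i i' n t t' g) (fun t t' ht ht' => one hi hi' ht ht') ?_ ?_ ?_ g t t'
  · intro j hj t t' ht ht'
    obtain ⟨l, rfl⟩ : ∃ l, n = j + 2 + l := ⟨n - (j + 2), by omega⟩
    obtain ⟨w, hw⟩ := hpar j
    obtain ⟨r, hr⟩ := hpar l
    have h2 : numLetters (some (FreeMagma.of () * .of ())) = 2 := rfl
    have e2 : numLetters (concat w (some (.of () * .of ()))) = j + 2 := by
      subst hw; exact (Par.concat ⟨w, rfl⟩ ⟨some (.of () * .of ()), rfl⟩).2
    have e3 : numLetters (concat (concat w (some (.of () * .of ()))) r) = j + 2 + l :=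
      (Par.concat (⟨_, e2⟩ : Par (j + 2)) (⟨r, hr⟩ : Par l)).2
    have k := tensor hi hi' e2 hr (tensor hi hi' hw h2 (refl j w) (sigma_two hi hi')) (refl l r)
    rw [map_one, map_one, one_mul, mul_one, shift_sigma _ (by omega), shift_sigma _ (by omega),
      add_zero, zero_add] at k
    have := ((one hi hi' ht e3).comp k).comp (one hi hi' e3 ht')
    rwa [mul_one, one_mul] at this
  · intro g h hg hh t t' ht ht'
    exact (hh t t ht ht).comp (hg t t' ht ht')
  · intro g hg t t' ht ht'
    exact (hg t' t ht' ht).symm ht'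

end Agree

/-- The endofunctor is determined by its properties: on uncompleted braids by the values on the
generating morphisms, and in general by density. -/
theorem IsTwistFor.unique (hT : T.IsNice) {m : T.Scal} {f : T.Free2} (hi : IsTwistFor m f i)
    (hi' : IsTwistFor m f i') : i' = i := by
  ext X Y φ
  have h := hT.reg_ext (α := X ⟶ Y) (braidPerm X.n).ker (braidPerm X.n).ker (fun φ => φ.val)
    (fun φ => (i'.map φ).val) (fun φ => (i.map φ).val) (fun _ _ h => WordHom.ext h)
    (hi'.regular X Y) (hi.regular X Y) (fun a g hg => by
      let b : X ⟶ Y := ⟨a.len, cof T X.n g, fun x => by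
        have e1 : braidFamily.permC T X.n (cof T X.n g) = braidFamily.permC T X.n a.val :=
          permT_congr (braidPerm X.n) (by rw [hg]; exact T.proj_of _ g)
        change Y.s (Fin.cast _ (braidFamily.permC T X.n (cof T X.n g) x)) = _
        rw [e1]; exact a.compat x⟩
      have hn : X.n = Y.n := a.len
      refine ⟨b, rfl, congrArg _ ?_⟩
      exact (Agree.all hi hi' X.t.2 (Y.t.2.trans hn.symm) g).map_eq X.t.2 X.s b rfl rfl)
  exact WordHom.ext (congrFun h φ)

end Uniqueness

/-! ### The product of the Grothendieck–Teichmüller semigroup -/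

section Product
variable {T : Setting.{v}} (hT : T.IsNice) {G : Type} [Group G] {P : Subgroup G} [P.Normal]
open Setting.IsNice

theorem proj_pow (x : T.Obj G P) (c : T.Scal) : T.proj P (T.powT P x c) = 1 := T.proj_powT _ _ _

include hT in
theorem sub_gtTheta (p' : T.Scal × T.Free2) (f : T.Free2) {x y : T.Obj G P} (hx : T.proj P x = 1)
    (hy : T.proj P y = 1) : T.substT P (gtTheta p' f) x y =
      T.substT P f (T.substT P p'.2 x y * T.powT P x p'.1 * (T.substT P p'.2 x y)⁻¹)
        (T.powT P y p'.1) := by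
  rw [gtTheta, Setting.sub, hT.sub_sub hx hy, sub_mul hx hy, sub_mul hx hy, sub_inv hx hy,
    Setting.exp, Setting.exp, hT.sub_pow hx hy, hT.sub_pow hx hy, sub_X hx hy, sub_Y hx hy]

include hT in
theorem sub_gtMul (p p' : T.Scal × T.Free2) {x y : T.Obj G P} (hx : T.proj P x = 1)
    (hy : T.proj P y = 1) : T.substT P (gtMul p p').2 x y =
      T.substT P p.2 (T.substT P p'.2 x y * T.powT P x p'.1 * (T.substT P p'.2 x y)⁻¹)
        (T.powT P y p'.1) * T.substT P p'.2 x y := by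
  rw [gtMul, sub_mul hx hy, sub_gtTheta hT _ _ hx hy]

include hT in
/-- The other form of the product, in which the second argument is conjugated instead of the first.
-/
theorem sub_gtMul' (p p' : T.Scal × T.Free2) {x y : T.Obj G P} (hx : T.proj P x = 1)
    (hy : T.proj P y = 1) : T.substT P (gtMul p p').2 x y = T.substT P p'.2 x y *
      T.substT P p.2 (T.powT P x p'.1)
        ((T.substT P p'.2 x y)⁻¹ * T.powT P y p'.1 * T.substT P p'.2 x y) := by
  rw [sub_gtMul hT _ _ hx hy, eq_comm]
  refine hT.sub_intertwine (proj_pow _ _) ?_ (by group) (by group) _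
  simpa using proj_conj (proj_pow y p'.1) (T.substT P p'.2 x y)⁻¹

theorem gtTheta_mul (p' : T.Scal × T.Free2) (f g : T.Free2) :
    gtTheta p' (f * g) = gtTheta p' f * gtTheta p' g := by
  rw [gtTheta, Setting.sub, sub_mul (proj_free _) (proj_free _)]; rfl

include hT in
theorem gtTheta_gtTheta (p' p'' : T.Scal × T.Free2) (f : T.Free2) :
    gtTheta p'' (gtTheta p' f) = gtTheta (gtMul p' p'') f := by
  have pX := proj_free (genX T)
  have pY := proj_free (genY T)
  rw [gtTheta, Setting.sub, sub_gtTheta hT _ _ (proj_free _) (proj_free _), gtTheta, Setting.sub]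
  have e1 : T.substT ⊤ p'.2 (p''.2 * T.exp (genX T) p''.1 * p''.2⁻¹) (T.exp (genY T) p''.1) =
    gtTheta p'' p'.2 := rfl
  rw [e1, gtMul]
  dsimp only
  rw [Setting.exp, Setting.exp, Setting.exp, Setting.exp, ← hT.pow_conj (proj_pow _ _),
    ← hT.pow_mul _ _ pX, ← hT.pow_mul _ _ pY, mul_comm p''.1]
  congr 1
  group

include hT in
theorem gtMul_assoc (p p' p'' : T.Scal × T.Free2) :
    gtMul (gtMul p p') p'' = gtMul p (gtMul p' p'') := by
  refine Prod.ext (mul_assoc _ _ _) ?_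
  change gtTheta p'' (gtTheta p' p.2 * p'.2) * p''.2 =
    gtTheta (gtMul p' p'') p.2 * (gtTheta p'' p'.2 * p''.2)
  rw [gtTheta_mul, gtTheta_gtTheta hT, mul_assoc]

theorem one_gtMul (p : T.Scal × T.Free2) : gtMul (1, 1) p = p := by
  refine Prod.ext (one_mul _) ?_
  change T.substT ⊤ 1 _ _ * p.2 = p.2
  rw [one_sub (proj_free _) (proj_free _), one_mul]

include hT in
theorem gtMul_one (p : T.Scal × T.Free2) : gtMul p (1, 1) = p := by
  refine Prod.ext (mul_one _) ?_
  change T.substT ⊤ p.2 (1 * T.powT ⊤ (genX T) 1 * 1⁻¹) (T.powT ⊤ (genY T) 1) * 1 = p.2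
  rw [hT.pow_one _ _ (proj_free _), hT.pow_one _ _ (proj_free _), one_mul, inv_one, mul_one,
    mul_one, hT.sub_XY]

include hT in
theorem IsGT.one : IsGT T 0 1 where
  symm := by rw [Setting.sub, one_sub (proj_free _) (proj_free _), inv_one]
  hexagon := by
    simp only [Setting.sub, Setting.exp, one_sub (proj_free _) (proj_free _),
      hT.pow_zero (proj_free _), mul_one]
  pentagon := by simp

variable {m m' : T.Scal} {f f' : T.Free2}

include hT in
/-- The mirror image of the hexagon equation. -/
theorem IsGT.hexagon_of_mul' (hf : IsGT T m f) {x y z : T.Obj G P} (hx : T.proj P x = 1)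
    (hy : T.proj P y = 1) (hz : T.proj P z = 1) (h : x * y * z = 1) :
    T.substT P f z y * T.powT P z (m + 1) * T.substT P f x z * T.powT P x (m + 1) *
      T.substT P f y x * T.powT P y (m + 1) = 1 := by
  have hz' : z = y⁻¹ * x⁻¹ := by rw [← mul_inv_rev, eq_comm]; exact inv_eq_of_mul_eq_one_right h
  have e := IsGT.hexagon_of_mul hT hf hy hx (z := y * z * y⁻¹) (by rw [hz']; group)
  have k1 : T.substT P f (y * z * y⁻¹) y = y * T.substT P f z y * y⁻¹ := by
    rw [hT.sub_conj hz hy]; simp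
  have k2 : T.substT P f x (y * z * y⁻¹) = x⁻¹ * T.substT P f x z * x := by
    have := hT.sub_conj hx hz f x⁻¹
    rw [inv_inv] at this
    rw [this]
    congr 1
    · simp
    · rw [hz']; group
  have p1 : ∀ w : T.Obj G P, T.proj P w = 1 → T.powT P w (m + 1) = T.powT P w m * w :=
    fun w hw => by rw [hT.pow_add _ _ hw, hT.pow_one _ _ hw]
  have p2 : T.powT P x (m + 1) = x * T.powT P x m := by
    rw [add_comm, hT.pow_add _ _ hx, hT.pow_one _ _ hx]
  rw [k1, k2, ← hT.pow_conj hz] at e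
  rw [p2, p1 y hy, p1 z hz]
  have e' := congrArg (fun w => y⁻¹ * w * y) e
  simp only [mul_one, inv_mul_cancel] at e'
  rw [← e']
  have hz2 : z = y⁻¹ * x⁻¹ := hz'
  generalize T.powT P z m = zm
  generalize T.substT P f z y = a
  generalize T.substT P f x z = b
  generalize T.substT P f y x = c
  rw [hz2]
  group

include hT in
theorem gtMul_swap (hf : IsGT T m f) (hf' : IsGT T m' f') (l l' : T.Scal) {x y : T.Obj G P}
    (hx : T.proj P x = 1) (hy : T.proj P y = 1) :
    T.substT P (gtMul (l, f) (l', f')).2 y x = (T.substT P (gtMul (l, f) (l', f')).2 x y)⁻¹ := by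
  rw [sub_gtMul hT _ _ hx hy, sub_gtMul' hT _ _ hy hx]
  dsimp only
  rw [IsGT.swap hT hf' hx hy, inv_inv, IsGT.swap hT hf (proj_conj (proj_pow _ _) _) (proj_pow _ _),
    mul_inv_rev]

include hT in
/-- The hexagon equation for a product. With `F(x, y) = f'(x, y)`, it is the conjugate of the
hexagon equation of `f` at `x^{λ'}`, `F(x, y)⁻¹ y^{λ'} F(x, y)` and a conjugate of `z^{λ'}`, whose
product is trivial by the hexagon equations of `f'`. -/
theorem gtMul_hexagon (hf : IsGT T m f) (hf' : IsGT T m' f') (l : T.Scal) {x y z : T.Obj G P}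
    (hx : T.proj P x = 1) (hy : T.proj P y = 1) (hz : T.proj P z = 1) (h : x * y * z = 1) :
    T.substT P (gtMul (l, f) (1 + 2 * m', f')).2 z x * T.powT P z (m' + (1 + 2 * m') * m) *
      T.substT P (gtMul (l, f) (1 + 2 * m', f')).2 y z * T.powT P y (m' + (1 + 2 * m') * m) *
      T.substT P (gtMul (l, f) (1 + 2 * m', f')).2 x y * T.powT P x (m' + (1 + 2 * m') * m) = 1 := by
  have h1 := IsGT.hexagon_of_mul hT hf' hx hy h
  have h2 := IsGT.hexagon_of_mul' hT hf' hx hy hz h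
  rw [sub_gtMul' hT _ _ hx hy, sub_gtMul' hT _ _ hy hz, sub_gtMul' hT _ _ hz hx]
  rw [IsGT.swap hT hf' hy hz, IsGT.swap hT hf' hz hx, IsGT.swap hT hf' hx hy] at h2
  dsimp only
  set F := T.substT P f' x y with hF
  set F1 := T.substT P f' y z with hF1
  set F2 := T.substT P f' z x with hF2
  have e : (m' + 1) + m' = 1 + 2 * m' := by ring
  have pw : ∀ w : T.Obj G P, T.proj P w = 1 → T.powT P w (1 + 2 * m') =
      T.powT P w (m' + 1) * T.powT P w m' := fun w hw => by rw [← e, hT.pow_add _ _ hw]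
  have pw' : ∀ w : T.Obj G P, T.proj P w = 1 → T.powT P w (1 + 2 * m') =
      T.powT P w m' * T.powT P w (m' + 1) := fun w hw => by
    rw [← e, add_comm, hT.pow_add _ _ hw]
  have pM : ∀ w : T.Obj G P, T.proj P w = 1 → T.powT P w (m' + (1 + 2 * m') * m) =
      T.powT P (T.powT P w (1 + 2 * m')) m * T.powT P w m' := fun w hw => by
    rw [add_comm, hT.pow_add _ _ hw, hT.pow_mul _ _ hw]
  have cc : ∀ w : T.Obj G P, T.proj P w = 1 →
      T.powT P w m' * T.powT P w (1 + 2 * m') = T.powT P w (1 + 2 * m') * T.powT P w m' :=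
    fun w hw => by rw [← hT.pow_add _ _ hw, ← hT.pow_add _ _ hw, add_comm]
  -- The scalar of the product is `1 + 2 (m' + λ' m)`, since `λ' (1 + 2 m) = 1 + 2 m' + 2 λ' m`.
  rw [pM x hx, pM y hy, pM z hz]
  set A := T.powT P x (1 + 2 * m') with hA
  set B := F⁻¹ * T.powT P y (1 + 2 * m') * F with hB
  set v := F1 * T.powT P y m' * F with hv
  set C := v⁻¹ * T.powT P z (1 + 2 * m') * v with hC
  have pA : T.proj P A = 1 := proj_pow _ _
  have pB : T.proj P B = 1 := by simpa [hB] using proj_conj (proj_pow y (1 + 2 * m')) F⁻¹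
  have pC : T.proj P C = 1 := by simpa [hC] using proj_conj (proj_pow z (1 + 2 * m')) v⁻¹
  have hw : F2 * T.powT P z m' * v = (T.powT P x m')⁻¹ := by
    rw [eq_inv_iff_mul_eq_one, ← h1, hv]; simp only [mul_assoc]
  have ABC : A * B * C = 1 := by
    have h2' : T.powT P x (m' + 1) * F⁻¹ * T.powT P y (m' + 1) =
        F2 * (T.powT P z (m' + 1))⁻¹ * F1 := by
      rw [← mul_right_inj (F1⁻¹ * T.powT P z (m' + 1) * F2⁻¹)]
      calc _ = F1⁻¹ * T.powT P z (m' + 1) * F2⁻¹ * T.powT P x (m' + 1) * F⁻¹ *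
            T.powT P y (m' + 1) := by simp only [mul_assoc]
        _ = 1 := h2
        _ = _ := by group
    calc A * B * C = T.powT P x m' * (T.powT P x (m' + 1) * F⁻¹ * T.powT P y (m' + 1)) *
          (T.powT P y m' * F * v⁻¹) * T.powT P z (1 + 2 * m') * v := by
          rw [hA, hB, hC, pw' x hx, pw y hy]; group
      _ = T.powT P x m' * (F2 * T.powT P z m' * v) := by
          rw [h2', hv, pw z hz]
          group
      _ = 1 := by rw [hw, mul_inv_cancel]
  have hex := IsGT.hexagon_of_mul hT hf pA pB ABC
  -- the three factors, conjugated to a common basis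
  have k1 : T.substT P f (T.powT P y (1 + 2 * m')) (F1⁻¹ * T.powT P z (1 + 2 * m') * F1) *
      T.powT P (T.powT P y (1 + 2 * m')) m * T.powT P y m' * F =
      T.powT P y m' * F * (T.substT P f B C * T.powT P B m) := by
    have i1 : T.powT P y m' * F * B = T.powT P y (1 + 2 * m') * (T.powT P y m' * F) := by
      rw [hB, ← mul_assoc (T.powT P y (1 + 2 * m')), ← cc y hy]; group
    have i2 : T.powT P y m' * F * C =
        F1⁻¹ * T.powT P z (1 + 2 * m') * F1 * (T.powT P y m' * F) := by
      rw [hC, hv]; group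
    rw [← mul_assoc (T.powT P y m' * F), hT.sub_intertwine pB pC i1 i2, mul_assoc _ _ (T.powT P B m),
      hT.pow_intertwine pB i1]
    simp only [mul_assoc]
  have k2 : T.substT P f (T.powT P z (1 + 2 * m')) (F2⁻¹ * T.powT P x (1 + 2 * m') * F2) *
      T.powT P (T.powT P z (1 + 2 * m')) m * T.powT P z m' * v =
      T.powT P z m' * v * (T.substT P f C A * T.powT P C m) := by
    have i1 : T.powT P z m' * v * C = T.powT P z (1 + 2 * m') * (T.powT P z m' * v) := by
      rw [hC, ← mul_assoc (T.powT P z (1 + 2 * m')), ← cc z hz]; group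
    have i2 : T.powT P z m' * v * A =
        F2⁻¹ * T.powT P x (1 + 2 * m') * F2 * (T.powT P z m' * v) := by
      have : T.powT P z m' * v = F2⁻¹ * (T.powT P x m')⁻¹ := by rw [← hw]; group
      rw [this, hA]
      have c := cc x hx
      have : T.powT P x (1 + 2 * m') * (T.powT P x m')⁻¹ =
        (T.powT P x m')⁻¹ * T.powT P x (1 + 2 * m') := by
        rw [mul_inv_eq_iff_eq_mul, mul_assoc, ← c]; group
      rw [mul_assoc, ← this]; group
    rw [← mul_assoc (T.powT P z m' * v), hT.sub_intertwine pC pA i1 i2, mul_assoc _ _ (T.powT P C m),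
      hT.pow_intertwine pC i1]
    simp only [mul_assoc]
  calc _ = F2 * (T.substT P f (T.powT P z (1 + 2 * m')) (F2⁻¹ * T.powT P x (1 + 2 * m') * F2) *
        T.powT P (T.powT P z (1 + 2 * m')) m * T.powT P z m') * F1 *
        (T.substT P f (T.powT P y (1 + 2 * m')) (F1⁻¹ * T.powT P z (1 + 2 * m') * F1) *
        T.powT P (T.powT P y (1 + 2 * m')) m * T.powT P y m' * F) * T.substT P f A B *
        T.powT P A m * T.powT P x m' := by simp only [mul_assoc]; rfl
    _ = F2 * (T.substT P f (T.powT P z (1 + 2 * m')) (F2⁻¹ * T.powT P x (1 + 2 * m') * F2) *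
        T.powT P (T.powT P z (1 + 2 * m')) m * T.powT P z m' * v) *
        (T.substT P f B C * T.powT P B m) * T.substT P f A B *
        T.powT P A m * T.powT P x m' := by rw [k1, hv]; simp only [mul_assoc]
    _ = (F2 * T.powT P z m' * v) * (T.substT P f C A * T.powT P C m * T.substT P f B C *
        T.powT P B m * T.substT P f A B * T.powT P A m) * T.powT P x m' := by
        rw [k2]; simp only [mul_assoc]
    _ = 1 := by rw [hex, hw, mul_one, inv_mul_cancel]

end Product

section ProductPentagon
variable {T : Setting.{v}} (hT : T.IsNice) {m m' : T.Scal} {f f' : T.Free2} (hf' : IsGT T m' f')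
open Setting.IsNice

/-- The action on the other crossing of two blocks, with the ambient number of strands as a
parameter. -/
theorem actVal_bl {n p q : ℕ} (hn : p + q = n) {s t : Option (FreeMagma Unit)}
    (hs : numLetters s = p) (ht : numLetters t = q) :
    actVal hT hf' n (concat s t) (concat t s) (cof T n (bl n 0 p q)) = cbl m' n 0 p q := by
  subst hn; exact actVal_braiding hT hf' hs ht

include hT in
theorem cbl_mul_cbl {N o p q : ℕ} (h : o + p + q ≤ N) :
    cbl m' N o q p * cbl m' N o p q = T.powT _ (cdbl T N o p q) (1 + 2 * m') := by
  have pd : T.proj _ (cdbl T N o p q) = 1 := proj_cdbl h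
  have e : cof T N (bl N o p q) * cdbl T N o p q = cdbl T N o q p * cof T N (bl N o p q) := by
    rw [cdbl, cdbl, ← map_mul, ← map_mul, bl_dbl]
  have k := hT.pow_intertwine pd e m'
  rw [cbl, cbl, mul_assoc, ← mul_assoc (T.powT _ _ _), ← k, mul_assoc, ← hT.pow_add _ _ pd,
    ← mul_assoc, ← map_mul]
  change cdbl T N o p q * _ = _
  nth_rewrite 1 [← hT.pow_one _ _ pd]
  rw [← hT.pow_add _ _ pd, two_mul]

/-- The action on a double crossing. -/
theorem actVal_dbl {n p q : ℕ} (hn : p + q = n) {s t : Option (FreeMagma Unit)}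
    (hs : numLetters s = p) (ht : numLetters t = q) :
    actVal hT hf' n (concat s t) (concat s t) (cdbl T n 0 p q) =
      T.powT _ (cdbl T n 0 p q) (1 + 2 * m') := by
  rw [← cbl_mul_cbl hT (by omega), ← actVal_bl hT hf' hn hs ht,
    ← actVal_bl hT hf' (by omega : q + p = n) ht hs, ← actVal_mul, cdbl, dbl, map_mul]

theorem actVal_cbl {n p q : ℕ} (hn : p + q = n) {s t : Option (FreeMagma Unit)}
    (hs : numLetters s = p) (ht : numLetters t = q) :
    actVal hT hf' n (concat s t) (concat t s) (cbl m n 0 p q) =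
      cbl (m' + (1 + 2 * m') * m) n 0 p q := by
  have pd : T.proj _ (cdbl T n 0 p q) = 1 := proj_cdbl (by omega)
  rw [cbl, actVal_mul hT hf' _ (concat s t), actVal_pow hT hf' _ pd, actVal_bl hT hf' hn hs ht,
    actVal_dbl hT hf' hn hs ht, cbl, mul_assoc, ← hT.pow_mul _ _ pd, ← hT.pow_add _ _ pd, cbl]

theorem numLetters_concat (s t : Option (FreeMagma Unit)) :
    numLetters (concat s t) = numLetters s + numLetters t :=
  (Par.concat ⟨s, rfl⟩ ⟨t, rfl⟩).2

/-- The action of `(λ', f')` on an associator formed with `f` is the associator of the product: the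
action raises both arguments to the power `λ'`, the second one in another parenthesization, whence
the conjugation by the associator of `f'`. -/
theorem actVal_assr {p q r : ℕ} {s t w : Option (FreeMagma Unit)} (hs : numLetters s = p)
    (ht : numLetters t = q) (hw : numLetters w = r) (l : T.Scal) : actVal hT hf' (p + q + r)
      (concat (concat s t) w) (concat s (concat t w)) (assr f (p + q + r) 0 p q r) =
      assr (gtMul (l, f) (1 + 2 * m', f')).2 (p + q + r) 0 p q r := by
  have p1 : T.proj _ (cdbl T (p + q + r) 0 p q) = 1 := proj_cdbl (by omega)
  have p2 : T.proj _ (cdbl T (p + q + r) (0 + p) q r) = 1 := proj_cdbl (by omega)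
  have d1 : actVal hT hf' (p + q + r) (concat (concat s t) w) (concat (concat s t) w)
      (cdbl T (p + q + r) 0 p q) = T.powT _ (cdbl T (p + q + r) 0 p q) (1 + 2 * m') := by
    have n1 : numLetters (concat s t) = p + q := by rw [numLetters_concat, hs, ht]
    have := actVal_tensor hT hf' n1 n1 hw hw (cdbl T (p + q) 0 p q) 1
    rw [map_one, mul_one, cshift_cdbl _ (by omega), actVal_one, map_one, mul_one,
      actVal_dbl hT hf' rfl hs ht, cshift_pow hT _ (proj_cdbl (by omega)),
      cshift_cdbl _ (by omega)] at this
    exact this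
  have d2 : actVal hT hf' (p + q + r) (concat s (concat t w)) (concat s (concat t w))
      (cdbl T (p + q + r) (0 + p) q r) =
        T.powT _ (cdbl T (p + q + r) (0 + p) q r) (1 + 2 * m') := by
    have n1 : numLetters (concat t w) = q + r := by rw [numLetters_concat, ht, hw]
    have := actVal_tensor hT hf' hs hs n1 n1 1 (cdbl T (q + r) 0 q r)
    rw [map_one, one_mul, cshift_cdbl _ (by omega), actVal_one, map_one, one_mul,
      actVal_dbl hT hf' rfl ht hw, cshift_pow hT _ (proj_cdbl (by omega)),
      cshift_cdbl _ (by omega)] at this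
    rw [zero_add]
    generalize hN : p + (q + r) = N at this
    rw [← add_assoc] at hN
    subst hN
    exact this
  have a := actVal_assoc hT hf' hs ht hw
  set F := assr f' (p + q + r) 0 p q r with hF
  have e := actVal_mul hT hf' (concat (concat s t) w) (concat (concat s t) w)
    (concat s (concat t w)) 1 (assr f (p + q + r) 0 p q r)
  have e2 : actVal hT hf' (p + q + r) (concat (concat s t) w) (concat (concat s t) w)
      (cdbl T (p + q + r) (0 + p) q r) =
        F⁻¹ * T.powT _ (cdbl T (p + q + r) (0 + p) q r) (1 + 2 * m') * F := by
    rw [← d2, ← a, actVal, actVal, actVal]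
    simp only [map_one, mul_one]
    group
  rw [one_mul, a] at e
  rw [e, assr, actVal_sub hT hf' _ p1 p2, d1, e2]
  exact (sub_gtMul' hT (l, f) (1 + 2 * m', f') p1 p2).symm

include hT hf' in
/-- The pentagon equation for the product, in the completed braid group on four strands: the action
of `(λ', f')` is applied to the pentagon of `f` along the five parenthesizations of four letters. -/
theorem gtMul_pentagon (hf : IsGT T m f) (l : T.Scal) :
    assr (gtMul (l, f) (1 + 2 * m', f')).2 4 1 1 1 1 *
      assr (gtMul (l, f) (1 + 2 * m', f')).2 4 0 1 2 1 *
      assr (gtMul (l, f) (1 + 2 * m', f')).2 4 0 1 1 1 =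
    assr (gtMul (l, f) (1 + 2 * m', f')).2 4 0 1 1 2 *
      assr (gtMul (l, f) (1 + 2 * m', f')).2 4 0 2 1 1 := by
  let x : Option (FreeMagma Unit) := some (.of ())
  let xx : Option (FreeMagma Unit) := concat x x
  have hx : numLetters x = 1 := rfl
  have hxx : numLetters xx = 2 := rfl
  have pent := assr_pentagon hT hf (N := 4) (o := 0) (p := 1) (q := 1) (r := 1) (s := 1) le_rfl
  have k0 := actVal_assr hT hf' (f := f) hx hx hx l
  have k1 : actVal hT hf' 4 (concat x (concat xx x)) (concat x (concat x xx)) (assr f 4 1 1 1 1) =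
      assr (gtMul (l, f) (1 + 2 * m', f')).2 4 1 1 1 1 := by
    have := actVal_tensor hT hf' hx hx (t := concat xx x) (t' := concat x xx) (q := 3) rfl rfl 1
      (assr f 3 0 1 1 1)
    rw [map_one, one_mul, actVal_one, map_one, one_mul, cshift_assr hT _ _ (by omega)] at this
    refine this.trans ((congrArg (cshift T 3 1 (1 + 3) le_rfl) k0).trans ?_)
    exact cshift_assr hT _ _ (by omega)
  have k2 : actVal hT hf' 4 (concat (concat xx x) x) (concat (concat x xx) x) (assr f 4 0 1 1 1) =
      assr (gtMul (l, f) (1 + 2 * m', f')).2 4 0 1 1 1 := by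
    have := actVal_tensor hT hf' (s := concat xx x) (s' := concat x xx) (p := 3) rfl rfl hx hx
      (assr f 3 0 1 1 1) 1
    rw [map_one, mul_one, actVal_one, map_one, mul_one, cshift_assr hT _ _ (by omega)] at this
    refine this.trans ((congrArg (cshift T 3 0 (3 + 1) (by omega)) k0).trans ?_)
    exact cshift_assr hT _ _ (by omega)
  have k3 : actVal hT hf' 4 (concat (concat x xx) x) (concat x (concat xx x)) (assr f 4 0 1 2 1) =
      assr (gtMul (l, f) (1 + 2 * m', f')).2 4 0 1 2 1 := actVal_assr hT hf' hx hxx hx l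
  have k4 : actVal hT hf' 4 (concat xx xx) (concat x (concat x xx)) (assr f 4 0 1 1 2) =
      assr (gtMul (l, f) (1 + 2 * m', f')).2 4 0 1 1 2 := actVal_assr hT hf' hx hx hxx l
  have k5 : actVal hT hf' 4 (concat (concat xx x) x) (concat xx xx) (assr f 4 0 2 1 1) =
      assr (gtMul (l, f) (1 + 2 * m', f')).2 4 0 2 1 1 := actVal_assr hT hf' hxx hx hx l
  rw [← k1, ← k2, ← k3, ← k4, ← k5, ← actVal_mul, ← actVal_mul, ← actVal_mul]
  exact congrArg _ pent

include hT in
/-- The pentagon equation holds if it holds in the completed braid group, since the completion of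
the pure braid group embeds into the one of the braid group. -/
theorem pentagon_of_assr {g : T.Free2} (h : assr g 4 1 1 1 1 * assr g 4 0 1 2 1 *
    assr g 4 0 1 1 1 = assr g 4 0 1 1 2 * assr g 4 0 2 1 1) :
    faceC T 3 g * faceC T 1 g = faceC T 0 g * faceC T 2 g * faceC T 4 g := by
  have : Finite (Braid 4 ⧸ (braidPerm 4).ker) :=
    Finite.of_injective _ (QuotientGroup.kerLift_injective (braidPerm 4))
  refine hT.map_subtype_injective (braidPerm 4).ker ?_
  have hk : ∀ p ∈ (⊤ : Subgroup PureBraid4), (braidPerm 4).ker.subtype p ∈ (braidPerm 4).ker :=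
    fun p _ => p.2
  change T.map ⊤ (braidPerm 4).ker (braidPerm 4).ker.subtype hk _ =
    T.map ⊤ (braidPerm 4).ker (braidPerm 4).ker.subtype hk _
  obtain ⟨a1, a2, a3, a4, a5, a6, a7, a8, a9, a10⟩ := face_values (braidPerm 4).ker.subtype
  simp only [map_mul, map_faceC hT _ hk, a1, a2, a3, a4, a5, a6, a7, a8, a9, a10]
  have b1 : ∀ o, (bl 4 o 1 2 : Braid 4) = sigma 4 (o + 1) * sigma 4 o := fun o => by
    rw [show (2 : ℕ) = 1 + 1 from rfl, bl_add_right, bl_one_one, bl_one_one]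
  have b2 : ∀ o, (bl 4 o 2 1 : Braid 4) = sigma 4 o * sigma 4 (o + 1) := fun o => by
    rw [show (2 : ℕ) = 1 + 1 from rfl, bl_add_left, bl_one_one, bl_one_one]
  unfold assr cdbl dbl at h
  rw [b1, b1, b2, b2, bl_one_one, bl_one_one, bl_one_one] at h
  have e1 : ∀ i hi, (braidPerm 4).ker.subtype (sq i hi) = sigma 4 i * sigma 4 i := fun _ _ => rfl
  have e2 : ∀ i hi g, (braidPerm 4).ker.subtype (sandwich i hi g) = sigma 4 i * g.1 * sigma 4 i :=
    fun _ _ _ => rfl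
  simp only [e1, e2]
  simp only [mul_assoc] at h ⊢
  exact h.symm

include hT hf' in
theorem IsGT.mul (hf : IsGT T m f) (l : T.Scal) : IsGT T (m' + (1 + 2 * m') * m)
    (gtMul (l, f) (1 + 2 * m', f')).2 where
  symm := by
    rw [Setting.sub, gtMul_swap hT hf hf' _ _ (proj_free _) (proj_free _), hT.sub_XY]
  hexagon := gtMul_hexagon hT hf hf' l (proj_free _) (proj_free _) (proj_free _) (by
    rw [genZ, mul_inv_cancel])
  pentagon := pentagon_of_assr hT (gtMul_pentagon hT hf' hf l)

end ProductPentagon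

/-! ### Composites of the endofunctors -/

section Composite
variable {T : Setting.{v}} (hT : T.IsNice) {m m' : T.Scal} {f f' : T.Free2}
  (hf : IsGT T m f) (hf' : IsGT T m' f') {S : Type u}
open Setting.IsNice

theorem mirrorTree_mirrorTree (a : FreeMagma Unit) : mirrorTree (mirrorTree a) = a := by
  induction a using FreeMagma.recOnMul with
  | ih1 x => rfl
  | ih2 a b iha ihb =>
    change mirrorTree (mirrorTree a) * mirrorTree (mirrorTree b) = a * b
    rw [iha, ihb]

theorem map_mirrorTree_map (s : Option (FreeMagma Unit)) :
    (s.map mirrorTree).map mirrorTree = s := by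
  cases s <;> simp [mirrorTree_mirrorTree]

include hT in
theorem chalf_mul_chalf (n : ℕ) : chalf (T := T) m n * chalf m n =
    T.powT _ (cof T n (halfTwist n) * cof T n (halfTwist n)) (1 + 2 * m) := by
  have pz := proj_halfTwist_sq (T := T) n
  have c := hT.pow_intertwine pz (u := cof T n (halfTwist n))
    (y := cof T n (halfTwist n) * cof T n (halfTwist n)) (by rw [mul_assoc]) m
  rw [chalf, mul_assoc, ← mul_assoc (T.powT _ _ _), ← c, mul_assoc, ← hT.pow_add _ _ pz,
    ← mul_assoc, ← two_mul, hT.pow_add _ _ pz, hT.pow_one _ _ pz]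

/-- The action on full twists, which are composites of two half-twists. -/
theorem actVal_halfTwist_sq {n : ℕ} {s : Option (FreeMagma Unit)} (hs : numLetters s = n) :
    actVal hT hf' n s s (cof T n (halfTwist n) * cof T n (halfTwist n)) =
      T.powT _ (cof T n (halfTwist n) * cof T n (halfTwist n)) (1 + 2 * m') := by
  have h2 := actVal_half hT hf' (s := s.map mirrorTree) (n := n) (by
    subst hs; cases s <;> simp [numLetters, length_mirrorTree])
  rw [map_mirrorTree_map] at h2
  rw [actVal_mul hT hf' s (s.map mirrorTree), actVal_half hT hf' hs, h2, chalf_mul_chalf hT]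

theorem actVal_chalf {n : ℕ} {s : Option (FreeMagma Unit)} (hs : numLetters s = n) :
    actVal hT hf' n s (s.map mirrorTree) (chalf m n) = chalf (m' + (1 + 2 * m') * m) n := by
  have pz := proj_halfTwist_sq (T := T) n
  rw [chalf, actVal_mul hT hf' s s, actVal_pow hT hf' s pz, actVal_half hT hf' hs,
    actVal_halfTwist_sq hT hf' hs, chalf, mul_assoc, ← hT.pow_mul _ _ pz, ← hT.pow_add _ _ pz,
    chalf]

/-- The composite of `i` and `j`: first `i`, then `j`. -/
def IdEndofunctor.comp {C : Type u} [Category.{v} C] (i j : IdEndofunctor C) :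
    IdEndofunctor C where
  map φ := j.map (i.map φ)
  map_id X := by rw [i.map_id, j.map_id]
  map_comp φ ψ := by rw [i.map_comp, j.map_comp]

/-- The identity functor. -/
def IdEndofunctor.refl (C : Type u) [Category.{v} C] : IdEndofunctor C where
  map φ := φ
  map_id _ := rfl
  map_comp _ _ := rfl

/-- The composite of two of the endofunctors belongs to the product of the pairs. -/
theorem isTwistFor_comp (l : T.Scal) : IsTwistFor (m' + (1 + 2 * m') * m)
    (gtMul (l, f) (1 + 2 * m', f')).2 ((iFun hT hf S).comp (iFun hT hf' S)) where
  map_tensor φ ψ := by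
    change (iFun hT hf' S).map ((iFun hT hf S).map _) = _
    rw [(isTwistFor_iFun hT hf).map_tensor, (isTwistFor_iFun hT hf').map_tensor]; rfl
  map_braiding X Y := by
    change (iFun hT hf' S).map ((iFun hT hf S).map _) = _
    refine WordHom.ext ?_
    rw [(isTwistFor_iFun hT hf).map_braiding, twisted_braiding_val, iFun_val, twisted_braiding_val]
    exact actVal_cbl hT hf' rfl X.t.2 Y.t.2
  map_assoc X Y Z := by
    change (iFun hT hf' S).map ((iFun hT hf S).map _) = _
    refine WordHom.ext ?_
    rw [(isTwistFor_iFun hT hf).map_assoc, twisted_assoc_val, iFun_val, twisted_assoc_val]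
    exact actVal_assr hT hf' X.t.2 Y.t.2 Z.t.2 l
  map_star φ := by
    change (iFun hT hf' S).map ((iFun hT hf S).map _) = _
    rw [(isTwistFor_iFun hT hf).map_star, (isTwistFor_iFun hT hf').map_star]; rfl
  map_half X := by
    change (iFun hT hf' S).map ((iFun hT hf S).map _) = _
    refine WordHom.ext ?_
    rw [(isTwistFor_iFun hT hf).map_half, twisted_half_val, iFun_val, twisted_half_val]
    exact actVal_chalf hT hf' X.t.2
  regular X Y := by
    refine hT.reg_trans (α := X ⟶ Y) _ (braidPerm X.n).ker _ (fun φ => φ.val)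
      (fun φ => ((iFun hT hf S).map φ).val) _
      ((isTwistFor_iFun hT hf).regular X Y) ?_
    change T.Regular (braidPerm X.n).ker (braidPerm X.n).ker
      (fun φ : X ⟶ Y => ((iFun hT hf S).map φ).val)
      (fun φ => cPar f' X.n Y.t.1 0 * actC hT hf' X.n ((iFun hT hf S).map φ).val *
        (cPar f' X.n X.t.1 0)⁻¹)
    exact hT.reg_mul _ _ _ _ _ (hT.reg_mul _ _ _ _ _ (hT.reg_const _ _ _ _)
      (hT.reg_lift _ _ _ _ (fun φ : X ⟶ Y => ((iFun hT hf S).map φ).val)))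
      (hT.reg_const _ _ _ _)

include hT in
theorem isTwistFor_refl : IsTwistFor 0 1 (IdEndofunctor.refl (PaB T S)) where
  map_tensor _ _ := rfl
  map_braiding X Y := by
    refine WordHom.ext ?_
    rw [twisted_braiding_val, cbl, hT.pow_zero (proj_cdbl (by omega)), mul_one]
    exact braiding_val X Y
  map_assoc X Y Z := by
    refine WordHom.ext ?_
    rw [twisted_assoc_val, assr, one_sub (proj_cdbl (by omega)) (proj_cdbl (by omega))]
    rfl
  map_star _ := rfl
  map_half X := by
    refine WordHom.ext ?_
    rw [twisted_half_val, chalf, hT.pow_zero (proj_halfTwist_sq _), mul_one]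
    rfl
  regular X Y := hT.reg_refl _ _

end Composite

/-! ### The Grothendieck–Teichmüller semigroup -/

section Monoid
variable {T : Setting.{v}} (hT : T.IsNice)

/-- The Grothendieck–Teichmüller semigroup as a monoid. -/
@[reducible] def gtMonoid : Monoid (GT T) where
  mul g g' := ⟨gtMul g.1 g'.1, by
    obtain ⟨⟨l, f⟩, m, h, hf⟩ := g
    obtain ⟨⟨l', f'⟩, m', h', hf'⟩ := g'
    change l = _ at h
    change l' = _ at h'
    subst h h'
    exact ⟨_, by change (1 + 2 * m) * (1 + 2 * m') = _; ring, IsGT.mul hT hf' hf _⟩⟩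
  mul_assoc g g' g'' := Subtype.ext (gtMul_assoc hT g.1 g'.1 g''.1)
  one := ⟨(1, 1), 0, by change (1 : T.Scal) = 1 + 2 * 0; ring, IsGT.one hT⟩
  one_mul g := Subtype.ext (one_gtMul g.1)
  mul_one g := Subtype.ext (gtMul_one hT g.1)

/-- The scalar `m` for which `λ = 1 + 2 m`. -/
def GT.m (g : GT T) : T.Scal := g.2.choose

theorem GT.isGT (g : GT T) : IsGT T g.m g.1.2 := g.2.choose_spec.2

include hT in
theorem GT.m_eq {g : GT T} {m : T.Scal} (h : g.1.1 = 1 + 2 * m) : g.m = m :=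
  hT.two_cancel _ _ (add_left_cancel (g.2.choose_spec.1.symm.trans h))

include hT in
theorem isTwist_iff {S : Type u} {g : GT T} {m : T.Scal} (h : g.1.1 = 1 + 2 * m)
    {i : IdEndofunctor (PaB T S)} : IsTwist g i ↔ IsTwistFor m g.1.2 i := by
  refine ⟨fun ⟨m', h', hi⟩ => ?_, fun hi => ⟨m, h, hi⟩⟩
  rwa [← GT.m_eq hT h, GT.m_eq hT h']

/-- The endofunctor `i_g`. -/
def gtFun (S : Type u) (g : GT T) : IdEndofunctor (PaB T S) := iFun hT g.isGT S

theorem isTwist_gtFun {S : Type u} (g : GT T) : IsTwist g (gtFun hT S g) :=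
  ⟨g.m, g.2.choose_spec.1, isTwistFor_iFun hT g.isGT⟩

include hT in
theorem IsTwist.unique {S : Type u} {g : GT T} {i i' : IdEndofunctor (PaB T S)} (hi : IsTwist g i)
    (hi' : IsTwist g i') : i' = i :=
  IsTwistFor.unique hT ((isTwist_iff hT g.2.choose_spec.1).mp hi)
    ((isTwist_iff hT g.2.choose_spec.1).mp hi')

theorem gtFun_mul (S : Type u) (g g' : GT T) :
    let _ := gtMonoid hT
    gtFun hT S (g * g') = (gtFun hT S g).comp (gtFun hT S g') := by
  let _ := gtMonoid hT
  refine IsTwist.unique hT (g := g * g') ?_ (isTwist_gtFun hT _)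
  have h := g.2.choose_spec.1
  have h' := g'.2.choose_spec.1
  refine ⟨g'.m + (1 + 2 * g'.m) * g.m, ?_, ?_⟩
  · change g.1.1 * g'.1.1 = _
    rw [h, h']; change (1 + 2 * g.m) * (1 + 2 * g'.m) = _; ring
  · have e := isTwistFor_comp hT g.isGT g'.isGT (S := S) g.1.1
    have e' : (g * g').1.2 = (gtMul (g.1.1, g.1.2) (1 + 2 * g'.m, g'.1.2)).2 := by
      change (gtMul g.1 g'.1).2 = _
      rw [show (1 + 2 * g'.m, g'.1.2) = g'.1 from Prod.ext h'.symm rfl]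
    rw [e']; exact e

theorem gtFun_one (S : Type u) :
    let _ := gtMonoid hT
    gtFun hT S 1 = IdEndofunctor.refl _ := by
  let _ := gtMonoid hT
  exact IsTwist.unique hT (g := 1) ⟨0, by change (1 : T.Scal) = _; ring, isTwistFor_refl hT⟩
    (isTwist_gtFun hT _)

end Monoid

/-! ### Double crossings in the mapping class groups of the sphere -/

section SphereRelations
variable {n : ℕ}

/-- The class of a braid in the mapping class group. -/
def toMCG (n : ℕ) : Braid n →* SphereMCG n := QuotientGroup.mk' _

theorem toMCG_dbl_one {r : ℕ} (h : 1 + r = n) : toMCG n (dbl n 0 1 r) = 1 := by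
  obtain rfl : r = n - 1 := by omega
  refine (QuotientGroup.eq_one_iff _).mpr (Subgroup.subset_normalClosure ?_)
  exact Or.inr (sphereWord_eq n).symm

theorem toMCG_fullTwist : toMCG n (halfTwist n * halfTwist n) = 1 :=
  (QuotientGroup.eq_one_iff _).mpr (Subgroup.subset_normalClosure
    (Or.inl (fullTwist_eq n).symm))

theorem toMCG_dbl_strand {p r : ℕ} (h : p + 1 + r = n) :
    toMCG n (dbl n p 1 r) = (toMCG n (dbl n 0 p 1))⁻¹ := by
  have e := toMCG_dbl_one (r := p + r) (n := n) (by omega)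
  rw [dbl_add_right, zero_add, map_mul, map_mul] at e
  rw [show dbl n 0 p 1 = bl n 0 1 p * bl n 0 p 1 from rfl, map_mul (toMCG n) (bl n 0 1 p), eq_inv_iff_mul_eq_one]
  generalize toMCG n (dbl n p 1 r) = y at e ⊢
  generalize toMCG n (bl n 0 p 1) = a at e ⊢
  generalize toMCG n (bl n 0 1 p) = b at e ⊢
  have : a = (y * b)⁻¹ := by rw [eq_inv_iff_mul_eq_one, ← mul_assoc, e]
  rw [this]; group

/-- On the sphere, the full twist of a block around all the other strands is a braid of the
block. -/
theorem exists_toMCG_dbl (p : ℕ) : ∀ {r : ℕ} (h : p + r = n),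
    ∃ g : Braid p, toMCG n (dbl n 0 p r) = toMCG n (shift p 0 n (by omega) g) := by
  induction p with
  | zero => exact fun h => ⟨1, by simp⟩
  | succ p ih =>
    intro r h
    obtain ⟨g, hg⟩ := ih (r := 1 + r) (by omega)
    have e := dbl_mul_dbl (N := n) (o := 0) (p := p) (q := 1) (r := r) (by omega)
    have e' := congrArg (toMCG n) e
    rw [zero_add, map_mul, map_mul, toMCG_dbl_strand (by omega), hg, inv_mul_eq_iff_eq_mul] at e'
    refine ⟨(dbl (p + 1) 0 p 1)⁻¹ * (dbl (p + 1) 0 p 1)⁻¹ * shift p 0 (p + 1) (by omega) g, ?_⟩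
    simp only [map_mul, map_inv, shift_dbl (N := n) (n := p + 1) (k := 0) _ (by omega : 0 + p + 1 ≤ _),
      shift_shift, add_zero]
    rw [e']; group

/-- On the sphere, the double crossings of three blocks which contain all strands commute. -/
theorem commute_toMCG_dbl {p q r : ℕ} (h : p + q + r = n) :
    Commute (toMCG n (dbl n 0 p q)) (toMCG n (dbl n p q r)) := by
  obtain ⟨g, hg⟩ := exists_toMCG_dbl q (r := p + r) (n := n) (by omega)
  have e := dbl_add_right (N := n) (o := 0) (p := q) (q := p) (r := r)
  have e' := congrArg (toMCG n) e
  have c := bl_shift_left (N := n) (o := 0) (p := q) (q := p) (n := q) (k := 0) le_rfl (by omega)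
    (by omega) g
  have c' := congrArg (toMCG n) c
  have k : Commute (toMCG n (dbl n 0 p q)) (toMCG n (shift q p n (by omega) g)) :=
    (dbl_shift_right (by omega) (by omega) (by omega) g).map (toMCG n)
  simp only [zero_add] at e' c'
  rw [hg, map_mul, map_mul] at e'
  rw [map_mul, map_mul] at c'
  have hy : toMCG n (dbl n p q r) =
      (toMCG n (dbl n 0 p q))⁻¹ * toMCG n (shift q p n (by omega) g) := by
    rw [eq_inv_mul_iff_mul_eq, dbl, map_mul, ← mul_inv_eq_iff_eq_mul.mpr c']
    rw [e']; group
  rw [hy]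
  exact (Commute.refl _).inv_right.mul_right k

end SphereRelations

/-! ### The action on the completed mapping class groups -/

section Sphere
variable {T : Setting.{v}} (hT : T.IsNice) {m : T.Scal} {f : T.Free2} (hf : IsGT T m f)
open Setting.IsNice

/-- The completion of the mapping class group of the sphere with `n` marked points. -/
abbrev CSphere (T : Setting.{v}) (n : ℕ) : Type v := T.Obj (SphereMCG n) (spherePerm n).ker

/-- The morphism from the completed braid group to the completed mapping class group. -/
def csph (T : Setting.{v}) (n : ℕ) : CBraid T n →* CSphere T n :=
  T.map (braidPerm n).ker (spherePerm n).ker (QuotientGroup.mk' _) (mk_mem_ker n)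

theorem csph_cof {n : ℕ} (g : Braid n) :
    csph T n (cof T n g) = T.of (spherePerm n).ker (toMCG n g) := T.map_of _ _ _ _ g

theorem proj_csph {n : ℕ} {x : CBraid T n} (hx : T.proj _ x = 1) :
    T.proj (spherePerm n).ker (csph T n x) = 1 := by
  have := T.proj_map (braidPerm n).ker (spherePerm n).ker (QuotientGroup.mk' _) (mk_mem_ker n) x 1
    (by rw [hx, map_one])
  rw [map_one, map_one] at this
  exact this

include hT in
theorem csph_pow {n : ℕ} {x : CBraid T n} (hx : T.proj _ x = 1) (c : T.Scal) :
    csph T n (T.powT _ x c) = T.powT (spherePerm n).ker (csph T n x) c :=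
  hT.pow_map _ _ hx c

theorem csph_halfTwist_sq (n : ℕ) :
    csph T n (cof T n (halfTwist n) * cof T n (halfTwist n)) = 1 := by
  rw [← map_mul, csph_cof, toMCG_fullTwist, map_one]

theorem exists_numLetters (n : ℕ) : ∃ s : Option (FreeMagma Unit), numLetters s = n := by
  induction n with
  | zero => exact ⟨none, rfl⟩
  | succ n ih =>
    obtain ⟨s, rfl⟩ := ih
    exact ⟨concat s (some (.of ())), numLetters_concat _ _⟩

/-- If the braid `z` becomes trivial on the sphere and is raised to a power by the action, in some
parenthesization, then its image under the action is trivial on the sphere. -/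
theorem csph_actB_eq_one {n : ℕ} {s : Option (FreeMagma Unit)} {z : Braid n} {c : T.Scal}
    (h : csph T n (cof T n z) = 1) (hz : T.proj _ (cof T n z) = 1)
    (hs : actVal hT hf n s s (cof T n z) = T.powT _ (cof T n z) c) :
    csph T n (actB hT hf n z) = 1 := by
  have e := congrArg (csph T n) hs
  rw [csph_pow hT hz, h, hT.one_pow, actVal, actC_cof, map_mul, map_mul, map_inv] at e
  rwa [mul_inv_eq_one, mul_eq_left] at e

theorem csph_actB_fullTwist {n : ℕ} {g : Braid n} (h : g = fullTwist n) :
    csph T n (actB hT hf n g) = 1 := by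
  obtain ⟨s, hs⟩ := exists_numLetters n
  rw [fullTwist_eq] at h
  subst h
  refine csph_actB_eq_one hT hf (s := s) (c := 1 + 2 * m) ?_ ?_ ?_
  · rw [map_mul]; exact csph_halfTwist_sq n
  · rw [map_mul]; exact proj_halfTwist_sq n
  · rw [map_mul]; exact actVal_halfTwist_sq hT hf hs

theorem csph_actB_sphereWord {n : ℕ} {g : Braid n} (h : g = sphereWord n) :
    csph T n (actB hT hf n g) = 1 := by
  obtain _ | n := n
  · have : sphereWord 0 = 1 := by simp [sphereWord, rho, row]
    rw [this] at h
    rw [h, map_one, map_one]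
  obtain ⟨s, hs⟩ := exists_numLetters n
  have e : sphereWord (n + 1) = dbl (n + 1) 0 1 n := sphereWord_eq (n + 1)
  rw [e] at h
  subst h
  refine csph_actB_eq_one hT hf (s := concat (some (.of ())) s) (c := 1 + 2 * m) ?_
    (proj_cdbl (by omega)) (actVal_dbl hT hf (by omega) rfl hs)
  rw [csph_cof, toMCG_dbl_one (by omega), map_one]

/-- The action on the mapping class group. -/
def actMCG (n : ℕ) : SphereMCG n →* CSphere T n :=
  QuotientGroup.lift _ ((csph T n).comp (actB hT hf n)) (by
    refine Subgroup.normalClosure_le_normal (N := ((csph T n).comp (actB hT hf n)).ker) ?_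
    rintro g (h | h)
    · exact csph_actB_fullTwist hT hf h
    · exact csph_actB_sphereWord hT hf h)

theorem actMCG_toMCG {n : ℕ} (g : Braid n) :
    actMCG hT hf n (toMCG n g) = csph T n (actB hT hf n g) := rfl

theorem actMCG_kills (n : ℕ) : ∀ p ∈ (spherePerm n).ker,
    T.proj (spherePerm n).ker (actMCG hT hf n p) = 1 := by
  intro p hp
  obtain ⟨g, rfl⟩ := QuotientGroup.mk'_surjective _ p
  exact proj_csph (actB_kills hT hf n g hp)

/-- The action on the completed mapping class group. -/
def actSphere (n : ℕ) : CSphere T n →* CSphere T n :=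
  T.lift _ _ (actMCG hT hf n) (actMCG_kills hT hf n)

theorem actSphere_csph {n : ℕ} (x : CBraid T n) :
    actSphere hT hf n (csph T n x) = csph T n (actC hT hf n x) := by
  refine DFunLike.congr_fun (hT.hom_ext (P := (braidPerm n).ker) (Q := (spherePerm n).ker)
    (h := (actSphere hT hf n).comp (csph T n)) (h' := (csph T n).comp (actC hT hf n))
    (hT.regHom_lift_comp _ _ (hT.regHom_map _ _)) (hT.regHom_lift_comp _ _ (regHom_actC hT hf n))
    fun g => ?_) x
  change actSphere hT hf n (csph T n (cof T n g)) = csph T n (actC hT hf n (cof T n g))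
  rw [csph_cof, actSphere, T.lift_of, actMCG_toMCG, actC_cof]

theorem csph_surjective (hT : T.IsNice) (n : ℕ) : Function.Surjective (csph T n) :=
  hT.map_surjective _ _ _ _ (QuotientGroup.mk'_surjective _) fun _ h => h

include hT hf in
/-- The associator becomes trivial on the sphere when its three blocks contain all strands: its two
arguments commute. Hence the action does not depend on the place of the root. -/
theorem csph_assr {p q r : ℕ} {n : ℕ} (h : p + q + r = n) :
    csph T n (assr f n 0 p q r) = 1 := by
  have p1 : T.proj _ (cdbl T n 0 p q) = 1 := proj_cdbl (by omega)
  have p2 : T.proj _ (cdbl T n (0 + p) q r) = 1 := proj_cdbl (by omega)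
  have c := (commute_toMCG_dbl h).map (T.of (spherePerm n).ker)
  rw [← csph_cof, ← csph_cof] at c
  rw [assr]
  refine (hT.sub_map _ _ p1 p2 f).trans ?_
  rw [zero_add]
  exact IsGT.sub_of_commute hT hf (proj_csph p1) (proj_csph (by rwa [zero_add] at p2)) c

end Sphere

/-! ### Planar trees -/

section Trees

theorem leafSets_mul (a b : FreeMagma Unit) (o : ℕ) : leafSets (a * b) o =
    {Set.Ico o (o + a.length + b.length)} ∪ leafSets a o ∪ leafSets b (o + a.length) := rfl

theorem leafSets_of (x : Unit) (o : ℕ) : leafSets (.of x) o = {{o}} := rfl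

theorem length_mul (a b : FreeMagma Unit) : (a * b).length = a.length + b.length := rfl

theorem self_mem_leafSets (a : FreeMagma Unit) (o : ℕ) :
    Set.Ico o (o + a.length) ∈ leafSets a o := by
  induction a using FreeMagma.recOnMul with
  | ih1 x => exact Set.Ico_add_one_right_eq_Icc o o ▸ Set.Icc_self o
  | ih2 a b iha ihb =>
    rw [leafSets_mul, length_mul, ← add_assoc]
    exact Or.inl (Or.inl rfl)

theorem leafSets_subset {a : FreeMagma Unit} : ∀ {o : ℕ} {I : Set ℕ}, I ∈ leafSets a o →
    I.Nonempty ∧ I ⊆ Set.Ico o (o + a.length) := by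
  induction a using FreeMagma.recOnMul with
  | ih1 x =>
    rintro o I rfl
    exact ⟨⟨o, rfl⟩, fun i hi => by rw [Set.mem_singleton_iff.mp hi]; exact ⟨le_rfl, by simp⟩⟩
  | ih2 a b iha ihb =>
    intro o I hI
    have ha := a.length_pos
    rw [length_mul]
    rcases hI with (rfl | hI) | hI
    · exact ⟨⟨o, le_rfl, by omega⟩, fun i hi => ⟨hi.1, by have := hi.2; omega⟩⟩
    · exact ⟨(iha hI).1, fun i hi => ⟨((iha hI).2 hi).1, by have := ((iha hI).2 hi).2; omega⟩⟩
    · exact ⟨(ihb hI).1, fun i hi => ⟨by have := ((ihb hI).2 hi).1; omega,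
        by have := ((ihb hI).2 hi).2; omega⟩⟩

/-- The vertices of the left subtree are those which only contain leaves of it. -/
theorem leafSets_left {a b : FreeMagma Unit} {o : ℕ} {I : Set ℕ} : I ∈ leafSets a o ↔
    I ∈ leafSets (a * b) o ∧ I ⊆ Set.Ico o (o + a.length) := by
  refine ⟨fun h => ⟨Or.inl (Or.inr h), (leafSets_subset h).2⟩, ?_⟩
  rintro ⟨(rfl | h) | h, h'⟩
  · have hb := b.length_pos
    have := (h' (a := o + a.length) ⟨by omega, by omega⟩).2
    omega
  · exact h
  · obtain ⟨⟨i, hi⟩, hs⟩ := leafSets_subset h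
    have := (hs hi).1
    have := (h' hi).2
    omega

theorem leafSets_right {a b : FreeMagma Unit} {o : ℕ} {I : Set ℕ} :
    I ∈ leafSets b (o + a.length) ↔ I ∈ leafSets (a * b) o ∧
      I ⊆ Set.Ico (o + a.length) (o + a.length + b.length) := by
  refine ⟨fun h => ⟨Or.inr h, (leafSets_subset h).2⟩, ?_⟩
  rintro ⟨(rfl | h) | h, h'⟩
  · have ha := a.length_pos
    have := (h' (a := o) ⟨by omega, by omega⟩).1
    omega
  · obtain ⟨⟨i, hi⟩, hs⟩ := leafSets_subset h
    have := (hs hi).2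
    have := (h' hi).1
    omega
  · exact h

/-- The right subtree of a tree is at least as large as any other vertex which contains the last
leaf but not the first one. -/
theorem length_le_of_leafSets {a b c d : FreeMagma Unit} {o : ℕ} (hl : (a * b).length =
    (c * d).length) (h : leafSets (a * b) o = leafSets (c * d) o) : c.length ≤ a.length := by
  by_contra! hlt
  rw [length_mul, length_mul] at hl
  have ha := a.length_pos
  have hb := b.length_pos
  have hd := d.length_pos
  have hm : Set.Ico (o + a.length) (o + a.length + b.length) ∈ leafSets (c * d) o := by
    rw [← h]; exact Or.inr (self_mem_leafSets b _)
  rcases hm with (hm | hm) | hm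
  · have h1 : o ∈ Set.Ico (o + a.length) (o + a.length + b.length) := by
      rw [Set.mem_singleton_iff.mp hm]; exact ⟨le_rfl, by omega⟩
    have := h1.1
    omega
  · have hs := (leafSets_subset hm).2
    have := (hs (a := o + a.length + b.length - 1) ⟨by omega, by omega⟩).2
    omega
  · have hs := (leafSets_subset hm).2
    have := (hs (a := o + a.length) ⟨by omega, by omega⟩).1
    omega

/-- A tree is determined by the leaves below its vertices. -/
theorem leafSets_injective {a t : FreeMagma Unit} : ∀ {o : ℕ}, a.length = t.length →
    leafSets a o = leafSets t o → a = t := by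
  induction a using FreeMagma.recOnMul generalizing t with
  | ih1 x =>
    intro o hl h
    cases t using FreeMagma.recOnMul with
    | ih1 y => rfl
    | ih2 c d _ _ =>
      have := c.length_pos
      have := d.length_pos
      rw [length_mul] at hl
      change 1 = _ at hl
      omega
  | ih2 a b iha ihb =>
    intro o hl h
    cases t using FreeMagma.recOnMul with
    | ih1 y =>
      have := a.length_pos
      have := b.length_pos
      rw [length_mul] at hl
      change _ = 1 at hl
      omega
    | ih2 c d _ _ =>
      have e1 : a.length = c.length :=
        le_antisymm (length_le_of_leafSets hl.symm h.symm) (length_le_of_leafSets hl h)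
      have e2 : b.length = d.length := by rw [length_mul, length_mul] at hl; omega
      rw [iha (o := o) e1 (Set.ext fun I => by
        rw [leafSets_left (b := b), leafSets_left (a := c) (b := d), h, e1])]
      rw [ihb (o := o + a.length) e2 (Set.ext fun I => by
        rw [leafSets_right, e1, leafSets_right (a := c) (b := d), h, e2])]

theorem leafSets_shift (a : FreeMagma Unit) (k : ℕ) : ∀ o, leafSets a (k + o) =
    (fun I => (fun i => k + i) '' I) '' leafSets a o := by
  induction a using FreeMagma.recOnMul with
  | ih1 x => intro o; simp [leafSets_of]
  | ih2 a b iha ihb =>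
    intro o
    rw [leafSets_mul, leafSets_mul, Set.image_union, Set.image_union, ← iha, ← ihb,
      Set.image_singleton, Set.image_const_add_Ico]
    simp only [add_assoc]

/-- The mirror image reverses the sets of leaves. -/
theorem leafSets_mirrorTree (a : FreeMagma Unit) : ∀ o o', leafSets (mirrorTree a) o' =
    (fun I => (fun i => o + o' + a.length - 1 - i) '' I) '' leafSets a o := by
  induction a using FreeMagma.recOnMul with
  | ih1 x =>
    intro o o'
    change leafSets (.of x) o' = _
    simp only [leafSets_of, Set.image_singleton]
    congr 2
    change o' = o + o' + 1 - 1 - o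
    omega
  | ih2 a b iha ihb =>
    intro o o'
    change leafSets (mirrorTree b * mirrorTree a) o' = _
    have ha := a.length_pos
    have hb := b.length_pos
    rw [leafSets_mul, leafSets_mul, Set.image_union, Set.image_union, iha o, ihb (o + a.length),
      length_mirrorTree, length_mirrorTree, Set.image_singleton, length_mul, Set.union_right_comm]
    have e1 : o + (o' + b.length) + a.length - 1 = o + o' + (a.length + b.length) - 1 := by omega
    have e2 : o + a.length + o' + b.length - 1 = o + o' + (a.length + b.length) - 1 := by omega
    rw [e1, e2]
    congr 3
    ext i
    constructor
    · rintro ⟨h1, h2⟩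
      exact ⟨o + o' + (a.length + b.length) - 1 - i, ⟨by omega, by omega⟩, by
        change _ - (_ - i) = i; omega⟩
    · rintro ⟨j, ⟨h1, h2⟩, rfl⟩
      constructor <;> dsimp only <;> omega

variable {n : ℕ}

/-- The leaves in the set `I`, when there are `n` of them. -/
def leaves (n : ℕ) (I : Set ℕ) : Set (Fin n) := {i | (i : ℕ) ∈ I}

/-- The edges of the planar tree underlying a parenthesization, see `Par.edges`. -/
def edgesOf (n : ℕ) (t : Option (FreeMagma Unit)) : Set (Set (Fin n)) :=
  {A | A.Nonempty ∧ Aᶜ.Nonempty ∧ ∃ a ∈ t, ∃ I ∈ leafSets a 0, A = leaves n I ∨ Aᶜ = leaves n I}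

/-- The vertices of `t` become sides of edges of `t'`, or the set of all leaves, under `τ`. -/
def Carries (τ : Equiv.Perm (Fin n)) (t t' : Option (FreeMagma Unit)) : Prop :=
  ∀ a ∈ t, ∀ I ∈ leafSets a 0, ∃ a' ∈ t', ∃ I' ∈ leafSets a' 0,
    τ '' leaves n I = leaves n I' ∨ (τ '' leaves n I)ᶜ = leaves n I'

theorem Carries.image_mem {τ : Equiv.Perm (Fin n)} {t t' : Option (FreeMagma Unit)}
    (h : Carries τ t t') {A : Set (Fin n)} (hA : A ∈ edgesOf n t) : τ '' A ∈ edgesOf n t' := by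
  obtain ⟨h1, h2, a, ha, I, hI, e⟩ := hA
  obtain ⟨a', ha', I', hI', e'⟩ := h a ha I hI
  have hc : (τ '' A)ᶜ = τ '' Aᶜ := (Set.image_compl_eq τ.bijective).symm
  refine ⟨h1.image _, hc ▸ h2.image _, a', ha', I', hI', ?_⟩
  rcases e with e | e
  · rwa [e]
  · rw [hc, e]
    rw [← e, ← hc, compl_compl, or_comm] at e'
    rwa [← e, ← hc]

theorem Carries.edgesOf_eq {τ : Equiv.Perm (Fin n)} {t t' : Option (FreeMagma Unit)}
    (h : Carries τ t t') (h' : Carries τ⁻¹ t' t) : edgesOf n t' = (fun A => τ '' A) '' edgesOf n t := by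
  ext A
  constructor
  · intro hA
    refine ⟨(τ⁻¹ : Equiv.Perm (Fin n)) '' A, h'.image_mem hA, ?_⟩
    change τ '' ((τ⁻¹ : Equiv.Perm (Fin n)) '' A) = A
    rw [← Set.image_comp]
    simp
  · rintro ⟨B, hB, rfl⟩
    exact h.image_mem hB

theorem leaves_compl_Ico {o k l : ℕ} (h : o = 0 ∧ l = n) :
    (leaves n (Set.Ico o k))ᶜ = leaves n (Set.Ico k l) := by
  ext ⟨i, hi⟩
  simp only [leaves, Set.mem_compl_iff, Set.mem_ofPred_eq, Set.mem_Ico]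
  omega

theorem leaves_compl_Ico' {o k l : ℕ} (h : o = 0 ∧ l = n) :
    (leaves n (Set.Ico k l))ᶜ = leaves n (Set.Ico o k) := by
  ext ⟨i, hi⟩
  simp only [leaves, Set.mem_compl_iff, Set.mem_ofPred_eq, Set.mem_Ico]
  omega

/-- The two trees with three given subtrees at the root have the same edges. -/
theorem edgesOf_assoc (a b c : FreeMagma Unit) (h : a.length + b.length + c.length = n) :
    edgesOf n (some (a * (b * c))) = edgesOf n (some ((a * b) * c)) := by
  have k1 : Carries (1 : Equiv.Perm (Fin n)) (some ((a * b) * c)) (some (a * (b * c))) := by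
    rintro _ ⟨⟩ I hI
    refine ⟨_, rfl, ?_⟩
    rw [Equiv.Perm.coe_one, Set.image_id]
    rcases hI with (rfl | ((rfl | hI) | hI)) | hI
    · exact ⟨_, self_mem_leafSets _ 0, Or.inl (by simp only [length_mul, add_assoc])⟩
    · refine ⟨_, Or.inr (Or.inr (self_mem_leafSets c _)), Or.inr ?_⟩
      exact leaves_compl_Ico ⟨rfl, by omega⟩
    · exact ⟨I, Or.inl (Or.inr hI), Or.inl rfl⟩
    · exact ⟨I, Or.inr (Or.inl (Or.inr hI)), Or.inl rfl⟩
    · rw [length_mul, ← add_assoc] at hI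
      exact ⟨I, Or.inr (Or.inr hI), Or.inl rfl⟩
  have k2 : Carries (1 : Equiv.Perm (Fin n))⁻¹ (some (a * (b * c))) (some ((a * b) * c)) := by
    rintro _ ⟨⟩ I hI
    refine ⟨_, rfl, ?_⟩
    rw [inv_one, Equiv.Perm.coe_one, Set.image_id]
    rcases hI with (rfl | hI) | ((rfl | hI) | hI)
    · exact ⟨_, self_mem_leafSets _ 0, Or.inl (by simp only [length_mul, add_assoc])⟩
    · exact ⟨I, Or.inl (Or.inr (Or.inl (Or.inr hI))), Or.inl rfl⟩
    · refine ⟨_, Or.inl (Or.inr (Or.inl (Or.inr (self_mem_leafSets a _)))), Or.inr ?_⟩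
      exact leaves_compl_Ico' ⟨rfl, by omega⟩
    · exact ⟨I, Or.inl (Or.inr (Or.inr hI)), Or.inl rfl⟩
    · rw [add_assoc, ← length_mul] at hI
      exact ⟨I, Or.inr hI, Or.inl rfl⟩
  have := k1.edgesOf_eq k2
  rw [this]
  simp

/-- The vertices of `u` are the edges of `u * x`, where `x` is one leaf: they are oriented by
`x`. -/
theorem mem_edgesOf_concat (u : Option (FreeMagma Unit)) (I : Set ℕ) :
    (∃ a ∈ u, I ∈ leafSets a 0) ↔ I ⊆ Set.Iio (numLetters u) ∧
      leaves (numLetters u + 1) I ∈ edgesOf (numLetters u + 1) (concat u (some (.of ()))) := by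
  constructor
  · rintro ⟨a, rfl, hI⟩
    obtain ⟨⟨i, hi⟩, hs⟩ := leafSets_subset hI
    have hs' : I ⊆ Set.Iio a.length := fun j hj => by have := (hs hj).2; rwa [zero_add] at this
    refine ⟨hs', ⟨⟨i, (hs' hi).trans (Nat.lt_succ_self _)⟩, hi⟩, ⟨Fin.last _, fun h => ?_⟩, _, rfl, I,
      Or.inl (Or.inr hI), Or.inl rfl⟩
    exact Nat.lt_irrefl a.length (hs' h)
  · rintro ⟨hs, ⟨i, hi⟩, -, a, ha, J, hJ, e⟩
    rcases u with _ | b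
    · exact absurd (hs hi) (Nat.not_lt_zero _)
    obtain rfl : b * .of () = a := Option.some.inj ha
    change I ⊆ Set.Iio b.length at hs
    change leaves (b.length + 1) I = leaves (b.length + 1) J ∨
      (leaves (b.length + 1) I)ᶜ = leaves (b.length + 1) J at e
    have hlast : ∀ K : Set ℕ, (Fin.last b.length) ∈ leaves (b.length + 1) K ↔ b.length ∈ K :=
      fun K => Iff.rfl
    have hI : b.length ∉ I := fun h => Nat.lt_irrefl b.length (hs h)
    refine ⟨b, rfl, ?_⟩
    rcases hJ with (rfl | hJ) | hJ
    · exfalso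
      have hJ' : b.length ∈ Set.Ico 0 (0 + b.length + (FreeMagma.of ()).length) :=
        ⟨by omega, by simp⟩
      rcases e with e | e
      · rw [← hlast, ← e, hlast] at hJ'; exact hI hJ'
      · have : i ∈ (leaves (b.length + 1) I)ᶜ := by
          rw [e]; exact ⟨Nat.zero_le _, i.2.trans_le (Nat.add_le_add_right (Nat.zero_add _).ge 1)⟩
        exact this hi
    · have hJs : J ⊆ Set.Iio b.length := fun j hj => by
        have := ((leafSets_subset hJ).2 hj).2; rwa [zero_add] at this
      rcases e with e | e
      · have : I = J := by
          ext j
          constructor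
          · intro hj
            have : (⟨j, (hs hj).trans (Nat.lt_succ_self _)⟩ : Fin _) ∈ leaves (b.length + 1) I := hj
            rwa [e] at this
          · intro hj
            have : (⟨j, (hJs hj).trans (Nat.lt_succ_self _)⟩ : Fin _) ∈ leaves (b.length + 1) J := hj
            rwa [← e] at this
        rwa [this]
      · exfalso
        have : Fin.last b.length ∈ (leaves (b.length + 1) I)ᶜ := fun h => hI h
        rw [e, hlast] at this
        exact Nat.lt_irrefl b.length (hJs this)
    · rw [zero_add] at hJ
      obtain rfl : J = {b.length} := hJ
      rcases e with e | e
      · exfalso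
        have : b.length ∈ ({b.length} : Set ℕ) := rfl
        rw [← hlast, ← e] at this
        exact hI this
      · have : I = Set.Ico 0 (0 + b.length) := by
          ext j
          constructor
          · exact fun hj => ⟨Nat.zero_le _, by rw [zero_add]; exact hs hj⟩
          · rintro ⟨-, hj⟩
            rw [zero_add] at hj
            by_contra hn
            have : (⟨j, hj.trans (Nat.lt_succ_self _)⟩ : Fin _) ∈ (leaves (b.length + 1) I)ᶜ := hn
            rw [e] at this
            exact hj.ne this
        rw [this]
        exact self_mem_leafSets b 0

/-- A parenthesization is determined by the planar tree in which its root is replaced by a last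
leaf. -/
theorem eq_of_edgesOf_concat {u u' : Option (FreeMagma Unit)} (h : numLetters u = numLetters u')
    (he : edgesOf (numLetters u + 1) (concat u (some (.of ()))) =
      edgesOf (numLetters u + 1) (concat u' (some (.of ())))) : u = u' := by
  have key : ∀ I, (∃ a ∈ u, I ∈ leafSets a 0) ↔ ∃ a ∈ u', I ∈ leafSets a 0 := fun I => by
    rw [mem_edgesOf_concat, mem_edgesOf_concat, he, h]
  rcases u with _ | a <;> rcases u' with _ | b
  · rfl
  · exact absurd h b.length_pos.ne
  · exact absurd h.symm a.length_pos.ne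
  · refine congrArg some (leafSets_injective (o := 0) h (Set.ext fun I => ?_))
    simpa using key I

/-- Moving the root of a planar tree, one can always arrange that the right subtree is a leaf. -/
theorem exists_concat_leaf (r : Option (FreeMagma Unit) → Option (FreeMagma Unit) → Prop)
    (hr : ∀ t, r t t) (ht : ∀ s t w, r s t → r t w → r s w)
    (ha : ∀ a b c, r (some (a * (b * c))) (some ((a * b) * c))) (a : FreeMagma Unit) :
    ∃ u, r (some a) (concat u (some (.of ()))) := by
  cases a using FreeMagma.recOnMul with
  | ih1 x => exact ⟨none, hr _⟩
  | ih2 a b ha' hb' =>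
    clear ha' hb'
    induction b using FreeMagma.recOnMul generalizing a with
    | ih1 x => exact ⟨some a, hr _⟩
    | ih2 b c _ ihc =>
      obtain ⟨u, hu⟩ := ihc (a * b)
      exact ⟨u, ht _ _ _ (ha a b c) hu⟩

/-- The rotation of the plane moves the last leaf to the first place. -/
theorem isRenumbering_rotation (u : Option (FreeMagma Unit)) :
    edgesOf (numLetters u + 1) (concat (some (.of ())) u) =
      (fun A => finRotate (numLetters u + 1) '' A) ''
        edgesOf (numLetters u + 1) (concat u (some (.of ()))) := by
  rcases u with _ | b
  · refine Carries.edgesOf_eq ?_ ?_ <;>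
    · rintro _ ⟨⟩ _ rfl
      refine ⟨_, rfl, _, rfl, Or.inl ?_⟩
      have e : leaves (numLetters none + 1) {0} = Set.univ :=
        Set.eq_univ_of_forall fun i => Nat.lt_one_iff.mp i.2
      rw [e, Set.image_univ, Equiv.range_eq_univ]
  change edgesOf (b.length + 1) (some (.of () * b)) =
    (fun A => finRotate (b.length + 1) '' A) '' edgesOf (b.length + 1) (some (b * .of ()))
  have hrot : ∀ i : Fin (b.length + 1), ((finRotate (b.length + 1) i : Fin _) : ℕ) =
      (if (i : ℕ) = b.length then 0 else (i : ℕ) + 1 : ℕ) := fun i => by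
    rw [coe_finRotate]
    simp only [Fin.ext_iff, Fin.val_last]
  have himg : ∀ I : Set ℕ, I ⊆ Set.Iio b.length → finRotate (b.length + 1) '' leaves _ I =
      leaves _ ((fun i => 1 + i) '' I) := fun I hI => by
    ext i
    constructor
    · rintro ⟨j, hj, rfl⟩
      refine ⟨j, hj, ?_⟩
      have : (j : ℕ) < b.length := hI hj
      rw [hrot, if_neg this.ne]
      exact add_comm _ _
    · rintro ⟨j, hj, e⟩
      have hjb : j < b.length := hI hj
      refine ⟨⟨j, by omega⟩, hj, Fin.ext ?_⟩
      rw [hrot, if_neg hjb.ne]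
      change 1 + j = i at e
      change j + 1 = i
      omega
  have hlast : finRotate (b.length + 1) '' leaves _ {b.length} = leaves _ {0} := by
    ext i
    constructor
    · rintro ⟨j, hj, rfl⟩
      change (j : ℕ) = b.length at hj
      change ((finRotate (b.length + 1) j : Fin _) : ℕ) = 0
      rw [hrot, if_pos hj]
    · intro hi
      change (i : ℕ) = 0 at hi
      refine ⟨Fin.last _, rfl, Fin.ext ?_⟩
      rw [hrot, if_pos (by simp), hi]
  have huniv : ∀ τ : Equiv.Perm (Fin (b.length + 1)), ∀ k l, b.length + 1 ≤ k →
      b.length + 1 ≤ l → τ '' leaves _ (Set.Ico 0 k) = leaves _ (Set.Ico 0 l) := fun τ k l hk hl => by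
    have e : ∀ k, b.length + 1 ≤ k → leaves (b.length + 1) (Set.Ico 0 k) = Set.univ := fun k hk =>
      Set.eq_univ_of_forall fun i => ⟨Nat.zero_le _, i.2.trans_le hk⟩
    rw [e k hk, e l hl, Set.image_univ, τ.range_eq_univ]
  have hsub : ∀ I ∈ leafSets b 0, I ⊆ Set.Iio b.length := fun I hI j hj => by
    have := ((leafSets_subset hI).2 hj).2; rwa [zero_add] at this
  have hinv : ∀ A B : Set (Fin (b.length + 1)), finRotate (b.length + 1) '' A = B →
      ((finRotate (b.length + 1))⁻¹ : Equiv.Perm _) '' B = A := fun A B h => by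
    rw [← h, ← Set.image_comp]; simp
  refine Carries.edgesOf_eq ?_ ?_
  · rintro _ ⟨⟩ I hI
    refine ⟨_, rfl, ?_⟩
    rcases hI with (rfl | hI) | hI
    · refine ⟨_, Or.inl (Or.inl rfl), Or.inl (huniv _ _ _ ?_ ?_)⟩ <;> simp [add_comm]
    · refine ⟨_, Or.inr ?_, Or.inl (himg I (hsub I hI))⟩
      have := leafSets_shift b 1 0
      rw [add_comm] at this
      exact this ▸ ⟨I, hI, rfl⟩
    · rw [zero_add] at hI
      obtain rfl : I = {b.length} := hI
      exact ⟨_, Or.inl (Or.inr rfl), Or.inl hlast⟩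
  · rintro _ ⟨⟩ I hI
    refine ⟨_, rfl, ?_⟩
    rcases hI with (rfl | rfl) | hI
    · refine ⟨_, Or.inl (Or.inl rfl), Or.inl (huniv _ _ _ ?_ ?_)⟩ <;> simp [add_comm]
    · refine ⟨_, Or.inr rfl, Or.inl ?_⟩
      rw [zero_add]
      exact hinv _ _ hlast
    · have := leafSets_shift b 1 0
      rw [add_comm] at this
      change I ∈ leafSets b (0 + 1) at hI
      rw [this] at hI
      obtain ⟨J, hJ, rfl⟩ := hI
      exact ⟨J, Or.inl (Or.inr hJ), Or.inl (hinv _ _ (himg J (hsub J hJ)))⟩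

/-- The reflection of the plane takes a tree to its mirror image. -/
theorem isRenumbering_reflection {t : Option (FreeMagma Unit)} (ht : numLetters t = n) :
    edgesOf n (t.map mirrorTree) = (fun A => Fin.revPerm '' A) '' edgesOf n t := by
  have key : ∀ t : Option (FreeMagma Unit), numLetters t = n →
      Carries (Fin.revPerm : Equiv.Perm (Fin n)) t (t.map mirrorTree) := by
    rintro t ht a rfl I hI
    change a.length = n at ht
    have hs : I ⊆ Set.Iio a.length := fun j hj => by
      have := ((leafSets_subset hI).2 hj).2; rwa [zero_add] at this
    refine ⟨_, rfl, (fun i => 0 + 0 + a.length - 1 - i) '' I, ?_, Or.inl ?_⟩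
    · rw [leafSets_mirrorTree a 0 0]; exact ⟨I, hI, rfl⟩
    · ext i
      constructor
      · rintro ⟨j, hj, rfl⟩
        refine ⟨j, hj, ?_⟩
        change _ = ((Fin.rev j : Fin n) : ℕ)
        rw [Fin.val_rev]
        have := j.2
        dsimp only
        omega
      · rintro ⟨j, hj, e⟩
        have hj' : j < a.length := hs hj
        refine ⟨⟨j, by omega⟩, hj, Fin.ext ?_⟩
        change ((Fin.rev _ : Fin n) : ℕ) = _
        rw [Fin.val_rev]
        dsimp only at e ⊢
        omega
  refine (key t ht).edgesOf_eq ?_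
  have := key (t.map mirrorTree) (by subst ht; cases t <;> simp [numLetters, length_mirrorTree])
  rw [map_mirrorTree_map] at this
  exact this

end Trees

/-! ### The action on planar trees -/

section PlanarAction
variable {T : Setting.{v}} (hT : T.IsNice) {m : T.Scal} {f : T.Free2} (hf : IsGT T m f)
open Setting.IsNice

include hT hf in
/-- Moving the root does not change the image in the completed mapping class group. -/
theorem csph_cPar_assoc (a b c : FreeMagma Unit) {n : ℕ} (h : a.length + b.length + c.length = n) :
    csph T n (cPar f n (some (a * (b * c))) 0) = csph T n (cPar f n (some ((a * b) * c)) 0) := by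
  subst h
  have e := congrArg (csph T _) (actVal_assoc hT hf (s := some a) (t := some b) (w := some c)
    rfl rfl rfl)
  rw [actVal, map_one, mul_one, map_mul, map_inv] at e
  exact mul_inv_eq_one.mp (e.trans (csph_assr hT hf rfl))

/-- The relation between two parenthesizations which agree on the sphere. -/
def SameOnSphere (f : T.Free2) (t t' : Option (FreeMagma Unit)) : Prop :=
  numLetters t = numLetters t' ∧ ∀ n, numLetters t = n → edgesOf n t = edgesOf n t' ∧
    csph T n (cPar f n t 0) = csph T n (cPar f n t' 0)

include hT hf in
/-- On the sphere, every root can be moved to the edge of the last leaf by a sequence of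
associativity moves. -/
theorem exists_sameOnSphere (a : FreeMagma Unit) :
    ∃ u, SameOnSphere f (some a) (concat u (some (.of ()))) := by
  refine exists_concat_leaf (SameOnSphere f) (fun t => ⟨rfl, fun n _ => ⟨rfl, rfl⟩⟩)
    (fun s t w h h' => ⟨h.1.trans h'.1, fun n hn => ?_⟩) (fun a b c => ⟨?_, fun n hn => ?_⟩) a
  · obtain ⟨h1, h2⟩ := h.2 n hn
    obtain ⟨h3, h4⟩ := h'.2 n (h.1 ▸ hn)
    exact ⟨h1.trans h3, h2.trans h4⟩
  · exact (add_assoc _ _ _).symm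
  · have hn' : a.length + b.length + c.length = n := (add_assoc _ _ _).trans hn
    exact ⟨edgesOf_assoc a b c hn', csph_cPar_assoc hT hf a b c hn'⟩

include hT hf in
/-- On the sphere, the correction element of a parenthesization depends only on the underlying
planar tree. -/
theorem csph_cPar_eq {n : ℕ} {t t' : Option (FreeMagma Unit)} (h : numLetters t = n)
    (h' : numLetters t' = n) (he : edgesOf n t = edgesOf n t') :
    csph T n (cPar f n t 0) = csph T n (cPar f n t' 0) := by
  rcases t with _ | a
  · rcases t' with _ | a'
    · rfl
    · subst h; exact absurd h' a'.length_pos.ne'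
  rcases t' with _ | a'
  · subst h'; exact absurd h a.length_pos.ne'
  obtain ⟨u, hu, hu'⟩ := exists_sameOnSphere hT hf a
  obtain ⟨w, hw, hw'⟩ := exists_sameOnSphere hT hf a'
  obtain ⟨e1, e2⟩ := hu' n h
  obtain ⟨e3, e4⟩ := hw' n h'
  have l1 := numLetters_concat u (some (.of ()))
  have l2 := numLetters_concat w (some (.of ()))
  have hx : numLetters (some (FreeMagma.of ())) = 1 := rfl
  have hn : n = numLetters u + 1 := by rw [← h, hu, l1, hx]
  have hn' : n = numLetters w + 1 := by rw [← h', hw, l2, hx]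
  rw [e1, e3] at he
  rw [e2, e4, eq_of_edgesOf_concat (u := u) (u' := w) (by omega) (by rw [← hn]; exact he)]

/-- The correction element of a planar tree, formed with an arbitrary root; by `cPl_eq` it does not
depend on the choice of the root. -/
def cPl (f : T.Free2) {n : ℕ} (t : PlT n) : CSphere T n := csph T n (cPar f n t.2.choose.1 0)

include hT hf in
theorem cPl_eq {n : ℕ} {t : PlT n} {a : Option (FreeMagma Unit)} (ha : numLetters a = n)
    (h : t.1 = edgesOf n a) : cPl f t = csph T n (cPar f n a 0) :=
  csph_cPar_eq hT hf t.2.choose.2 ha (t.2.choose_spec.trans h)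

theorem proj_csph_cPar (f : T.Free2) (n : ℕ) (t : Option (FreeMagma Unit)) :
    T.proj (spherePerm n).ker (csph T n (cPar f n t 0)) = 1 := proj_csph (proj_cPar _ _)

theorem proj_csph' {n : ℕ} (x y : CBraid T n) (h : T.proj _ x = T.proj _ y) :
    T.proj (spherePerm n).ker (csph T n x) = T.proj (spherePerm n).ker (csph T n y) := by
  have : T.proj _ (x * y⁻¹) = 1 := by rw [map_mul, map_inv, h, mul_inv_cancel]
  have e := proj_csph this
  rwa [map_mul, map_inv, map_mul, map_inv, mul_inv_eq_one] at e

theorem proj_actSphere {n : ℕ} (x : CSphere T n) :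
    T.proj (spherePerm n).ker (actSphere hT hf n x) = T.proj (spherePerm n).ker x := by
  obtain ⟨y, rfl⟩ := csph_surjective hT n x
  rw [actSphere_csph]
  exact proj_csph' _ _ (proj_actC hT hf y)

/-- The action on morphisms between planar trees. -/
def plVal (n : ℕ) (t t' : PlT n) (x : CSphere T n) : CSphere T n :=
  cPl f t' * actSphere hT hf n x * (cPl f t)⁻¹

theorem proj_plVal {n : ℕ} (t t' : PlT n) (x : CSphere T n) :
    T.proj (spherePerm n).ker (plVal hT hf n t t' x) = T.proj (spherePerm n).ker x := by
  rw [plVal, map_mul, map_mul, map_inv, cPl, cPl, proj_csph_cPar, proj_csph_cPar, proj_actSphere,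
    one_mul, inv_one, mul_one]

theorem plVal_mul {n : ℕ} (s t r : PlT n) (y x : CSphere T n) :
    plVal hT hf n s r (y * x) = plVal hT hf n t r y * plVal hT hf n s t x := by
  simp only [plVal, map_mul]; group

theorem plVal_one {n : ℕ} (s : PlT n) : plVal hT hf n s s 1 = 1 := by
  simp [plVal]

/-- The action on planar trees is induced by the action on rooted trees, for all choices of the
roots. -/
theorem plVal_csph {n : ℕ} {t t' : PlT n} {a a' : Option (FreeMagma Unit)} (ha : numLetters a = n)
    (ha' : numLetters a' = n) (h : t.1 = edgesOf n a) (h' : t'.1 = edgesOf n a') (x : CBraid T n) :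
    plVal hT hf n t t' (csph T n x) = csph T n (actVal hT hf n a a' x) := by
  rw [plVal, cPl_eq hT hf ha h, cPl_eq hT hf ha' h', actSphere_csph, actVal, map_mul, map_mul,
    map_inv]

/-- The rotations are fixed by the action. -/
theorem plVal_rotation {n : ℕ} {t t' : PlT n} (h : PlT.IsRenumbering (finRotate n) t t') :
    plVal hT hf n t t' (csph T n (cof T n (rho n (n - 1)))) =
      csph T n (cof T n (rho n (n - 1))) := by
  obtain ⟨⟨a, ha⟩, hta⟩ := t.2
  replace hta : t.1 = edgesOf n a := hta.symm
  rcases a with _ | a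
  · obtain rfl : 0 = n := ha
    have : rho 0 (0 - 1) = 1 := rfl
    have ht' : t'.1 = edgesOf 0 none := by
      rw [show t'.1 = _ from h, hta]
      have : edgesOf 0 none = ∅ := Set.eq_empty_of_forall_notMem fun A hA => by
        obtain ⟨⟨i, hi⟩, -⟩ := hA; exact i.elim0
      rw [this, Set.image_empty]
    rw [plVal_csph hT hf (n := 0) (a := none) (a' := none) rfl rfl hta ht', this, map_one, actVal_one]
  -- With the root on the edge of the last leaf, a rotation exchanges the two subtrees at the root,
  -- and is the crossing of the last strand with all others.
  obtain ⟨u, hu, hu'⟩ := exists_sameOnSphere hT hf a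
  have e := (hu' n ha).1
  rw [numLetters_concat] at hu
  have hn : n = numLetters u + 1 := ha.symm.trans hu
  subst hn
  have ht' : t'.1 = edgesOf _ (concat (some (.of ())) u) := by
    rw [show t'.1 = _ from h, isRenumbering_rotation, hta, e]
  have hr : cof T (numLetters u + 1) (rho (numLetters u + 1) (numLetters u + 1 - 1)) =
      cof T (numLetters u + 1) (bl (numLetters u + 1) 0 (numLetters u) 1) :=
    congrArg _ (rho_eq_bl _)
  rw [plVal_csph hT hf (n := numLetters u + 1) (a := concat u (some (.of ()))) (numLetters_concat _ _)
    ((numLetters_concat _ _).trans (add_comm _ _)) (hta.trans e) ht', hr,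
    actVal_bl hT hf (n := numLetters u + 1) (p := numLetters u) (q := 1) (s := u)
      (t := some (.of ())) rfl rfl rfl, cbl, map_mul, csph_pow hT (proj_cdbl (by omega))]
  -- The double crossing of one strand with all others is the sphere relation, so that the twisted
  -- crossing agrees with the crossing.
  have hd : csph T (numLetters u + 1) (cdbl T (numLetters u + 1) 0 (numLetters u) 1) = 1 := by
    have k := bl_dbl (N := numLetters u + 1) 0 (numLetters u) 1
    have k' := congrArg (toMCG (numLetters u + 1)) k
    rw [map_mul, map_mul, toMCG_dbl_one (add_comm _ _), one_mul, mul_eq_left] at k'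
    rw [cdbl, csph_cof, k', map_one]
  rw [hd, hT.one_pow, mul_one]

/-- The reflections are fixed by the action. -/
theorem plVal_reflection {n : ℕ} {t t' : PlT n} (h : PlT.IsRenumbering Fin.revPerm t t') :
    plVal hT hf n t t' (csph T n (cof T n (halfTwist n))) = csph T n (cof T n (halfTwist n)) := by
  obtain ⟨⟨a, ha⟩, hta⟩ := t.2
  replace hta : t.1 = edgesOf n a := hta.symm
  have ht' : t'.1 = edgesOf n (a.map mirrorTree) := by
    rw [show t'.1 = _ from h, hta, isRenumbering_reflection ha]
  rw [plVal_csph hT hf ha (by subst ha; cases a <;> simp [numLetters, length_mirrorTree]) hta ht',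
    actVal_half hT hf ha, chalf, map_mul, csph_pow hT (proj_halfTwist_sq n), csph_halfTwist_sq,
    hT.one_pow, mul_one]

variable (S : Type u)

/-- The endofunctor of `PaDihTilde` given by the action on planar trees. -/
def tildeFun : IdEndofunctor (PaDihTilde T S) where
  map {X Y} φ :=
    { len := φ.len
      val := cPl f ((show Y.n = X.n from φ.len.symm) ▸ Y.t) * actSphere hT hf X.n φ.val * (cPl f X.t)⁻¹
      compat := fun i => by
        have h : sphereFamily.permC T X.word.1 (plVal hT hf X.n X.t ((show Y.n = X.n from φ.len.symm) ▸ Y.t) φ.val) =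
            sphereFamily.permC T X.word.1 φ.val :=
          permT_congr (spherePerm X.n) (proj_plVal hT hf _ _ _)
        exact (congrArg (fun p : Equiv.Perm (Fin X.n) => Y.s (Fin.cast φ.len (p i))) h).trans
          (φ.compat i) }
  map_id X := WordHom.ext (plVal_one hT hf X.t)
  map_comp {X Y Z} φ ψ := by
    obtain ⟨n, t, s⟩ := X
    obtain ⟨n', t', s'⟩ := Y
    obtain ⟨n'', t'', s''⟩ := Z
    obtain ⟨h, x, hx⟩ := φ
    obtain ⟨h', y, hy⟩ := ψ
    change n = n' at h
    change n' = n'' at h'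
    subst h h'
    exact WordHom.ext (plVal_mul hT hf t t' t'' y x)

/-- The isomorphisms which are identified with identities in the quotient category are fixed. -/
theorem tildeFun_gen {X Y : PaDihTilde T S} (φ : X ⟶ Y) (h : PaDihTilde.dihedral T S φ) :
    (tildeFun hT hf S).map φ = φ := by
  cases h with
  | rotation ht hs φ hφ =>
    refine WordHom.ext (Eq.trans (b := plVal hT hf _ _ _ φ.val) rfl ?_)
    rw [hφ]
    change plVal hT hf _ _ _ (T.of (spherePerm _).ker (toMCG _ _)) =
      T.of (spherePerm _).ker (toMCG _ _)
    rw [← csph_cof]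
    exact plVal_rotation hT hf ht
  | reflection ht hs φ hφ =>
    refine WordHom.ext (Eq.trans (b := plVal hT hf _ _ _ φ.val) rfl ?_)
    rw [hφ]
    change plVal hT hf _ _ _ (T.of (spherePerm _).ker (toMCG _ _)) =
      T.of (spherePerm _).ker (toMCG _ _)
    rw [← csph_cof]
    exact plVal_reflection hT hf ht

/-- The endofunctors for rooted and planar trees are compatible with forgetting the root. -/
theorem toTilde_iFun {X Y : PaB T S} (φ : X ⟶ Y) : (PaB.toTilde T S).map ((iFun hT hf S).map φ) =
    (tildeFun hT hf S).map ((PaB.toTilde T S).map φ) := by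
  obtain ⟨n, t, s⟩ := X
  obtain ⟨n', t', s'⟩ := Y
  obtain ⟨h, x, hx⟩ := φ
  change n = n' at h
  subst h
  exact WordHom.ext (plVal_csph hT hf (t := t.toPlT) (t' := t'.toPlT) t.2 t'.2 rfl rfl x).symm

end PlanarAction

/-! ### Functors on the quotient category -/

section CollapseFunctor
variable {C : Type u} [Groupoid.{v} C] {W : MorphismProperty C}

/-- An endofunctor which fixes `W` fixes all the morphisms generated by `W` and their inverses. -/
theorem IdEndofunctor.map_genBy {i : IdEndofunctor C}
    (hi : ∀ {X Y : C} (φ : X ⟶ Y), W φ → i.map φ = φ) {X Y : C} (φ : X ⟶ Y) (h : GenBy W φ) :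
    i.map φ = φ := by
  induction h with
  | of φ h => exact hi φ h
  | id X => exact i.map_id X
  | comp φ ψ _ _ h h' => rw [i.map_comp, h, h']
  | @inv X Y φ _ h =>
    have e := i.map_comp φ (Groupoid.inv φ)
    rw [Groupoid.comp_inv, i.map_id, h] at e
    rw [← Category.id_comp (i.map _), ← Groupoid.inv_comp φ, Category.assoc, ← e, Category.comp_id]

namespace Collapse

/-- The map on morphisms of the quotient category induced by an endofunctor. -/
def mapHom (i : IdEndofunctor C) (hi : ∀ {X Y : C} (φ : X ⟶ Y), W φ → i.map φ = φ)
    {α β : Collapse W} : Hom α β → Hom α β :=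
  Quot.map (fun p => ⟨p.hsrc, p.htgt, i.map p.hom⟩) (by
    rintro _ _ (⟨hX, hY, hX', hY', φ, j, k, hj, hk⟩ | ⟨hX, hY, φ, j, k, ψ, hj, hk⟩)
    · dsimp only
      rw [i.map_comp, i.map_comp, IdEndofunctor.map_genBy hi j hj,
        IdEndofunctor.map_genBy hi k hk]
      exact .move _ _ _ _ _ _ _ hj hk
    · dsimp only
      rw [i.map_comp, i.map_comp, i.map_comp, i.map_comp, IdEndofunctor.map_genBy hi j hj,
        IdEndofunctor.map_genBy hi k hk]
      exact .middle _ _ _ _ _ _ hj hk)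

/-- The endofunctor of the quotient category induced by an endofunctor which fixes `W`. -/
def mapFunctor (i : IdEndofunctor C) (hi : ∀ {X Y : C} (φ : X ⟶ Y), W φ → i.map φ = φ) :
    Collapse W ⥤ Collapse W where
  obj α := α
  map φ := mapHom i hi φ
  map_id α := by
    change Quot.mk _ _ = Quot.mk _ _
    congr 1
    change (⟨_, _, i.map (𝟙 _)⟩ : Rep α α) = _
    rw [i.map_id]; rfl
  map_comp := by
    rintro α β γ ⟨p⟩ ⟨q⟩
    obtain ⟨k, hk⟩ := p.connect q
    change mapHom i hi (Quot.mk _ (p.comp q)) =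
      Quot.mk _ (Rep.comp ⟨p.hsrc, p.htgt, i.map p.hom⟩ ⟨q.hsrc, q.htgt, i.map q.hom⟩)
    rw [Rep.mk_comp p q k hk, Rep.mk_comp ⟨p.hsrc, p.htgt, i.map p.hom⟩ ⟨q.hsrc, q.htgt, i.map q.hom⟩
      k hk]
    change Quot.mk _ (⟨_, _, i.map (p.hom ≫ k ≫ q.hom)⟩ : Rep α γ) = _
    rw [i.map_comp, i.map_comp, IdEndofunctor.map_genBy hi k hk]

end Collapse
end CollapseFunctor

/-! ### The action on the universal contraction -/

section Final
variable {T : Setting.{v}} (hT : T.IsNice) (S : Type u)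

include hT in
/-- A functor on `PaDih` is determined by its composite with the contraction. -/
theorem contraction_cancel {J J' : PaDih T S ⥤ PaDih T S}
    (h : contraction T S ⋙ J = contraction T S ⋙ J') : J = J' := by
  have hobj : ∀ α, J.obj α = J'.obj α := by
    rintro ⟨⟨n, ⟨_, t, rfl⟩, s⟩⟩
    exact Functor.congr_obj h (⟨n, t, s⟩ : PaB T S)
  refine Functor.hext hobj ?_
  rintro α β ⟨p⟩
  obtain @⟨X, Y, h1, h2, φ⟩ := p
  subst h1 h2
  obtain ⟨n, ⟨_, t, rfl⟩, s⟩ := X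
  obtain ⟨n', ⟨_, t', rfl⟩, s'⟩ := Y
  obtain ⟨hl, x, hx⟩ := φ
  obtain ⟨y, rfl⟩ := csph_surjective hT n x
  have hy : ∀ i : Fin n, s' (Fin.cast hl (braidFamily.permC T n y i)) = s i := fun i => by
    have e := permC_toSphere n y
    rw [← e]; exact hx i
  exact Functor.hcongr_hom h (X := (⟨n, t, s⟩ : PaB T S)) (Y := ⟨n', t', s'⟩) ⟨hl, y, hy⟩

/-- The endofunctor `j_g`. -/
def jFun (g : GT T) : PaDih T S ⥤ PaDih T S :=
  Collapse.mapFunctor (tildeFun hT g.isGT S) (tildeFun_gen hT g.isGT S)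

/-- The endofunctor `j_g` is compatible with `i_g` through the contraction. -/
theorem contraction_jFun (g : GT T) :
    contraction T S ⋙ jFun hT S g = (gtFun hT S g).toFunctor ⋙ contraction T S := by
  refine Functor.hext (fun _ => rfl) fun X Y φ => heq_of_eq ?_
  change (Collapse.quotientFunctor (PaDihTilde.dihedral T S)).map
      ((tildeFun hT g.isGT S).map ((PaB.toTilde T S).map φ)) =
    (Collapse.quotientFunctor (PaDihTilde.dihedral T S)).map ((PaB.toTilde T S).map _)
  rw [← toTilde_iFun]; rfl

theorem jFun_mul (g g' : GT T) :
    letI := gtMonoid hT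
    jFun hT S (g * g') = jFun hT S g ⋙ jFun hT S g' := by
  let _ := gtMonoid hT
  refine contraction_cancel hT S ?_
  rw [contraction_jFun, gtFun_mul, ← Functor.assoc, contraction_jFun, Functor.assoc,
    contraction_jFun]
  rfl

theorem jFun_one :
    letI := gtMonoid hT
    jFun hT S 1 = 𝟭 _ := by
  let _ := gtMonoid hT
  refine contraction_cancel hT S ?_
  rw [contraction_jFun, gtFun_one]
  rfl

include hT in
/-- The proposition in every setting with the required properties. -/
theorem definesMorphism : DefinesMorphism T S := by
  refine ⟨gtMonoid hT, fun _ _ => rfl, rfl, ?_⟩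
  let _ := gtMonoid hT
  refine ⟨{ toFun := fun g => MulOpposite.op (jFun hT S g).toCatHom
            map_one' := ?_
            map_mul' := fun g g' => ?_ }, fun g => ⟨gtFun hT S g, ⟨isTwist_gtFun hT g,
              fun i' hi' => IsTwist.unique hT (isTwist_gtFun hT g) hi'⟩, fun J => ?_⟩⟩
  · rw [jFun_one]; rfl
  · rw [jFun_mul]; rfl
  · rw [← contraction_jFun]
    constructor
    · intro h
      have := contraction_cancel hT S h
      change J = (jFun hT S g).toCatHom
      rw [← this]; rfl
    · rintro rfl
      rfl

end Final

/-! ### The discrete, profinite and pro-`l` settings -/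

theorem Setting.powT_of {T : Setting.{v}} {G : Type} [Group G] (P : Subgroup G) [P.Normal]
    {x : T.Obj G P} (h : T.proj P x = 1) (c : T.Scal) :
    T.powT P x c = (T.pow P ⟨x, h⟩ c : (T.proj P).ker) := dif_pos h

/-- Without completion, the kernel of the projection is `P`. -/
theorem discrete_mem {G : Type} [Group G] (P : Subgroup G) [P.Normal] (x : discrete.Obj G P)
    (h : discrete.proj P x = 1) : (show G from x) ∈ P := (QuotientGroup.eq_one_iff (N := P) _).mp h

theorem discrete_powT {G : Type} [Group G] (P : Subgroup G) [P.Normal] (x : discrete.Obj G P)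
    (h : discrete.proj P x = 1) (c : discrete.Scal) :
    discrete.powT P x c = @HPow.hPow G ℤ G _ x c :=
  Setting.powT_of (T := discrete) P h c

theorem discrete_isNice : discrete.IsNice where
  reg_refl _ _ _ := trivial
  reg_trans _ _ _ _ _ _ _ _ _ _ _ := trivial
  reg_mul _ _ _ _ _ _ _ _ _ := trivial
  reg_const _ _ _ _ _ _ := trivial
  reg_lift _ _ _ _ _ _ _ := trivial
  reg_ext P Q _ _ p q q' hp _ _ h := funext fun a => by
    obtain ⟨b, hb, e⟩ := h a (p a) rfl
    obtain rfl : b = a := hp hb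
    exact e
  pow_lift {G H} _ _ P Q _ _ θ hθ x hx c := by
    rw [discrete_powT P x hx]
    exact (map_zpow (G := G) (H := H) θ x c).trans
      (discrete_powT Q _ (hθ x (discrete_mem P x hx)) c).symm
  pow_add {G} _ P _ x hx a b := by
    rw [discrete_powT P x hx, discrete_powT P x hx, discrete_powT P x hx]
    exact zpow_add (G := G) x a b
  pow_mul {G} _ P _ x hx a b := by
    rw [discrete_powT P _ (discrete.proj_powT P x a), discrete_powT P x hx, discrete_powT P x hx]
    exact zpow_mul (α := G) x a b
  pow_one {G} _ P _ x hx := by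
    rw [discrete_powT P x hx]
    exact zpow_one (G := G) x
  mul_pow {G} _ P _ x y hx hy h c := by
    rw [discrete_powT P x hx, discrete_powT P y hy,
      discrete_powT P _ (by rw [map_mul, hx, hy, one_mul])]
    exact Commute.mul_zpow (G := G) h c
  two_cancel := fun a b h => @mul_left_cancel₀ ℤ _ _ _ 2 a b two_ne_zero h
  map_surjective _ _ _ _ _ _ hs _ := hs
  map_subtype_injective P _ _ := P.subtype_injective

section ProL
variable {L : Set ℕ} {G H : Type} [Group G] [Group H] {P : Subgroup G} {Q : Subgroup H}
  [P.Normal] [Q.Normal]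

/-- The inclusion order on open subgroups. -/
instance : Preorder (OpenSub L P) := Preorder.lift OpenSub.N

namespace ProCompl

theorem ext {x y : ProCompl L P} (h : ∀ N : OpenSub L P, comp N x = comp N y) : x = y :=
  Subtype.ext (funext h)

theorem transition_comp (x : ProCompl L P) (N M : OpenSub L P) (h : N.N ≤ M.N) :
    transition h (comp N x) = comp M x := x.2 N M h

theorem comp_eq_of_le {x y : ProCompl L P} {N M : OpenSub L P} (h : N.N ≤ M.N)
    (e : comp N x = comp N y) : comp M x = comp M y := by
  rw [← transition_comp x N M h, e, transition_comp]

theorem comp_lift (θ : G →* ProCompl L Q) (hθ : ∀ p ∈ P, proj Q (θ p) = 1) (M : OpenSub L Q)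
    (x : ProCompl L P) : comp M (lift θ hθ x) = QuotientGroup.lift (liftSub θ hθ M).N
      ((comp M).comp θ) inf_le_left (comp (liftSub θ hθ M) x) := rfl

theorem comp_pow_val (x : (proj (L := L) P).ker) (c : ZHat L) (N : OpenSub L P) :
    comp N (pow x c).1 = comp N x.1 ^ (c.1 ⟨N.N.relIndex P, N.idx⟩).val := rfl

theorem pow_eq_of_cast_eq {x : ProCompl L P} (hx : proj P x = 1) (N : OpenSub L P) {m n : ℕ}
    (h : (m : ZMod (N.N.relIndex P)) = n) : comp N x ^ m = comp N x ^ n := by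
  rw [pow_eq_pow_iff_modEq]
  exact Nat.ModEq.of_dvd (orderOf_dvd_of_pow_eq_one (comp_pow N x hx))
    ((ZMod.natCast_eq_natCast_iff _ _ _).mp h)

theorem exists_comp_of (x : ProCompl L P) (N : OpenSub L P) : ∃ g : G,
    comp N x = QuotientGroup.mk' N.N g ∧ proj P x = QuotientGroup.mk' P g := by
  obtain ⟨g, hg⟩ := QuotientGroup.mk'_surjective N.N (comp N x)
  refine ⟨g, hg.symm, ?_⟩
  exact (transition_comp x N (self P L) N.le).symm.trans (congrArg (transition N.le) hg.symm)

end ProCompl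

theorem IsLNum.mul {m n : ℕ} (hm : IsLNum L m) (hn : IsLNum L n) : IsLNum L (m * n) :=
  ⟨mul_ne_zero hm.1 hn.1, fun p hp h => (hp.dvd_mul.mp h).elim (hm.2 p hp) (hn.2 p hp)⟩

theorem IsLNum.relIndex_inf {A B : Subgroup G} [A.Normal] (hA : IsLNum L (A.relIndex P))
    (hB : IsLNum L (B.relIndex P)) : IsLNum L ((A ⊓ B).relIndex P) := by
  rw [← Subgroup.relIndex_inf_mul_relIndex]
  refine IsLNum.mul (hA.of_dvd ?_) hB
  have h : ∀ K : Subgroup G, A.relIndex K = Nat.card (K.map (QuotientGroup.mk' A)) := fun K => by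
    rw [← Subgroup.relIndex_ker, QuotientGroup.ker_mk']
  rw [h, h]
  exact Subgroup.card_dvd_of_le (Subgroup.map_mono inf_le_right)

/-- The intersection of two open subgroups. -/
def OpenSub.inf (A B : OpenSub L P) : OpenSub L P where
  N := A.N ⊓ B.N
  le := inf_le_left.trans A.le
  idx := A.idx.relIndex_inf B.idx

/-- If `2 ∈ L`, the component of level `n` is determined by twice the component of level `2 n`;
otherwise `2` is invertible modulo all levels. -/
theorem ZHat.two_cancel (a b : ZHat L) (h : 2 * a = 2 * b) : a = b := by
  refine Subtype.ext (funext fun n => ?_)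
  have hc : ∀ m, 2 * a.1 m = 2 * b.1 m := fun m => congrFun (congrArg Subtype.val h) m
  have hn : NeZero n.1 := ⟨n.2.1⟩
  by_cases h2 : 2 ∈ L
  · have hL : IsLNum L (2 * n.1) := IsLNum.mul ⟨two_ne_zero, fun p hp hd => by
      rwa [(Nat.prime_dvd_prime_iff_eq hp Nat.prime_two).mp hd]⟩ n.2
    have hm : NeZero (2 * n.1) := ⟨hL.1⟩
    have e := hc ⟨2 * n.1, hL⟩
    have hd : n.1 ∣ 2 * n.1 := ⟨2, mul_comm _ _⟩
    rw [← a.2 n ⟨_, hL⟩ hd, ← b.2 n ⟨_, hL⟩ hd]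
    generalize a.1 ⟨2 * n.1, hL⟩ = x at e
    generalize b.1 ⟨2 * n.1, hL⟩ = y at e
    rw [← ZMod.natCast_zmod_val x, ← ZMod.natCast_zmod_val y] at e ⊢
    have e' : ((2 * x.val : ℕ) : ZMod (2 * n.1)) = ((2 * y.val : ℕ) : ZMod (2 * n.1)) := by
      push_cast; exact e
    rw [ZMod.natCast_eq_natCast_iff] at e'
    rw [map_natCast, map_natCast, ZMod.natCast_eq_natCast_iff]
    exact Nat.ModEq.mul_left_cancel' two_ne_zero e'
  · have hcop : Nat.Coprime 2 n.1 := by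
      rw [Nat.prime_two.coprime_iff_not_dvd]
      exact fun hd => h2 (n.2.2 2 Nat.prime_two hd)
    have hu : IsUnit ((2 : ℕ) : ZMod n.1) := (ZMod.isUnit_iff_coprime 2 n.1).mpr hcop
    exact hu.mul_left_cancel (by exact_mod_cast hc n)

/-- The fibres of `G / N → G / P` are cosets of the finite group `P / N`. -/
theorem OpenSub.finite_fiber (N : OpenSub L P) (c : G ⧸ P) :
    Finite {z : G ⧸ N.N // transition N.le z = c} := by
  obtain ⟨g, rfl⟩ := QuotientGroup.mk'_surjective P c
  have : N.N.IsFiniteRelIndex P := ⟨N.idx.1⟩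
  have hf : Finite (P ⧸ N.N.subgroupOf P) := inferInstance
  refine Finite.of_surjective (α := P ⧸ N.N.subgroupOf P) (fun z =>
    ⟨QuotientGroup.mk' N.N g * QuotientGroup.map (N.N.subgroupOf P) N.N P.subtype (fun _ h => h) z, ?_⟩) ?_
  · obtain ⟨p, rfl⟩ := QuotientGroup.mk'_surjective _ z
    have : QuotientGroup.mk' P (p : G) = 1 := (QuotientGroup.eq_one_iff _).mpr p.2
    rw [map_mul]
    change QuotientGroup.mk' P g * QuotientGroup.mk' P (p : G) = QuotientGroup.mk' P g
    rw [this, mul_one]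
  · rintro ⟨z, hz⟩
    obtain ⟨h, rfl⟩ := QuotientGroup.mk'_surjective _ z
    have hz : QuotientGroup.mk' P h = QuotientGroup.mk' P g := hz
    have hp : g⁻¹ * h ∈ P := QuotientGroup.eq.mp hz.symm
    refine ⟨QuotientGroup.mk' (N.N.subgroupOf P) ⟨g⁻¹ * h, hp⟩, Subtype.ext ?_⟩
    change QuotientGroup.mk' N.N g * QuotientGroup.mk' N.N (g⁻¹ * h) = _
    rw [← map_mul, mul_inv_cancel_left]

/-- The image of an open subgroup under a surjection. -/
def OpenSub.image (φ : G →* H) (hφ : Function.Surjective φ) (h : ∀ p ∈ P, φ p ∈ Q)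
    (h' : ∀ g, φ g ∈ Q → g ∈ P) (N : OpenSub L P) : OpenSub L Q where
  N := N.N.map φ
  normal := N.normal.map φ hφ
  le := Subgroup.map_le_iff_le_comap.mpr fun p hp => h p (N.le hp)
  idx := by
    refine N.idx.of_dvd ?_
    have e : Q = P.map φ := le_antisymm (fun q hq => by
      obtain ⟨g, rfl⟩ := hφ q
      exact ⟨g, h' g hq, rfl⟩) (Subgroup.map_le_iff_le_comap.mpr h)
    have hk : φ.ker ≤ P := fun g hg => h' g (by rw [MonoidHom.mem_ker.mp hg]; exact Q.one_mem)
    rw [e, Subgroup.relIndex_map_map, sup_eq_left.mpr hk]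
    exact Subgroup.relIndex_dvd_of_le_left _ le_sup_left

/-- By compactness: the fibres of the maps `G / N → H / φ(N)` over the components of an element of
the completion of `H` form an inverse system of nonempty finite sets. -/
theorem ProCompl.lift_surjective (φ : G →* H) (h : ∀ p ∈ P, φ p ∈ Q) (hφ : Function.Surjective φ)
    (h' : ∀ g, φ g ∈ Q → g ∈ P)
    (hp : ∀ p ∈ P, ProCompl.proj (L := L) Q (((ProCompl.of Q).comp φ) p) = 1) :
    Function.Surjective (ProCompl.lift ((ProCompl.of Q).comp φ) hp) := by
  intro y
  let e : ∀ N : OpenSub L P, G ⧸ N.N →* H ⧸ (N.image φ hφ h h').N := fun N =>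
    QuotientGroup.map _ _ φ (Subgroup.le_comap_map φ N.N)
  let F : OpenSub L P ⥤ Type :=
    { obj := fun N => {z : G ⧸ N.N // e N z = ProCompl.comp (N.image φ hφ h h') y}
      map := fun {N M} f => TypeCat.ofHom fun z => ⟨transition (leOfHom f) z.1, by
        obtain ⟨g, hg⟩ := QuotientGroup.mk'_surjective _ z.1
        have k : e M (transition (leOfHom f) z.1) =
            transition (N := (N.image φ hφ h h').N) (M := (M.image φ hφ h h').N)
              (Subgroup.map_mono (f := φ) (leOfHom f)) (e N z.1) := by
          rw [← hg]; rfl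
        exact k.trans ((congrArg (transition _) z.2).trans (ProCompl.transition_comp y (N.image φ hφ h h')
          (M.image φ hφ h h') (Subgroup.map_mono (f := φ) (leOfHom f))))⟩
      map_id := fun N => by
        ext z
        obtain ⟨g, hg⟩ := QuotientGroup.mk'_surjective _ z.1
        change transition _ z.1 = z.1
        rw [← hg]; rfl
      map_comp := fun f f' => by
        ext z
        obtain ⟨g, hg⟩ := QuotientGroup.mk'_surjective _ z.1
        change transition _ z.1 = transition _ (transition _ z.1)
        rw [← hg]; rfl }
  have hne : ∀ N, Nonempty (F.obj N) := fun N => by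
    obtain ⟨g, hg⟩ := QuotientGroup.mk'_surjective _ (ProCompl.comp (N.image φ hφ h h') y)
    obtain ⟨g, rfl⟩ := hφ g
    exact ⟨⟨QuotientGroup.mk' _ g, hg⟩⟩
  have hfin : ∀ N, Finite (F.obj N) := fun N => by
    obtain ⟨g₀, -, hg₀⟩ := ProCompl.exists_comp_of y (N.image φ hφ h h')
    obtain ⟨g₀, rfl⟩ := hφ g₀
    have := N.finite_fiber (QuotientGroup.mk' P g₀)
    refine Finite.of_injective (β := {z : G ⧸ N.N // transition N.le z = QuotientGroup.mk' P g₀})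
      (fun z => ⟨z.1, ?_⟩) fun z z' hz => ?_
    swap
    · have hz := congrArg Subtype.val hz
      exact Subtype.ext hz
    obtain ⟨g, hg⟩ := QuotientGroup.mk'_surjective _ z.1
    have hz := z.2
    have k := ProCompl.transition_comp y (N.image φ hφ h h') (ProCompl.self Q L)
      (N.image φ hφ h h').le
    rw [← hz, ← hg] at k
    have k' : QuotientGroup.mk' Q (φ g) = QuotientGroup.mk' Q (φ g₀) := k.trans hg₀
    rw [← hg]
    refine QuotientGroup.eq.mpr (h' _ ?_)
    rw [map_mul, map_inv]
    exact QuotientGroup.eq.mp k'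
  have : IsCodirectedOrder (OpenSub L P) := ⟨fun A B => ⟨A.inf B, inf_le_left (a := A.N),
    inf_le_right (a := A.N)⟩⟩
  obtain ⟨x, hx⟩ := nonempty_sections_of_finite_cofiltered_system F
  refine ⟨⟨fun N => (x N).1, fun N M hNM => congrArg Subtype.val (hx (homOfLE hNM))⟩, ?_⟩
  refine ProCompl.ext fun M => ?_
  let N : OpenSub L P := ProCompl.liftSub ((ProCompl.of Q).comp φ) hp M
  have hN : (N.image φ hφ h h').N ≤ M.N := by
    rintro _ ⟨g, hg, rfl⟩
    exact (QuotientGroup.eq_one_iff _).mp hg.1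
  obtain ⟨g, hg⟩ := QuotientGroup.mk'_surjective _ (x N).1
  have k : QuotientGroup.lift N.N ((ProCompl.comp M).comp ((ProCompl.of Q).comp φ)) inf_le_left
      (x N).1 = transition hN (e N (x N).1) := by
    rw [← hg]; rfl
  exact k.trans ((congrArg _ (x N).2).trans (ProCompl.transition_comp y _ _ hN))

theorem IsLNum.index_iInf {ι : Type*} [Finite ι] (A : ι → Subgroup G) [∀ i, (A i).Normal]
    (hA : ∀ i, IsLNum L (A i).index) : IsLNum L (⨅ i, A i).index := by
  classical
  have := Fintype.ofFinite ι
  have key : ∀ s : Finset ι, IsLNum L ((⨅ i ∈ s, A i).relIndex ⊤) := by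
    intro s
    induction s using Finset.induction_on with
    | empty =>
      simp only [Finset.notMem_empty, iInf_false, iInf_top, Subgroup.relIndex_self]
      exact ⟨one_ne_zero, fun p hp h => absurd (Nat.dvd_one.mp h) hp.one_lt.ne'⟩
    | insert a s _ ih =>
      rw [Finset.iInf_insert]
      exact IsLNum.relIndex_inf (by rw [Subgroup.relIndex_top_right]; exact hA a) ih
  simpa using key Finset.univ

/-- The pro-`L` topology of a normal subgroup `P` of finite index is induced by that of the group:
an open subgroup of `P` has finitely many conjugates. -/
theorem OpenSub.exists_le_map [Finite (G ⧸ P)] (N : OpenSub L (⊤ : Subgroup P)) :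
    ∃ M : OpenSub L P, M.N ≤ N.N.map P.subtype := by
  let A : G → Subgroup P := fun g => N.N.comap (MulAut.conjNormal g : P ≃* P).toMonoidHom
  have hA : ∀ g x, x ∈ A g ↔ MulAut.conjNormal g x ∈ N.N := fun _ _ => Iff.rfl
  have hAn : ∀ g, (A g).Normal := fun g => N.normal.comap _
  have e : ⨅ g, A g = ⨅ c : G ⧸ P, A c.out := by
    refine le_antisymm (le_iInf fun c => iInf_le _ _) (le_iInf fun g => ?_)
    refine (iInf_le _ (g : G ⧸ P)).trans fun x hx => ?_
    rw [hA] at hx ⊢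
    have hp : g * (g : G ⧸ P).out⁻¹ ∈ P := by
      have := QuotientGroup.eq.mp (Quotient.out_eq (g : G ⧸ P))
      have k := ‹P.Normal›.conj_mem _ this (g : G ⧸ P).out
      rwa [mul_inv_cancel_left] at k
    have k := N.normal.conj_mem _ hx ⟨_, hp⟩
    convert k using 1
    refine Subtype.ext ?_
    simp [MulAut.conjNormal_apply, mul_assoc]
  have hi : IsLNum L (⨅ g, A g).index := by
    rw [e]
    refine IsLNum.index_iInf _ fun c => ?_
    rw [Subgroup.index_comap_of_surjective _ (MulEquiv.surjective _), ← Subgroup.relIndex_top_right]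
    exact N.idx
  refine ⟨{ N := (⨅ g, A g).map P.subtype, normal := ⟨?_⟩, le := ?_, idx := ?_ }, ?_⟩
  · rintro _ ⟨x, hx, rfl⟩ h
    refine ⟨MulAut.conjNormal h x, ?_, rfl⟩
    simp only [SetLike.mem_coe, Subgroup.mem_iInf, hA] at hx ⊢
    intro g
    rw [← MulAut.mul_apply, ← map_mul]
    exact hx _
  · rintro _ ⟨x, -, rfl⟩
    exact x.2
  · rw [Subgroup.relIndex, Subgroup.subgroupOf,
      Subgroup.comap_map_eq_self_of_injective P.subtype_injective]
    exact hi
  · refine Subgroup.map_mono fun x hx => ?_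
    have := Subgroup.mem_iInf.mp hx 1
    rwa [hA, map_one] at this

/-- The pro-`L` completion of a normal subgroup of finite index embeds into the relative completion
of the group, since both groups induce the same topology on the subgroup. -/
theorem ProCompl.lift_subtype_injective [Finite (G ⧸ P)]
    (hp : ∀ p ∈ (⊤ : Subgroup P), ProCompl.proj (L := L) P (((ProCompl.of P).comp P.subtype) p) = 1) :
    Function.Injective (ProCompl.lift ((ProCompl.of P).comp P.subtype) hp) := by
  rw [injective_iff_map_eq_one]
  intro x hx
  refine ProCompl.ext fun N => ?_
  obtain ⟨M, hM⟩ := N.exists_le_map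
  let N' : OpenSub L (⊤ : Subgroup P) := ProCompl.liftSub ((ProCompl.of P).comp P.subtype) hp M
  have hN : N'.N ≤ N.N := fun p hp => by
    obtain ⟨q, hq, e⟩ := hM ((QuotientGroup.eq_one_iff _).mp hp.1)
    rwa [← Subtype.ext e]
  refine ProCompl.comp_eq_of_le (y := 1) hN ?_
  have hx' : QuotientGroup.lift N'.N ((ProCompl.comp M).comp ((ProCompl.of P).comp P.subtype))
      inf_le_left (ProCompl.comp N' x) = 1 := congrArg (ProCompl.comp M) hx
  obtain ⟨g, hg⟩ := QuotientGroup.mk'_surjective _ (ProCompl.comp N' x)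
  rw [← hg] at hx' ⊢
  exact (QuotientGroup.eq_one_iff g).mpr ⟨hx', trivial⟩

namespace ProCompl

/-- Extensions of morphisms commute with powers: the exponents are read off at the levels `[P : N]`
and `[Q : M]`, of which the first divides the second. -/
theorem pow_lift (θ : G →* ProCompl L Q) (hθ : ∀ p ∈ P, proj Q (θ p) = 1)
    (x : (proj (L := L) P).ker) (h : lift θ hθ x.1 ∈ (proj (L := L) Q).ker) (c : ZHat L) :
    lift θ hθ (pow x c).1 = (pow ⟨lift θ hθ x.1, h⟩ c).1 := by
  refine ext fun M => ?_
  rw [comp_lift, comp_pow_val, comp_pow_val, comp_lift]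
  refine Eq.trans (congrArg (QuotientGroup.lift (liftSub θ hθ M).N ((comp M).comp θ) inf_le_left) ?_)
    (map_pow (QuotientGroup.lift (liftSub θ hθ M).N ((comp M).comp θ) inf_le_left) _ _)
  have hd : (liftSub θ hθ M).N.relIndex P ∣ M.N.relIndex Q := by
    rw [liftSub, Subgroup.inf_relIndex_right, Subgroup.relIndex_ker]
    have h1 : M.N.relIndex Q = Nat.card (Q.map (QuotientGroup.mk' M.N)) := by
      rw [← Subgroup.relIndex_ker, QuotientGroup.ker_mk']
    rw [h1]
    refine Subgroup.card_dvd_of_le ?_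
    rintro _ ⟨p, hp, rfl⟩
    exact comp_mem_map M (θ p) (hθ p hp)
  have : NeZero (M.N.relIndex Q) := ⟨M.idx.1⟩
  have : NeZero ((liftSub θ hθ M).N.relIndex P) := ⟨(liftSub θ hθ M).idx.1⟩
  refine pow_eq_of_cast_eq x.2 _ ?_
  rw [ZMod.natCast_zmod_val, ← c.2 ⟨_, (liftSub θ hθ M).idx⟩ ⟨_, M.idx⟩ hd]
  simp

theorem pow_add (x : (proj (L := L) P).ker) (a b : ZHat L) :
    (pow x (a + b)).1 = (pow x a).1 * (pow x b).1 := by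
  refine ext fun N => ?_
  have : NeZero (N.N.relIndex P) := ⟨N.idx.1⟩
  rw [map_mul, comp_pow_val, comp_pow_val, comp_pow_val, ← _root_.pow_add]
  refine pow_eq_of_cast_eq x.2 N ?_
  rw [Nat.cast_add, ZMod.natCast_zmod_val, ZMod.natCast_zmod_val, ZMod.natCast_zmod_val]
  rfl

theorem pow_mul (x : (proj (L := L) P).ker) (a b : ZHat L) :
    (pow x (a * b)).1 = (pow (pow x a) b).1 := by
  refine ext fun N => ?_
  have : NeZero (N.N.relIndex P) := ⟨N.idx.1⟩
  rw [comp_pow_val, comp_pow_val, comp_pow_val, ← _root_.pow_mul]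
  refine pow_eq_of_cast_eq x.2 N ?_
  rw [Nat.cast_mul, ZMod.natCast_zmod_val, ZMod.natCast_zmod_val, ZMod.natCast_zmod_val]
  rfl

theorem pow_one (x : (proj (L := L) P).ker) : (pow x 1).1 = x.1 := by
  refine ext fun N => ?_
  have : NeZero (N.N.relIndex P) := ⟨N.idx.1⟩
  rw [comp_pow_val]
  refine (pow_eq_of_cast_eq x.2 N (n := 1) ?_).trans (_root_.pow_one _)
  rw [ZMod.natCast_zmod_val, Nat.cast_one]
  rfl

theorem mul_pow (x y : (proj (L := L) P).ker) (h : Commute x.1 y.1) (c : ZHat L) :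
    (pow (x * y) c).1 = (pow x c).1 * (pow y c).1 := by
  refine ext fun N => ?_
  rw [map_mul, comp_pow_val, comp_pow_val, comp_pow_val, ← (h.map (comp N)).mul_pow]
  rfl

end ProCompl

/-- The profinite and the pro-`l` settings have the required properties. -/
theorem proL_isNice (L : Set ℕ) : (proL L).IsNice where
  reg_refl _ _ _ N := ⟨N, fun _ _ h => h⟩
  reg_trans _ _ _ _ _ _ _ _ _ h h' N := by
    obtain ⟨M, hM⟩ := h' N
    obtain ⟨M', hM'⟩ := h M
    exact ⟨M', fun a b e => hM a b (hM' a b e)⟩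
  reg_mul P Q _ _ p q q' h h' N := by
    obtain ⟨M, hM⟩ := h N
    obtain ⟨M', hM'⟩ := h' N
    refine ⟨M.inf M', fun a b e => ?_⟩
    exact congrArg₂ (· * ·) (hM a b (ProCompl.comp_eq_of_le (N := M.inf M') inf_le_left e))
      (hM' a b (ProCompl.comp_eq_of_le (N := M.inf M') inf_le_right e))
  reg_const P _ _ _ _ _ _ := ⟨ProCompl.self P L, fun _ _ _ => rfl⟩
  reg_lift P Q _ _ θ hθ p N := ⟨ProCompl.liftSub θ hθ N, fun a b e =>
    congrArg (QuotientGroup.lift (ProCompl.liftSub θ hθ N).N ((ProCompl.comp N).comp θ)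
      inf_le_left) e⟩
  reg_ext P Q _ _ p q q' hp h h' e := funext fun a => ProCompl.ext fun N => by
    obtain ⟨M, hM⟩ := h N
    obtain ⟨M', hM'⟩ := h' N
    -- At level `N`, both maps only depend on `p a` at the level `M ∩ M'`, where `p a` is the class
    -- of an element of `G`.
    obtain ⟨g, hg, hg'⟩ := ProCompl.exists_comp_of (p a) (M.inf M')
    obtain ⟨b, hb, hq⟩ := e a g hg'
    have hb' : ProCompl.comp (M.inf M') (p a) = ProCompl.comp (M.inf M') (p b) := by
      rw [hg, hb]; rfl
    exact (hM a b (ProCompl.comp_eq_of_le (N := M.inf M') inf_le_left hb')).trans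
      ((congrArg (ProCompl.comp N) hq).trans
      (hM' a b (ProCompl.comp_eq_of_le (N := M.inf M') inf_le_right hb')).symm)
  pow_lift P Q _ _ θ hθ x hx c := by
    have hy : (proL L).proj Q ((proL L).lift P Q θ hθ x) = 1 := by
      rw [Setting.proj_lift, hx, map_one]
    rw [Setting.powT_of P hx, Setting.powT_of Q hy]
    exact ProCompl.pow_lift θ hθ ⟨x, hx⟩ hy c
  pow_add P _ x hx a b := by
    rw [Setting.powT_of P hx, Setting.powT_of P hx, Setting.powT_of P hx]
    exact ProCompl.pow_add ⟨x, hx⟩ a b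
  pow_mul P _ x hx a b := by
    rw [Setting.powT_of P ((proL L).proj_powT P x a), Setting.powT_of P hx]
    refine (ProCompl.pow_mul ⟨x, hx⟩ a b).trans (congrArg (fun z => (ProCompl.pow z b).1) ?_)
    exact Subtype.ext (Setting.powT_of P hx a).symm
  pow_one P _ x hx := by
    rw [Setting.powT_of P hx]
    exact ProCompl.pow_one ⟨x, hx⟩
  mul_pow P _ x y hx hy h c := by
    rw [Setting.powT_of P hx, Setting.powT_of P hy,
      Setting.powT_of P (by rw [map_mul, hx, hy, one_mul])]
    exact ProCompl.mul_pow ⟨x, hx⟩ ⟨y, hy⟩ h c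
  two_cancel := ZHat.two_cancel
  map_surjective P Q _ _ φ h hφ h' := ProCompl.lift_surjective φ h hφ h' _
  map_subtype_injective P _ _ := ProCompl.lift_subtype_injective _

end ProL

/-! ### The filtration of a group algebra -/

section Filtration
variable {k : Type v} [CommRing k] {G H : Type} [Group G] [Group H] {P : Subgroup G}
  {Q : Subgroup H} [P.Normal] [Q.Normal] {V : Type*} [AddCommGroup V] [Module k V]

/-- The linear extension of a map on the group. -/
def linExt (F : G → V) : MonoidAlgebra k G →ₗ[k] V := (MonoidAlgebra.basis G k).constr k F

@[simp] theorem linExt_of (F : G → V) (g : G) : linExt F (MonoidAlgebra.of k G g) = F g := by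
  have := (MonoidAlgebra.basis G k).constr_basis k F g
  rwa [MonoidAlgebra.basis_apply] at this

theorem groupAlgebra_hom_ext {f f' : MonoidAlgebra k G →ₗ[k] V}
    (h : ∀ g, f (MonoidAlgebra.of k G g) = f' (MonoidAlgebra.of k G g)) (x : MonoidAlgebra k G) :
    f x = f' x := by
  induction x using MonoidAlgebra.induction_on with
  | of g => exact h g
  | add x y hx hy => rw [map_add, map_add, hx, hy]
  | smul r x hx => rw [map_smul, map_smul, hx]

theorem groupAlgebra_mem {f : MonoidAlgebra k G →ₗ[k] V} {W : Submodule k V}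
    (h : ∀ g, f (MonoidAlgebra.of k G g) ∈ W) (x : MonoidAlgebra k G) : f x ∈ W := by
  induction x using MonoidAlgebra.induction_on with
  | of g => exact h g
  | add x y hx hy => rw [map_add]; exact W.add_mem hx hy
  | smul r x hx => rw [map_smul]; exact W.smul_mem r hx

theorem of_sub_of_mem {g g' : G} (h : QuotientGroup.mk' P g = QuotientGroup.mk' P g') :
    MonoidAlgebra.of k G g - MonoidAlgebra.of k G g' ∈ augIdeal k P := by
  rw [augIdeal, RingHom.mem_ker, map_sub, sub_eq_zero]
  simp only [MonoidAlgebra.of_apply, MonoidAlgebra.mapDomainRingHom_apply,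
    MonoidAlgebra.mapDomain_single, h]

/-- The kernel of `k[G] → k[G / P]` is spanned by the differences of congruent elements. -/
theorem map_augIdeal_mem (f : MonoidAlgebra k G →ₗ[k] V) (W : Submodule k V)
    (h : ∀ g g', QuotientGroup.mk' P g = QuotientGroup.mk' P g' →
      f (MonoidAlgebra.of k G g) - f (MonoidAlgebra.of k G g') ∈ W)
    {x : MonoidAlgebra k G} (hx : x ∈ augIdeal k P) : f x ∈ W := by
  let s : MonoidAlgebra k (G ⧸ P) →ₗ[k] V := linExt fun c => f (MonoidAlgebra.of k G c.out)
  let π : MonoidAlgebra k G →ₗ[k] MonoidAlgebra k (G ⧸ P) :=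
    MonoidAlgebra.mapDomainLinearMap k k (QuotientGroup.mk' P)
  have e : (f - s ∘ₗ π) x = f x := by
    have : π x = 0 := hx
    rw [LinearMap.sub_apply, LinearMap.comp_apply, this, map_zero, sub_zero]
  rw [← e]
  refine groupAlgebra_mem (fun g => ?_) x
  have : π (MonoidAlgebra.of k G g) = MonoidAlgebra.of k _ (QuotientGroup.mk' P g) := by
    simp [π, MonoidAlgebra.of_apply]
  rw [LinearMap.sub_apply, LinearMap.comp_apply, this, linExt_of]
  exact h _ _ (Quotient.out_eq (QuotientGroup.mk' P g)).symm

/-- The map of group algebras induced by a group morphism. -/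
def algMap (k : Type v) [CommRing k] (φ : G →* H) : MonoidAlgebra k G →ₐ[k] MonoidAlgebra k H :=
  MonoidAlgebra.mapDomainAlgHom k k φ

@[simp] theorem algMap_of (φ : G →* H) (g : G) :
    algMap k φ (MonoidAlgebra.of k G g) = MonoidAlgebra.of k H (φ g) := by
  simp [algMap, MonoidAlgebra.of_apply]

theorem mem_augIdeal_iff (x : MonoidAlgebra k G) :
    x ∈ augIdeal k P ↔ algMap k (QuotientGroup.mk' P) x = 0 := Iff.rfl

theorem mul_mem_augIdeal_pow {x y : MonoidAlgebra k G} {i j n : ℕ} (h : i + j = n)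
    (hx : x ∈ augIdeal k P ^ i) (hy : y ∈ augIdeal k P ^ j) : x * y ∈ augIdeal k P ^ n := by
  subst h
  rw [Ideal.IsTwoSided.pow_add]
  exact Ideal.mul_mem_mul hx hy

theorem mem_augIdeal_pow_zero (x : MonoidAlgebra k G) : x ∈ augIdeal k P ^ 0 := by
  rw [Submodule.pow_zero, Ideal.one_eq_top]; trivial

theorem augIdeal_pow_le {m n : ℕ} (h : m ≤ n) : augIdeal k P ^ n ≤ augIdeal k P ^ m :=
  Ideal.pow_le_pow_right h

/-- Induction on the powers of the augmentation ideal. -/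
theorem augIdeal_pow_induction (W : ℕ → Submodule k (MonoidAlgebra k G))
    (h0 : ∀ x, x ∈ W 0)
    (hs : ∀ n, ∀ x ∈ W n, ∀ g g', QuotientGroup.mk' P g = QuotientGroup.mk' P g' →
      (MonoidAlgebra.of k G g - MonoidAlgebra.of k G g') * x ∈ W (n + 1)) (n : ℕ)
    {x : MonoidAlgebra k G} (hx : x ∈ augIdeal k P ^ n) : x ∈ W n := by
  induction n generalizing x with
  | zero => exact h0 x
  | succ n ih =>
    rcases Nat.eq_zero_or_pos n with rfl | hn
    · rw [zero_add, Submodule.pow_one] at hx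
      have := map_augIdeal_mem (P := P) (LinearMap.mulRight k 1) (W 1) (fun g g' h => by
        rw [← map_sub]
        exact hs 0 1 (h0 1) g g' h) hx
      rwa [LinearMap.mulRight_apply, mul_one] at this
    rw [Submodule.pow_succ' _ hn.ne'] at hx
    induction hx using Submodule.mul_induction_on' with
    | mem_mul_mem a ha b hb =>
      refine map_augIdeal_mem (P := P) (LinearMap.mulRight k b) (W (n + 1)) (fun g g' h => ?_) ha
      rw [← map_sub]
      exact hs n b (ih hb) g g' h
    | add a _ b _ ha hb => exact (W (n + 1)).add_mem ha hb

theorem algMap_mem (φ : G →* H) (h : ∀ p ∈ P, φ p ∈ Q) (n : ℕ) {x : MonoidAlgebra k G}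
    (hx : x ∈ augIdeal k P ^ n) : algMap k φ x ∈ augIdeal k Q ^ n := by
  refine augIdeal_pow_induction
    (P := P) (W := fun n => ((augIdeal k Q ^ n).restrictScalars k).comap (algMap k φ).toLinearMap)
    (fun x => mem_augIdeal_pow_zero (P := Q) _) (fun n x hx g g' hg => ?_) n hx
  change algMap k φ (_ * x) ∈ augIdeal k Q ^ (n + 1)
  rw [map_mul, map_sub, algMap_of, algMap_of]
  refine mul_mem_augIdeal_pow (i := 1) (j := n) (add_comm _ _) ?_ hx
  rw [Submodule.pow_one]
  refine of_sub_of_mem ?_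
  have := h _ (QuotientGroup.eq.mp hg)
  rw [map_mul, map_inv] at this
  exact QuotientGroup.eq.mpr this

/-- The filtration of `k[G × G]` is the tensor square of the filtration of `k[G]`. -/
theorem augIdeal_prod_pow_induction (W : Submodule k (MonoidAlgebra k (G × G))) (n : ℕ)
    (h : ∀ i j, i + j = n → ∀ x ∈ augIdeal k P ^ i, ∀ y ∈ augIdeal k P ^ j,
      algMap k (MonoidHom.inl G G) x * algMap k (MonoidHom.inr G G) y ∈ W)
    {z : MonoidAlgebra k (G × G)} (hz : z ∈ augIdeal k (P.prod P) ^ n) : z ∈ W := by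
  let S : ℕ → Submodule k (MonoidAlgebra k (G × G)) := fun n => Submodule.span k
    {z | ∃ i j, i + j = n ∧ ∃ x ∈ augIdeal k P ^ i, ∃ y ∈ augIdeal k P ^ j,
      z = algMap k (MonoidHom.inl G G) x * algMap k (MonoidHom.inr G G) y}
  have hS : z ∈ S n := by
    refine augIdeal_pow_induction S (fun x => ?_) (fun n x hx g g' hg => ?_) n hz
    · refine groupAlgebra_mem (f := LinearMap.id) (fun g => ?_) x
      refine Submodule.subset_span ⟨0, 0, rfl, MonoidAlgebra.of k G g.1, mem_augIdeal_pow_zero _,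
        MonoidAlgebra.of k G g.2, mem_augIdeal_pow_zero _, ?_⟩
      rw [algMap_of, algMap_of, ← map_mul]
      simp
    · have e : MonoidAlgebra.of k (G × G) g - MonoidAlgebra.of k (G × G) g' =
          algMap k (MonoidHom.inl G G) (MonoidAlgebra.of k G g.1 - MonoidAlgebra.of k G g'.1) *
            algMap k (MonoidHom.inr G G) (MonoidAlgebra.of k G g.2) +
          algMap k (MonoidHom.inl G G) (MonoidAlgebra.of k G g'.1) *
            algMap k (MonoidHom.inr G G) (MonoidAlgebra.of k G g.2 - MonoidAlgebra.of k G g'.2) := by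
        simp only [map_sub, algMap_of, sub_mul, mul_sub, ← map_mul]
        simp
      have hc : ∀ x y, algMap k (MonoidHom.inr G G) x * algMap k (MonoidHom.inl G G) y =
          algMap k (MonoidHom.inl G G) y * algMap k (MonoidHom.inr G G) x := by
        intro x y
        induction x using MonoidAlgebra.induction_on with
        | of a =>
          induction y using MonoidAlgebra.induction_on with
          | of b => simp only [algMap_of, ← map_mul]; simp
          | add y y' h h' => rw [map_add, mul_add, add_mul, h, h']
          | smul r y h => rw [map_smul, mul_smul_comm, smul_mul_assoc, h]
        | add x x' h h' => rw [map_add, mul_add, add_mul, h, h']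
        | smul r x h => rw [map_smul, mul_smul_comm, smul_mul_assoc, h]
      have hg' := (QuotientGroup.eq.mp hg)
      have h1 : QuotientGroup.mk' P g.1 = QuotientGroup.mk' P g'.1 := QuotientGroup.eq.mpr hg'.1
      have h2 : QuotientGroup.mk' P g.2 = QuotientGroup.mk' P g'.2 := QuotientGroup.eq.mpr hg'.2
      have hJ : ∀ {a b : G}, QuotientGroup.mk' P a = QuotientGroup.mk' P b →
          MonoidAlgebra.of k G a - MonoidAlgebra.of k G b ∈ augIdeal k P ^ 1 := fun h => by
        rw [Submodule.pow_one]; exact of_sub_of_mem h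
      have hm : ∀ (a b x y : MonoidAlgebra k G), (algMap k (MonoidHom.inl G G) a *
          algMap k (MonoidHom.inr G G) b) * (algMap k (MonoidHom.inl G G) x *
          algMap k (MonoidHom.inr G G) y) = algMap k (MonoidHom.inl G G) (a * x) *
          algMap k (MonoidHom.inr G G) (b * y) := fun a b x y => by
        rw [map_mul, map_mul, mul_assoc, ← mul_assoc _ _ (algMap k (MonoidHom.inr G G) y), hc]
        simp only [mul_assoc]
      rw [e, add_mul]
      induction hx using Submodule.span_induction with
      | mem x hx =>
        obtain ⟨i, j, hij, x, hx, y, hy, rfl⟩ := hx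
        refine (S (n + 1)).add_mem (Submodule.subset_span ?_) (Submodule.subset_span ?_)
        · exact ⟨i + 1, j, by omega, _, mul_mem_augIdeal_pow (add_comm _ _) (hJ h1) hx, _,
            mul_mem_augIdeal_pow (zero_add j) (mem_augIdeal_pow_zero _) hy, hm _ _ _ _⟩
        · exact ⟨i, j + 1, by omega, _, mul_mem_augIdeal_pow (zero_add i)
            (mem_augIdeal_pow_zero _) hx, _,
            mul_mem_augIdeal_pow (add_comm _ _) (hJ h2) hy, hm _ _ _ _⟩
      | zero => simp
      | add x y _ _ hx hy =>
        rw [mul_add, mul_add, add_add_add_comm]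
        exact (S (n + 1)).add_mem hx hy
      | smul r x _ hx =>
        rw [mul_smul_comm, mul_smul_comm, ← smul_add]
        exact (S (n + 1)).smul_mem r hx
  refine Submodule.span_le.mpr ?_ hS
  rintro _ ⟨i, j, hij, x, hx, y, hy, rfl⟩
  exact h i j hij x hx y hy

/-- The linear map on `k[G × G] = k[G] ⊗ k[G]` given by a bilinear map. -/
def tens (β : MonoidAlgebra k G →ₗ[k] MonoidAlgebra k G →ₗ[k] V) :
    MonoidAlgebra k (G × G) →ₗ[k] V :=
  linExt fun g => β (MonoidAlgebra.of k G g.1) (MonoidAlgebra.of k G g.2)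

theorem tens_mul (β : MonoidAlgebra k G →ₗ[k] MonoidAlgebra k G →ₗ[k] V) (x y : MonoidAlgebra k G) :
    tens β (algMap k (MonoidHom.inl G G) x * algMap k (MonoidHom.inr G G) y) = β x y := by
  induction x using MonoidAlgebra.induction_on with
  | of a =>
    induction y using MonoidAlgebra.induction_on with
    | of b =>
      rw [algMap_of, algMap_of, ← map_mul, tens, linExt_of]
      simp
    | add y y' h h' => rw [map_add, mul_add, map_add, h, h', map_add]
    | smul r y h => rw [map_smul, mul_smul_comm, map_smul, h, map_smul]
  | add x x' h h' => rw [map_add, add_mul, map_add, h, h', map_add]; rfl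
  | smul r x h => rw [map_smul, smul_mul_assoc, map_smul, h, map_smul]; rfl

/-- A bilinear map vanishing modulo `W` on `J ^ i × J ^ j` for `i + j = n` induces a linear map on
`k[G × G]` vanishing modulo `W` on the `n`-th power of the ideal of `G × G`. -/
theorem tens_mem (β : MonoidAlgebra k G →ₗ[k] MonoidAlgebra k G →ₗ[k] V) (W : Submodule k V) (n : ℕ)
    (h : ∀ i j, i + j = n → ∀ x ∈ augIdeal k P ^ i, ∀ y ∈ augIdeal k P ^ j, β x y ∈ W)
    {z : MonoidAlgebra k (G × G)} (hz : z ∈ augIdeal k (P.prod P) ^ n) : tens β z ∈ W :=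
  augIdeal_prod_pow_induction (W.comap (tens β)) n (fun i j hij x hx y hy => by
    rw [Submodule.mem_comap, tens_mul]; exact h i j hij x hx y hy) hz

/-- The diagonal of `k[G]`. -/
abbrev diagMap (k : Type v) [CommRing k] (G : Type) [Group G] :
    MonoidAlgebra k G →ₐ[k] MonoidAlgebra k (G × G) :=
  algMap k ((MonoidHom.id G).prod (MonoidHom.id G))

/-- The linear map `g ↦ β(g, g)`, for a bilinear map `β`. -/
def conv (β : MonoidAlgebra k G →ₗ[k] MonoidAlgebra k G →ₗ[k] V) : MonoidAlgebra k G →ₗ[k] V :=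
  tens β ∘ₗ (diagMap k G).toLinearMap

@[simp] theorem conv_of (β : MonoidAlgebra k G →ₗ[k] MonoidAlgebra k G →ₗ[k] V) (g : G) :
    conv β (MonoidAlgebra.of k G g) = β (MonoidAlgebra.of k G g) (MonoidAlgebra.of k G g) := by
  rw [conv, LinearMap.comp_apply, AlgHom.toLinearMap_apply, algMap_of, tens, linExt_of]
  rfl

theorem conv_mem (β : MonoidAlgebra k G →ₗ[k] MonoidAlgebra k G →ₗ[k] V) (W : Submodule k V) (n : ℕ)
    (h : ∀ i j, i + j = n → ∀ x ∈ augIdeal k P ^ i, ∀ y ∈ augIdeal k P ^ j, β x y ∈ W)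
    {x : MonoidAlgebra k G} (hx : x ∈ augIdeal k P ^ n) : conv β x ∈ W :=
  tens_mem β W n h (algMap_mem (Q := P.prod P) _ (fun _ hp => ⟨hp, hp⟩) n hx)

end Filtration

namespace AlgCompl
variable {k : Type v} [CommRing k] {G H : Type} [Group G] [Group H] {P : Subgroup G}
  {Q : Subgroup H} [P.Normal] [Q.Normal] {V : Type*} [AddCommGroup V] [Module k V]

theorem eval_map_of_eq (φ : G →* H) (h : P ≤ Q.comap φ) (n : ℕ) {a : AlgCompl k P}
    {x : MonoidAlgebra k G} (hx : Ideal.Quotient.mk _ x = eval P n a) :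
    eval Q n (map φ h a) = Ideal.Quotient.mk _ (algMap k φ x) := by
  rw [eval_map, ← hx, liftComp_mk]
  have e : (pre ((of k Q).comp φ) n).toLinearMap =
      (Ideal.Quotient.mkₐ k (augIdeal k Q ^ n)).toLinearMap ∘ₗ (algMap k φ).toLinearMap := by
    refine LinearMap.ext (groupAlgebra_hom_ext fun g => ?_)
    rw [AlgHom.toLinearMap_apply, pre_of, LinearMap.comp_apply, AlgHom.toLinearMap_apply,
      AlgHom.toLinearMap_apply, algMap_of]
    rfl
  exact LinearMap.congr_fun e x

/-- A bilinear map which vanishes in filtration `n` cannot distinguish `Δ(u)` from `u ⊗ u`, for the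
representative of a group-like element modulo `J ^ n`. -/
theorem IsGroupLike.conv_eq {u : AlgCompl k P} (hu : IsGroupLike u) {n : ℕ}
    {x : MonoidAlgebra k G} (hx : Ideal.Quotient.mk _ x = eval P n u)
    (β : MonoidAlgebra k G →ₗ[k] MonoidAlgebra k G →ₗ[k] V) {W : Submodule k V}
    (h : ∀ i j, i + j = n → ∀ x ∈ augIdeal k P ^ i, ∀ y ∈ augIdeal k P ^ j, β x y ∈ W) :
    conv β x - β x x ∈ W := by
  have e := congrArg (eval (P.prod P) n) hu
  rw [map_mul, comul, inl, inr, eval_map_of_eq _ _ n hx, eval_map_of_eq _ _ n hx,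
    eval_map_of_eq _ _ n hx, ← map_mul, Ideal.Quotient.eq] at e
  have k1 := tens_mem β W n h e
  rwa [map_sub, tens_mul] at k1

/-- A linear map which vanishes on an ideal factors through the quotient. -/
theorem exists_linear_factor {n : ℕ} (f : MonoidAlgebra k G →ₗ[k] V)
    (h : ∀ x ∈ augIdeal k P ^ n, f x = 0) :
    ∃ f' : Trunc k P n →ₗ[k] V, ∀ x, f' (Ideal.Quotient.mk _ x) = f x := by
  have hs : ∀ y : Trunc k P n, ∃ x, Ideal.Quotient.mk _ x = y := Ideal.Quotient.mk_surjective
  choose s hs using hs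
  have key : ∀ x x', (Ideal.Quotient.mk _ x : Trunc k P n) = Ideal.Quotient.mk _ x' → f x = f x' :=
    fun x x' e => by rw [← sub_eq_zero, ← map_sub]; exact h _ (Ideal.Quotient.eq.mp e)
  refine ⟨{ toFun := fun y => f (s y), map_add' := fun y y' => ?_, map_smul' := fun r y => ?_ },
    fun x => key _ _ (hs _)⟩
  · rw [← map_add]
    exact key _ _ (by rw [hs, map_add, hs, hs])
  · rw [RingHom.id_apply, ← map_smul]
    refine key _ _ ?_
    rw [hs]
    exact congrArg (r • ·) (hs y).symm

end AlgCompl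

/-! ### Powers with exponents in a `ℚ`-algebra -/

section Powers
variable {k : Type v} [CommRing k] [Algebra ℚ k] {R : Type*} [Ring R] [Algebra k R]

variable (k R) in
/-- The polynomial functions of an exponent with values in a noncommutative algebra. -/
def polyFun : Subalgebra k (k → R) :=
  Algebra.adjoin k (Set.range (fun r _ => r) ∪ {fun c => algebraMap k R c})

theorem const_mem_polyFun (r : R) : (fun _ => r) ∈ polyFun k R :=
  Algebra.subset_adjoin (Or.inl ⟨r, rfl⟩)

theorem id_mem_polyFun : (fun c => algebraMap k R c) ∈ polyFun k R :=
  Algebra.subset_adjoin (Or.inr rfl)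

/-- A polynomial function which vanishes on the natural numbers vanishes: it is a polynomial in an
element of `k` with coefficients in a `ℚ`-vector space. -/
theorem polyFun_eq_zero {f : k → R} (hf : f ∈ polyFun k R) (h : ∀ n : ℕ, f n = 0) (c : k) :
    f c = 0 := by
  have key : ∃ q : Polynomial R, ∀ c, f c = q.eval (algebraMap k R c) := by
    clear h
    induction hf using Algebra.adjoin_induction with
    | mem f hf =>
      rcases hf with ⟨r, rfl⟩ | rfl
      · exact ⟨Polynomial.C r, fun c => by simp⟩
      · exact ⟨Polynomial.X, fun c => by simp⟩
    | algebraMap r => exact ⟨Polynomial.C (algebraMap k R r), fun c => by simp⟩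
    | add f g _ _ hf hg =>
      obtain ⟨p, hp⟩ := hf
      obtain ⟨q, hq⟩ := hg
      exact ⟨p + q, fun c => by rw [Pi.add_apply, hp, hq, Polynomial.eval_add]⟩
    | mul f g _ _ hf hg =>
      obtain ⟨p, hp⟩ := hf
      obtain ⟨q, hq⟩ := hg
      refine ⟨p * q, fun c => ?_⟩
      rw [Pi.mul_apply, hp, hq, Polynomial.eval, Polynomial.eval,
        Polynomial.eval, Polynomial.eval₂_mul_noncomm]
      exact fun i => (Algebra.commutes c _).symm
  obtain ⟨q, hq⟩ := key
  have e : ∀ c, f c = ∑ i ∈ Finset.range (q.natDegree + 1),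
      Polynomial.aeval c (Polynomial.X ^ i : Polynomial ℚ) • q.coeff i := fun c => by
    rw [hq, Polynomial.eval_eq_sum_range]
    refine Finset.sum_congr rfl fun i _ => ?_
    rw [map_pow, Polynomial.aeval_X, Algebra.smul_def, map_pow]
    exact (show Commute _ _ from (Algebra.commutes c (q.coeff i)).symm).pow_right i
  rw [e]
  exact sum_aeval_smul_eq_zero _ _ _ (fun n => by rw [← e, h]) c

theorem polyFun_smul {p : k → k} (hp : p ∈ polyFun k k) (r : R) :
    (fun c => p c • r) ∈ polyFun k R := by
  induction hp using Algebra.adjoin_induction generalizing r with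
  | mem f hf =>
    rcases hf with ⟨s, rfl⟩ | rfl
    · exact const_mem_polyFun _
    · have := mul_mem (id_mem_polyFun (k := k)) (const_mem_polyFun (k := k) r)
      convert this using 1
      funext c
      simp [Algebra.smul_def]
  | algebraMap s => exact const_mem_polyFun (k := k) (s • r)
  | add f g _ _ hf hg =>
    convert add_mem (hf r) (hg r) using 1
    funext c
    simp [add_smul]
  | mul f g _ _ hf hg =>
    convert mul_mem (hf 1) (hg r) using 1
    funext c
    simp [mul_smul, smul_comm (g c)]

theorem polyFun_binom {p : k → k} (hp : p ∈ polyFun k k) (j : ℕ) :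
    (fun c => binom (p c) j) ∈ polyFun k k := by
  have e : (fun c => binom (p c) j) = fun c => algebraMap ℚ k ((j.factorial : ℚ)⁻¹) *
      (∏ i ∈ Finset.range j, (p - fun _ => (i : k)) : k → k) c := by
    funext c
    simp [binom, Algebra.smul_def]
  rw [e]
  exact mul_mem (const_mem_polyFun _)
    (prod_mem fun i _ => sub_mem hp (const_mem_polyFun (k := k) (i : k)))

theorem polyFun_powTrunc {p : k → k} (hp : p ∈ polyFun k k) (n : ℕ) (a : R) :
    (fun c => powTrunc n a (p c)) ∈ polyFun k R := by
  have e : (fun c => powTrunc n a (p c)) =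
      ∑ j ∈ Finset.range n, fun c => binom (p c) j • a ^ j := by
    funext c
    simp [powTrunc]
  rw [e]
  exact sum_mem fun j _ => polyFun_smul (polyFun_binom hp j) _

/-- The rules of exponents hold for natural exponents, and both sides are polynomial functions of
the exponents. -/
theorem powTrunc_add (n : ℕ) (a : R) (ha : a ^ n = 0) (c d : k) :
    powTrunc n a (c + d) = powTrunc n a c * powTrunc n a d := by
  have hid : (fun c : k => c) ∈ polyFun k k := id_mem_polyFun (k := k) (R := k)
  have h1 : ∀ (M : ℕ) (c : k), powTrunc n a (c + M) - powTrunc n a c * powTrunc n a (M : k) = 0 :=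
    fun M => polyFun_eq_zero (sub_mem (polyFun_powTrunc (add_mem hid (const_mem_polyFun (M : k))) n a)
      (mul_mem (polyFun_powTrunc hid n a) (const_mem_polyFun _))) fun N => by
        rw [sub_eq_zero, powTrunc_natCast n a ha, powTrunc_natCast n a ha, ← pow_add,
          ← powTrunc_natCast (k := k) n a ha]
        push_cast
        rfl
  rw [← sub_eq_zero]
  exact polyFun_eq_zero (f := fun d => powTrunc n a (c + d) - powTrunc n a c * powTrunc n a d)
    (sub_mem (polyFun_powTrunc (add_mem (const_mem_polyFun c) hid) n a)
      (mul_mem (const_mem_polyFun _) (polyFun_powTrunc hid n a))) (fun M => h1 M c) d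

theorem powTrunc_zero (n : ℕ) (hn : n ≠ 0) (a : R) : powTrunc n a (0 : k) = 1 := by
  unfold powTrunc
  rw [Finset.sum_eq_single_of_mem 0 (Finset.mem_range.mpr (Nat.pos_of_ne_zero hn))]
  · simp [binom]
  · intro j _ hj
    have : binom (0 : k) j = 0 := by
      have := binom_natCast (k := k) 0 j
      rw [Nat.cast_zero] at this
      rw [this, Nat.choose_eq_zero_of_lt (Nat.pos_of_ne_zero hj), Nat.cast_zero]
    rw [this, zero_smul]

theorem powTrunc_powTrunc (n : ℕ) (hn : n ≠ 0) (a : R) (ha : a ^ n = 0) (c d : k)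
    (hc : (powTrunc n a c - 1) ^ n = 0) :
    powTrunc n a (c * d) = powTrunc n (powTrunc n a c - 1) d := by
  have hid : (fun c : k => c) ∈ polyFun k k := id_mem_polyFun (k := k) (R := k)
  rw [← sub_eq_zero]
  refine polyFun_eq_zero
    (f := fun d => powTrunc n a (c * d) - powTrunc n (powTrunc n a c - 1) d)
    (sub_mem (polyFun_powTrunc (mul_mem (const_mem_polyFun c) hid) n a)
      (polyFun_powTrunc hid n _)) (fun M => ?_) d
  rw [powTrunc_natCast n _ hc, sub_eq_zero, add_sub_cancel]
  induction M with
  | zero => rw [Nat.cast_zero, mul_zero, powTrunc_zero n hn, pow_zero]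
  | succ M ih => rw [Nat.cast_succ, mul_add, mul_one, powTrunc_add n a ha, ih, pow_succ]

end Powers

namespace AlgCompl
variable {k : Type v} [CommRing k] {G H : Type} [Group G] [Group H] {P : Subgroup G}
  {Q : Subgroup H} [P.Normal] [Q.Normal]

theorem gl_ext {x y : GroupLike P k} (h : glVal x = glVal y) (h' : glProj P k x = glProj P k y) :
    x = y := Subtype.ext (Prod.ext (Units.ext h) h')

/-- The truncation at order `0` is zero, since `J ^ 0` is the whole algebra. -/
theorem subsingleton_trunc_zero : Subsingleton (Trunc k P 0) := by
  rw [Ideal.Quotient.subsingleton_iff, Submodule.pow_zero, Ideal.one_eq_top]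

theorem glVal_mul (x y : GroupLike P k) : glVal (x * y) = glVal x * glVal y := rfl

theorem isGroupLike_glVal (x : GroupLike P k) : IsGroupLike (glVal x) := x.2.1

theorem mk_eval_of_le (a : AlgCompl k P) {x : MonoidAlgebra k G} {m n : ℕ} (h : m ≤ n)
    (e : Ideal.Quotient.mk _ x = eval P n a) : Ideal.Quotient.mk _ x = eval P m a := by
  rw [← factor_eval P a h, ← e]; rfl

variable [Algebra ℚ k]

theorem eval_glPow (x : (glProj P k).ker) (c : k) (n : ℕ) :
    eval P n (glVal (glPow x c).1) = powTrunc n (eval P n (glVal x.1) - 1) c := rfl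

theorem sub_one_pow_gl (x : (glProj P k).ker) (n : ℕ) : (eval P n (glVal x.1) - 1) ^ n = 0 :=
  sub_one_pow P (eval_one_glVal x.1 x.2) n

theorem glProj_glPow (x : (glProj P k).ker) (c : k) : glProj P k (glPow x c).1 = 1 := (glPow x c).2

/-- Extensions of morphisms commute with powers. -/
theorem glLift_glPow (θ : G →* GroupLike Q k) (hθ : ∀ p ∈ P, glProj Q k (θ p) = 1)
    (x : (glProj P k).ker) (h : glLift θ hθ x.1 ∈ (glProj Q k).ker) (c : k) :
    glLift θ hθ (glPow x c).1 = (glPow ⟨glLift θ hθ x.1, h⟩ c).1 := by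
  refine gl_ext (ext fun n => ?_) ?_
  · rw [eval_glPow]
    change liftComp (glHom θ) (glHom_one θ hθ) n (eval P n (glVal (glPow x c).1)) =
      powTrunc n (liftComp (glHom θ) (glHom_one θ hθ) n (eval P n (glVal x.1)) - 1) c
    rw [eval_glPow, map_powTrunc, map_sub, map_one]
  · rw [glProj_glPow]
    exact map_one (QuotientGroup.lift P ((glProj Q k).comp θ) hθ)

theorem glPow_add (x : (glProj P k).ker) (c d : k) :
    (glPow x (c + d)).1 = (glPow x c).1 * (glPow x d).1 := by
  refine gl_ext (ext fun n => ?_) (by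
    rw [map_mul, glProj_glPow, glProj_glPow, glProj_glPow, one_mul])
  rw [glVal_mul, map_mul, eval_glPow, eval_glPow, eval_glPow, powTrunc_add n _ (sub_one_pow_gl x n)]

theorem glPow_mul (x : (glProj P k).ker) (c d : k) :
    (glPow x (c * d)).1 = (glPow (glPow x c) d).1 := by
  refine gl_ext (ext fun n => ?_) (by rw [glProj_glPow, glProj_glPow])
  rcases eq_or_ne n 0 with rfl | hn
  · exact subsingleton_trunc_zero.elim _ _
  rw [eval_glPow, eval_glPow, eval_glPow]
  exact powTrunc_powTrunc n hn _ (sub_one_pow_gl x n) c d (sub_one_pow_gl (glPow x c) n)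

theorem glPow_one (x : (glProj P k).ker) : (glPow x 1).1 = x.1 := by
  refine gl_ext (ext fun n => ?_) ((glProj_glPow x 1).trans x.2.symm)
  rw [eval_glPow]
  have := powTrunc_natCast (k := k) n _ (sub_one_pow_gl x n) 1
  rw [Nat.cast_one, pow_one, add_sub_cancel] at this
  exact this

theorem mul_glPow (x y : (glProj P k).ker) (h : Commute x.1 y.1) (c : k) :
    (glPow (x * y) c).1 = (glPow x c).1 * (glPow y c).1 :=
  gl_ext (powVal_mul _ _ (congrArg glVal h) (eval_one_glVal x.1 x.2) (eval_one_glVal y.1 y.2)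
    (eval_one_glVal _ (x * y).2) c) (by
    rw [map_mul, glProj_glPow, glProj_glPow, glProj_glPow, one_mul])

/-! ### Regular maps in the prounipotent setting -/

omit [Algebra ℚ k] in
/-- A group-like element over a coset is a combination of the elements of this coset. -/
theorem eval_mem_span (u : GroupLike P k) {g₀ : G} (h : glProj P k u = QuotientGroup.mk' P g₀)
    (n : ℕ) : eval P n (glVal u) ∈ Submodule.span k {y | ∃ g : G, QuotientGroup.mk' P g =
      QuotientGroup.mk' P g₀ ∧ y = eval P n (of k P g)} := by
  rcases Nat.eq_zero_or_pos n with rfl | hn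
  · rw [subsingleton_trunc_zero.elim (eval P 0 (glVal u)) 0]
    exact Submodule.zero_mem _
  classical
  obtain ⟨x, hx⟩ := Ideal.Quotient.mk_surjective (eval P n (glVal u))
  let ε : MonoidAlgebra k G →ₗ[k] k :=
    linExt fun g => if QuotientGroup.mk' P g = QuotientGroup.mk' P g₀ then 1 else 0
  have hε : ∀ x ∈ augIdeal k P, ε x = 0 := fun x hx => by
    refine (Submodule.mem_bot k).mp (map_augIdeal_mem (P := P) ε ⊥ (fun g g' hg => ?_) hx)
    rw [Submodule.mem_bot, linExt_of, linExt_of, hg, sub_self]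
  let β : MonoidAlgebra k G →ₗ[k] MonoidAlgebra k G →ₗ[k] Trunc k P n :=
    (LinearMap.lsmul k (Trunc k P n)).flip.compl₁₂
      (Ideal.Quotient.mkₐ k (augIdeal k P ^ n)).toLinearMap ε
  have hβ : ∀ x y, β x y = ε y • Ideal.Quotient.mk _ x := fun _ _ => rfl
  -- For a group-like element `u`, represented by `x`, the convolution `g ↦ ε (g) g` takes the value
  -- `ε (u) u`, and `ε` takes the value `1` on `u`.
  have key : conv β x - β x x ∈ (⊥ : Submodule k (Trunc k P n)) := by
    refine (isGroupLike_glVal u).conv_eq hx β fun i j hij a ha b hb => ?_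
    rw [hβ, Submodule.mem_bot]
    rcases Nat.eq_zero_or_pos j with rfl | hj
    · have : (Ideal.Quotient.mk _ a : Trunc k P n) = 0 :=
        Ideal.Quotient.eq_zero_iff_mem.mpr (augIdeal_pow_le (by omega) ha)
      rw [this, smul_zero]
    · rw [hε b (by have := augIdeal_pow_le (m := 1) hj hb; rwa [Submodule.pow_one] at this), zero_smul]
  have h1 : ε x = 1 := by
    obtain ⟨-, g, hg, hgx⟩ := u.2
    have e := mk_eval_of_le (glVal u) hn hx
    have e' : (Ideal.Quotient.mk (augIdeal k P ^ 1) x) =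
      Ideal.Quotient.mk _ (MonoidAlgebra.of k G g) := e.trans hgx
    rw [Ideal.Quotient.eq, Submodule.pow_one] at e'
    have := hε _ e'
    rw [map_sub, linExt_of, if_pos (hg.trans h), sub_eq_zero] at this
    exact this
  rw [Submodule.mem_bot, sub_eq_zero, hβ, h1, one_smul, hx] at key
  rw [← key]
  refine groupAlgebra_mem (fun g => ?_) x
  rw [conv_of, hβ, linExt_of]
  split_ifs with hg
  · rw [one_smul]
    exact Submodule.subset_span ⟨g, hg, rfl⟩
  · rw [zero_smul]
    exact Submodule.zero_mem _

/-- The projection is determined by the completed group algebra, unless the latter vanishes. -/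
theorem glProj_eq_of_glVal [Nontrivial k] {x y : GroupLike P k} (h : glVal x = glVal y) :
    glProj P k x = glProj P k y := by
  obtain ⟨-, g, hg, hgx⟩ := x.2
  obtain ⟨-, g', hg', hgx'⟩ := y.2
  refine hg.symm.trans (Eq.trans ?_ hg')
  have e : eval P 1 (of k P g) = eval P 1 (of k P g') :=
    hgx.symm.trans ((congrArg (eval P 1) h).trans hgx')
  rw [eval_of, eval_of, Ideal.Quotient.eq, Submodule.pow_one, mem_augIdeal_iff, map_sub, algMap_of,
    algMap_of, sub_eq_zero] at e
  exact MonoidAlgebra.of_injective e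

theorem factor_linear (m n : ℕ) (h : m ≤ n) : ∃ f : Trunc k P n →ₗ[k] Trunc k P m,
    ∀ a : AlgCompl k P, f (eval P n a) = eval P m a :=
  ⟨(Ideal.Quotient.factorₐ k (Ideal.pow_le_pow_right (I := augIdeal k P) h)).toLinearMap,
    fun a => factor_eval P a h⟩

/-- Products of regular maps are regular: on group-like elements, the product of two linear maps `Λ`
and `Λ'` is given by the linear map `g ↦ Λ (g) Λ' (g)`. -/
theorem regular_mul {α : Type v} (p : α → GroupLike P k) (q q' : α → GroupLike Q k)
    (h : (unip k).Regular P Q p q) (h' : (unip k).Regular P Q p q') :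
    (unip k).Regular P Q p (fun a => (q a * q' a : GroupLike Q k)) := by
  intro N
  obtain ⟨M, Λ, hΛ⟩ := h N
  obtain ⟨M', Λ', hΛ'⟩ := h' N
  let β : MonoidAlgebra k G →ₗ[k] MonoidAlgebra k G →ₗ[k] Trunc k Q N :=
    (LinearMap.mul k (Trunc k Q N)).compl₁₂
      (Λ ∘ₗ (Ideal.Quotient.mkₐ k (augIdeal k P ^ M)).toLinearMap)
      (Λ' ∘ₗ (Ideal.Quotient.mkₐ k (augIdeal k P ^ M')).toLinearMap)
  have hβ : ∀ x y, β x y = Λ (Ideal.Quotient.mk _ x) * Λ' (Ideal.Quotient.mk _ y) :=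
    fun _ _ => rfl
  have hβ0 : ∀ i j, i + j = M + M' → ∀ x ∈ augIdeal k P ^ i, ∀ y ∈ augIdeal k P ^ j,
      β x y ∈ (⊥ : Submodule k (Trunc k Q N)) := by
    intro i j hij x hx y hy
    rw [hβ, Submodule.mem_bot]
    rcases le_total M i with hi | hi
    · rw [show (Ideal.Quotient.mk _ x : Trunc k P M) = 0 from
        Ideal.Quotient.eq_zero_iff_mem.mpr (augIdeal_pow_le hi hx), map_zero, zero_mul]
    · rw [show (Ideal.Quotient.mk _ y : Trunc k P M') = 0 from
        Ideal.Quotient.eq_zero_iff_mem.mpr (augIdeal_pow_le (by omega) hy), map_zero, mul_zero]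
  obtain ⟨f, hf⟩ := exists_linear_factor (P := P) (n := M + M') (conv β) (fun x hx =>
    (Submodule.mem_bot k).mp (conv_mem β ⊥ (M + M') hβ0 hx))
  refine ⟨M + M', f, fun a => ?_⟩
  obtain ⟨x, hx⟩ := Ideal.Quotient.mk_surjective (eval P (M + M') (glVal (p a)))
  have key := (Submodule.mem_bot k).mp ((isGroupLike_glVal (p a)).conv_eq hx β hβ0)
  rw [sub_eq_zero] at key
  refine (congrArg₂ (· * ·) (hΛ a) (hΛ' a)).trans ?_
  rw [← hx, hf, key, hβ, mk_eval_of_le _ (Nat.le_add_right M M') hx,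
    mk_eval_of_le _ (Nat.le_add_left M' M) hx]

/-- A regular map is determined by its values on the uncompleted group, since a group-like element
over a coset is modulo each power of `J` a combination of elements of this coset. -/
theorem regular_ext {α : Type v} (p : α → GroupLike P k) (q q' : α → GroupLike Q k)
    (hp : Function.Injective p) (h : (unip k).Regular P Q p q) (h' : (unip k).Regular P Q p q')
    (e : ∀ a g, glProj P k (p a) = QuotientGroup.mk' P g → ∃ b, p b = glOf P k g ∧ q b = q' b) :
    q = q' := by
  funext a
  obtain ⟨g₀, hg₀⟩ := QuotientGroup.mk'_surjective P (glProj P k (p a))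
  -- Over the zero ring the completed algebra is zero, and the completion is the quotient `G / P`.
  rcases subsingleton_or_nontrivial k with hk | hk
  · obtain ⟨b, hb, hq⟩ := e a g₀ hg₀.symm
    have : Subsingleton (AlgCompl k P) := Module.subsingleton k _
    obtain rfl : b = a := hp (hb.trans (gl_ext (Subsingleton.elim _ _) hg₀))
    exact hq
  have hv : glVal (q a) = glVal (q' a) := ext fun N => by
    obtain ⟨M, Λ, hΛ⟩ := h N
    obtain ⟨M', Λ', hΛ'⟩ := h' N
    obtain ⟨f, hf⟩ := factor_linear (k := k) (P := P) M (max M M') (le_max_left _ _)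
    obtain ⟨f', hf'⟩ := factor_linear (k := k) (P := P) M' (max M M') (le_max_right _ _)
    have key : (Λ ∘ₗ f - Λ' ∘ₗ f') (eval P (max M M') (glVal (p a))) = 0 := by
      have hs : Submodule.span k {y | ∃ g : G, QuotientGroup.mk' P g =
          QuotientGroup.mk' P g₀ ∧ y = eval P (max M M') (of k P g)} ≤
          LinearMap.ker (Λ ∘ₗ f - Λ' ∘ₗ f') := by
        rw [Submodule.span_le]
        rintro _ ⟨g, hg, rfl⟩
        obtain ⟨b, hb, hq⟩ := e a g (hg₀.symm.trans hg.symm)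
        have hb' : of k P g = glVal (p b) := (congrArg glVal hb).symm
        rw [SetLike.mem_coe, LinearMap.mem_ker, LinearMap.sub_apply, LinearMap.comp_apply,
          LinearMap.comp_apply, hf, hf', hb', ← hΛ b, ← hΛ' b, hq, sub_self]
      exact hs (eval_mem_span (p a) hg₀.symm _)
    rw [LinearMap.sub_apply, LinearMap.comp_apply, LinearMap.comp_apply, hf, hf', ← hΛ a, ← hΛ' a,
      sub_eq_zero] at key
    exact key
  exact gl_ext hv (glProj_eq_of_glVal hv)

/-- A constant map is a multiple of the counit, which takes the value `1` on group-like elements. -/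
theorem regular_const {α : Type v} (p : α → GroupLike P k) (c : GroupLike Q k) :
    (unip k).Regular P Q p (fun _ => c) := by
  intro N
  obtain ⟨ε, hε⟩ := exists_linear_factor (P := P) (n := 1) (linExt fun _ : G => (1 : k))
    (fun x hx => by
      rw [Submodule.pow_one] at hx
      refine (Submodule.mem_bot k).mp (map_augIdeal_mem (P := P) _ ⊥ (fun g g' _ => ?_) hx)
      rw [Submodule.mem_bot, linExt_of, linExt_of, sub_self])
  refine ⟨1, LinearMap.toSpanSingleton k _ (eval Q N (glVal c)) ∘ₗ ε, fun a => ?_⟩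
  obtain ⟨-, g, -, hg⟩ := (p a).2
  have e : ε (eval P 1 (glVal (p a))) = 1 := by
    refine (congrArg ε hg).trans ?_
    rw [eval_of, hε, linExt_of]
  rw [LinearMap.comp_apply, e, LinearMap.toSpanSingleton_apply, one_smul]

end AlgCompl

/-! ### Exponentials and logarithms of nilpotent elements -/

section ExpLog
open Polynomial

/-- The truncation at order `n` of the exponential series. -/
def expPoly (n : ℕ) : ℚ[X] := ∑ i ∈ Finset.range n, C ((i.factorial : ℚ)⁻¹) * X ^ i

/-- The coefficient of `X ^ j` in the series `log (1 + X)`. -/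
def logCoeff (j : ℕ) : ℚ := (-1) ^ (j + 1) / j

/-- The truncation at order `n` of the series `log (1 + X)`. -/
def logPoly (n : ℕ) : ℚ[X] := ∑ j ∈ Finset.range n, C (logCoeff j) * X ^ j

theorem logCoeff_zero : logCoeff 0 = 0 := by simp [logCoeff]

theorem logPoly_succ (m : ℕ) :
    logPoly (m + 1) = ∑ j ∈ Finset.range m, C (logCoeff (j + 1)) * X ^ (j + 1) := by
  rw [logPoly, Finset.sum_range_succ', logCoeff_zero, map_zero, zero_mul, add_zero]

theorem X_dvd_logPoly (n : ℕ) : X ∣ logPoly n := by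
  rcases n with _ | m
  · simp [logPoly]
  · rw [logPoly_succ]
    exact Finset.dvd_sum fun j _ => (dvd_pow_self X j.succ_ne_zero).mul_left _

theorem derivative_expPoly (m : ℕ) :
    derivative (expPoly (m + 1)) = expPoly (m + 1) - C ((m.factorial : ℚ)⁻¹) * X ^ m := by
  have h : derivative (expPoly (m + 1)) = expPoly m := by
    rw [expPoly, Finset.sum_range_succ', derivative_add, derivative_sum]
    simp only [pow_zero, mul_one, derivative_C, add_zero, expPoly]
    refine Finset.sum_congr rfl fun i _ => ?_
    rw [derivative_C_mul_X_pow, Nat.add_sub_cancel]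
    congr 2
    rw [Nat.factorial_succ]
    have : (i.factorial : ℚ) ≠ 0 := by positivity
    push_cast
    field_simp
  rw [h, expPoly, expPoly, Finset.sum_range_succ, add_sub_cancel_right]

/-- The differential equation `(1 + X) l' = 1` of the logarithm, up to the truncation. -/
theorem one_add_X_mul_derivative_logPoly (m : ℕ) :
    (1 + X) * derivative (logPoly (m + 1)) = 1 - (-X) ^ m := by
  have h : derivative (logPoly (m + 1)) = ∑ j ∈ Finset.range m, (-X : ℚ[X]) ^ j := by
    rw [logPoly_succ, derivative_sum]
    refine Finset.sum_congr rfl fun j _ => ?_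
    rw [derivative_C_mul_X_pow, Nat.add_sub_cancel, neg_pow]
    have : logCoeff (j + 1) * ((j + 1 : ℕ) : ℚ) = (-1) ^ j := by
      have : ((j : ℚ) + 1) ≠ 0 := by positivity
      rw [logCoeff]
      push_cast
      field_simp
      ring
    rw [this]
    simp
  rw [h]
  have := mul_neg_geom_sum (-X : ℚ[X]) m
  rwa [sub_neg_eq_add] at this

/-- `exp (log (1 + X)) = 1 + X` modulo `X ^ n`: by the differential equation
`(1 + X) y' = y` of the left hand side. -/
theorem X_pow_dvd_expPoly_comp_logPoly (m : ℕ) :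
    X ^ (m + 1) ∣ (expPoly (m + 1)).comp (logPoly (m + 1)) - (1 + X) := by
  set l := logPoly (m + 1) with hl
  set y := (expPoly (m + 1)).comp l with hy
  have hX : X ∣ l := X_dvd_logPoly _
  have hd : X ^ m ∣ (1 + X) * derivative y - y := by
    have e : (1 + X) * derivative y - y = -(-X) ^ m * y -
        (1 - (-X) ^ m) * (C ((m.factorial : ℚ)⁻¹) * l ^ m) := by
      rw [hy, derivative_comp, ← mul_assoc, hl, one_add_X_mul_derivative_logPoly, derivative_expPoly]
      simp only [sub_comp, mul_comp, C_comp, X_pow_comp]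
      ring
    rw [e]
    refine dvd_sub (Dvd.dvd.mul_right ?_ _) (Dvd.dvd.mul_left (Dvd.dvd.mul_left ?_ _) _)
    · rw [neg_pow, dvd_neg]
      exact dvd_mul_left _ _
    · exact pow_dvd_pow_of_dvd hX m
  have h0 : y.coeff 0 = 1 := by
    rw [coeff_zero_eq_eval_zero, hy, eval_comp]
    obtain ⟨q, hq⟩ := hX
    rw [hq, eval_mul, eval_X, zero_mul, expPoly, Finset.sum_range_succ']
    simp [eval_finsetSum]
  have hs : ∀ i < m, y.coeff (i + 1) * (i + 1) = (1 - i) * y.coeff i := by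
    intro i hi
    have := (X_pow_dvd_iff.mp hd) i hi
    rw [coeff_sub, add_mul, one_mul, coeff_add, coeff_derivative] at this
    rcases i with _ | i
    · rw [coeff_X_mul_zero] at this
      simp only [Nat.cast_zero] at this ⊢
      linarith
    · rw [coeff_X_mul, coeff_derivative] at this
      push_cast at this ⊢
      linarith
  rw [X_pow_dvd_iff]
  intro i hi
  have key : ∀ i < m + 1, y.coeff i = (1 + X : ℚ[X]).coeff i := by
    intro i
    induction i with
    | zero => intro _; rw [h0]; simp
    | succ i ih =>
      intro hi
      have e := hs i (by omega)
      rw [ih (by omega)] at e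
      have hne : (i : ℚ) + 1 ≠ 0 := by positivity
      refine mul_right_cancel₀ hne (e.trans ?_)
      rw [coeff_add, coeff_add, coeff_one, coeff_one, coeff_X, coeff_X]
      rcases i with _ | _ | i
      · simp
      · simp
      · simp
  rw [coeff_sub, key i hi, sub_self]

variable {R : Type*} [Ring R] [Algebra ℚ R]

theorem aeval_logPoly_pow {n : ℕ} {a : R} (ha : a ^ n = 0) : (aeval a (logPoly n)) ^ n = 0 := by
  obtain ⟨q, hq⟩ := X_dvd_logPoly n
  rw [hq, ← map_pow, mul_pow, map_mul, map_pow, aeval_X, ha, zero_mul]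

theorem exp_aeval_logPoly {n : ℕ} {a : R} (ha : a ^ n = 0) :
    IsNilpotent.exp (aeval a (logPoly n)) = 1 + a := by
  rcases n with _ | m
  · rw [pow_zero] at ha
    have := subsingleton_of_zero_eq_one ha.symm
    exact Subsingleton.elim _ _
  have e : aeval (aeval a (logPoly (m + 1))) (expPoly (m + 1)) = 1 + a := by
    obtain ⟨q, hq⟩ := X_pow_dvd_expPoly_comp_logPoly m
    rw [← aeval_comp, sub_eq_iff_eq_add.mp hq, map_add, map_mul, map_pow, aeval_X, ha, zero_mul,
      zero_add, map_add, map_one, aeval_X]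
  rw [IsNilpotent.exp_eq_sum (aeval_logPoly_pow ha), ← e, expPoly, map_sum]
  refine Finset.sum_congr rfl fun i _ => ?_
  rw [map_mul, aeval_C, map_pow, aeval_X, Algebra.smul_def]

/-- For nilpotent `z`, the element `exp z - 1` is the product of `z` and a unit. -/
theorem eq_zero_of_exp_eq_one {z : R} (hz : IsNilpotent z) (h : IsNilpotent.exp z = 1) : z = 0 := by
  obtain ⟨m, hm⟩ := hz
  have e := IsNilpotent.exp_eq_sum (pow_eq_zero_of_le (Nat.le_add_right m 2) hm)
  rw [Finset.sum_range_succ', Finset.sum_range_succ'] at e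
  set w := ∑ i ∈ Finset.range m, ((i + 1 + 1).factorial : ℚ)⁻¹ • z ^ i with hw
  have e2 : ∑ i ∈ Finset.range m, ((i + 1 + 1).factorial : ℚ)⁻¹ • z ^ (i + 1 + 1) = z * (z * w) := by
    rw [hw, Finset.mul_sum, Finset.mul_sum]
    refine Finset.sum_congr rfl fun i _ => ?_
    rw [mul_smul_comm, mul_smul_comm, pow_succ', pow_succ']
  rw [e2, h] at e
  simp only [zero_add, Nat.factorial_one, Nat.cast_one, inv_one, one_smul, pow_one,
    Nat.factorial_zero, pow_zero] at e
  have hc : Commute z w := Commute.sum_right _ _ _ fun i _ =>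
    ((Commute.refl z).pow_right i).smul_right _
  have hu : IsUnit (1 + z * w) := (hc.isNilpotent_mul_right ⟨m, hm⟩).isUnit_one_add
  have e3 : z * (1 + z * w) = 0 := by
    rw [mul_add, mul_one, add_comm]
    exact add_eq_right.mp e.symm
  exact hu.mul_left_eq_zero.mp e3

theorem commute_aeval {x y : R} (h : Commute x y) (p : ℚ[X]) : Commute (aeval x p) y := by
  induction p using Polynomial.induction_on' with
  | add p q hp hq => rw [map_add]; exact hp.add_left hq
  | monomial n r =>
    rw [aeval_monomial]
    exact (Algebra.commute_algebraMap_left r y).mul_left (h.pow_left n)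

/-- The logarithm turns products of commuting elements into sums. -/
theorem aeval_logPoly_mul {n : ℕ} {a b : R} (hab : Commute a b) (ha : a ^ n = 0) (hb : b ^ n = 0)
    (h : (a + b + a * b) ^ n = 0) :
    aeval (a + b + a * b) (logPoly n) = aeval a (logPoly n) + aeval b (logPoly n) := by
  have hc : ∀ {x y : R}, Commute x y → ∀ p q : ℚ[X], Commute (aeval x p) (aeval y q) := by
    intro x y hxy p q
    exact commute_aeval (commute_aeval hxy.symm q).symm p
  have hs : Commute (a + b + a * b) a :=
    ((Commute.refl a).add_left hab.symm).add_left ((Commute.refl a).mul_left hab.symm)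
  have hs' : Commute (a + b + a * b) b :=
    (hab.add_left (Commute.refl b)).add_left (hab.mul_left (Commute.refl b))
  have c1 := hc hab (logPoly n) (logPoly n)
  have c2 := (hc hs (logPoly n) (logPoly n)).add_right (hc hs' (logPoly n) (logPoly n))
  have n1 : IsNilpotent (aeval a (logPoly n)) := ⟨n, aeval_logPoly_pow ha⟩
  have n2 : IsNilpotent (aeval b (logPoly n)) := ⟨n, aeval_logPoly_pow hb⟩
  have n3 : IsNilpotent (aeval (a + b + a * b) (logPoly n)) := ⟨n, aeval_logPoly_pow h⟩
  have n4 := c1.isNilpotent_add n1 n2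
  rw [← sub_eq_zero]
  refine eq_zero_of_exp_eq_one (c2.isNilpotent_sub n3 n4) ?_
  rw [sub_eq_add_neg, IsNilpotent.exp_add_of_commute c2.neg_right n3 n4.neg]
  have e : IsNilpotent.exp (aeval (a + b + a * b) (logPoly n)) =
      IsNilpotent.exp (aeval a (logPoly n) + aeval b (logPoly n)) := by
    rw [exp_aeval_logPoly h, IsNilpotent.exp_add_of_commute c1 n1 n2, exp_aeval_logPoly ha,
      exp_aeval_logPoly hb]
    noncomm_ring
  rw [e, IsNilpotent.exp_mul_exp_neg_self n4]

end ExpLog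

/-! ### Lifting group-like elements along surjections -/

namespace AlgCompl
section Log
variable {k : Type v} [CommRing k] {G H : Type} [Group G] [Group H] {P : Subgroup G}
  {Q : Subgroup H} [P.Normal] [Q.Normal]

/-- A sequence in `k[G]` which converges for the `J`-adic topology. -/
def ofSeq (x : ℕ → MonoidAlgebra k G) (h : ∀ n, x (n + 1) - x n ∈ augIdeal k P ^ n) :
    AlgCompl k P :=
  ⟨fun n => Ideal.Quotient.mk _ (x n), fun m n hmn => by
    rw [Ideal.Quotient.factor_mk]
    induction n, hmn using Nat.le_induction with
    | base => rfl
    | succ n hmn ih =>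
      rw [← ih]
      exact Ideal.Quotient.eq.mpr (augIdeal_pow_le hmn (h n))⟩

theorem eval_ofSeq (x : ℕ → MonoidAlgebra k G) (h : ∀ n, x (n + 1) - x n ∈ augIdeal k P ^ n)
    (n : ℕ) : eval P n (ofSeq x h) = Ideal.Quotient.mk _ (x n) := rfl

theorem algMap_surjective {φ : G →* H} (hφ : Function.Surjective φ) :
    Function.Surjective (algMap k φ) := by
  intro y
  induction y using MonoidAlgebra.induction_on with
  | of h =>
    obtain ⟨g, rfl⟩ := hφ h
    exact ⟨_, algMap_of φ g⟩
  | add x y hx hy =>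
    obtain ⟨a, rfl⟩ := hx
    obtain ⟨b, rfl⟩ := hy
    exact ⟨a + b, map_add _ _ _⟩
  | smul r x hx =>
    obtain ⟨a, rfl⟩ := hx
    exact ⟨r • a, map_smul _ _ _⟩

/-- The powers of the ideal of `H` are the images of those of the ideal of `G`, if `P` is the
inverse image of `Q`. -/
theorem exists_algMap_eq {φ : G →* H} (hφ : Function.Surjective φ) (h' : ∀ g, φ g ∈ Q → g ∈ P)
    (n : ℕ) {y : MonoidAlgebra k H} (hy : y ∈ augIdeal k Q ^ n) :
    ∃ x ∈ augIdeal k P ^ n, algMap k φ x = y := by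
  refine augIdeal_pow_induction (P := Q)
    (W := fun n => ((augIdeal k P ^ n).restrictScalars k).map (algMap k φ).toLinearMap)
    (fun y => ?_) (fun n y hy g g' hg => ?_) n hy
  · obtain ⟨x, rfl⟩ := algMap_surjective hφ y
    exact ⟨x, mem_augIdeal_pow_zero (P := P) x, rfl⟩
  · obtain ⟨x, hx, rfl⟩ := hy
    obtain ⟨g, rfl⟩ := hφ g
    obtain ⟨g', rfl⟩ := hφ g'
    refine ⟨(MonoidAlgebra.of k G g - MonoidAlgebra.of k G g') * x,
      mul_mem_augIdeal_pow (add_comm 1 n) ?_ hx, ?_⟩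
    · rw [Submodule.pow_one]
      refine of_sub_of_mem (QuotientGroup.eq.mpr (h' _ ?_))
      rw [map_mul, map_inv]
      exact QuotientGroup.eq.mp hg
    · rw [AlgHom.toLinearMap_apply, map_mul, map_sub, algMap_of, algMap_of]
      rfl

/-- An element of the completion of `k[H]` is represented by the image of a convergent sequence of
elements of `k[G]`, for `G → H` surjective. -/
theorem exists_seq {φ : G →* H} (hφ : Function.Surjective φ) (h' : ∀ g, φ g ∈ Q → g ∈ P)
    (y : AlgCompl k Q) : ∃ x : ℕ → MonoidAlgebra k G,
      (∀ n, x (n + 1) - x n ∈ augIdeal k P ^ n) ∧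
      ∀ n, Ideal.Quotient.mk _ (algMap k φ (x n)) = eval Q n y := by
  have h1 : ∀ n, ∃ z, Ideal.Quotient.mk _ z = eval Q n y := fun n => Ideal.Quotient.mk_surjective _
  choose z hz using h1
  have h2 : ∀ n, z (n + 1) - z n ∈ augIdeal k Q ^ n := fun n => by
    refine Ideal.Quotient.eq.mp ?_
    rw [hz n]
    exact mk_eval_of_le y (Nat.le_succ n) (hz (n + 1))
  choose j hj hj' using fun n => exists_algMap_eq hφ h' n (h2 n)
  obtain ⟨x₀, hx₀⟩ := algMap_surjective hφ (z 0)
  refine ⟨fun n => x₀ + ∑ i ∈ Finset.range n, j i, fun n => ?_, fun n => ?_⟩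
  · dsimp only
    rw [Finset.sum_range_succ, ← add_assoc, add_sub_cancel_left]
    exact hj n
  · rw [← hz n, map_add, map_sum, hx₀, Finset.sum_congr rfl fun i _ => hj' i,
      Finset.sum_range_sub, add_sub_cancel]

variable (k P) in
/-- The linear map `g ↦ (g - 1) ^ j` on `k[P]`, extended by zero to `k[G]`. -/
def powMap (j : ℕ) : MonoidAlgebra k G →ₗ[k] MonoidAlgebra k G := by
  classical exact linExt fun g => if g ∈ P then (MonoidAlgebra.of k G g - 1) ^ j else 0

theorem powMap_of_mem (j : ℕ) {g : G} (hg : g ∈ P) :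
    powMap k P j (MonoidAlgebra.of k G g) = (MonoidAlgebra.of k G g - 1) ^ j := by
  rw [powMap, linExt_of, if_pos hg]

theorem powMap_of_notMem (j : ℕ) {g : G} (hg : g ∉ P) :
    powMap k P j (MonoidAlgebra.of k G g) = 0 := by
  rw [powMap, linExt_of, if_neg hg]

variable (k G) in
/-- The linear map `g ↦ g - 1`. -/
def subOne : MonoidAlgebra k G →ₗ[k] MonoidAlgebra k G :=
  LinearMap.id - linExt fun _ => 1

theorem subOne_of (g : G) : subOne k G (MonoidAlgebra.of k G g) = MonoidAlgebra.of k G g - 1 := by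
  rw [subOne, LinearMap.sub_apply, linExt_of, LinearMap.id_apply]

theorem linExt_one_eq_zero {x : MonoidAlgebra k G} (hx : x ∈ augIdeal k P) :
    linExt (k := k) (fun _ : G => (1 : MonoidAlgebra k G)) x = 0 := by
  refine (Submodule.mem_bot k).mp (map_augIdeal_mem (P := P) _ ⊥ (fun g g' _ => ?_) hx)
  rw [Submodule.mem_bot, linExt_of, linExt_of, sub_self]

theorem subOne_mem (n : ℕ) {x : MonoidAlgebra k G} (hx : x ∈ augIdeal k P ^ n) :
    subOne k G x ∈ augIdeal k P ^ n := by
  rcases n with _ | n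
  · exact mem_augIdeal_pow_zero _
  · have : x ∈ augIdeal k P := by
      have := augIdeal_pow_le (Nat.succ_le_succ (Nat.zero_le n)) hx
      rwa [Nat.succ_eq_add_one, zero_add, Submodule.pow_one] at this
    rwa [subOne, LinearMap.sub_apply, linExt_one_eq_zero this, sub_zero]

/-- `g ↦ (g - 1) ^ (j + 1)` is the convolution of `g ↦ (g - 1) ^ j` and `g ↦ g - 1`. -/
theorem powMap_succ (j : ℕ) (x : MonoidAlgebra k G) : powMap k P (j + 1) x =
    conv ((LinearMap.mul k (MonoidAlgebra k G)).compl₁₂ (powMap k P j) (subOne k G)) x := by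
  refine groupAlgebra_hom_ext (f' := conv _) (fun g => ?_) x
  rw [conv_of, LinearMap.compl₁₂_apply, LinearMap.mul_apply', subOne_of]
  by_cases hg : g ∈ P
  · rw [powMap_of_mem _ hg, powMap_of_mem _ hg, pow_succ]
  · rw [powMap_of_notMem _ hg, powMap_of_notMem _ hg, zero_mul]

/-- For `j = 0`, the map `g ↦ (g - 1) ^ j` is constant on the cosets of `P`. -/
theorem powMap_zero_of_sub (x : MonoidAlgebra k G) (hx : x ∈ augIdeal k P) :
    powMap k P 0 x = 0 := by
  refine (Submodule.mem_bot k).mp (map_augIdeal_mem (P := P) _ ⊥ (fun g g' hg => ?_) hx)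
  have h := QuotientGroup.eq.mp hg
  rw [Submodule.mem_bot]
  by_cases h1 : g ∈ P
  · have h2 : g' ∈ P := by
      have := P.mul_mem h1 h
      rwa [mul_inv_cancel_left] at this
    rw [powMap_of_mem _ h1, powMap_of_mem _ h2, pow_zero, pow_zero, sub_self]
  · have h2 : g' ∉ P := fun h2 => h1 (by
      have := P.mul_mem h2 (P.inv_mem h)
      rwa [mul_inv_rev, inv_inv, mul_inv_cancel_left] at this)
    rw [powMap_of_notMem _ h1, powMap_of_notMem _ h2, sub_self]

/-- The map `powMap` respects the filtration. For `j = 0` it factors through `k[G/P]`, and the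
general case follows by convolution. -/
theorem powMap_mem (j n : ℕ) {x : MonoidAlgebra k G} (hx : x ∈ augIdeal k P ^ n) :
    powMap k P j x ∈ augIdeal k P ^ n := by
  induction j generalizing x n with
  | zero =>
    rcases n with _ | n
    · exact mem_augIdeal_pow_zero _
    · have : x ∈ augIdeal k P := by
        have := augIdeal_pow_le (Nat.succ_le_succ (Nat.zero_le n)) hx
        rwa [Nat.succ_eq_add_one, zero_add, Submodule.pow_one] at this
      rw [powMap_zero_of_sub x this]
      exact Submodule.zero_mem _
  | succ j ih =>
    rw [powMap_succ]
    refine conv_mem (P := P) _ ((augIdeal k P ^ n).restrictScalars k) n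
      (fun i l hil a ha b hb => ?_) hx
    exact mul_mem_augIdeal_pow hil (ih i ha) (subOne_mem l hb)

/-- On a group-like element over `1`, the map `powMap` is a power. -/
theorem mk_powMap {u : AlgCompl k P} (hu : IsGroupLike u) (h1 : eval P 1 u = 1) {n : ℕ} (hn : n ≠ 0)
    {x : MonoidAlgebra k G} (hx : Ideal.Quotient.mk _ x = eval P n u) (j : ℕ) :
    (Ideal.Quotient.mk _ (powMap k P j x) : Trunc k P n) = (eval P n u - 1) ^ j := by
  have hx1 : x - 1 ∈ augIdeal k P := by
    have e := (mk_eval_of_le u (Nat.one_le_iff_ne_zero.mpr hn) hx).trans h1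
    rw [← map_one (Ideal.Quotient.mk (augIdeal k P ^ 1)), Ideal.Quotient.eq, Submodule.pow_one] at e
    exact e
  have ho : (1 : MonoidAlgebra k G) = MonoidAlgebra.of k G 1 := (map_one _).symm
  induction j with
  | zero =>
    have := powMap_zero_of_sub _ hx1
    rw [map_sub, sub_eq_zero] at this
    rw [this, ho, powMap_of_mem 0 P.one_mem, pow_zero, pow_zero, map_one]
  | succ j ih =>
    have key := hu.conv_eq hx
      ((LinearMap.mul k (MonoidAlgebra k G)).compl₁₂ (powMap k P j) (subOne k G))
      (W := (augIdeal k P ^ n).restrictScalars k) fun i l hil a ha b hb =>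
        mul_mem_augIdeal_pow hil (powMap_mem j i ha) (subOne_mem l hb)
    rw [← powMap_succ, LinearMap.compl₁₂_apply, LinearMap.mul_apply'] at key
    have e : subOne k G x = x - 1 := by
      have := linExt_one_eq_zero hx1
      rw [map_sub, sub_eq_zero] at this
      rw [subOne, LinearMap.sub_apply, this, ho, linExt_of, LinearMap.id_apply]
    rw [Ideal.Quotient.eq.mpr key, map_mul, ih, e, map_sub, map_one, hx, pow_succ]

theorem of_sub_one_mem {g : G} (hg : g ∈ P) : MonoidAlgebra.of k G g - 1 ∈ augIdeal k P := by
  rw [← map_one (MonoidAlgebra.of k G)]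
  exact of_sub_of_mem (((QuotientGroup.eq_one_iff g).mpr hg).trans (map_one _).symm)

variable [Algebra ℚ k]

variable (k P) in
/-- The linear map `g ↦ log g` on `k[P]`, truncated at order `n` and extended by zero to `k[G]`. -/
def logMap (n : ℕ) : MonoidAlgebra k G →ₗ[k] MonoidAlgebra k G :=
  ∑ j ∈ Finset.range n, logCoeff j • powMap k P j

theorem logMap_apply (n : ℕ) (x : MonoidAlgebra k G) :
    logMap k P n x = ∑ j ∈ Finset.range n, logCoeff j • powMap k P j x := by
  simp [logMap]

theorem logMap_of_mem (n : ℕ) {g : G} (hg : g ∈ P) : logMap k P n (MonoidAlgebra.of k G g) =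
    Polynomial.aeval (MonoidAlgebra.of k G g - 1) (logPoly n) := by
  rw [logMap_apply, logPoly, map_sum]
  refine Finset.sum_congr rfl fun j _ => ?_
  rw [powMap_of_mem j hg, map_mul, map_pow, Polynomial.aeval_X, Polynomial.aeval_C, Algebra.smul_def]

theorem logMap_of_notMem (n : ℕ) {g : G} (hg : g ∉ P) :
    logMap k P n (MonoidAlgebra.of k G g) = 0 := by
  rw [logMap_apply]
  refine Finset.sum_eq_zero fun j _ => ?_
  rw [powMap_of_notMem j hg, smul_zero]

theorem ratSMul_mem (I : Ideal (MonoidAlgebra k G)) (q : ℚ) {x : MonoidAlgebra k G} (hx : x ∈ I) :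
    q • x ∈ I := by
  rw [← algebraMap_smul k q x]
  exact (I.restrictScalars k).smul_mem _ hx

theorem logMap_mem (n m : ℕ) {x : MonoidAlgebra k G} (hx : x ∈ augIdeal k P ^ m) :
    logMap k P n x ∈ augIdeal k P ^ m := by
  rw [logMap_apply]
  exact sum_mem fun j _ => ratSMul_mem _ _ (powMap_mem j m hx)

/-- The truncated logarithms converge. -/
theorem logMap_succ_sub_mem (n : ℕ) (x : MonoidAlgebra k G) :
    logMap k P (n + 1) x - logMap k P n x ∈ augIdeal k P ^ n := by
  rw [logMap_apply, logMap_apply, Finset.sum_range_succ, add_sub_cancel_left]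
  refine ratSMul_mem _ _ ?_
  refine groupAlgebra_mem (W := (augIdeal k P ^ n).restrictScalars k) (fun g => ?_) x
  by_cases hg : g ∈ P
  · rw [powMap_of_mem n hg]
    exact Ideal.pow_mem_pow (of_sub_one_mem hg) n
  · rw [powMap_of_notMem n hg]
    exact Submodule.zero_mem _

theorem logMap_mem_augIdeal (n : ℕ) (x : MonoidAlgebra k G) : logMap k P n x ∈ augIdeal k P := by
  refine groupAlgebra_mem (W := (augIdeal k P).restrictScalars k) (fun g => ?_) x
  by_cases hg : g ∈ P
  · rw [logMap_of_mem n hg]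
    obtain ⟨q, hq⟩ := X_dvd_logPoly n
    rw [hq, map_mul, Polynomial.aeval_X]
    exact Ideal.mul_mem_right _ _ (of_sub_one_mem hg)
  · rw [logMap_of_notMem n hg]
    exact Submodule.zero_mem _

theorem aeval_ringHom {R R' : Type*} [Ring R] [Ring R'] [Algebra ℚ R] [Algebra ℚ R']
    (f : R →+* R') (a : R) (p : Polynomial ℚ) :
    f (Polynomial.aeval a p) = Polynomial.aeval (f a) p :=
  (Polynomial.aeval_algHom_apply f.toRatAlgHom a p).symm

theorem algMap_logMap (φ : G →* H) (h : ∀ g, φ g ∈ Q ↔ g ∈ P) (n : ℕ) (x : MonoidAlgebra k G) :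
    algMap k φ (logMap k P n x) = logMap k Q n (algMap k φ x) := by
  refine groupAlgebra_hom_ext (f := (algMap k φ).toLinearMap ∘ₗ logMap k P n)
    (f' := logMap k Q n ∘ₗ (algMap k φ).toLinearMap) (fun g => ?_) x
  rw [LinearMap.comp_apply, LinearMap.comp_apply, AlgHom.toLinearMap_apply,
    AlgHom.toLinearMap_apply, algMap_of]
  by_cases hg : g ∈ P
  · rw [logMap_of_mem n hg, logMap_of_mem n ((h g).mpr hg)]
    refine (aeval_ringHom (algMap k φ).toRingHom _ _).trans (congrArg (Polynomial.aeval · _) ?_)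
    change algMap k φ _ = _
    rw [map_sub, map_one, algMap_of]
  · rw [logMap_of_notMem n hg, logMap_of_notMem n (fun h' => hg ((h g).mp h')), map_zero]

/-- On a group-like element over `1`, the linear map `logMap` is the logarithm. -/
theorem mk_logMap {u : AlgCompl k P} (hu : IsGroupLike u) (h1 : eval P 1 u = 1) {n : ℕ} (hn : n ≠ 0)
    {x : MonoidAlgebra k G} (hx : Ideal.Quotient.mk _ x = eval P n u) :
    (Ideal.Quotient.mk _ (logMap k P n x) : Trunc k P n) =
      Polynomial.aeval (eval P n u - 1) (logPoly n) := by
  rw [logMap_apply, logPoly, map_sum, map_sum]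
  refine Finset.sum_congr rfl fun j _ => ?_
  rw [map_mul, map_pow, Polynomial.aeval_X, Polynomial.aeval_C, ← Algebra.smul_def,
    ← mk_powMap hu h1 hn hx]
  rfl

/-- The logarithms of the elements of `P` are primitive. -/
theorem mk_diag_logMap (n : ℕ) (x : MonoidAlgebra k G) :
    (Ideal.Quotient.mk _ (diagMap k G (logMap k P n x)) : Trunc k (P.prod P) n) =
      Ideal.Quotient.mk _ (algMap k (MonoidHom.inl G G) (logMap k P n x)) +
      Ideal.Quotient.mk _ (algMap k (MonoidHom.inr G G) (logMap k P n x)) := by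
  let π := (Ideal.Quotient.mkₐ k (augIdeal k (P.prod P) ^ n)).toLinearMap
  refine groupAlgebra_hom_ext (f := π ∘ₗ (diagMap k G).toLinearMap ∘ₗ logMap k P n)
    (f' := π ∘ₗ (algMap k (MonoidHom.inl G G)).toLinearMap ∘ₗ logMap k P n +
      π ∘ₗ (algMap k (MonoidHom.inr G G)).toLinearMap ∘ₗ logMap k P n) (fun g => ?_) x
  by_cases hg : g ∈ P
  · have key : ∀ φ : G →* G × G, π ((algMap k φ) (logMap k P n (MonoidAlgebra.of k G g))) =
        Polynomial.aeval (eval _ n (of k (P.prod P) (φ g)) - 1) (logPoly n) := fun φ => by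
      rw [logMap_of_mem n hg]
      refine (aeval_ringHom ((Ideal.Quotient.mk (augIdeal k (P.prod P) ^ n)).comp
        (algMap k φ).toRingHom) _ _).trans (congrArg (Polynomial.aeval · _) ?_)
      change Ideal.Quotient.mk _ (algMap k φ _) = _
      rw [map_sub, map_one, algMap_of, map_sub, map_one]
      rfl
    have hl : eval (P.prod P) 1 (of k (P.prod P) ((g, 1) : G × G)) = 1 :=
      eval_one_of _ _ ⟨hg, P.one_mem⟩
    have hr : eval (P.prod P) 1 (of k (P.prod P) ((1, g) : G × G)) = 1 :=
      eval_one_of _ _ ⟨P.one_mem, hg⟩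
    have hd : eval (P.prod P) 1 (of k (P.prod P) ((g, g) : G × G)) = 1 :=
      eval_one_of _ _ ⟨hg, hg⟩
    set A := eval (P.prod P) n (of k (P.prod P) ((g, 1) : G × G)) - 1 with hA
    set B := eval (P.prod P) n (of k (P.prod P) ((1, g) : G × G)) - 1 with hB
    have hm : eval (P.prod P) n (of k (P.prod P) ((g, g) : G × G)) - 1 = A + B + A * B := by
      have : of k (P.prod P) ((g, g) : G × G) = of k (P.prod P) (g, 1) * of k (P.prod P) (1, g) := by
        rw [← map_mul]; simp
      rw [this, map_mul, hA, hB]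
      noncomm_ring
    have hc : Commute A B := by
      have : Commute ((g, 1) : G × G) (1, g) := by
        change _ * _ = _ * _
        simp
      exact (((this.map (of k (P.prod P))).map (eval (P.prod P) n)).sub_left
        (Commute.one_left _)).sub_right ((Commute.one_right _))
    have e := aeval_logPoly_mul hc (sub_one_pow _ hl n) (sub_one_pow _ hr n)
      (by rw [← hm]; exact sub_one_pow _ hd n)
    rw [← hm] at e
    exact (key _).trans (e.trans (congrArg₂ (· + ·) (key (MonoidHom.inl G G)).symm
      (key (MonoidHom.inr G G)).symm))
  · simp only [LinearMap.comp_apply, LinearMap.add_apply]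
    rw [logMap_of_notMem n hg]
    simp

end Log
end AlgCompl

/-! ### The prounipotent setting -/

namespace AlgCompl
variable {k : Type v} [CommRing k] {G H : Type} [Group G] [Group H] {P : Subgroup G}
  {Q : Subgroup H} [P.Normal] [Q.Normal]

theorem eval_pow_eq_zero {a : AlgCompl k P} (ha : eval P 1 a = 0) (n : ℕ) : eval P n a ^ n = 0 := by
  have := sub_one_pow P (a := a + 1) (by rw [map_add, ha, map_one, zero_add]) n
  rwa [map_add, map_one, add_sub_cancel_right] at this

variable [Algebra ℚ k]

/-- The exponential of an element of the completed augmentation ideal. -/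
def expVal (a : AlgCompl k P) (ha : eval P 1 a = 0) : AlgCompl k P :=
  ⟨fun n => IsNilpotent.exp (eval P n a), fun m n h => by
    rw [IsNilpotent.map_exp ⟨n, eval_pow_eq_zero ha n⟩, factor_eval P a h]⟩

theorem eval_expVal (a : AlgCompl k P) (ha : eval P 1 a = 0) (n : ℕ) :
    eval P n (expVal a ha) = IsNilpotent.exp (eval P n a) := rfl

theorem map_expVal (φ : G →* H) (h : P ≤ Q.comap φ) (a : AlgCompl k P) (ha : eval P 1 a = 0)
    (ha' : eval Q 1 (map φ h a) = 0) : map φ h (expVal a ha) = expVal (map φ h a) ha' := by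
  refine ext fun n => ?_
  rw [eval_map, eval_expVal, eval_expVal, IsNilpotent.map_exp ⟨n, eval_pow_eq_zero ha n⟩, eval_map]

theorem expVal_add (a b : AlgCompl k P) (hab : Commute a b) (ha : eval P 1 a = 0)
    (hb : eval P 1 b = 0) (h : eval P 1 (a + b) = 0) :
    expVal (a + b) h = expVal a ha * expVal b hb := by
  refine ext fun n => ?_
  rw [map_mul, eval_expVal, eval_expVal, eval_expVal, map_add]
  exact IsNilpotent.exp_add_of_commute (hab.map (eval P n)) ⟨n, eval_pow_eq_zero ha n⟩
    ⟨n, eval_pow_eq_zero hb n⟩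

theorem expVal_congr {a b : AlgCompl k P} (h : a = b) (ha : eval P 1 a = 0) (hb : eval P 1 b = 0) :
    expVal a ha = expVal b hb := by
  subst h; rfl

theorem expVal_mul_eq_one (a b : AlgCompl k P) (hc : Commute a b) (h : a + b = 0)
    (ha : eval P 1 a = 0) (hb : eval P 1 b = 0) : expVal a ha * expVal b hb = 1 := by
  rw [← expVal_add a b hc ha hb (by rw [h, map_zero])]
  refine ext fun n => ?_
  rw [eval_expVal, h, map_zero, IsNilpotent.exp_zero, map_one]

/-- The exponential of a primitive element is group-like. -/
theorem isGroupLike_expVal {a : AlgCompl k P} (ha : eval P 1 a = 0)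
    (h : comul P a = inl P a + inr P a) : IsGroupLike (expVal a ha) := by
  unfold IsGroupLike comul inl inr at *
  have h0 : ∀ (φ : G →* G × G) (h : P ≤ (P.prod P).comap φ), eval (P.prod P) 1 (map φ h a) = 0 :=
    fun φ h => by rw [eval_map, ha, map_zero]
  rw [map_expVal _ _ _ ha (h0 _ _), map_expVal _ _ _ ha (h0 _ _), map_expVal _ _ _ ha (h0 _ _),
    ← expVal_add (map (MonoidHom.inl G G) (le_comap_inl (P := P)) a)
      (map (MonoidHom.inr G G) (le_comap_inr (P := P)) a) (commute_inl_inr a a) (h0 _ _) (h0 _ _)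
      (by rw [map_add, h0, h0, zero_add])]
  exact expVal_congr h _ _

/-- The group-like element over `1` which is the exponential of a primitive element. -/
def glExp (a : AlgCompl k P) (ha : eval P 1 a = 0) (h : comul P a = inl P a + inr P a) :
    GroupLike P k :=
  ⟨(⟨expVal a ha, expVal ((-1 : k) • a) (by rw [map_smul, ha, smul_zero]),
      expVal_mul_eq_one _ _ ((Commute.refl a).smul_right _) (ext fun n => by
        rw [map_add, map_smul, neg_one_smul, add_neg_cancel, map_zero]) _ _,
      expVal_mul_eq_one _ _ ((Commute.refl a).smul_left _) (ext fun n => by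
        rw [map_add, map_smul, neg_one_smul, neg_add_cancel, map_zero]) _ _⟩, 1),
    isGroupLike_expVal ha h, 1, map_one _, by
      rw [map_one, map_one, eval_expVal, ha, IsNilpotent.exp_zero]⟩

theorem glVal_glExp (a : AlgCompl k P) (ha : eval P 1 a = 0) (h : comul P a = inl P a + inr P a) :
    glVal (glExp a ha h) = expVal a ha := rfl

theorem glProj_glExp (a : AlgCompl k P) (ha : eval P 1 a = 0)
    (h : comul P a = inl P a + inr P a) : glProj P k (glExp a ha h) = 1 := rfl

/-- A group-like element over `1` lifts along a surjection: it is the exponential of its logarithm,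
which is a limit of combinations of logarithms of elements of the group, and these lift to
primitive elements. -/
theorem exists_map_eq (φ : G →* H) (h : P ≤ Q.comap φ) (hφ : Function.Surjective φ)
    (h' : ∀ g, φ g ∈ Q → g ∈ P) {y : AlgCompl k Q} (hy : IsGroupLike y) (hy1 : eval Q 1 y = 1) :
    ∃ x : GroupLike P k, map φ h (glVal x) = y ∧ glProj P k x = 1 := by
  obtain ⟨x, hx, hxy⟩ := exists_seq hφ h' y
  let a : AlgCompl k P := ofSeq (fun n => logMap k P n (x n)) fun n => by
    have e : logMap k P (n + 1) (x (n + 1)) - logMap k P n (x n) =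
        (logMap k P (n + 1) (x (n + 1)) - logMap k P n (x (n + 1))) +
          logMap k P n (x (n + 1) - x n) := by
      rw [map_sub]; abel
    rw [e]
    exact Ideal.add_mem _ (logMap_succ_sub_mem n _) (logMap_mem n n (hx n))
  have ha : eval P 1 a = 0 := by
    refine Ideal.Quotient.eq_zero_iff_mem.mpr ?_
    rw [Submodule.pow_one]
    exact logMap_mem_augIdeal 1 _
  have hp : comul P a = inl P a + inr P a := ext fun n => by
    rw [map_add, comul, inl, inr, eval_map_of_eq _ _ n (eval_ofSeq _ _ n).symm,
      eval_map_of_eq _ _ n (eval_ofSeq _ _ n).symm, eval_map_of_eq _ _ n (eval_ofSeq _ _ n).symm]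
    exact mk_diag_logMap n _
  refine ⟨glExp a ha hp, ?_, glProj_glExp a ha hp⟩
  rw [glVal_glExp, map_expVal φ h a ha (by rw [eval_map, ha, map_zero])]
  refine ext fun n => ?_
  rcases eq_or_ne n 0 with rfl | hn
  · exact subsingleton_trunc_zero.elim _ _
  rw [eval_expVal, eval_map_of_eq φ h n (eval_ofSeq _ _ n).symm,
    algMap_logMap φ (fun g => ⟨h' g, fun hg => h hg⟩), mk_logMap hy hy1 hn (hxy n),
    exp_aeval_logPoly (sub_one_pow Q hy1 n), add_sub_cancel]

/-- The completion of a surjective morphism is surjective: after translation by an element of the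
group, only elements over `1` have to be lifted. -/
theorem glLift_surjective (φ : G →* H) (h : ∀ p ∈ P, φ p ∈ Q) (hφ : Function.Surjective φ)
    (h' : ∀ g, φ g ∈ Q → g ∈ P) (hp : ∀ p ∈ P, glProj Q k (((glOf Q k).comp φ) p) = 1) :
    Function.Surjective (glLift ((glOf Q k).comp φ) hp) := by
  intro y
  obtain ⟨g, hg⟩ := QuotientGroup.mk'_surjective Q (glProj Q k y)
  obtain ⟨g, rfl⟩ := hφ g
  let y' := (glOf Q k (φ g))⁻¹ * y
  have hy' : glProj Q k y' = 1 := by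
    rw [map_mul, map_inv, ← hg]
    exact inv_mul_cancel _
  obtain ⟨x, hx, hx1⟩ := exists_map_eq φ h hφ h' (isGroupLike_glVal y') (eval_one_glVal y' hy')
  refine ⟨glOf P k g * x, ?_⟩
  have e1 : glLift ((glOf Q k).comp φ) hp (glOf P k g) = glOf Q k (φ g) :=
    (unip k).lift_of P Q ((glOf Q k).comp φ) hp g
  have e2 : glLift ((glOf Q k).comp φ) hp x = y' := by
    refine gl_ext hx ?_
    rw [hy']
    refine ((unip k).proj_lift P Q ((glOf Q k).comp φ) hp x).trans ?_
    exact (congrArg (QuotientGroup.lift P ((glProj Q k).comp ((glOf Q k).comp φ)) hp) hx1).trans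
      (map_one _)
  rw [map_mul, e1, e2, mul_inv_cancel_left]

omit [Algebra ℚ k] in
/-- The filtration of `k[G]` induces the filtration of `k[P]`: the retraction `k[G] → k[P]` which
kills the elements outside `P` is compatible with the filtrations. -/
theorem mem_augIdeal_top_pow (n : ℕ) {x : MonoidAlgebra k P}
    (hx : algMap k P.subtype x ∈ augIdeal k P ^ n) : x ∈ augIdeal k (⊤ : Subgroup P) ^ n := by
  classical
  let ρ : MonoidAlgebra k G →ₗ[k] MonoidAlgebra k P :=
    linExt fun g => if h : g ∈ P then MonoidAlgebra.of k P ⟨g, h⟩ else 0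
  have hρ : ∀ (p : P) y, ρ (MonoidAlgebra.of k G p * y) = MonoidAlgebra.of k P p * ρ y := by
    intro p y
    refine groupAlgebra_hom_ext (f := ρ ∘ₗ LinearMap.mulLeft k (MonoidAlgebra.of k G p))
      (f' := LinearMap.mulLeft k (MonoidAlgebra.of k P p) ∘ₗ ρ) (fun g => ?_) y
    rw [LinearMap.comp_apply, LinearMap.comp_apply, LinearMap.mulLeft_apply,
      LinearMap.mulLeft_apply, ← map_mul, linExt_of, linExt_of]
    by_cases hg : g ∈ P
    · rw [dif_pos hg, dif_pos (P.mul_mem p.2 hg), ← map_mul]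
      rfl
    · rw [dif_neg hg, dif_neg (fun h => hg ((P.mul_mem_cancel_left p.2).mp h)), mul_zero]
  -- The elements whose left translates are all mapped to the `n`-th power by the retraction; this
  -- condition is stable under the multiplication by `g - g'` for `g` and `g'` in the same coset.
  let W : ℕ → Submodule k (MonoidAlgebra k G) := fun n => ⨅ g : G,
    ((augIdeal k (⊤ : Subgroup P) ^ n).restrictScalars k).comap
      (ρ ∘ₗ LinearMap.mulLeft k (MonoidAlgebra.of k G g))
  have hW : ∀ n y, y ∈ W n ↔ ∀ g : G,
      ρ (MonoidAlgebra.of k G g * y) ∈ augIdeal k (⊤ : Subgroup P) ^ n := fun n y =>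
    Submodule.mem_iInf _
  have key : algMap k P.subtype x ∈ W n := by
    refine augIdeal_pow_induction (P := P) W (fun y => (hW 0 y).mpr fun g =>
      mem_augIdeal_pow_zero _) (fun n y hy g g' hg => (hW _ _).mpr fun h => ?_) n hx
    have hp : h * g * (h * g')⁻¹ ∈ P := by
      have := ‹P.Normal›.conj_mem _ (P.inv_mem (QuotientGroup.eq.mp hg)) (h * g')
      convert this using 1
      group
    have e : MonoidAlgebra.of k G h * ((MonoidAlgebra.of k G g - MonoidAlgebra.of k G g') * y) =
        MonoidAlgebra.of k G ((⟨_, hp⟩ : P) : G) * (MonoidAlgebra.of k G (h * g') * y) -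
          MonoidAlgebra.of k G (h * g') * y := by
      have e1 : MonoidAlgebra.of k G (h * g * (h * g')⁻¹) * MonoidAlgebra.of k G (h * g') =
          MonoidAlgebra.of k G h * MonoidAlgebra.of k G g := by
        rw [← map_mul, inv_mul_cancel_right, map_mul]
      change _ = MonoidAlgebra.of k G (h * g * (h * g')⁻¹) * (MonoidAlgebra.of k G (h * g') * y) -
          MonoidAlgebra.of k G (h * g') * y
      rw [← mul_assoc (MonoidAlgebra.of k G (h * g * _)), e1, map_mul]
      simp only [mul_sub, sub_mul, mul_assoc]
    rw [e, map_sub, hρ, ← sub_one_mul]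
    exact mul_mem_augIdeal_pow (add_comm 1 n)
      (by rw [Submodule.pow_one]; exact of_sub_one_mem trivial) ((hW n y).mp hy _)
  have h1 := (hW _ _).mp key 1
  have e : ρ (algMap k P.subtype x) = x := by
    refine groupAlgebra_hom_ext (f := ρ ∘ₗ (algMap k P.subtype).toLinearMap)
      (f' := LinearMap.id) (fun g => ?_) x
    rw [LinearMap.comp_apply, AlgHom.toLinearMap_apply, algMap_of, linExt_of,
      dif_pos (show P.subtype g ∈ P from g.2)]
    rfl
  rwa [map_one, one_mul, e] at h1

omit [Algebra ℚ k] in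
/-- The prounipotent completion of `P` embeds into the relative completion of `G`. -/
theorem glLift_subtype_injective
    (hp : ∀ p ∈ (⊤ : Subgroup P), glProj P k (((glOf P k).comp P.subtype) p) = 1) :
    Function.Injective (glLift ((glOf P k).comp P.subtype) hp) := by
  rw [injective_iff_map_eq_one]
  intro x hx
  refine gl_ext (ext fun n => ?_) ?_
  · obtain ⟨z, hz⟩ := Ideal.Quotient.mk_surjective (eval ⊤ n (glVal x))
    have h1 : map P.subtype (fun p _ => p.2) (glVal x) = (1 : AlgCompl k P) := congrArg glVal hx
    have h2 := eval_map_of_eq (k := k) (Q := P) P.subtype (fun p _ => p.2) n hz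
    rw [h1, map_one, ← map_one (Ideal.Quotient.mk (augIdeal k P ^ n)), eq_comm, Ideal.Quotient.eq,
      ← map_one (algMap k P.subtype), ← map_sub] at h2
    rw [← hz]
    exact Ideal.Quotient.eq.mpr (mem_augIdeal_top_pow n h2)
  · obtain ⟨g, hg⟩ := QuotientGroup.mk'_surjective _ (glProj ⊤ k x)
    rw [← hg, map_one]
    exact (QuotientGroup.eq_one_iff g).mpr trivial

end AlgCompl

open AlgCompl in
theorem unip_isNice (k : Type v) [CommRing k] [Algebra ℚ k] : (unip k).IsNice where
  reg_refl _ _ _ N := ⟨N, LinearMap.id, fun _ => rfl⟩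
  reg_trans P Q R _ _ _ p q r h h' N := by
    obtain ⟨M, Λ, hΛ⟩ := h' N
    obtain ⟨M', Λ', hΛ'⟩ := h M
    exact ⟨M', Λ ∘ₗ Λ', fun a => by rw [hΛ, hΛ', LinearMap.comp_apply]⟩
  reg_mul _ _ _ _ p q q' h h' := regular_mul p q q' h h'
  reg_const _ _ _ _ p c := regular_const p c
  reg_lift _ _ _ _ θ hθ p N := ⟨N, (liftComp (glHom θ) (glHom_one θ hθ) N).toLinearMap,
    fun _ => rfl⟩
  reg_ext _ _ _ _ p q q' hp h h' e := regular_ext p q q' hp h h' e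
  pow_lift P Q _ _ θ hθ x hx c := by
    have hy : (unip k).proj Q ((unip k).lift P Q θ hθ x) = 1 := by
      rw [Setting.proj_lift, hx, map_one]
    rw [Setting.powT_of P hx, Setting.powT_of Q hy]
    exact glLift_glPow θ hθ ⟨x, hx⟩ hy c
  pow_add P _ x hx a b := by
    rw [Setting.powT_of P hx, Setting.powT_of P hx, Setting.powT_of P hx]
    exact glPow_add ⟨x, hx⟩ a b
  pow_mul P _ x hx a b := by
    rw [Setting.powT_of P ((unip k).proj_powT P x a), Setting.powT_of P hx]
    refine (glPow_mul ⟨x, hx⟩ a b).trans (congrArg (fun z => (glPow (k := k) z b).1) ?_)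
    exact Subtype.ext (Setting.powT_of P hx a).symm
  pow_one P _ x hx := by
    rw [Setting.powT_of P hx]
    exact glPow_one ⟨x, hx⟩
  mul_pow P _ x y hx hy h c := by
    rw [Setting.powT_of P hx, Setting.powT_of P hy,
      Setting.powT_of P (by rw [map_mul, hx, hy, one_mul])]
    exact mul_glPow ⟨x, hx⟩ ⟨y, hy⟩ h c
  two_cancel := fun (a b : k) h => by
    have h2 : IsUnit ((2 : ℚ) : ℚ) := isUnit_iff_ne_zero.mpr two_ne_zero
    have h3 := h2.map (algebraMap ℚ k)
    rw [map_ofNat] at h3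
    exact h3.mul_left_cancel h
  map_surjective _ _ _ _ φ h hφ h' := glLift_surjective φ h hφ h' _
  map_subtype_injective _ _ _ := glLift_subtype_injective _

end HalfBalanced
end

theorem mainTheorem7 (S : Type*) :
    HalfBalanced.DefinesMorphism HalfBalanced.discrete S ∧
    HalfBalanced.DefinesMorphism (HalfBalanced.proL {p | p.Prime}) S ∧
    (∀ l : ℕ, l.Prime → HalfBalanced.DefinesMorphism (HalfBalanced.proL {l}) S) ∧
    (∀ (k : Type*) [CommRing k] [Algebra ℚ k],
      HalfBalanced.DefinesMorphism (HalfBalanced.unip k) S) :=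
  ⟨HalfBalanced.definesMorphism HalfBalanced.discrete_isNice S,
    HalfBalanced.definesMorphism (HalfBalanced.proL_isNice _) S,
    fun l _ => HalfBalanced.definesMorphism (HalfBalanced.proL_isNice {l}) S,
    fun k _ _ => HalfBalanced.definesMorphism (HalfBalanced.unip_isNice k) S⟩
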